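/- **Conventions.** Manifolds and maps are $C^\infty$. For an immersion $f\colon M\to\mathbb R^{d}$ let $\alpha_f$ be its second fundamental form, $\nabla^\perp$ its normal connection, $R^\perp$ its normal curvature, $A_\beta$ its shape operators. A *principal normal* of multiplicity $s\ge 1$ is a smooth normal vector field $\eta$ such that $E_\eta=\{v:\alpha_f(v,w)=\langle v,w\rangle\eta\ \text{for all } w\}$ has constant dimension $s$; it is *Dupin* if $\nabla^\perp_v\eta=0$ for all $v\in E_\eta$. Its conullity is the distribution $E_\eta^\perp$, which is *integrable* if every point lies on an integral manifold. $f$ is a *$k$-Dupin submanifold* if it has flat normal bundle and exactly $k$ principal normals $\eta_1,\dots,\eta_k$ (smooth, pairwise distinct at every point, each of constant multiplicity, with $TM=E_{\eta_1}\oplus\cdots\oplus E_{\eta_k}$), all of which are Dupin; it is *weakly reducible* if some $E_{\eta_j}^\perp$ is integrable. Let $\mathcal N$ be a subbundle of rank $s$ of the normal bundle of an immersion $h\colon L\to\mathbb R^d$ of a simply connected manifold, parallel with respect to $\nabla^\perp$ and flat ($R^\perp|_{\mathcal N}=0$), and let $\mathcal N^{\|}$ be the space of its parallel sections. Let $\varphi$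 be a function and $\beta$ a normal field on $L$ with $\alpha_h(\nabla\varphi,X)+\nabla^\perp_X\beta=0$ for all $X$, such that $\varphi$ and $F=h_*\nabla\varphi+\beta$ vanish nowhere. For $t\in\mathcal N^{\|}$ put $F_t=F+t$. The *$\mathcal N$-Ribaucour transform* of $h$ determined by $(\varphi,\beta)$ is the submanifold parametrized, at regular points, by $$f\colon L\times \mathcal N^{\|}\to\mathbb R^d,\qquad f(u,t)=h(u)-2\varphi(u)\frac{F_t(u)}{\|F_t(u)\|^2},$$ completed by $f(u,\infty)=h(u)$. If $h$ is $(k-1)$-Dupin with principal normals $\eta_1,\dots,\eta_{k-1}$, the transform is *of Dupin type* if $\Phi=\operatorname{Hess}\varphi-A_\beta$ is a Codazzi tensor of the form $\Phi=\sum_j\phi_jP_{E_{\eta_j}}$, with $P_{E_{\eta_j}}$ the orthogonal projection onto $E_{\eta_j}$ and $\phi_j$ smooth functions constant along $E_{\eta_j}$. It is *regular* if $\mathcal N\ne0$ and the $\mathcal N^\perp$-components of $-\varphi^{-1}\beta,\eta_1,\dots,\eta_{k-1}$ are pairwise distinct at every point. **Theorem.** Let $d\ge 0$ and $k\ge1$.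 (1) Let $h\colon L^{m}\to\mathbb R^{d}$ be a simply connected $(k-1)$-Dupin submanifold with a parallel flat normal subbundle $\mathcal N$ of rank $s$. Then $\mathcal N$ has a global parallel orthonormal frame, so that $\mathcal N^{\|}\cong\mathbb R^s$, and every regular $\mathcal N$-Ribaucour transform of Dupin type of $h$ is, in an open neighborhood of $h$, an $(m+s)$-dimensional weakly reducible $k$-Dupin submanifold. That is, in the coordinates $(u,z)$, $z=t/\|t\|^2$, with $z=0$ corresponding to $t=\infty$, there is an open set $W\supseteq L\times\{0\}$ in $L\times\mathbb R^s$ such that $F_t\neq0$ at the points of $W$ with $z\ne0$ and the completed parametrization restricted to $W$ is a weakly reducible $k$-Dupin submanifold. (2) Conversely, let $f\colon M^n\to\mathbb R^{d}$ be a weakly reducible $k$-Dupin submanifold. Then for every $x_0\in M$ there are a simply connected $(k-1)$-Dupin submanifold $h\colon L^{n-s}\to\mathbb R^{d}$, a parallel flat normal subbundle $\mathcal N$ of $h$ of rank $s$, a regular $\mathcal N$-Ribaucour transform of Dupin type of $h$, and a diffeomorphism $\psi$ from an open neighborhood $U$ of $x_0$ onto an open subset of $L\times\mathcal N^{\|}$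 on which $F_t\ne0$, such that $f|_U$ is the composition of $\psi$ with the parametrization of this transform. One may take for $L$ an open subset of $\mathbb R^{n-s}$. -/

import Mathlib

open scoped Manifold ContDiff InnerProductSpace Topology

namespace DupinSub

noncomputable section

variable {B : Type*} [NormedAddCommGroup B] [NormedSpace ℝ B]
  {H : Type*} [TopologicalSpace H] (I : ModelWithCorners ℝ B H)
  {M : Type*} [TopologicalSpace M] [ChartedSpace H M]
  {E : Type*} [NormedAddCommGroup E] [InnerProductSpace ℝ E] [FiniteDimensional ℝ E]

/-! Geometry of an immersion `f` of an open set `U` of a manifold `M` into a Euclidean space `E`.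
Vectors tangent or normal to `f` at `x` are regarded as vectors of `E`. -/

/-- The differential at `x` of a map `f : M → E`, with values in `E`. -/
def push (f : M → E) (x : M) : TangentSpace I x →L[ℝ] E := mfderiv I 𝓘(ℝ, E) f x

/-- The tangent space `f_* T_x M`. -/
def tangent (f : M → E) (x : M) : Submodule ℝ E :=
  LinearMap.range (push I f x : TangentSpace I x →ₗ[ℝ] E)

/-- The normal space of `f` at `x`. -/
def normal (f : M → E) (x : M) : Submodule ℝ E := (tangent I f x)ᗮ

/-- `f` is a smooth immersion of the open set `U`. -/
def IsImmersionOn (U : Set M) (f : M → E) : Prop :=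
  ContMDiffOn I 𝓘(ℝ, E) ∞ f U ∧ ∀ x ∈ U, Function.Injective (push I f x)

/-- `ξ` is a smooth section over `V` of the bundle with fibres `N x ⊆ E`. -/
def IsSectionOn (V : Set M) (N : M → Submodule ℝ E) (ξ : M → E) : Prop :=
  ContMDiffOn I 𝓘(ℝ, E) ∞ ξ V ∧ ∀ x ∈ V, ξ x ∈ N x

/-- The normal connection `∇^⊥_v ξ`: the normal part of the derivative of `ξ` in `E`. -/
def normalDeriv (f ξ : M → E) (x : M) (v : TangentSpace I x) : E :=
  (normal I f x).starProjection (push I ξ x v)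

/-- The second fundamental form `α_f(v, w)`: the normal part of the derivative in the direction
of `v` of a tangent vector field extending `f_* w`; the extension used is
`y ↦ (f_* w)` projected to the tangent space at `y`. -/
def sff (f : M → E) (x : M) (v w : TangentSpace I x) : E :=
  (normal I f x).starProjection
    (push I (fun y => (tangent I f y).starProjection (push I f x w)) x v)

/-- The nullity `E_η(x) = {v : α_f(v, w) = ⟨v, w⟩ η for all w}`. -/
def nullity (f η : M → E) (x : M) : Submodule ℝ (TangentSpace I x) where
  carrier := {v | ∀ w : TangentSpace I x,
    sff I f x v w = ⟪push I f x v, push I f x w⟫_ℝ • η x}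
  add_mem' := by
    intro a b ha hb w
    have h1 := ha w
    have h2 := hb w
    simp only [sff] at h1 h2 ⊢
    rw [map_add, map_add, h1, h2, map_add, inner_add_left, add_smul]
  zero_mem' := by
    intro w
    simp [sff]
  smul_mem' := by
    intro c a ha w
    have h1 := ha w
    simp only [sff] at h1 ⊢
    rw [map_smul, map_smul, h1, map_smul, real_inner_smul_left, mul_smul]

/-- The conullity `E_η(x)^⊥`, the orthogonal complement in the metric induced by `f`. -/
def conullity (f η : M → E) (x : M) : Submodule ℝ (TangentSpace I x) where
  carrier := {v | ∀ w ∈ nullity I f η x, ⟪push I f x v, push I f x w⟫_ℝ = 0}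
  add_mem' := by
    intro a b ha hb w hw
    rw [map_add, inner_add_left, ha w hw, hb w hw, add_zero]
  zero_mem' := by
    intro w _
    simp
  smul_mem' := by
    intro c a ha w hw
    rw [map_smul, real_inner_smul_left, ha w hw, mul_zero]

/-- `η` is a principal normal of `f` on `U` of multiplicity `s ≥ 1`. -/
def IsPrincipalNormalOn (U : Set M) (f η : M → E) (s : ℕ) : Prop :=
  IsSectionOn I U (normal I f) η ∧ 1 ≤ s ∧
    ∀ x ∈ U, Module.finrank ℝ (nullity I f η x) = s

/-- `η` is parallel in the normal connection along its nullity. -/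
def IsParallelAlongNullityOn (U : Set M) (f η : M → E) : Prop :=
  ∀ x ∈ U, ∀ v ∈ nullity I f η x, normalDeriv I f η x v = 0

/-- A distribution `D` is integrable on `U` if every point of `U` lies on an integral manifold,
i.e. on the image of an immersion `ι` of an open set of `ℝʳ` whose tangent spaces are those
of `D`. -/
def IsIntegrableOn (U : Set M) (D : ∀ x : M, Submodule ℝ (TangentSpace I x)) : Prop :=
  ∀ x ∈ U, ∃ (r : ℕ) (O : Set (EuclideanSpace ℝ (Fin r))) (ι : EuclideanSpace ℝ (Fin r) → M),
    IsOpen O ∧ 0 ∈ O ∧ ι 0 = x ∧ Set.MapsTo ι O U ∧ ContMDiffOn (𝓡 r) I ∞ ι O ∧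
      ∀ y ∈ O, Function.Injective (mfderiv (𝓡 r) I ι y) ∧
        LinearMap.range
          (mfderiv (𝓡 r) I ι y : TangentSpace (𝓡 r) y →ₗ[ℝ] TangentSpace I (ι y)) = D (ι y)

/-- Smoothness on `V` of a vector field on `M`. -/
def IsVectorFieldOn (V : Set M) [IsManifold I 1 M] (X : ∀ x : M, TangentSpace I x) : Prop :=
  ContMDiffOn I I.tangent ∞ (fun x => (⟨x, X x⟩ : TangentBundle I M)) V

/-- The normal curvature `R^⊥(X, Y) ξ = ∇_X ∇_Y ξ - ∇_Y ∇_X ξ - ∇_{[X, Y]} ξ`. -/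
def normalCurvature (f : M → E) (X Y : ∀ x : M, TangentSpace I x) (ξ : M → E) (x : M) : E :=
  normalDeriv I f (fun y => normalDeriv I f ξ y (Y y)) x (X x)
    - normalDeriv I f (fun y => normalDeriv I f ξ y (X y)) x (Y x)
    - normalDeriv I f ξ x (VectorField.mlieBracket I X Y x)

/-- `N` is flat for the normal connection of `f`: `R^⊥` vanishes on sections of `N`. -/
def IsFlatOn [IsManifold I 1 M] (U : Set M) (f : M → E) (N : M → Submodule ℝ E) : Prop :=
  ∀ V ⊆ U, IsOpen V → ∀ X Y : (∀ x : M, TangentSpace I x),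
    IsVectorFieldOn I V X → IsVectorFieldOn I V Y →
    ∀ ξ : M → E, IsSectionOn I V N ξ → ∀ x ∈ V, normalCurvature I f X Y ξ x = 0

/-- `f` is, on `U`, a `k`-Dupin submanifold with principal normals `η₁, …, η_k`: an immersion with
flat normal bundle whose tangent spaces split as `E_{η₁} ⊕ ⋯ ⊕ E_{η_k}` (the summands are then
orthogonal, since the `η_j` are distinct), all the `η_j` being Dupin principal normals. -/
structure IsDupinOn [IsManifold I 1 M] (U : Set M) (f : M → E) {k : ℕ} (η : Fin k → M → E) :
    Prop where
  immersion : IsImmersionOn I U f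
  flat : IsFlatOn I U f (normal I f)
  principal : ∀ j, ∃ s, IsPrincipalNormalOn I U f (η j) s
  distinct : ∀ x ∈ U, Function.Injective fun j => η j x
  splitting : ∀ x ∈ U, ⨆ j, nullity I f (η j) x = ⊤
  dupin : ∀ j, IsParallelAlongNullityOn I U f (η j)

/-- `f` is, on `U`, a weakly reducible `k`-Dupin submanifold: one of its principal normals has
integrable conullity. -/
def IsWeaklyReducibleDupinOn [IsManifold I 1 M] (U : Set M) (f : M → E) (k : ℕ) : Prop :=
  ∃ η : Fin k → M → E, IsDupinOn I U f η ∧ ∃ j, IsIntegrableOn I U (conullity I f (η j))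

/-- `N` is a parallel flat subbundle of rank `s` of the normal bundle of `f` on `U`. -/
structure IsParallelFlatSubbundleOn [IsManifold I 1 M] (U : Set M) (f : M → E)
    (N : M → Submodule ℝ E) (s : ℕ) : Prop where
  le_normal : ∀ x ∈ U, N x ≤ normal I f x
  rank : ∀ x ∈ U, Module.finrank ℝ (N x) = s
  smooth : ContMDiffOn I 𝓘(ℝ, E →L[ℝ] E) ∞ (fun x => (N x).starProjection) U
  parallel : ∀ V ⊆ U, IsOpen V → ∀ ξ : M → E, IsSectionOn I V N ξ →
    ∀ x ∈ V, ∀ v : TangentSpace I x, normalDeriv I f ξ x v ∈ N x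
  flat : IsFlatOn I U f N

/-- `ξ₁, …, ξ_s` is an orthonormal frame of `N` over `U` formed by parallel sections; it identifies
`ℝˢ` with the space of parallel sections of `N` (for connected `U`). -/
structure IsParallelFrameOn (U : Set M) (f : M → E) (N : M → Submodule ℝ E) {s : ℕ}
    (ξ : Fin s → M → E) : Prop where
  smooth : ∀ i, IsSectionOn I U N (ξ i)
  parallel : ∀ i, ∀ x ∈ U, ∀ v : TangentSpace I x, normalDeriv I f (ξ i) x v = 0
  orthonormal : ∀ x ∈ U, Orthonormal ℝ fun i => ξ i x
  spans : ∀ x ∈ U, Submodule.span ℝ (Set.range fun i => ξ i x) = N x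

/-- An immersion has exactly one gradient vector at `x` for each differential of a function. -/
theorem existsUnique_gradient [FiniteDimensional ℝ B] (f : M → E) (φ : M → ℝ) (x : M)
    (hf : Function.Injective (push I f x)) :
    ∃! g : TangentSpace I x, ∀ v : TangentSpace I x,
      ⟪push I f x g, push I f x v⟫_ℝ = push I φ x v := by
  let A : B →ₗ[ℝ] E := (push I f x : TangentSpace I x →L[ℝ] E).toLinearMap
  have hA : Function.Injective A := hf
  let T : B →ₗ[ℝ] Module.Dual ℝ B := ((innerₗ E).compl₂ A).comp A
  have hT : Function.Injective T := by
    rw [← LinearMap.ker_eq_bot, LinearMap.ker_eq_bot']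
    intro a ha
    have h1 : ⟪A a, A a⟫_ℝ = 0 := LinearMap.congr_fun ha a
    exact hA (by rw [inner_self_eq_zero.1 h1, map_zero])
  have hT2 : Function.Surjective T :=
    (LinearMap.injective_iff_surjective_of_finrank_eq_finrank
      (Subspace.dual_finrank_eq (K := ℝ) (V := B)).symm).1 hT
  let p : Module.Dual ℝ B := (push I φ x : TangentSpace I x →L[ℝ] ℝ).toLinearMap
  obtain ⟨g, hg⟩ := hT2 p
  refine ⟨g, fun v => LinearMap.congr_fun hg v, fun g' hg' => hT ?_⟩
  rw [hg]
  exact LinearMap.ext hg'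

/-- The gradient of `φ` at `x` in the metric induced by `f`. -/
def grad (f : M → E) (φ : M → ℝ) (x : M) : TangentSpace I x :=
  Classical.epsilon fun g : TangentSpace I x => ∀ v : TangentSpace I x,
    ⟪push I f x g, push I f x v⟫_ℝ = push I φ x v

/-- The map `F = f_* ∇φ + β`. -/
def combescure (f : M → E) (φ : M → ℝ) (β : M → E) (x : M) : E :=
  push I f x (grad I f φ x) + β x

/-- `f_* (Hess φ) v`, where `(Hess φ) v = ∇_v ∇φ` for the Levi-Civita connection of the metric
induced by `f`, which is the tangential part of the derivative in `E`. -/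
def hess (f : M → E) (φ : M → ℝ) (x : M) (v : TangentSpace I x) : E :=
  (tangent I f x).starProjection (push I (fun y => push I f y (grad I f φ y)) x v)

/-- `f_* A_β v`, where `A_β` is the shape operator in the direction of the normal field `β`. -/
def shape (f β : M → E) (x : M) (v : TangentSpace I x) : E :=
  - (tangent I f x).starProjection (push I β x v)

/-- The tensor `Φ = Hess φ - A_β`, composed with `f_*`. -/
def codazziTensor (f : M → E) (φ : M → ℝ) (β : M → E) (x : M) (v : TangentSpace I x) : E :=
  hess I f φ x v - shape I f β x v

/-- `(φ, β) ∈ S(f)`: `α_f(∇φ, v) + ∇^⊥_v β = 0` for all `v`, and `φ` and `F` vanish nowhere. -/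
structure IsRibaucourPairOn (U : Set M) (f : M → E) (φ : M → ℝ) (β : M → E) : Prop where
  smooth : ContMDiffOn I 𝓘(ℝ, ℝ) ∞ φ U
  section_normal : IsSectionOn I U (normal I f) β
  eqn : ∀ x ∈ U, ∀ v : TangentSpace I x,
    sff I f x (grad I f φ x) v + normalDeriv I f β x v = 0
  ne_zero : ∀ x ∈ U, φ x ≠ 0
  combescure_ne_zero : ∀ x ∈ U, combescure I f φ β x ≠ 0

/-- An endomorphism field `Φ` of the tangent bundle (composed with `f_*`) is a Codazzi tensor:
it is symmetric and smooth, and `∇_X(ΦY) - ∇_Y(ΦX) = Φ[X, Y]`,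
equivalently `(∇_X Φ)Y = (∇_Y Φ)X`. -/
structure IsCodazziOn [IsManifold I 1 M] (U : Set M) (f : M → E)
    (Φ : ∀ x : M, TangentSpace I x → E) : Prop where
  mem_tangent : ∀ x ∈ U, ∀ v, Φ x v ∈ tangent I f x
  symm : ∀ x ∈ U, ∀ v w : TangentSpace I x, ⟪Φ x v, push I f x w⟫_ℝ = ⟪push I f x v, Φ x w⟫_ℝ
  smooth : ∀ V ⊆ U, IsOpen V → ∀ X : (∀ x : M, TangentSpace I x), IsVectorFieldOn I V X →
    ContMDiffOn I 𝓘(ℝ, E) ∞ (fun x => Φ x (X x)) V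
  codazzi : ∀ V ⊆ U, IsOpen V → ∀ X Y : (∀ x : M, TangentSpace I x),
    IsVectorFieldOn I V X → IsVectorFieldOn I V Y → ∀ x ∈ V,
      (tangent I f x).starProjection (push I (fun y => Φ y (Y y)) x (X x))
        - (tangent I f x).starProjection (push I (fun y => Φ y (X y)) x (Y x))
        = Φ x (VectorField.mlieBracket I X Y x)

/-- `Φ` (composed with `f_*`) is a Dupin tensor adapted to the net `(E_{η₁}, …, E_{η_k})`: a
Codazzi tensor of the form `∑ ψ_j P_{E_{η_j}}` with `ψ_j` smooth and constant along `E_{η_j}`. -/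
def IsDupinTensorOn [IsManifold I 1 M] (U : Set M) (f : M → E) {k : ℕ} (η : Fin k → M → E)
    (Φ : ∀ x : M, TangentSpace I x → E) : Prop :=
  IsCodazziOn I U f Φ ∧ ∃ ψ : Fin k → M → ℝ,
    (∀ j, ContMDiffOn I 𝓘(ℝ, ℝ) ∞ (ψ j) U) ∧
    (∀ j, ∀ x ∈ U, ∀ v ∈ nullity I f (η j) x, push I (ψ j) x v = 0) ∧
    ∀ x ∈ U, ∀ v : TangentSpace I x, Φ x v = ∑ j, ψ j x •
      ((nullity I f (η j) x).map (push I f x : TangentSpace I x →ₗ[ℝ] E)).starProjection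
        (push I f x v)

/-- Regularity: `N ≠ 0`, and the fields `-φ⁻¹ β_{N^⊥}, (η₁)_{N^⊥}, …, (η_k)_{N^⊥}` are distinct at
every point. -/
def IsRegularOn (U : Set M) (N : M → Submodule ℝ E) {k : ℕ} (η : Fin k → M → E)
    (φ : M → ℝ) (β : M → E) : Prop :=
  ∀ x ∈ U, N x ≠ ⊥ ∧ (Function.Injective fun j => (N x)ᗮ.starProjection (η j x)) ∧
    ∀ j, (N x)ᗮ.starProjection (η j x) ≠ -((φ x)⁻¹ • (N x)ᗮ.starProjection (β x))

/-- On `U`, `f` is a `k`-Dupin submanifold with principal normals `η_j` and a parallel flat normal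
subbundle `N` of rank `s`, and `(φ, β) ∈ S(f)` determines an `N`-Ribaucour transform of `f` which
is regular and of Dupin type. -/
structure IsRegularDupinTypeOn [IsManifold I 1 M] (U : Set M) (f : M → E) {k : ℕ}
    (η : Fin k → M → E) (N : M → Submodule ℝ E) (s : ℕ) (φ : M → ℝ) (β : M → E) : Prop where
  dupin : IsDupinOn I U f η
  subbundle : IsParallelFlatSubbundleOn I U f N s
  pair : IsRibaucourPairOn I U f φ β
  regular : IsRegularOn U N η φ β
  dupinType : IsDupinTensorOn I U f η (codazziTensor I f φ β)

/-- `F_t = f_* ∇φ + β + t` for the parallel section `t = ∑ y_i ξ_i` of `N`. -/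
def combescureT (f : M → E) (φ : M → ℝ) (β : M → E) {s : ℕ} (ξ : Fin s → M → E)
    (p : M × EuclideanSpace ℝ (Fin s)) : E :=
  combescure I f φ β p.1 + ∑ i, p.2 i • ξ i p.1

/-- The parametrization `(u, t) ↦ f - 2 φ F_t / ‖F_t‖²` of the `N`-Ribaucour transform of `f`
determined by `(φ, β)`, where `t = ∑ y_i ξ_i`. It is meaningful at the points with `F_t ≠ 0`. -/
def ribaucour (f : M → E) (φ : M → ℝ) (β : M → E) {s : ℕ} (ξ : Fin s → M → E)
    (p : M × EuclideanSpace ℝ (Fin s)) : E :=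
  f p.1 - (2 * φ p.1 * (‖combescureT I f φ β ξ p‖ ^ 2)⁻¹) • combescureT I f φ β ξ p

/-- The inversion `z ↦ z / ‖z‖²`; the point `t = ∞` corresponds to `z = 0`. -/
def inv {s : ℕ} (z : EuclideanSpace ℝ (Fin s)) : EuclideanSpace ℝ (Fin s) := (‖z‖ ^ 2)⁻¹ • z

open Classical in
/-- The `N`-Ribaucour transform of `f` together with `f` itself, in the coordinate
`z = t / ‖t‖²`: the section `t = ∞`, that is `z = 0`, is mapped by `f`. -/
def ribaucourAtInfinity (f : M → E) (φ : M → ℝ) (β : M → E) {s : ℕ} (ξ : Fin s → M → E)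
    (p : M × EuclideanSpace ℝ (Fin s)) : E :=
  if p.2 = 0 then f p.1 else ribaucour I f φ β ξ (p.1, inv p.2)

end

end DupinSub

set_option linter.unusedSectionVars false

/-! Everything is computed in parallel normal frames. On a Dupin submanifold each shape operator is
a multiple of the identity on every E_{η_j}, so shape operators commute and every parallel normal
subbundle has local parallel orthonormal frames (`IsDupinOn.exists_frame`). A member ζ of such a
frame satisfies dζ = -⟨η_j, ζ⟩ df on E_{η_j}, and ⟨η_j, ζ⟩ is constant along E_{η_j}. Conversely, an
immersion with normal frames of this kind is Dupin (`isDupinOn_of_frame`). Both halves of the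
theorem come down to producing such frames.

Part (1). Monodromy of parallel sections is excluded by simple connectedness, which gives the global
frame ξ of N. The equation for (φ, β) says that dF is tangent to h, and Dupin type says that dF =
ψ_j dh on E_{η_j}. Put Z = ∑ z_i ξ_i, G = ‖z‖² F + Z and q = ‖F‖² ‖z‖² + 2⟨F, Z⟩ + 1. Then F_t =
‖z‖⁻² G and ‖F_t‖² = ‖z‖⁻² q, so the completed transform is h - 2 φ q⁻¹ G, which is smooth across z
= 0. On vectors orthogonal to N the reflection along F_t is R n = n - 2⟨n, F⟩ G / q, the identity at
z = 0. Along E_{η_j} one has dG = μ_j dh, and the transform has differential (1 - 2 φ μ_j / q) R dh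
there; in the z-directions it is a conformal map onto a subspace orthogonal to the image of R. If ζ
is a parallel section of the complement of N in the normal bundle, then R ζ is normal to the
transform and has diagonal derivative, with curvature components -φ⁻¹⟨β, ζ⟩ in the z-directions and
(q⟨η_j, ζ⟩ + 2 μ_j⟨F, ζ⟩) / (q - 2 φ μ_j) along E_{η_j}. These are constant along their own leaves.
At z = 0 they are the components of the vectors in the definition of regularity, so the principal
normals stay distinct near z = 0. The conullity of the principal normal belonging to the
z-directions is tangent to the slices z = const.

Part (2). Let E_η be the nullity with integrable conullity, and λ_a = ⟨η, ζ_a⟩ for a parallel normal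
frame ζ. Along E_η the quantities λ_a and ζ_a + λ_a f are constant, and their joint differential has
kernel exactly E_η. This gives coordinates (x, y) with E_η vertical, in which integral manifolds of
the conullity are graphs over x. Let h and g be two such leaves and ν = (g - h) / ‖g - h‖².
Constancy along the fibres gives 2⟨ν, ζ_a⟩ = λ_a, and the reflection along g - h takes ζ_a on h to
ζ_a on g. Differentiating, 2⟨dζ_a + λ_a dh, ν⟩ = dλ_a. Since no other principal normal has all the
components λ_a, the tangential part of ν is the same for every g. This is the heart of the
construction (`IsPencilOn.inner_nu_D`).

Fix a base leaf h and s + 1 further leaves, with inversions ν_c. Put φ = ‖ν_{i₀} - ν_none‖⁻¹, F_c =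
-2 φ ν_c and ξ_i = (F_none - F_i) / 2. The reflection along g - h maps the tangent space of the leaf
g into that of h (`IsAdaptedOn.mirror_mem`). It follows that dF_c is tangent to h and that F_c has
tangential part ∇φ, so the ξ_i are parallel normal fields orthogonal to the ζ_a. They are
orthonormal if the leaves are chosen suitably at one point. They span N. The point f(x, y) is
recovered by inverting its own ν, which is the Ribaucour formula with F_t = -2 φ ν.

For Dupin type the derivative dF has to be diagonal in the net E_{η_j}, j ≠ j₀. The maps dζ_a and
dF_c commute as symmetric operators, so joint eigenvectors w span. A further leaf stretches w by a
factor depending continuously on its point y of the fibre (`IsPencilOn.mirror_D_twin`), whence w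
lies in some E_{η_j} of that leaf. By connectedness of the fibre the index j does not depend on y
(`IsLeafPencilOn.exists_index`). So each E_{η_j} over the base leaf consists of joint eigenvectors,
and the stretching factors S_j satisfy λ - l_j = S_j (λ - l'_j), with l_j and l'_j the components of
η_j on the two leaves. Differentiating this relation shows that the eigenvalues 2 φ ‖ν‖² (1 - S_j)
of dF are constant along E_{η_j}. Regularity holds because the η_j are distinguished from each other
and from η by their ζ-components. -/

namespace DupinSub

/-! ### Differential calculus for vector valued maps on a manifold. -/

section Calculus

variable {B : Type*} [NormedAddCommGroup B] [NormedSpace ℝ B]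
  {H : Type*} [TopologicalSpace H] {I : ModelWithCorners ℝ B H}
  {M : Type*} [TopologicalSpace M] [ChartedSpace H M]
  {F : Type*} [NormedAddCommGroup F] [NormedSpace ℝ F]
  {F' : Type*} [NormedAddCommGroup F'] [NormedSpace ℝ F']
  {F'' : Type*} [NormedAddCommGroup F''] [NormedSpace ℝ F'']
  {E : Type*} [NormedAddCommGroup E] [InnerProductSpace ℝ E]

variable (I) in
/-- The map `f` with values in a normed space has differential `f'` at `x`. -/
def HasPush (f : M → F) (x : M) (f' : B →L[ℝ] F) : Prop :=
  HasMFDerivAt I 𝓘(ℝ, F) f x f'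

variable (I) in
/-- The differential of `f` at `x`, as a map on the model space. -/
noncomputable def D (f : M → F) (x : M) : B →L[ℝ] F := mfderiv I 𝓘(ℝ, F) f x

theorem HasPush.eq {f : M → F} {x : M} {f' : B →L[ℝ] F} (h : HasPush I f x f') :
    D I f x = f' :=
  HasMFDerivAt.mfderiv h

theorem hasPush_of_mdifferentiableAt {f : M → F} {x : M}
    (h : MDifferentiableAt I 𝓘(ℝ, F) f x) : HasPush I f x (D I f x) :=
  h.hasMFDerivAt

theorem hasPush_of_contMDiffAt {f : M → F} {x : M} (h : ContMDiffAt I 𝓘(ℝ, F) ∞ f x) :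
    HasPush I f x (D I f x) :=
  hasPush_of_mdifferentiableAt (h.mdifferentiableAt (by simp))

theorem HasPush.mdifferentiableAt {f : M → F} {x : M} {f' : B →L[ℝ] F} (h : HasPush I f x f') :
    MDifferentiableAt I 𝓘(ℝ, F) f x :=
  HasMFDerivAt.mdifferentiableAt h

theorem HasPush.unique {f : M → F} {x : M} {f' f'' : B →L[ℝ] F} (h : HasPush I f x f')
    (h' : HasPush I f x f'') : f' = f'' :=
  hasMFDerivAt_unique h h'

theorem HasPush.congr {f g : M → F} {x : M} {f' : B →L[ℝ] F} (h : HasPush I f x f')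
    (hg : g =ᶠ[𝓝 x] f) : HasPush I g x f' :=
  HasMFDerivAt.congr_of_eventuallyEq h hg

theorem HasPush.continuousAt {f : M → F} {x : M} {f' : B →L[ℝ] F} (h : HasPush I f x f') :
    ContinuousAt f x :=
  HasMFDerivAt.continuousAt h

theorem hasPush_const (c : F) (x : M) : HasPush I (fun _ => c) x (0 : B →L[ℝ] F) :=
  hasMFDerivAt_const c x

theorem HasFDerivAt.comp_hasPush {f : M → F} {x : M} {f' : B →L[ℝ] F} {g : F → F'}
    {g' : F →L[ℝ] F'} (hg : HasFDerivAt g g' (f x)) (hf : HasPush I f x f') :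
    HasPush I (fun y => g (f y)) x (g'.comp f') :=
  HasMFDerivAt.comp x hg.hasMFDerivAt hf

theorem HasPush.prodMk {f : M → F} {g : M → F'} {x : M} {f' : B →L[ℝ] F} {g' : B →L[ℝ] F'}
    (hf : HasPush I f x f') (hg : HasPush I g x g') :
    HasPush I (fun y => (f y, g y)) x (f'.prod g') := by
  refine ⟨hf.1.prodMk hg.1, ?_⟩
  exact HasFDerivWithinAt.prodMk hf.2 hg.2

theorem HasPush.clm (L : F →L[ℝ] F') {f : M → F} {x : M} {f' : B →L[ℝ] F}
    (hf : HasPush I f x f') : HasPush I (fun y => L (f y)) x (L.comp f') :=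
  HasFDerivAt.comp_hasPush L.hasFDerivAt hf

theorem two_le_infty : (2 : ℕ∞ω) ≤ ∞ := by
  exact WithTop.coe_le_coe.2 (le_top : (2 : ℕ∞) ≤ ⊤)

theorem HasPush.add {f g : M → F} {x : M} {f' g' : B →L[ℝ] F}
    (hf : HasPush I f x f') (hg : HasPush I g x g') :
    HasPush I (fun y => f y + g y) x (f' + g') :=
  (hf.prodMk hg).clm (ContinuousLinearMap.fst ℝ F F + ContinuousLinearMap.snd ℝ F F)

theorem HasPush.neg {f : M → F} {x : M} {f' : B →L[ℝ] F}
    (hf : HasPush I f x f') : HasPush I (fun y => -f y) x (-f') :=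
  HasFDerivAt.comp_hasPush (g := fun p : F => -p) (hasFDerivAt_id _).neg hf

theorem HasPush.sub {f g : M → F} {x : M} {f' g' : B →L[ℝ] F}
    (hf : HasPush I f x f') (hg : HasPush I g x g') :
    HasPush I (fun y => f y - g y) x (f' - g') := by
  simpa only [sub_eq_add_neg] using hf.add hg.neg

theorem HasPush.sum {ι : Type*} (s : Finset ι) {f : ι → M → F} {x : M} {f' : ι → B →L[ℝ] F}
    (hf : ∀ i ∈ s, HasPush I (f i) x (f' i)) :
    HasPush I (fun y => ∑ i ∈ s, f i y) x (∑ i ∈ s, f' i) := by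
  classical
  induction s using Finset.induction_on with
  | empty => simpa using hasPush_const (I := I) (0 : F) x
  | insert i s hi ih =>
    simp only [Finset.sum_insert hi]
    exact (hf i (Finset.mem_insert_self i s)).add
      (ih fun j hj => hf j (Finset.mem_insert_of_mem hj))

theorem HasPush.bilin (b : F →L[ℝ] F' →L[ℝ] F'') {f : M → F} {g : M → F'} {x : M}
    {f' : B →L[ℝ] F} {g' : B →L[ℝ] F'} (hf : HasPush I f x f') (hg : HasPush I g x g') :
    HasPush I (fun y => b (f y) (g y)) x
      ((b (f x)).comp g' + (b.flip (g x)).comp f') := by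
  have h := HasFDerivAt.comp_hasPush (f := fun y => (f y, g y))
    (g := fun p : F × F' => b p.1 p.2)
    (b.hasFDerivAt_of_bilinear (x := (f x, g x)) hasFDerivAt_fst hasFDerivAt_snd)
    (hf.prodMk hg)
  exact h

theorem HasPush.smul {c : M → ℝ} {f : M → F} {x : M} {c' : B →L[ℝ] ℝ} {f' : B →L[ℝ] F}
    (hc : HasPush I c x c') (hf : HasPush I f x f') :
    HasPush I (fun y => c y • f y) x (c x • f' + c'.smulRight (f x)) := by
  exact hc.bilin (ContinuousLinearMap.lsmul ℝ ℝ) hf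

theorem HasPush.const_smul (c : ℝ) {f : M → F} {x : M} {f' : B →L[ℝ] F}
    (hf : HasPush I f x f') : HasPush I (fun y => c • f y) x (c • f') := by
  convert (hasPush_const (I := I) c x).smul hf using 1
  ext; simp

theorem HasPush.mul {c d : M → ℝ} {x : M} {c' d' : B →L[ℝ] ℝ}
    (hc : HasPush I c x c') (hd : HasPush I d x d') :
    HasPush I (fun y => c y * d y) x (c x • d' + d x • c') := by
  have e : d x • c' = c'.smulRight (d x) := by
    ext v
    simp [mul_comm]
  rw [e]
  exact hc.smul hd

theorem HasPush.const_mul (c : ℝ) {f : M → ℝ} {x : M} {f' : B →L[ℝ] ℝ}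
    (hf : HasPush I f x f') : HasPush I (fun y => c * f y) x (c • f') :=
  hf.const_smul c

theorem HasPush.inv {c : M → ℝ} {x : M} {c' : B →L[ℝ] ℝ}
    (hc : HasPush I c x c') (h0 : c x ≠ 0) :
    HasPush I (fun y => (c y)⁻¹) x (-((c x ^ 2)⁻¹) • c') := by
  convert HasFDerivAt.comp_hasPush (g := fun p : ℝ => p⁻¹) (hasDerivAt_inv h0).hasFDerivAt hc
    using 1
  ext v
  simp [mul_comm]

theorem HasPush.inner {f g : M → E} {x : M} {f' g' : B →L[ℝ] E}
    (hf : HasPush I f x f') (hg : HasPush I g x g') :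
    HasPush I (fun y => ⟪f y, g y⟫_ℝ) x
      ((innerSL ℝ (f x)).comp g' + (innerSL ℝ (g x)).comp f') := by
  have h := hf.bilin (innerSL ℝ) hg
  have e : ((innerSL ℝ).flip (g x)).comp f' = (innerSL ℝ (g x)).comp f' := by
    ext v
    exact real_inner_comm _ _
  rw [← e]
  exact h

theorem HasPush.clm_apply {A : M → F →L[ℝ] F'} {f : M → F} {x : M} {A' : B →L[ℝ] F →L[ℝ] F'}
    {f' : B →L[ℝ] F} (hA : HasPush I A x A') (hf : HasPush I f x f') :
    HasPush I (fun y => A y (f y)) x ((A x).comp f' + A'.flip (f x)) := by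
  exact hA.bilin (ContinuousLinearMap.id ℝ (F →L[ℝ] F')) hf

theorem hasPush_id_iff {f : B → F} {x : B} {f' : B →L[ℝ] F} :
    HasPush 𝓘(ℝ, B) f x f' ↔ HasFDerivAt f f' x :=
  hasMFDerivAt_iff_hasFDerivAt

theorem _root_.ContMDiffOn.hasPush {f : M → F} {U : Set M} (hU : IsOpen U)
    (hf : ContMDiffOn I 𝓘(ℝ, F) ∞ f U) {x : M} (hx : x ∈ U) :
    HasPush I f x (D I f x) :=
  hasPush_of_contMDiffAt (hf.contMDiffAt (hU.mem_nhds hx))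

theorem D_congr {f g : M → F} {x : M} (h : f =ᶠ[𝓝 x] g) : D I f x = D I g x :=
  h.mfderiv_eq

/-- Chain rule with a map between manifolds. -/
theorem HasPush.comp {B' : Type*} [NormedAddCommGroup B'] [NormedSpace ℝ B']
    {H' : Type*} [TopologicalSpace H'] {I' : ModelWithCorners ℝ B' H'}
    {M' : Type*} [TopologicalSpace M'] [ChartedSpace H' M']
    {f : M → F} {g : M' → M} {x : M'} {f' : B →L[ℝ] F} {g' : B' →L[ℝ] B}
    (hf : HasPush I f (g x) f') (hg : HasMFDerivAt I' I g x g') :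
    HasPush I' (fun y => f (g y)) x (f'.comp g') :=
  HasMFDerivAt.comp x hf hg

theorem D_eq_fderiv {f : B → F} {x : B} : D 𝓘(ℝ, B) f x = fderiv ℝ f x :=
  mfderiv_eq_fderiv

end Calculus

/-! ### Reading maps in a chart; symmetry of second derivatives. -/

section Chart

variable {B : Type*} [NormedAddCommGroup B] [NormedSpace ℝ B]
  {H : Type*} [TopologicalSpace H] {I : ModelWithCorners ℝ B H} [I.Boundaryless]
  {M : Type*} [TopologicalSpace M] [ChartedSpace H M] [IsManifold I ∞ M]
  {F : Type*} [NormedAddCommGroup F] [NormedSpace ℝ F]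
  {E : Type*} [NormedAddCommGroup E] [InnerProductSpace ℝ E]

variable (I) in
/-- A function read in the chart at `x₀`. -/
noncomputable def read (x₀ : M) (f : M → F) : B → F := fun b => f ((extChartAt I x₀).symm b)

variable (I) in
/-- The differential of the chart at `x₀`. -/
noncomputable def dchart (x₀ y : M) : B →L[ℝ] B := mfderiv I 𝓘(ℝ, B) (extChartAt I x₀) y

theorem hasPush_chart {x₀ y : M} (hy : y ∈ (extChartAt I x₀).source) :
    HasPush I (extChartAt I x₀) y (dchart I x₀ y) :=
  (mdifferentiableAt_extChartAt (I := I) (x := x₀) (y := y)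
    (extChartAt_source I x₀ ▸ hy)).hasMFDerivAt

theorem dchart_bijective {x₀ y : M} (hy : y ∈ (extChartAt I x₀).source) :
    Function.Bijective (dchart I x₀ y) := by
  have h := isInvertible_mfderiv_extChartAt hy
  obtain ⟨e, he⟩ := h
  have h2 : ⇑(dchart I x₀ y) = ⇑e := congrArg DFunLike.coe he.symm
  rw [h2]
  exact e.bijective

theorem contMDiffAt_chart_symm {x₀ : M} {b : B} (hb : b ∈ (extChartAt I x₀).target) :
    ContMDiffAt 𝓘(ℝ, B) I ∞ (extChartAt I x₀).symm b :=
  (contMDiffOn_extChartAt_symm x₀).contMDiffAt ((isOpen_extChartAt_target x₀).mem_nhds hb)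

theorem contDiffAt_read {x₀ y : M} (hy : y ∈ (extChartAt I x₀).source) {f : M → F}
    {n : ℕ∞} (hf : ContMDiffAt I 𝓘(ℝ, F) n f y) :
    ContDiffAt ℝ n (read I x₀ f) (extChartAt I x₀ y) := by
  rw [← contMDiffAt_iff_contDiffAt]
  have h1 := contMDiffAt_chart_symm (I := I) ((extChartAt I x₀).map_source hy)
  refine ContMDiffAt.comp _ ?_ (h1.of_le (by exact_mod_cast le_top))
  rwa [(extChartAt I x₀).left_inv hy]

theorem contMDiffAt_of_read {x₀ y : M} (hy : y ∈ (extChartAt I x₀).source) {g : B → F}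
    {n : ℕ∞} (hg : ContDiffAt ℝ n g (extChartAt I x₀ y)) :
    ContMDiffAt I 𝓘(ℝ, F) n (fun z => g (extChartAt I x₀ z)) y := by
  refine ContMDiffAt.comp y hg.contMDiffAt ?_
  have h : ContMDiffAt I 𝓘(ℝ, B) ∞ (extChartAt I x₀) y :=
    contMDiffAt_extChartAt' (by simpa using hy)
  exact h.of_le (by exact_mod_cast le_top)

theorem read_chart {x₀ y : M} (hy : y ∈ (extChartAt I x₀).source) (f : M → F) :
    read I x₀ f (extChartAt I x₀ y) = f y := by
  simp only [read]
  rw [(extChartAt I x₀).left_inv hy]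

theorem eventually_read_chart {x₀ y : M} (hy : y ∈ (extChartAt I x₀).source) (f : M → F) :
    (fun z => read I x₀ f (extChartAt I x₀ z)) =ᶠ[𝓝 y] f := by
  filter_upwards [extChartAt_source_mem_nhds' hy] with z hz using read_chart hz f

theorem hasPush_read {x₀ y : M} (hy : y ∈ (extChartAt I x₀).source) {f : M → F}
    (hf : MDifferentiableAt I 𝓘(ℝ, F) f y) :
    HasPush I f y ((fderiv ℝ (read I x₀ f) (extChartAt I x₀ y)).comp (dchart I x₀ y)) := by
  have h1 : MDifferentiableAt 𝓘(ℝ, B) I (extChartAt I x₀).symm (extChartAt I x₀ y) :=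
    (contMDiffAt_chart_symm ((extChartAt I x₀).map_source hy)).mdifferentiableAt (by simp)
  have h2 : MDifferentiableAt 𝓘(ℝ, B) 𝓘(ℝ, F) (read I x₀ f) (extChartAt I x₀ y) := by
    refine MDifferentiableAt.comp _ ?_ h1
    rwa [(extChartAt I x₀).left_inv hy]
  have h3 : HasPush I (fun z => read I x₀ f (extChartAt I x₀ z)) y
      ((fderiv ℝ (read I x₀ f) (extChartAt I x₀ y)).comp (dchart I x₀ y)) :=
    HasPush.comp (hasPush_id_iff.2 h2.differentiableAt.hasFDerivAt) (hasPush_chart hy)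
  exact h3.congr (eventually_read_chart hy f).symm

theorem D_read {x₀ y : M} (hy : y ∈ (extChartAt I x₀).source) {f : M → F}
    (hf : MDifferentiableAt I 𝓘(ℝ, F) f y) (v : B) :
    D I f y v = fderiv ℝ (read I x₀ f) (extChartAt I x₀ y) (dchart I x₀ y v) := by
  rw [(hasPush_read hy hf).eq]; rfl

theorem _root_.ContMDiffAt.eventually_mdifferentiableAt {f : M → F} {x : M}
    (h : ContMDiffAt I 𝓘(ℝ, F) ∞ f x) : ∀ᶠ y in 𝓝 x, MDifferentiableAt I 𝓘(ℝ, F) f y := by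
  have h1 : ContMDiffAt I 𝓘(ℝ, F) 1 f x := h.of_le (by exact_mod_cast le_top)
  have h2 := (contMDiffAt_iff_contMDiffAt_nhds (by simp)).1 h1
  filter_upwards [h2] with y hy using hy.mdifferentiableAt (by simp)

theorem eventually_of_chart {x₀ : M} {p : M → Prop} (h : ∀ᶠ y in 𝓝 x₀, p y) :
    ∀ᶠ b in 𝓝 (extChartAt I x₀ x₀), b ∈ (extChartAt I x₀).target ∧
      p ((extChartAt I x₀).symm b) := by
  refine Filter.Eventually.and
    ((isOpen_extChartAt_target x₀).mem_nhds (mem_extChartAt_target x₀)) ?_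
  have h1 := continuousAt_extChartAt_symm (I := I) x₀
  rw [ContinuousAt, extChartAt_to_inv] at h1
  exact h1.eventually h

/-- If `⟪a, db⟫` is a closed form, then `⟪da(v), db(w)⟫` is symmetric. -/
theorem inner_D_symm {a b : M → E} {θ : M → ℝ} {x : M}
    (ha : ContMDiffAt I 𝓘(ℝ, E) ∞ a x) (hb : ContMDiffAt I 𝓘(ℝ, E) ∞ b x)
    (hθ : ContMDiffAt I 𝓘(ℝ, ℝ) ∞ θ x)
    (h : ∀ᶠ y in 𝓝 x, ∀ v, ⟪a y, D I b y v⟫_ℝ = D I θ y v) (v w : B) :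
    ⟪D I a x v, D I b x w⟫_ℝ = ⟪D I a x w, D I b x v⟫_ℝ := by
  have hx := mem_extChartAt_source (I := I) x
  have hA := contDiffAt_read hx ha
  have hB := contDiffAt_read hx hb
  have hT := contDiffAt_read hx hθ
  set c := extChartAt I x x
  have key : (fun z => (innerSL ℝ (read I x a z)).comp (fderiv ℝ (read I x b) z))
      =ᶠ[𝓝 c] fun z => fderiv ℝ (read I x θ) z := by
    filter_upwards [eventually_of_chart (I := I) (h.and
        (hb.eventually_mdifferentiableAt.and hθ.eventually_mdifferentiableAt))] with z hz
    obtain ⟨hz, h1, h2, h3⟩ := hz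
    have hy := (extChartAt I x).map_target hz
    ext u
    obtain ⟨u', rfl⟩ := (dchart_bijective hy).2 u
    have := h1 u'
    rw [D_read hy h2, D_read hy h3, (extChartAt I x).right_inv hz] at this
    exact this
  have dA : HasFDerivAt (read I x a) (fderiv ℝ (read I x a) c) c :=
    (hA.differentiableAt (by simp)).hasFDerivAt
  have dB : HasFDerivAt (fderiv ℝ (read I x b)) (fderiv ℝ (fderiv ℝ (read I x b)) c) c :=
    ((hB.fderiv_right (m := 1) two_le_infty).differentiableAt (by simp)).hasFDerivAt
  have dT : HasFDerivAt (fderiv ℝ (read I x θ)) (fderiv ℝ (fderiv ℝ (read I x θ)) c) c :=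
    ((hT.fderiv_right (m := 1) two_le_infty).differentiableAt (by simp)).hasFDerivAt
  have sB := (hB.isSymmSndFDerivAt (by simpa using two_le_infty)).eq
  have sT := (hT.isSymmSndFDerivAt (by simpa using two_le_infty)).eq
  -- Differentiating ⟨a, db⟩ = dθ in the direction p expresses ⟨da(p), db(r)⟩ through second
  -- derivatives of b and θ, which are symmetric in p and r.
  have form : ∀ p r : B, ⟪fderiv ℝ (read I x a) c p, fderiv ℝ (read I x b) c r⟫_ℝ +
      ⟪read I x a c, fderiv ℝ (fderiv ℝ (read I x b)) c p r⟫_ℝ =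
      fderiv ℝ (fderiv ℝ (read I x θ)) c p r := by
    intro p r
    have d1 := dA.inner ℝ (dB.clm_apply (hasFDerivAt_const r c))
    have d2 := dT.clm_apply (hasFDerivAt_const r c)
    have d3 : (fun z => ⟪read I x a z, fderiv ℝ (read I x b) z r⟫_ℝ) =ᶠ[𝓝 c]
        fun z => fderiv ℝ (read I x θ) z r := by
      filter_upwards [key] with z hz
      simpa using congrArg (fun L => L r) hz
    have := congrArg (fun L => L p) (d1.unique (d2.congr_of_eventuallyEq d3))
    simp at this
    linarith
  rw [D_read hx (ha.mdifferentiableAt (by simp)), D_read hx (hb.mdifferentiableAt (by simp)),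
    D_read hx (ha.mdifferentiableAt (by simp)), D_read hx (hb.mdifferentiableAt (by simp))]
  have f1 := form (dchart I x x v) (dchart I x x w)
  have f2 := form (dchart I x x w) (dchart I x x v)
  rw [sB, sT] at f1
  linarith

end Chart

/-! ### Smooth dependence of tangent projections and gradients on the point. -/

section Gram

variable {B : Type*} [NormedAddCommGroup B] [NormedSpace ℝ B] [FiniteDimensional ℝ B]
  {E : Type*} [NormedAddCommGroup E] [InnerProductSpace ℝ E] [FiniteDimensional ℝ E]

/-- The linear form `w ↦ ⟪y, A w⟫`, as a linear function of `y`. -/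
noncomputable def pairing (A : B →L[ℝ] E) : E →L[ℝ] B →L[ℝ] ℝ :=
  ((ContinuousLinearMap.compL ℝ B E ℝ).flip A).comp (innerSL ℝ)

/-- The bilinear form `⟪A v, A w⟫`. -/
noncomputable def gram (A : B →L[ℝ] E) : B →L[ℝ] B →L[ℝ] ℝ := (pairing A).comp A

@[simp] theorem pairing_apply (A : B →L[ℝ] E) (y : E) (w : B) : pairing A y w = ⟪y, A w⟫_ℝ := rfl

@[simp] theorem gram_apply (A : B →L[ℝ] E) (v w : B) : gram A v w = ⟪A v, A w⟫_ℝ := rfl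

theorem isInvertible_gram {A : B →L[ℝ] E} (hA : Function.Injective A) :
    (gram A).IsInvertible := by
  have inj : Function.Injective (gram A) := by
    rw [injective_iff_map_eq_zero]
    intro v hv
    have h1 : ⟪A v, A v⟫_ℝ = 0 := by rw [← gram_apply, hv]; rfl
    exact hA (by rw [inner_self_eq_zero.1 h1, map_zero])
  have hd : Module.finrank ℝ B = Module.finrank ℝ (B →L[ℝ] ℝ) := by
    rw [← (LinearMap.toContinuousLinearMap (𝕜 := ℝ) (E := B) (F' := ℝ)).finrank_eq]
    exact (Subspace.dual_finrank_eq (K := ℝ) (V := B)).symm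
  refine ⟨((gram A : B →ₗ[ℝ] B →L[ℝ] ℝ).linearEquivOfInjective inj hd).toContinuousLinearEquiv, ?_⟩
  ext v w
  rfl

theorem exists_gram_preimage {A : B →L[ℝ] E} (hA : Function.Injective A) (l : B →L[ℝ] ℝ) (w : B) :
    ⟪A ((gram A).inverse l), A w⟫_ℝ = l w := by
  obtain ⟨e, he⟩ := isInvertible_gram hA
  rw [← gram_apply, ← he, ContinuousLinearMap.inverse_equiv]
  simp

/-- The vector (gram A)⁻¹ (pairing A y) solves the normal equations for y. The formula makes the
projection a smooth function of A, which is the source of smoothness of the tangent and normal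
bundles. -/
theorem starProjection_range_eq {A : B →L[ℝ] E} (hA : Function.Injective A) :
    (LinearMap.range (A : B →ₗ[ℝ] E)).starProjection
      = A.comp ((gram A).inverse.comp (pairing A)) := by
  ext1 y
  refine Submodule.eq_starProjection_of_mem_of_inner_eq_zero ?_ ?_
  · exact ⟨_, rfl⟩
  · rintro _ ⟨w, rfl⟩
    rw [inner_sub_left]
    have := exists_gram_preimage hA (pairing A y) w
    simp only [pairing_apply] at this
    simp [this]

theorem contDiffAt_pairing {A : B →L[ℝ] E} : ContDiffAt ℝ ∞ (pairing (B := B) (E := E)) A := by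
  have h : ContDiff ℝ ∞ (fun A : B →L[ℝ] E => (ContinuousLinearMap.compL ℝ B E ℝ).flip A) :=
    ContinuousLinearMap.contDiff (𝕜 := ℝ) (E := B →L[ℝ] E) (F := (E →L[ℝ] ℝ) →L[ℝ] B →L[ℝ] ℝ)
      (ContinuousLinearMap.compL ℝ B E ℝ).flip
  exact h.contDiffAt.clm_comp contDiffAt_const

theorem contDiffAt_gram_inverse {A : B →L[ℝ] E} (hA : Function.Injective A) :
    ContDiffAt ℝ ∞ (fun A : B →L[ℝ] E => (gram A).inverse) A := by
  obtain ⟨e, he⟩ := isInvertible_gram hA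
  have h1 : ContDiffAt ℝ ∞ (gram (B := B) (E := E)) A := contDiffAt_pairing.clm_comp contDiffAt_id
  have h2 := contDiffAt_map_inverse (𝕜 := ℝ) (n := ∞) e
  rw [he] at h2
  exact h2.comp A h1

end Gram

section

variable {B : Type*} [NormedAddCommGroup B] [NormedSpace ℝ B] [FiniteDimensional ℝ B]
  {H : Type*} [TopologicalSpace H] {I : ModelWithCorners ℝ B H} [I.Boundaryless]
  {M : Type*} [TopologicalSpace M] [ChartedSpace H M] [IsManifold I ∞ M]
  {F : Type*} [NormedAddCommGroup F] [NormedSpace ℝ F]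
  {E : Type*} [NormedAddCommGroup E] [InnerProductSpace ℝ E] [FiniteDimensional ℝ E]

theorem tangent_eq (f : M → E) (x : M) :
    tangent I f x = LinearMap.range (D I f x : B →ₗ[ℝ] E) := rfl

theorem IsImmersionOn.injective {U : Set M} {f : M → E} (hf : IsImmersionOn I U f) {x : M}
    (hx : x ∈ U) : Function.Injective (D I f x) := hf.2 x hx

/-- Near a point of an immersion, in a chart, the immersion has injective differential `A`, and
`tangent` is the range of `A`. -/
theorem IsImmersionOn.read_injective {U : Set M} (hU : IsOpen U) {f : M → E}
    (hf : IsImmersionOn I U f) {x y : M} (hx : y ∈ (extChartAt I x).source) (hy : y ∈ U) :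
    Function.Injective (fderiv ℝ (read I x f) (extChartAt I x y)) ∧
    tangent I f y
      = LinearMap.range (fderiv ℝ (read I x f) (extChartAt I x y) : B →ₗ[ℝ] E) := by
  have hm := (ContMDiffOn.hasPush hU hf.1 hy).mdifferentiableAt
  have hb := dchart_bijective hx
  constructor
  · intro v w hvw
    obtain ⟨v, rfl⟩ := hb.2 v
    obtain ⟨w, rfl⟩ := hb.2 w
    rw [← D_read hx hm, ← D_read hx hm] at hvw
    rw [hf.injective hy hvw]
  · rw [tangent_eq]
    ext e
    constructor
    · rintro ⟨v, rfl⟩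
      exact ⟨dchart I x y v, (D_read hx hm v).symm⟩
    · rintro ⟨v, rfl⟩
      obtain ⟨v, rfl⟩ := hb.2 v
      exact ⟨v, D_read hx hm v⟩

theorem contMDiffOn_tangent_starProjection {U : Set M} (hU : IsOpen U) {f : M → E}
    (hf : IsImmersionOn I U f) :
    ContMDiffOn I 𝓘(ℝ, E →L[ℝ] E) ∞ (fun x => (tangent I f x).starProjection) U := by
  intro x hx
  have hs := mem_extChartAt_source (I := I) x
  have hr : ContDiffAt ℝ ∞ (read I x f) (extChartAt I x x) :=
    contDiffAt_read hs (hf.1.contMDiffAt (hU.mem_nhds hx))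
  have hA : ContDiffAt ℝ ∞ (fderiv ℝ (read I x f)) (extChartAt I x x) :=
    hr.fderiv_right (by simp)
  have hinj := (hf.read_injective hU hs hx).1
  have h1 : ContDiffAt ℝ ∞ (fun A : B →L[ℝ] E => A.comp ((gram A).inverse.comp (pairing A)))
      (fderiv ℝ (read I x f) (extChartAt I x x)) :=
    contDiffAt_id.clm_comp ((contDiffAt_gram_inverse hinj).clm_comp contDiffAt_pairing)
  have h2 := contMDiffAt_of_read hs (h1.comp _ hA)
  refine (h2.congr_of_eventuallyEq ?_).contMDiffWithinAt
  filter_upwards [hU.mem_nhds hx, extChartAt_source_mem_nhds (I := I) x] with y hy hyc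
  obtain ⟨h3, h4⟩ := hf.read_injective hU hyc hy
  simp only [h4]
  exact starProjection_range_eq h3

variable (I) in
/-- The gradient, as a vector of the model space. -/
noncomputable def gradB (f : M → E) (φ : M → ℝ) (x : M) : B := grad I f φ x

/-- `grad` is chosen by `Classical.epsilon`; it has the defining property of a gradient once
injectivity of the differential ensures existence. -/
theorem push_grad {f : M → E} {x : M} (hf : Function.Injective (D I f x)) (φ : M → ℝ) (v : B) :
    ⟪D I f x (gradB I f φ x), D I f x v⟫_ℝ = D I φ x v := by
  have h := (existsUnique_gradient I f φ x hf).exists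
  exact Classical.epsilon_spec h v

/-- In a chart, f_* ∇φ = A (gram A)⁻¹ (dφ), where A is the differential of f. -/
theorem contMDiffOn_push_grad {U : Set M} (hU : IsOpen U) {f : M → E}
    (hf : IsImmersionOn I U f) {φ : M → ℝ} (hφ : ContMDiffOn I 𝓘(ℝ, ℝ) ∞ φ U) :
    ContMDiffOn I 𝓘(ℝ, E) ∞ (fun x => D I f x (gradB I f φ x)) U := by
  intro x hx
  have hs := mem_extChartAt_source (I := I) x
  have hr : ContDiffAt ℝ ∞ (read I x f) (extChartAt I x x) :=
    contDiffAt_read hs (hf.1.contMDiffAt (hU.mem_nhds hx))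
  have hrφ : ContDiffAt ℝ ∞ (read I x φ) (extChartAt I x x) :=
    contDiffAt_read hs (hφ.contMDiffAt (hU.mem_nhds hx))
  have hA : ContDiffAt ℝ ∞ (fderiv ℝ (read I x f)) (extChartAt I x x) :=
    hr.fderiv_right (by simp)
  have hl : ContDiffAt ℝ ∞ (fderiv ℝ (read I x φ)) (extChartAt I x x) :=
    hrφ.fderiv_right (by simp)
  have hinj := (hf.read_injective hU hs hx).1
  have h2 := contMDiffAt_of_read hs
    (hA.clm_apply (((contDiffAt_gram_inverse hinj).comp _ hA).clm_apply hl))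
  refine (h2.congr_of_eventuallyEq ?_).contMDiffWithinAt
  filter_upwards [hU.mem_nhds hx, extChartAt_source_mem_nhds (I := I) x] with y hy hyc
  obtain ⟨h3, -⟩ := hf.read_injective hU hyc hy
  have hm := (ContMDiffOn.hasPush hU hf.1 hy).mdifferentiableAt
  have hmφ := (ContMDiffOn.hasPush hU hφ hy).mdifferentiableAt
  simp only [Function.comp]
  set A := fderiv ℝ (read I x f) (extChartAt I x y)
  rw [D_read hyc hm]
  congr 1
  refine (isInvertible_gram h3).injective ?_
  ext w
  obtain ⟨w, rfl⟩ := (dchart_bijective hyc).2 w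
  rw [gram_apply, gram_apply, exists_gram_preimage h3, ← D_read hyc hm, ← D_read hyc hm,
    ← D_read hyc hmφ]
  exact push_grad (hf.injective hy) φ w

end

/-! ### Lie brackets and second derivatives of vector valued maps. -/

section Bracket

variable {B : Type*} [NormedAddCommGroup B] [NormedSpace ℝ B] [CompleteSpace B]
  {H : Type*} [TopologicalSpace H] {I : ModelWithCorners ℝ B H} [I.Boundaryless]
  {M : Type*} [TopologicalSpace M] [ChartedSpace H M] [IsManifold I ∞ M]
  {F : Type*} [NormedAddCommGroup F] [NormedSpace ℝ F]

/-- A vector field, with values in the model space. -/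
def vec (X : ∀ x : M, TangentSpace I x) (x : M) : B := X x

theorem contMDiffOn_D_apply {V : Set M} (hV : IsOpen V) {g : M → F}
    (hg : ContMDiffOn I 𝓘(ℝ, F) ∞ g V) {X : ∀ x : M, TangentSpace I x}
    (hX : IsVectorFieldOn I V X) :
    ContMDiffOn I 𝓘(ℝ, F) ∞ (fun x => D I g x (vec X x)) V := by
  have h1 := hg.contMDiffOn_tangentMapWithin (m := ∞) (by simp) hV.uniqueMDiffOn
  have h2 : ContMDiffOn I 𝓘(ℝ, F).tangent ∞
      (fun x => tangentMapWithin I 𝓘(ℝ, F) g V ⟨x, X x⟩) V :=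
    h1.comp hX (fun x hx => hx)
  have h3 := (contMDiff_snd_tangentBundle_modelSpace F 𝓘(ℝ, F) (n := ∞)).comp_contMDiffOn h2
  refine h3.congr fun x hx => ?_
  simp only [Function.comp, tangentMapWithin, mfderivWithin_of_isOpen hV hx]
  rfl

/-- Pulled back to the chart, the claim is the identity for brackets in a vector space, where the
second derivative of g drops out by symmetry. -/
theorem D_mlieBracket {V : Set M} (hV : IsOpen V) {g : M → F}
    (hg : ContMDiffOn I 𝓘(ℝ, F) ∞ g V) {X Y : ∀ x : M, TangentSpace I x}
    (hX : IsVectorFieldOn I V X) (hY : IsVectorFieldOn I V Y) {x : M} (hx : x ∈ V) :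
    D I g x (vec (VectorField.mlieBracket I X Y) x)
      = D I (fun y => D I g y (vec Y y)) x (vec X x)
        - D I (fun y => D I g y (vec X y)) x (vec Y x) := by
  have hs := mem_extChartAt_source (I := I) x
  set c := extChartAt I x
  let pb : (∀ x : M, TangentSpace I x) → B → B := fun Z =>
    VectorField.mpullbackWithin 𝓘(ℝ, B) I c.symm Z (Set.range I)
  have pb_eq : ∀ Z : (∀ x : M, TangentSpace I x), ∀ z ∈ c.target,
      pb Z z = dchart I x (c.symm z) (vec Z (c.symm z)) := by
    intro Z z hz
    have h1 := mfderiv_extChartAt_comp_mfderivWithin_extChartAt_symm (I := I) hz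
    have h2 := mfderivWithin_extChartAt_symm_comp_mfderiv_extChartAt (I := I) hz
    have h3 := ContinuousLinearMap.inverse_eq h2 h1
    exact congrArg (fun L => L (Z (c.symm z))) h3
  have pb_diff : ∀ Z : (∀ x : M, TangentSpace I x), IsVectorFieldOn I V Z →
      DifferentiableAt ℝ (pb Z) (c x) := by
    intro Z hZ
    have h1 := ((hZ x hx).mdifferentiableWithinAt (by simp)).mdifferentiableAt (hV.mem_nhds hx)
    have h2 :=
      (mdifferentiableWithinAt_univ.2 h1).differentiableWithinAt_mpullbackWithin_vectorField
    have h3 : (extChartAt I x).symm ⁻¹' Set.univ ∩ Set.range I = Set.univ := by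
      rw [I.range_eq_univ]; simp
    rw [h3] at h2
    have h4 : DifferentiableWithinAt ℝ (pb Z) Set.univ (c x) := h2
    exact differentiableWithinAt_univ.1 h4
  have hbr : vec (VectorField.mlieBracket I X Y) x
      = (dchart I x x).inverse (VectorField.lieBracket ℝ (pb X) (pb Y) (c x)) := by
    have h3 : (extChartAt I x).symm ⁻¹' Set.univ ∩ Set.range I = Set.univ := by
      rw [I.range_eq_univ]; simp
    have h4 := VectorField.mlieBracketWithin_apply (I := I) (V := X) (W := Y) (s := Set.univ)
      (x₀ := x)
    rw [h3] at h4
    have h5 : vec (VectorField.mlieBracket I X Y) x = (dchart I x x).inverse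
      (VectorField.lieBracketWithin ℝ (pb X) (pb Y) Set.univ (c x)) := h4
    rwa [VectorField.lieBracketWithin_univ] at h5
  have hinv : dchart I x x ((dchart I x x).inverse (VectorField.lieBracket ℝ (pb X) (pb Y) (c x)))
      = VectorField.lieBracket ℝ (pb X) (pb Y) (c x) := by
    have h5 : (dchart I x x).IsInvertible := isInvertible_mfderiv_extChartAt hs
    obtain ⟨e, he⟩ := h5
    rw [← he, ContinuousLinearMap.inverse_equiv]
    simp
  have hgm : ∀ y ∈ V, MDifferentiableAt I 𝓘(ℝ, F) g y :=
    fun y hy => (ContMDiffOn.hasPush hV hg hy).mdifferentiableAt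
  have hread : ∀ Z : (∀ x : M, TangentSpace I x),
      read I x (fun y => D I g y (vec Z y)) =ᶠ[𝓝 (c x)] fun z => fderiv ℝ (read I x g) z (pb Z z) := by
    intro Z
    filter_upwards [eventually_of_chart (I := I) (hV.mem_nhds hx)] with z hz
    rw [pb_eq Z z hz.1]
    simp only [read]
    rw [D_read (c.map_target hz.1) (hgm _ hz.2), c.right_inv hz.1]
  have hD : ∀ Z : (∀ x : M, TangentSpace I x), IsVectorFieldOn I V Z → ∀ v : B,
      D I (fun y => D I g y (vec Z y)) x v
        = fderiv ℝ (fun z => fderiv ℝ (read I x g) z (pb Z z)) (c x) (dchart I x x v) := by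
    intro Z hZ v
    rw [D_read hs (ContMDiffOn.hasPush hV (contMDiffOn_D_apply hV hg hZ) hx).mdifferentiableAt,
      (hread Z).fderiv_eq]
  have hval : ∀ Z : (∀ x : M, TangentSpace I x), dchart I x x (vec Z x) = pb Z (c x) := by
    intro Z
    rw [pb_eq Z _ (mem_extChartAt_target x), extChartAt_to_inv]
  have main := VectorField.fderiv_apply_lieBracket (𝕜 := ℝ) (n := ∞)
    (contDiffAt_read hs (hg.contMDiffAt (hV.mem_nhds hx))) (by simpa using two_le_infty)
    (pb_diff Y hY) (pb_diff X hX)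
  rw [hbr, D_read hs (hgm x hx), hinv, hD Y hY, hD X hX, hval, hval]
  exact main

end Bracket

theorem inner_eq_zero_of_mem_span {E : Type*} [NormedAddCommGroup E] [InnerProductSpace ℝ E]
    {ι : Type*} {e : ι → E} {a b : E} (h : ∀ i, ⟪a, e i⟫_ℝ = 0)
    (hb : b ∈ Submodule.span ℝ (Set.range e)) : ⟪a, b⟫_ℝ = 0 := by
  induction hb using Submodule.span_induction with
  | zero => simp
  | add a b _ _ ha hb => rw [inner_add_right, ha, hb, add_zero]
  | smul c a _ ha => rw [real_inner_smul_right, ha, mul_zero]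
  | mem _ hx => obtain ⟨i, rfl⟩ := hx; exact h i

theorem eq_of_inner_eq {E : Type*} [NormedAddCommGroup E] [InnerProductSpace ℝ E]
    {K : Submodule ℝ E} {a b : E} (ha : a ∈ K) (hb : b ∈ K)
    (h : ∀ n ∈ K, ⟪a, n⟫_ℝ = ⟪b, n⟫_ℝ) : a = b := by
  have h1 := h (a - b) (K.sub_mem ha hb)
  rw [← sub_eq_zero, ← inner_self_eq_zero (𝕜 := ℝ), inner_sub_left, h1, sub_self]

/-! ### Second fundamental form, nullities, and the map F. -/

section

variable {B : Type*} [NormedAddCommGroup B] [NormedSpace ℝ B] [FiniteDimensional ℝ B]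
  {H : Type*} [TopologicalSpace H] {I : ModelWithCorners ℝ B H} [I.Boundaryless]
  {M : Type*} [TopologicalSpace M] [ChartedSpace H M] [IsManifold I ∞ M]
  {E : Type*} [NormedAddCommGroup E] [InnerProductSpace ℝ E] [FiniteDimensional ℝ E]

variable (I) in
/-- The second fundamental form, on the model space. -/
noncomputable def sffB (f : M → E) (x : M) (v w : B) : E := sff I f x v w

variable (I) in
/-- The nullity, as a subspace of the model space. -/
def nullB (f η : M → E) (x : M) : Submodule ℝ B := nullity I f η x

variable (I) in
/-- The normal derivative, on the model space. -/
noncomputable def nablaB (f ξ : M → E) (x : M) (v : B) : E := normalDeriv I f ξ x v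

theorem sffB_eq (f : M → E) (x : M) (v w : B) : sffB I f x v w = (normal I f x).starProjection
    (D I (fun y => (tangent I f y).starProjection (D I f x w)) x v) := rfl

theorem nablaB_eq (f ξ : M → E) (x : M) (v : B) :
    nablaB I f ξ x v = (normal I f x).starProjection (D I ξ x v) := rfl

theorem mem_nullB {f η : M → E} {x : M} {v : B} : v ∈ nullB I f η x ↔
    ∀ w : B, sffB I f x v w = ⟪D I f x v, D I f x w⟫_ℝ • η x := Iff.rfl

theorem mem_normal {f : M → E} {x : M} {n : E} :
    n ∈ normal I f x ↔ ∀ w : B, ⟪n, D I f x w⟫_ℝ = 0 := by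
  rw [normal, Submodule.mem_orthogonal']
  constructor
  · intro h w
    exact h _ ⟨w, rfl⟩
  · rintro h _ ⟨w, rfl⟩
    exact h w

theorem D_mem_tangent (f : M → E) (x : M) (w : B) : D I f x w ∈ tangent I f x := ⟨w, rfl⟩

theorem sffB_mem_normal (f : M → E) (x : M) (v w : B) : sffB I f x v w ∈ normal I f x :=
  Submodule.starProjection_apply_mem _ _

theorem inner_normal_starProjection {f : M → E} {x : M} {n : E} (hn : n ∈ normal I f x) (y : E) :
    ⟪(normal I f x).starProjection y, n⟫_ℝ = ⟪y, n⟫_ℝ := by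
  rw [Submodule.inner_starProjection_left_eq_right, Submodule.starProjection_eq_self_iff.2 hn]

theorem normal_starProjection (f : M → E) (x : M) :
    (normal I f x).starProjection
      = ContinuousLinearMap.id ℝ E - (tangent I f x).starProjection := by
  ext y
  rw [normal, Submodule.starProjection_orthogonal]

/-- If `⟪a, b⟫` vanishes near `x`, differentiate. -/
theorem inner_D_add_eq_zero {a b : M → E} {x : M} (ha : MDifferentiableAt I 𝓘(ℝ, E) a x)
    (hb : MDifferentiableAt I 𝓘(ℝ, E) b x) (h : ∀ᶠ y in 𝓝 x, ⟪a y, b y⟫_ℝ = 0) (v : B) :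
    ⟪D I a x v, b x⟫_ℝ + ⟪a x, D I b x v⟫_ℝ = 0 := by
  have h1 := (hasPush_of_mdifferentiableAt ha).inner (hasPush_of_mdifferentiableAt hb)
  have h2 : HasPush I (fun y => ⟪a y, b y⟫_ℝ) x 0 := (hasPush_const (0 : ℝ) x).congr h
  have := congrArg (fun L => L v) (h1.unique h2)
  simp at this
  linarith [real_inner_comm (b x) (D I a x v)]

variable {U : Set M} {f : M → E} {x : M}

/-- Weingarten's formula: differentiate ⟨P w, n⟩ = 0, where P w is the tangential extension that
defines `sff`. -/
theorem inner_sffB (hU : IsOpen U) (hf : IsImmersionOn I U f) (hx : x ∈ U) {n : M → E}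
    (hn : MDifferentiableAt I 𝓘(ℝ, E) n x) (hperp : ∀ᶠ y in 𝓝 x, n y ∈ normal I f y) (v w : B) :
    ⟪sffB I f x v w, n x⟫_ℝ = -⟪D I f x w, D I n x v⟫_ℝ := by
  have hP := (contMDiffOn_tangent_starProjection hU hf).contMDiffAt (hU.mem_nhds hx)
  have h1 := (hasPush_of_contMDiffAt hP).clm_apply (hasPush_const (D I f x w) x)
  rw [sffB_eq, inner_normal_starProjection hperp.self_of_nhds]
  have h2 := inner_D_add_eq_zero h1.mdifferentiableAt hn (by
    filter_upwards [hperp] with y hy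
    exact Submodule.inner_right_of_mem_orthogonal (Submodule.starProjection_apply_mem _ _) hy) v
  rw [Submodule.starProjection_eq_self_iff.2 (D_mem_tangent f x w)] at h2
  linarith

theorem contMDiffOn_normal_starProjection (hU : IsOpen U) (hf : IsImmersionOn I U f) :
    ContMDiffOn I 𝓘(ℝ, E →L[ℝ] E) ∞ (fun x => (normal I f x).starProjection) U := by
  simp only [normal_starProjection]
  exact contMDiffOn_const.sub (contMDiffOn_tangent_starProjection hU hf)

/-- Every normal vector extends to a smooth normal field. -/
theorem exists_normal_extension (hU : IsOpen U) (hf : IsImmersionOn I U f) {n : E}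
    (hn : n ∈ normal I f x) :
    ∃ ξ : M → E, ContMDiffOn I 𝓘(ℝ, E) ∞ ξ U ∧ (∀ y, ξ y ∈ normal I f y) ∧ ξ x = n :=
  ⟨fun y => (normal I f y).starProjection n,
    (contMDiffOn_normal_starProjection hU hf).clm_apply contMDiffOn_const,
    fun _ => Submodule.starProjection_apply_mem _ _, Submodule.starProjection_eq_self_iff.2 hn⟩

/-- The definition of `sff` extends only the second argument. Against a normal field ξ the symmetry
comes from `inner_D_symm`, since the form ⟨ξ, df⟩ vanishes and so is the differential of a constant.
-/
theorem sffB_symm (hU : IsOpen U) (hf : IsImmersionOn I U f) (hx : x ∈ U) (v w : B) :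
    sffB I f x v w = sffB I f x w v := by
  refine eq_of_inner_eq (sffB_mem_normal f x v w) (sffB_mem_normal f x w v) fun n hn => ?_
  obtain ⟨ξ, hs, hp, rfl⟩ := exists_normal_extension hU hf hn
  have hs' := hs.contMDiffAt (hU.mem_nhds hx)
  have hm := hs'.mdifferentiableAt (by simp)
  rw [inner_sffB hU hf hx hm (.of_forall hp), inner_sffB hU hf hx hm (.of_forall hp)]
  have := inner_D_symm hs' (hf.1.contMDiffAt (hU.mem_nhds hx))
    (contMDiffAt_const (c := (0 : ℝ))) (.of_forall fun y u => by
      rw [mem_normal.1 (hp y) u, (hasPush_const (I := I) (0 : ℝ) y).eq]; rfl) v w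
  rw [real_inner_comm, this, real_inner_comm]

/-- By symmetry α(v, w) equals both ⟨v, w⟩ η and ⟨v, w⟩ η'. -/
theorem inner_D_eq_zero_of_mem_nullB (hU : IsOpen U) (hf : IsImmersionOn I U f) (hx : x ∈ U)
    {η η' : M → E} (hη : η x ≠ η' x) {v w : B} (hv : v ∈ nullB I f η x)
    (hw : w ∈ nullB I f η' x) : ⟪D I f x v, D I f x w⟫_ℝ = 0 := by
  have h1 := mem_nullB.1 hv w
  rw [sffB_symm hU hf hx, mem_nullB.1 hw v, real_inner_comm] at h1
  by_contra h
  exact hη (smul_right_injective E h h1).symm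

/-- A normal field with tangent derivative along `v`, a principal direction. -/
theorem inner_D_of_mem_nullB (hU : IsOpen U) (hf : IsImmersionOn I U f) (hx : x ∈ U)
    {η : M → E} {n : M → E} (hn : MDifferentiableAt I 𝓘(ℝ, E) n x)
    (hperp : ∀ᶠ y in 𝓝 x, n y ∈ normal I f y) {v : B} (hv : v ∈ nullB I f η x) (w : B) :
    ⟪D I n x v, D I f x w⟫_ℝ = -⟪η x, n x⟫_ℝ * ⟪D I f x v, D I f x w⟫_ℝ := by
  have h := inner_sffB hU hf hx hn hperp v w
  rw [mem_nullB.1 hv w, inner_smul_left] at h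
  simp only [conj_trivial] at h
  rw [real_inner_comm]
  linarith

theorem D_eq_neg_smul_of_mem_nullB (hU : IsOpen U) (hf : IsImmersionOn I U f) (hx : x ∈ U)
    {η : M → E} {n : M → E} (hn : MDifferentiableAt I 𝓘(ℝ, E) n x)
    (hperp : ∀ᶠ y in 𝓝 x, n y ∈ normal I f y) {v : B} (hv : v ∈ nullB I f η x)
    (ht : D I n x v ∈ tangent I f x) :
    D I n x v = -(⟪η x, n x⟫_ℝ • D I f x v) := by
  refine eq_of_inner_eq ht (Submodule.neg_mem _ (Submodule.smul_mem _ _ (D_mem_tangent f x v))) ?_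
  rintro _ ⟨w, rfl⟩
  have := inner_D_of_mem_nullB hU hf hx hn hperp hv w
  rw [inner_neg_left, inner_smul_left]
  simp only [conj_trivial, ContinuousLinearMap.coe_coe]
  change ⟪D I n x v, D I f x w⟫_ℝ = -(_ * ⟪D I f x v, D I f x w⟫_ℝ)
  linarith

theorem mem_tangent_of_nablaB_eq_zero {n : M → E} {v : B} (h : nablaB I f n x v = 0) :
    D I n x v ∈ tangent I f x := by
  rw [nablaB_eq, normal_starProjection] at h
  simp only [sub_apply, ContinuousLinearMap.id_apply, sub_eq_zero] at h
  rw [h]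
  exact Submodule.starProjection_apply_mem _ _

theorem nablaB_eq_zero_of_mem_tangent {n : M → E} {v : B} (h : D I n x v ∈ tangent I f x) :
    nablaB I f n x v = 0 := by
  rw [nablaB_eq, normal_starProjection, sub_apply,
    Submodule.starProjection_eq_self_iff.2 h, ContinuousLinearMap.id_apply, sub_self]

theorem combescure_eq (f : M → E) (φ : M → ℝ) (β : M → E) (x : M) :
    combescure I f φ β x = D I f x (gradB I f φ x) + β x := rfl

theorem contMDiffOn_combescure (hU : IsOpen U) (hf : IsImmersionOn I U f) {φ : M → ℝ} {β : M → E}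
    (h : IsRibaucourPairOn I U f φ β) : ContMDiffOn I 𝓘(ℝ, E) ∞ (combescure I f φ β) U :=
  (contMDiffOn_push_grad hU hf h.smooth).add h.section_normal.1

theorem inner_combescure (hf : IsImmersionOn I U f) {φ : M → ℝ} {β : M → E}
    (h : IsRibaucourPairOn I U f φ β) (hx : x ∈ U) (v : B) :
    ⟪combescure I f φ β x, D I f x v⟫_ℝ = D I φ x v := by
  rw [combescure_eq, inner_add_left, push_grad (hf.injective hx),
    mem_normal.1 (h.section_normal.2 x hx), add_zero]

/-- Hess φ and -A_β are the tangential parts of the derivatives of the two summands of F. -/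
theorem codazziTensor_eq (hU : IsOpen U) (hf : IsImmersionOn I U f) {φ : M → ℝ} {β : M → E}
    (hφ : ContMDiffOn I 𝓘(ℝ, ℝ) ∞ φ U) (hβ : ContMDiffOn I 𝓘(ℝ, E) ∞ β U) (hx : x ∈ U) (v : B) :
    codazziTensor I f φ β x v
      = (tangent I f x).starProjection (D I (combescure I f φ β) x v) := by
  have h1 := (contMDiffOn_push_grad hU hf hφ).hasPush hU hx
  have h2 := hβ.hasPush hU hx
  have h3 : HasPush I (combescure I f φ β) x _ := h1.add h2
  rw [h3.eq, add_apply, map_add]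
  change _ - -_ = _
  rw [sub_neg_eq_add]
  rfl

/-- The normal part of the derivative of `f_* ∇φ`. -/
theorem normal_starProjection_D_push_grad (hU : IsOpen U) (hf : IsImmersionOn I U f) {φ : M → ℝ}
    (hφ : ContMDiffOn I 𝓘(ℝ, ℝ) ∞ φ U) (hx : x ∈ U) (v : B) :
    (normal I f x).starProjection (D I (fun y => D I f y (gradB I f φ y)) x v)
      = sffB I f x (gradB I f φ x) v := by
  refine eq_of_inner_eq (Submodule.starProjection_apply_mem _ _) (sffB_mem_normal _ _ _ _)
    fun n hn => ?_
  obtain ⟨ξ, hs, hp, rfl⟩ := exists_normal_extension hU hf hn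
  have hm := (hs.hasPush hU hx).mdifferentiableAt
  have hg := ((contMDiffOn_push_grad hU hf hφ).hasPush hU hx).mdifferentiableAt
  rw [sffB_symm hU hf hx, inner_sffB hU hf hx hm (.of_forall hp), inner_normal_starProjection hn]
  have := inner_D_add_eq_zero hg hm (.of_forall fun y => by
    rw [real_inner_comm]; exact mem_normal.1 (hp y) _) v
  linarith

/-- The normal part of dF is α(∇φ, ·) + ∇^⊥ β, so the defining equation of the pair says precisely
that it vanishes. -/
theorem D_combescure_mem_tangent (hU : IsOpen U) (hf : IsImmersionOn I U f) {φ : M → ℝ}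
    {β : M → E} (h : IsRibaucourPairOn I U f φ β) (hx : x ∈ U) (v : B) :
    D I (combescure I f φ β) x v ∈ tangent I f x := by
  refine mem_tangent_of_nablaB_eq_zero ?_
  have h1 := (contMDiffOn_push_grad hU hf h.smooth).hasPush hU hx
  have h2 := h.section_normal.1.hasPush hU hx
  have h3 : HasPush I (combescure I f φ β) x _ := h1.add h2
  rw [nablaB_eq, h3.eq, add_apply, map_add,
    normal_starProjection_D_push_grad hU hf h.smooth hx]
  exact h.eqn x hx v

end

/-! ### Parallel sections of a flat subbundle of a trivial bundle. -/

section Frobenius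

variable {B : Type*} [NormedAddCommGroup B] [NormedSpace ℝ B]
  {E : Type*} [NormedAddCommGroup E] [InnerProductSpace ℝ E] [FiniteDimensional ℝ E]

/-- A first order Taylor estimate for a map with Lipschitz derivative. -/
theorem norm_taylor_le {F : Type*} [NormedAddCommGroup F] [NormedSpace ℝ F] {f : B → F}
    {s : Set B} (hs : Convex ℝ s) (hf : ∀ x ∈ s, DifferentiableAt ℝ f x) {K : ℝ} (hK : 0 ≤ K)
    (hl : ∀ x ∈ s, ∀ y ∈ s, ‖fderiv ℝ f x - fderiv ℝ f y‖ ≤ K * ‖x - y‖)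
    {x y : B} (hx : x ∈ s) (hy : y ∈ s) :
    ‖f y - f x - fderiv ℝ f x (y - x)‖ ≤ K * ‖y - x‖ * ‖y - x‖ := by
  have hxy : segment ℝ x y ⊆ s := hs.segment_subset hx hy
  refine Convex.norm_image_sub_le_of_norm_fderiv_le' (𝕜 := ℝ) (s := segment ℝ x y)
    (fun z hz => hf z (hxy hz)) (fun z hz => ?_) (convex_segment x y)
    (left_mem_segment ℝ x y) (right_mem_segment ℝ x y)
  refine (hl z (hxy hz) x hx).trans (mul_le_mul_of_nonneg_left ?_ hK)
  obtain ⟨a, b, ha, hb, hab, rfl⟩ := hz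
  have e : a • x + b • y - x = b • (y - x) := by
    rw [← eq_sub_iff_add_eq] at hab
    rw [hab]; module
  rw [e, norm_smul, Real.norm_of_nonneg hb]
  exact mul_le_of_le_one_left (norm_nonneg _) (by linarith)

variable {P : B → E →L[ℝ] E} {V : Set B}

section Algebra

variable (hV : IsOpen V) (hP : ∀ y ∈ V, DifferentiableAt ℝ P y)
  (hidem : ∀ y ∈ V, ∀ a, P y (P y a) = P y a) (hsymm : ∀ y ∈ V, ∀ a b, ⟪P y a, b⟫_ℝ = ⟪a, P y b⟫_ℝ)

-- This is the derivative of P² = P. It makes dP interchange the range and the kernel of P, as the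
-- lemmas below record.
include hV hP hidem in
theorem fderiv_proj_apply {y : B} (hy : y ∈ V) (v : B) (a : E) :
    fderiv ℝ P y v (P y a) + P y (fderiv ℝ P y v a) = fderiv ℝ P y v a := by
  have h1 : HasFDerivAt (fun z => P z (P z a)) _ y :=
    (hP y hy).hasFDerivAt.clm_apply ((hP y hy).hasFDerivAt.clm_apply (hasFDerivAt_const a y))
  have h2 : HasFDerivAt (fun z => P z a) _ y :=
    (hP y hy).hasFDerivAt.clm_apply (hasFDerivAt_const a y)
  have h3 := h1.unique (h2.congr_of_eventuallyEq
    (Filter.eventually_of_mem (hV.mem_nhds hy) fun z hz => hidem z hz a))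
  have h4 := congrArg (fun L : B →L[ℝ] E => L v) h3
  simpa [add_comm] using h4

include hV hP hsymm in
theorem inner_fderiv_proj {y : B} (hy : y ∈ V) (v : B) (a b : E) :
    ⟪fderiv ℝ P y v a, b⟫_ℝ = ⟪a, fderiv ℝ P y v b⟫_ℝ := by
  have h1 : HasFDerivAt (fun z => ⟪P z a, b⟫_ℝ) _ y :=
    ((hP y hy).hasFDerivAt.clm_apply (hasFDerivAt_const a y)).inner ℝ (hasFDerivAt_const b y)
  have h2 : HasFDerivAt (fun z => ⟪a, P z b⟫_ℝ) _ y :=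
    (hasFDerivAt_const a y).inner ℝ ((hP y hy).hasFDerivAt.clm_apply (hasFDerivAt_const b y))
  have h3 := h1.unique (h2.congr_of_eventuallyEq
    (Filter.eventually_of_mem (hV.mem_nhds hy) fun z hz => hsymm z hz a b))
  have h4 := congrArg (fun L : B →L[ℝ] ℝ => L v) h3
  simpa using h4

include hV hP hidem in
theorem proj_fderiv_proj {y : B} (hy : y ∈ V) (v : B) {n : E} (hn : P y n = n) :
    P y (fderiv ℝ P y v n) = 0 := by
  have h := fderiv_proj_apply hV hP hidem hy v n
  rw [hn] at h
  simpa using h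

include hV hP hidem in
theorem proj_fderiv_of_proj_eq_zero {y : B} (hy : y ∈ V) (v : B) {n : E} (hn : P y n = 0) :
    P y (fderiv ℝ P y v n) = fderiv ℝ P y v n := by
  have h := fderiv_proj_apply hV hP hidem hy v n
  rw [hn] at h
  simpa using h

-- Both iterated derivatives of n lie in the range of P, and pairing one with a gives ⟨dP(w) n,
-- dP(v) P a⟩. The hypothesis, which expresses vanishing curvature of the subbundle, makes this
-- symmetric in v and w.
include hV hP hidem hsymm in
theorem fderiv_proj_comm {y : B} (hy : y ∈ V)
    (hc : ∀ v w : B, ∀ n n' : E, P y n = n → P y n' = n' →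
      ⟪fderiv ℝ P y v n, fderiv ℝ P y w n'⟫_ℝ = ⟪fderiv ℝ P y w n, fderiv ℝ P y v n'⟫_ℝ)
    (v w : B) {n : E} (hn : P y n = n) :
    fderiv ℝ P y v (fderiv ℝ P y w n) = fderiv ℝ P y w (fderiv ℝ P y v n) := by
  have key : ∀ v w : B, ∀ a : E, ⟪fderiv ℝ P y v (fderiv ℝ P y w n), a⟫_ℝ
      = ⟪fderiv ℝ P y w n, fderiv ℝ P y v (P y a)⟫_ℝ := by
    intro v w a
    rw [← proj_fderiv_of_proj_eq_zero hV hP hidem hy v (proj_fderiv_proj hV hP hidem hy w hn),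
      hsymm y hy, inner_fderiv_proj hV hP hsymm hy]
  refine ext_inner_right ℝ fun a => ?_
  rw [key, key]
  exact hc w v n (P y a) hn (hidem y hy a)

end Algebra

/-- A linear differential equation on `[0, 1]` with small coefficients. -/
theorem exists_linear_ode {A : ℝ → E →L[ℝ] E} (hA : ContinuousOn A (Set.Icc 0 1)) {κ : ℝ}
    (hκ : ∀ t ∈ Set.Icc (0 : ℝ) 1, ‖A t‖ ≤ κ) (hκ1 : κ ≤ 1 / 2) (n : E) :
    ∃ c : ℝ → E, c 0 = n ∧ ∀ t ∈ Set.Icc (0 : ℝ) 1,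
      HasDerivWithinAt c (A t (c t)) (Set.Icc 0 1) t := by
  have hκ0 : 0 ≤ κ := (norm_nonneg _).trans (hκ 0 (by simp))
  -- On the ball of radius a about n norms are at most 2a, so with κ ≤ 1/2 the velocity is at most a
  -- and the solution cannot leave the ball in unit time.
  let a : NNReal := ⟨‖n‖ + 1, by positivity⟩
  have hn : ∀ x ∈ Metric.closedBall n a, ‖x‖ ≤ 2 * a := by
    intro x hx
    have h1 : ‖x - n‖ ≤ a := by simpa [dist_eq_norm] using hx
    have h2 : ‖x‖ ≤ ‖x - n‖ + ‖n‖ := by simpa using norm_add_le (x - n) n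
    have h3 : ‖n‖ ≤ a := by change ‖n‖ ≤ ‖n‖ + 1; linarith
    linarith
  have hpl : IsPicardLindelof (fun t x => A t x) (⟨0, by simp⟩ : Set.Icc (0 : ℝ) 1) n a 0 a
      ⟨κ, hκ0⟩ := by
    refine ⟨fun t ht => ?_, fun x _ => hA.clm_apply continuousOn_const, fun t ht x hx => ?_, ?_⟩
    · refine LipschitzOnWith.of_dist_le_mul fun x _ y _ => ?_
      rw [dist_eq_norm, dist_eq_norm, ← map_sub]
      exact (A t).le_of_opNorm_le (hκ t ht) _
    · calc ‖A t x‖ ≤ κ * ‖x‖ := (A t).le_of_opNorm_le (hκ t ht) _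
        _ ≤ 1 / 2 * (2 * a) := by gcongr; exact hn x hx
        _ = a := by ring
    · simp
  obtain ⟨c, hc0, hc⟩ := hpl.exists_eq_forall_mem_Icc_hasDerivWithinAt₀
  exact ⟨c, hc0, hc⟩

/-- Grönwall's inequality with initial value zero. It serves for uniqueness, with ε = 0, and for
error estimates, with ε quadratic in the displacement. -/
theorem norm_le_of_linear_bound {f f' : ℝ → E} {K ε : ℝ} (hK : 0 < K)
    (hf : ∀ t ∈ Set.Icc (0 : ℝ) 1, HasDerivWithinAt f (f' t) (Set.Icc 0 1) t) (h0 : f 0 = 0)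
    (hb : ∀ t ∈ Set.Icc (0 : ℝ) 1, ‖f' t‖ ≤ K * ‖f t‖ + ε) {t : ℝ} (ht : t ∈ Set.Icc (0 : ℝ) 1) :
    ‖f t‖ ≤ ε / K * (Real.exp (K * t) - 1) := by
  have h := norm_le_gronwallBound_of_norm_deriv_right_le (f := f) (f' := f') (δ := 0) (K := K)
    (ε := ε) (a := 0) (b := 1) (fun t ht => (hf t ht).continuousWithinAt)
    (fun t ht => by
      have h1 := hf t ⟨ht.1, ht.2.le⟩
      exact h1.mono_of_mem_nhdsWithin (Icc_mem_nhdsGE_of_mem ht))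
    (by simp [h0]) (fun t ht => hb t ⟨ht.1, ht.2.le⟩) t ht
  rw [gronwallBound_of_K_ne_0 hK.ne'] at h
  simpa using h

/-- Grönwall's inequality applies to c - c(0), which starts at zero. The bound does not depend on
the coefficients, hence is uniform over all rays below. -/
theorem norm_solution_le {A : ℝ → E →L[ℝ] E} (hκ : ∀ t ∈ Set.Icc (0 : ℝ) 1, ‖A t‖ ≤ 1 / 2)
    {c : ℝ → E}
    (hc : ∀ t ∈ Set.Icc (0 : ℝ) 1, HasDerivWithinAt c (A t (c t)) (Set.Icc 0 1) t)
    {t : ℝ} (ht : t ∈ Set.Icc (0 : ℝ) 1) : ‖c t‖ ≤ ‖c 0‖ * Real.exp 1 := by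
  have h1 := norm_le_of_linear_bound (f := fun t => c t - c 0) (K := 1 / 2) (ε := 1 / 2 * ‖c 0‖)
    (by norm_num) (fun t ht => (hc t ht).sub_const (c 0)) (by simp) (fun t ht => by
      calc ‖A t (c t)‖ ≤ 1 / 2 * ‖c t‖ := (A t).le_of_opNorm_le (hκ t ht) _
        _ ≤ 1 / 2 * (‖c t - c 0‖ + ‖c 0‖) := by
          gcongr; simpa using norm_add_le (c t - c 0) (c 0)
        _ = _ := by ring) ht
  have h2 : ‖c t‖ ≤ ‖c t - c 0‖ + ‖c 0‖ := by simpa using norm_add_le (c t - c 0) (c 0)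
  have h3 : Real.exp (1 / 2 * t) ≤ Real.exp 1 := by
    apply Real.exp_le_exp.2; linarith [ht.2]
  have h4 : 1 / 2 * ‖c 0‖ / (1 / 2) * (Real.exp (1 / 2 * t) - 1)
      = ‖c 0‖ * Real.exp (1 / 2 * t) - ‖c 0‖ := by ring
  have h5 := mul_le_mul_of_nonneg_left h3 (norm_nonneg (c 0))
  linarith

theorem norm_apply₂_le (L : B →L[ℝ] E →L[ℝ] E) (v : B) (a : E) :
    ‖L v a‖ ≤ ‖L‖ * ‖v‖ * ‖a‖ :=
  L.le_opNorm₂ v a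

set_option maxSynthPendingDepth 6 in
set_option maxHeartbeats 1000000 in
/-- Around every point, a flat metric subbundle of a trivial bundle has parallel sections with
prescribed initial value. -/
theorem exists_parallel_chart (hV : IsOpen V) (hP : ContDiffOn ℝ ∞ P V)
    (hidem : ∀ y ∈ V, ∀ a, P y (P y a) = P y a)
    (hsymm : ∀ y ∈ V, ∀ a b, ⟪P y a, b⟫_ℝ = ⟪a, P y b⟫_ℝ)
    (hcurv : ∀ y ∈ V, ∀ v w : B, ∀ n n' : E, P y n = n → P y n' = n' →
      ⟪fderiv ℝ P y v n, fderiv ℝ P y w n'⟫_ℝ = ⟪fderiv ℝ P y w n, fderiv ℝ P y v n'⟫_ℝ)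
    {x₀ : B} (hx₀ : x₀ ∈ V) :
    ∃ r > 0, Metric.ball x₀ r ⊆ V ∧ ∀ n₀ : E, P x₀ n₀ = n₀ → ∃ ξ : B → E,
      ContDiffOn ℝ ∞ ξ (Metric.ball x₀ r) ∧ ξ x₀ = n₀ ∧
      ∀ y ∈ Metric.ball x₀ r, P y (ξ y) = ξ y ∧ HasFDerivAt ξ ((fderiv ℝ P y).flip (ξ y)) y := by
  set Ω := fderiv ℝ P with hΩ
  have hdP : ∀ y ∈ V, DifferentiableAt ℝ P y := fun y hy =>
    (hP.contDiffAt (hV.mem_nhds hy)).differentiableAt (by simp)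
  have hΩ1 : ContDiffOn ℝ ∞ Ω V := hP.fderiv_of_isOpen hV (by simp)
  have hΩ2 : ContDiffOn ℝ ∞ (fderiv ℝ Ω) V := hΩ1.fderiv_of_isOpen hV (by simp)
  have hdΩ : ∀ y ∈ V, DifferentiableAt ℝ Ω y := fun y hy =>
    (hΩ1.contDiffAt (hV.mem_nhds hy)).differentiableAt (by simp)
  obtain ⟨K2, t2, ht2, hK2⟩ :=
    ((hΩ1.contDiffAt (hV.mem_nhds hx₀)).of_le (by simp)).exists_lipschitzOnWith
  obtain ⟨K3, t3, ht3, hK3⟩ :=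
    ((hΩ2.contDiffAt (hV.mem_nhds hx₀)).of_le (by simp)).exists_lipschitzOnWith
  set K : ℝ := ‖Ω x₀‖ + 1 with hKdef
  have hK0 : 0 < K := by positivity
  have hbd : ∀ᶠ y in 𝓝 x₀, ‖Ω y‖ < K :=
    (hΩ1.contDiffAt (hV.mem_nhds hx₀)).continuousAt.norm.eventually_lt continuousAt_const
      (by simp [hKdef])
  obtain ⟨r', hr'0, hr'⟩ := Metric.mem_nhds_iff.1
    (Filter.inter_mem (Filter.inter_mem (hV.mem_nhds hx₀) hbd) (Filter.inter_mem ht2 ht3))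
  -- The radius keeps the ball where Ω and its derivative are Lipschitz. It makes the coefficient of
  -- the equation along each ray at most K r ≤ 1/2, and r ≤ 1 absorbs factors ‖x - x₀‖.
  set r : ℝ := min r' (min 1 (1 / (2 * K))) with hr
  have hr0 : 0 < r := by positivity
  have hsub : Metric.ball x₀ r ⊆ Metric.ball x₀ r' := Metric.ball_subset_ball (min_le_left _ _)
  have hr1 : r ≤ 1 := (min_le_right _ _).trans (min_le_left _ _)
  have hrK : K * r ≤ 1 / 2 := by
    calc K * r ≤ K * (1 / (2 * K)) := by
          gcongr; exact (min_le_right _ _).trans (min_le_right _ _)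
      _ = 1 / 2 := by field_simp
  have hbV : Metric.ball x₀ r ⊆ V := fun y hy => (hr' (hsub hy)).1.1
  have hbK : ∀ y ∈ Metric.ball x₀ r, ‖Ω y‖ ≤ K := fun y hy => (hr' (hsub hy)).1.2.le
  have hbl : ∀ y ∈ Metric.ball x₀ r, ∀ z ∈ Metric.ball x₀ r, ‖Ω y - Ω z‖ ≤ K2 * ‖y - z‖ :=
    fun y hy z hz => hK2.norm_sub_le (hr' (hsub hy)).2.1 (hr' (hsub hz)).2.1
  have hbl' : ∀ y ∈ Metric.ball x₀ r, ∀ z ∈ Metric.ball x₀ r,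
      ‖fderiv ℝ Ω y - fderiv ℝ Ω z‖ ≤ K3 * ‖y - z‖ :=
    fun y hy z hz => hK3.norm_sub_le (hr' (hsub hy)).2.2 (hr' (hsub hz)).2.2
  refine ⟨r, hr0, hbV, fun n₀ hn₀ => ?_⟩
  have hray : ∀ x ∈ Metric.ball x₀ r, ∀ t ∈ Set.Icc (0 : ℝ) 1,
      x₀ + t • (x - x₀) ∈ Metric.ball x₀ r := by
    intro x hx t ht
    rw [Metric.mem_ball, dist_eq_norm] at hx ⊢
    rw [add_sub_cancel_left, norm_smul, Real.norm_of_nonneg ht.1]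
    exact (mul_le_of_le_one_left (norm_nonneg _) ht.2).trans_lt hx
  have hnr : ∀ x ∈ Metric.ball x₀ r, ‖x - x₀‖ ≤ r := fun x hx => by
    rw [Metric.mem_ball, dist_eq_norm] at hx; exact hx.le
  have hA : ∀ x ∈ Metric.ball x₀ r, ∀ t ∈ Set.Icc (0 : ℝ) 1,
      ‖Ω (x₀ + t • (x - x₀)) (x - x₀)‖ ≤ 1 / 2 := fun x hx t ht =>
    calc ‖Ω (x₀ + t • (x - x₀)) (x - x₀)‖ ≤ K * ‖x - x₀‖ :=
          (Ω _).le_of_opNorm_le (hbK _ (hray x hx t ht)) _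
      _ ≤ K * r := by gcongr; exact hnr x hx
      _ ≤ 1 / 2 := hrK
  have hγ : ∀ (x : B) (t : ℝ), HasDerivWithinAt (fun t : ℝ => x₀ + t • (x - x₀)) (x - x₀)
      (Set.Icc 0 1) t := fun x t => by
    simpa using (((hasDerivAt_id t).smul_const (x - x₀)).const_add x₀).hasDerivWithinAt
  -- Parallel transport of n₀ along the ray from x₀ to x; outside the ball the value zero is
  -- irrelevant. The section will be ξ(x) = c_x(1).
  have hex : ∀ x : B, ∃ c : ℝ → E, x ∈ Metric.ball x₀ r → c 0 = n₀ ∧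
      ∀ t ∈ Set.Icc (0 : ℝ) 1, HasDerivWithinAt c
        (Ω (x₀ + t • (x - x₀)) (x - x₀) (c t)) (Set.Icc 0 1) t := by
    intro x
    by_cases hx : x ∈ Metric.ball x₀ r
    · have hcont : ContinuousOn (fun t : ℝ => Ω (x₀ + t • (x - x₀)) (x - x₀)) (Set.Icc 0 1) := by
        refine ContinuousOn.clm_apply ?_ continuousOn_const
        exact (hΩ1.continuousOn.mono hbV).comp
          (fun t _ => (hγ x t).continuousWithinAt) (fun t ht => hray x hx t ht)
      obtain ⟨c, h0, hc⟩ := exists_linear_ode hcont (hA x hx) le_rfl n₀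
      exact ⟨c, fun _ => ⟨h0, hc⟩⟩
    · exact ⟨fun _ => 0, fun h => absurd h hx⟩
  choose c hc using hex
  have hc0 : ∀ x ∈ Metric.ball x₀ r, c x 0 = n₀ := fun x hx => (hc x hx).1
  have hcd : ∀ x ∈ Metric.ball x₀ r, ∀ t ∈ Set.Icc (0 : ℝ) 1, HasDerivWithinAt (c x)
        (Ω (x₀ + t • (x - x₀)) (x - x₀) (c x t)) (Set.Icc 0 1) t := fun x hx => (hc x hx).2
  set C : ℝ := ‖n₀‖ * Real.exp 1 with hC
  have hcb : ∀ x ∈ Metric.ball x₀ r, ∀ t ∈ Set.Icc (0 : ℝ) 1, ‖c x t‖ ≤ C := fun x hx t ht => by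
    have := norm_solution_le (hA x hx) (hcd x hx) ht
    rwa [hc0 x hx] at this
  -- the solution stays in the subbundle
  have hcN : ∀ x ∈ Metric.ball x₀ r, ∀ t ∈ Set.Icc (0 : ℝ) 1,
      P (x₀ + t • (x - x₀)) (c x t) = c x t := by
    intro x hx t ht
    have hd : ∀ t ∈ Set.Icc (0 : ℝ) 1, HasDerivWithinAt
        (fun t => P (x₀ + t • (x - x₀)) (c x t) - c x t)
        (-(P (x₀ + t • (x - x₀)) (Ω (x₀ + t • (x - x₀)) (x - x₀)
          (P (x₀ + t • (x - x₀)) (c x t) - c x t)))) (Set.Icc 0 1) t := by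
      intro t ht
      have hy := hbV (hray x hx t ht)
      have h1 : HasDerivWithinAt (fun t : ℝ => P (x₀ + t • (x - x₀)))
          (Ω (x₀ + t • (x - x₀)) (x - x₀)) (Set.Icc 0 1) t :=
        (hdP _ hy).hasFDerivAt.comp_hasDerivWithinAt t (hγ x t)
      have h2 := (h1.clm_apply (hcd x hx t ht)).sub (hcd x hx t ht)
      refine HasDerivWithinAt.congr_deriv h2 ?_
      have h3 := proj_fderiv_proj hV hdP hidem hy (x - x₀)
        (n := P (x₀ + t • (x - x₀)) (c x t)) (hidem _ hy _)
      rw [map_sub (fderiv ℝ P _ _), map_sub (P _), h3]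
      abel
    -- The defect P c - c solves a homogeneous linear equation and starts at zero. Any constant at
    -- least 1/2 would serve as K.
    have hb := norm_le_of_linear_bound (K := ‖P x₀‖ + 1 + 1) (ε := 0) (by positivity)
      (f := fun t => P (x₀ + t • (x - x₀)) (c x t) - c x t) hd
      (by simp [hc0 x hx, hn₀]) (fun t ht => ?_) ht
    · simpa [sub_eq_zero] using hb
    · have hy := hbV (hray x hx t ht)
      set e := P (x₀ + t • (x - x₀)) (c x t) - c x t
      have hproj : ∀ a, ‖P (x₀ + t • (x - x₀)) a‖ ≤ ‖a‖ := by
        intro a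
        have h1 : ‖P (x₀ + t • (x - x₀)) a‖ ^ 2 ≤ ‖a‖ * ‖P (x₀ + t • (x - x₀)) a‖ := by
          rw [← real_inner_self_eq_norm_sq, hsymm _ hy, hidem _ hy]
          exact real_inner_le_norm _ _
        by_contra hlt
        push Not at hlt
        nlinarith [norm_nonneg a]
      rw [norm_neg]
      refine (hproj _).trans ?_
      refine ((Ω (x₀ + t • (x - x₀)) (x - x₀)).le_of_opNorm_le (hA x hx t ht) e).trans ?_
      have : 0 ≤ ‖P x₀‖ * ‖e‖ := by positivity
      nlinarith [norm_nonneg e]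
  -- The transports along the rays to x and y are compared through the remainder c_y(t) - c_x(t) - t
  -- Ω(z)(y - x) c_x(t), with z on the ray to x. It obeys a linear equation with an inhomogeneity of
  -- order ‖y - x‖², hence is of that order at t = 1.
  have key : ∀ x ∈ Metric.ball x₀ r, ∀ y ∈ Metric.ball x₀ r,
      ‖c y 1 - c x 1 - Ω x (y - x) (c x 1)‖
        ≤ ((K3 + K2 + K2 * K + K * K) * C / (1 / 2) * (Real.exp (1 / 2 * 1) - 1))
          * ‖y - x‖ ^ 2 := by
    intro x hx y hy
    have hd : ∀ t ∈ Set.Icc (0 : ℝ) 1, HasDerivWithinAt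
        (fun t => c y t - c x t - t • Ω (x₀ + t • (x - x₀)) (y - x) (c x t))
        (Ω (x₀ + t • (y - x₀)) (y - x₀) (c y t) - Ω (x₀ + t • (x - x₀)) (x - x₀) (c x t)
          - (t • (fderiv ℝ Ω (x₀ + t • (x - x₀)) (x - x₀) (y - x) (c x t)
              + Ω (x₀ + t • (x - x₀)) (y - x) (Ω (x₀ + t • (x - x₀)) (x - x₀) (c x t)))
            + (1 : ℝ) • Ω (x₀ + t • (x - x₀)) (y - x) (c x t)))
        (Set.Icc 0 1) t := by
      intro t ht
      have hz := hbV (hray x hx t ht)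
      have h1 : HasDerivWithinAt (fun t : ℝ => Ω (x₀ + t • (x - x₀)))
          (fderiv ℝ Ω (x₀ + t • (x - x₀)) (x - x₀)) (Set.Icc 0 1) t :=
        (hdΩ _ hz).hasFDerivAt.comp_hasDerivWithinAt t (hγ x t)
      have h2 : HasDerivWithinAt (fun t : ℝ => Ω (x₀ + t • (x - x₀)) (y - x))
          (fderiv ℝ Ω (x₀ + t • (x - x₀)) (x - x₀) (y - x)) (Set.Icc 0 1) t := by
        simpa using h1.clm_apply (hasDerivWithinAt_const t (Set.Icc 0 1) (y - x))
      have h3 := ((hasDerivAt_id t).hasDerivWithinAt (s := Set.Icc 0 1)).smul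
        (h2.clm_apply (hcd x hx t ht))
      exact ((hcd y hy t ht).sub (hcd x hx t ht)).sub h3
    have hb := norm_le_of_linear_bound (K := 1 / 2)
      (ε := (K3 + K2 + K2 * K + K * K) * C * ‖y - x‖ ^ 2) (by norm_num)
      (f := fun t => c y t - c x t - t • Ω (x₀ + t • (x - x₀)) (y - x) (c x t)) hd
      (by simp [hc0 x hx, hc0 y hy]) (fun t ht => ?_) (t := 1) (by simp)
    · have e1 : x₀ + (1 : ℝ) • (x - x₀) = x := by simp
      rw [e1, one_smul] at hb
      refine hb.trans (le_of_eq ?_)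
      ring
    · have hz := hray x hx t ht
      have hz' := hray y hy t ht
      set z := x₀ + t • (x - x₀) with hzdef
      set z' := x₀ + t • (y - x₀) with hz'def
      have hzz : z' - z = t • (y - x) := by rw [hzdef, hz'def]; module
      have hnzz : ‖z' - z‖ ≤ ‖y - x‖ := by
        rw [hzz, norm_smul, Real.norm_of_nonneg ht.1]
        exact mul_le_of_le_one_left (norm_nonneg _) ht.2
      have hsym : fderiv ℝ Ω z (y - x) (x - x₀) = fderiv ℝ Ω z (x - x₀) (y - x) :=
        ((hP.contDiffAt (hV.mem_nhds (hbV hz))).isSymmSndFDerivAt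
          (by simpa using two_le_infty)) (y - x) (x - x₀)
      have hcomm := fderiv_proj_comm hV hdP hidem hsymm (hbV hz) (hcurv z (hbV hz))
        (x - x₀) (y - x) (hcN x hx t ht)
      set cx := c x t
      set Dt := c y t - cx - t • Ω z (y - x) cx with hDt
      have hcy : c y t = Dt + cx + t • Ω z (y - x) cx := by rw [hDt]; abel
      have hyx : y - x₀ = (x - x₀) + (y - x) := by abel
      -- The first order terms in y - x cancel here: `hsym` is the symmetry of the second derivative
      -- of P, and `hcomm` is flatness. This is the only use of the curvature hypothesis.
      have hsplit : Ω z' (y - x₀) (c y t) - Ω z (x - x₀) cx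
          - (t • (fderiv ℝ Ω z (x - x₀) (y - x) cx + Ω z (y - x) (Ω z (x - x₀) cx))
            + (1 : ℝ) • Ω z (y - x) cx)
          = Ω z' (y - x₀) Dt + (Ω z' - Ω z - fderiv ℝ Ω z (z' - z)) (x - x₀) cx
            + (Ω z' - Ω z) (y - x) cx
            + t • ((Ω z' - Ω z) (y - x₀) (Ω z (y - x) cx) + Ω z (y - x) (Ω z (y - x) cx)) := by
        rw [hcy, map_add, map_add, map_smul, ← hΩ] at *
        simp only [sub_apply, hzz, map_smul, smul_apply, hsym]
        rw [hyx]
        simp only [map_add, add_apply, hcomm]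
        module
      rw [hsplit]
      have hX : ‖x - x₀‖ ≤ 1 := (hnr x hx).trans hr1
      have hY : ‖y - x₀‖ ≤ 1 := (hnr y hy).trans hr1
      have hcx : ‖cx‖ ≤ C := hcb x hx t ht
      have hC0 : 0 ≤ C := (norm_nonneg _).trans hcx
      have b1 : ‖Ω z' (y - x₀) Dt‖ ≤ 1 / 2 * ‖Dt‖ :=
        (Ω z' (y - x₀)).le_of_opNorm_le (hA y hy t ht) Dt
      have b2 : ‖(Ω z' - Ω z - fderiv ℝ Ω z (z' - z)) (x - x₀) cx‖ ≤ K3 * ‖y - x‖ ^ 2 * C := by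
        refine (norm_apply₂_le _ _ _).trans ?_
        have h1 := norm_taylor_le (convex_ball x₀ r) (fun p hp => hdΩ p (hbV hp)) K3.2 hbl' hz hz'
        calc ‖Ω z' - Ω z - fderiv ℝ Ω z (z' - z)‖ * ‖x - x₀‖ * ‖cx‖
            ≤ (K3 * ‖y - x‖ * ‖y - x‖) * 1 * C := by
              gcongr
              refine h1.trans ?_
              gcongr
              exact le_rfl
          _ = _ := by ring
      have b3 : ‖(Ω z' - Ω z) (y - x) cx‖ ≤ K2 * ‖y - x‖ ^ 2 * C := by
        refine (norm_apply₂_le _ _ _).trans ?_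
        calc ‖Ω z' - Ω z‖ * ‖y - x‖ * ‖cx‖ ≤ (K2 * ‖y - x‖) * ‖y - x‖ * C := by
              gcongr
              exact (hbl z' hz' z hz).trans (by gcongr)
          _ = _ := by ring
      have b0 : ‖Ω z (y - x) cx‖ ≤ K * ‖y - x‖ * C := by
        refine (norm_apply₂_le _ _ _).trans ?_
        gcongr
        exact hbK z hz
      have b4 : ‖(Ω z' - Ω z) (y - x₀) (Ω z (y - x) cx)‖ ≤ K2 * K * ‖y - x‖ ^ 2 * C := by
        refine (norm_apply₂_le _ _ _).trans ?_
        calc ‖Ω z' - Ω z‖ * ‖y - x₀‖ * ‖Ω z (y - x) cx‖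
            ≤ (K2 * ‖y - x‖) * 1 * (K * ‖y - x‖ * C) := by
              gcongr
              exact (hbl z' hz' z hz).trans (by gcongr)
          _ = _ := by ring
      have b5 : ‖Ω z (y - x) (Ω z (y - x) cx)‖ ≤ K * K * ‖y - x‖ ^ 2 * C := by
        refine (norm_apply₂_le _ _ _).trans ?_
        calc ‖Ω z‖ * ‖y - x‖ * ‖Ω z (y - x) cx‖
            ≤ K * ‖y - x‖ * (K * ‖y - x‖ * C) := by
              gcongr
              exact hbK z hz
          _ = _ := by ring
      have b6 : ‖t • ((Ω z' - Ω z) (y - x₀) (Ω z (y - x) cx) + Ω z (y - x) (Ω z (y - x) cx))‖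
          ≤ K2 * K * ‖y - x‖ ^ 2 * C + K * K * ‖y - x‖ ^ 2 * C := by
        rw [norm_smul, Real.norm_of_nonneg ht.1]
        refine (mul_le_of_le_one_left (norm_nonneg _) ht.2).trans ?_
        exact (norm_add_le _ _).trans (add_le_add b4 b5)
      refine (norm_add_le _ _).trans ((add_le_add (norm_add₃_le) b6).trans ?_)
      linarith
  obtain ⟨Q, hQ⟩ : ∃ Q : ℝ, ∀ x ∈ Metric.ball x₀ r, ∀ y ∈ Metric.ball x₀ r,
      ‖c y 1 - c x 1 - Ω x (y - x) (c x 1)‖ ≤ Q * ‖y - x‖ ^ 2 := ⟨_, key⟩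
  have hder : ∀ x ∈ Metric.ball x₀ r, HasFDerivAt (fun y => c y 1) ((Ω x).flip (c x 1)) x := by
    intro x hx
    refine HasFDerivAt.of_isLittleO ?_
    refine Asymptotics.IsBigO.trans_isLittleO (g := fun y => ‖y - x‖ ^ 2) ?_ ?_
    swap
    · have h1 := (Asymptotics.isLittleO_norm_pow_id (E' := B) one_lt_two).comp_tendsto
        (tendsto_sub_nhds_zero_iff.2 (Filter.tendsto_id (α := B) (x := 𝓝 x)))
      simpa [Function.comp_def] using h1
    refine Asymptotics.IsBigO.of_bound Q ?_
    filter_upwards [Metric.isOpen_ball.mem_nhds hx] with y hy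
    simpa using hQ x hx y hy
  refine ⟨fun y => c y 1, ?_, ?_, fun y hy => ⟨?_, hder y hy⟩⟩
  -- The equation dξ = Ω ξ raises the order of differentiability of ξ by one at a time.
  · rw [contDiffOn_infty]
    intro n
    induction n with
    | zero =>
      rw [Nat.cast_zero, contDiffOn_zero]
      exact fun y hy => (hder y hy).continuousAt.continuousWithinAt
    | succ n ih =>
      rw [Nat.cast_succ, contDiffOn_succ_iff_fderiv_of_isOpen Metric.isOpen_ball]
      refine ⟨fun y hy => (hder y hy).differentiableAt.differentiableWithinAt, by simp, ?_⟩
      refine ContDiffOn.congr ?_ fun y hy => (hder y hy).fderiv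
      have h1 : ContDiffOn ℝ n (fun y => (Ω y).flip) (Metric.ball x₀ r) :=
        ((ContinuousLinearMap.flipₗᵢ ℝ B E E).contDiff.comp_contDiffOn (hΩ1.mono hbV)).of_le
          (by exact_mod_cast le_top)
      exact ContDiffOn.clm_apply h1 ih
  -- The ray from x₀ to itself is constant, so the transport along it is constant.
  · have h1 := hcd x₀ (Metric.mem_ball_self hr0)
    have h2 := norm_le_of_linear_bound (f := fun t => c x₀ t - n₀) (f' := fun _ => 0) (K := 1)
      (ε := 0) one_pos (fun t ht => by simpa using (h1 t ht).sub_const n₀)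
      (by simp [hc0 x₀ (Metric.mem_ball_self hr0)]) (fun t _ => by simp) (t := 1) (by simp)
    simpa [sub_eq_zero] using h2
  · have := hcN y hy 1 (by simp)
    simpa using this

end Frobenius

/-! ### Parallel bundles of normal vectors and their local frames. -/

section

variable {B : Type*} [NormedAddCommGroup B] [NormedSpace ℝ B] [FiniteDimensional ℝ B]
  {H : Type*} [TopologicalSpace H] {I : ModelWithCorners ℝ B H} [I.Boundaryless]
  {M : Type*} [TopologicalSpace M] [ChartedSpace H M] [IsManifold I ∞ M]
  {E : Type*} [NormedAddCommGroup E] [InnerProductSpace ℝ E] [FiniteDimensional ℝ E]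
  {U : Set M} {N : M → Submodule ℝ E}

variable (I) in
/-- The differential of the orthogonal projection onto the fibres of `N`, applied to a vector. -/
noncomputable def dProj (N : M → Submodule ℝ E) (x : M) (v : B) (n : E) : E :=
  (D I (fun y => (N y).starProjection) x v) n

theorem hasPush_proj (hU : IsOpen U)
    (hN : ContMDiffOn I 𝓘(ℝ, E →L[ℝ] E) ∞ (fun x => (N x).starProjection) U) {x : M} (hx : x ∈ U)
    {ξ : M → E} {ξ' : B →L[ℝ] E} (hξ : HasPush I ξ x ξ') :
    HasPush I (fun y => (N y).starProjection (ξ y)) x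
      ((N x).starProjection.comp ξ' + (D I (fun y => (N y).starProjection) x).flip (ξ x)) :=
  (ContMDiffOn.hasPush hU hN hx).clm_apply hξ

theorem D_proj (hU : IsOpen U)
    (hN : ContMDiffOn I 𝓘(ℝ, E →L[ℝ] E) ∞ (fun x => (N x).starProjection) U) {x : M} (hx : x ∈ U)
    (n : E) (v : B) : D I (fun y => (N y).starProjection n) x v = dProj I N x v n := by
  rw [(hasPush_proj hU hN hx (hasPush_const n x)).eq]
  simp [dProj]

/-- A flat bundle has parallel orthonormal frames around every point. -/
theorem exists_parallel_frame (hU : IsOpen U)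
    (hN : ContMDiffOn I 𝓘(ℝ, E →L[ℝ] E) ∞ (fun x => (N x).starProjection) U)
    (hcurv : ∀ x ∈ U, ∀ v w : B, ∀ n ∈ N x, ∀ n' ∈ N x,
      ⟪dProj I N x v n, dProj I N x w n'⟫_ℝ = ⟪dProj I N x w n, dProj I N x v n'⟫_ℝ)
    {r : ℕ} (hr : ∀ x ∈ U, Module.finrank ℝ (N x) = r) {x₀ : M} (hx₀ : x₀ ∈ U) :
    ∃ V ⊆ U, IsOpen V ∧ x₀ ∈ V ∧ ∃ ζ : Fin r → M → E,
      (∀ a, ContMDiffOn I 𝓘(ℝ, E) ∞ (ζ a) V) ∧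
      ∀ x ∈ V, (Orthonormal ℝ fun a => ζ a x) ∧ Submodule.span ℝ (Set.range fun a => ζ a x) = N x ∧
        ∀ a v, D I (ζ a) x v = dProj I N x v (ζ a x) := by
  set c := extChartAt I x₀ with hc
  set V : Set B := c.target ∩ c.symm ⁻¹' U with hVdef
  have hV : IsOpen V :=
    (continuousOn_extChartAt_symm x₀).isOpen_inter_preimage (isOpen_extChartAt_target x₀) hU
  set P : M → E →L[ℝ] E := fun x => (N x).starProjection with hPdef
  set Q : B → E →L[ℝ] E := read I x₀ P with hQdef
  have hmem : ∀ b ∈ V, c.symm b ∈ c.source ∧ c.symm b ∈ U ∧ c (c.symm b) = b := fun b hb =>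
    ⟨c.map_target hb.1, hb.2, c.right_inv hb.1⟩
  have hQ : ContDiffOn ℝ ∞ Q V := by
    intro b hb
    obtain ⟨h1, h2, h3⟩ := hmem b hb
    have := contDiffAt_read h1 (hN.contMDiffAt (hU.mem_nhds h2))
    rw [h3] at this
    exact this.contDiffWithinAt
  have hQa : ∀ b, Q b = (N (c.symm b)).starProjection := fun b => rfl
  have hDQ : ∀ b ∈ V, ∀ (v : B) n,
      fderiv ℝ Q b (dchart I x₀ (c.symm b) v) n = dProj I N (c.symm b) v n := by
    intro b hb v n
    obtain ⟨h1, h2, h3⟩ := hmem b hb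
    have h4 := D_read h1 (ContMDiffOn.hasPush hU hN h2).mdifferentiableAt v
    rw [h3] at h4
    rw [dProj, h4]
  have hmN : ∀ b n, Q b n = n ↔ n ∈ N (c.symm b) := fun b n => by
    rw [hQa, Submodule.starProjection_eq_self_iff]
  have hx₀V : c x₀ ∈ V := by
    refine ⟨mem_extChartAt_target x₀, ?_⟩
    rw [Set.mem_preimage, hc, extChartAt_to_inv]
    exact hx₀
  obtain ⟨ρ, hρ, hball, hpar⟩ := exists_parallel_chart hV hQ
    (fun b _ a => (hmN b _).2 (Submodule.starProjection_apply_mem _ _))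
    (fun b _ a a' => Submodule.inner_starProjection_left_eq_right _ _ _)
    (fun b hb v w n n' hn hn' => by
      obtain ⟨h1, h2, h3⟩ := hmem b hb
      obtain ⟨v, rfl⟩ := (dchart_bijective h1).2 v
      obtain ⟨w, rfl⟩ := (dchart_bijective h1).2 w
      rw [hDQ b hb, hDQ b hb, hDQ b hb, hDQ b hb]
      exact hcurv _ h2 v w n ((hmN b n).1 hn) n' ((hmN b n').1 hn')) hx₀V
  have hNx₀ : ∀ n ∈ N x₀, Q (c x₀) n = n := fun n hn => by
    rw [hmN, hc, extChartAt_to_inv]; exact hn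
  -- An orthonormal basis of one fibre is extended by parallel sections.
  let e := (stdOrthonormalBasis ℝ (N x₀)).reindex (finCongr (hr x₀ hx₀))
  choose ξ hξs hξ0 hξ using fun a : Fin r => hpar (e a) (hNx₀ _ (e a).2)
  have hξN : ∀ a, ∀ b ∈ Metric.ball (c x₀) ρ, ξ a b ∈ N (c.symm b) := fun a b hb =>
    (hmN b _).1 (hξ a b hb).1
  have hdQ : ∀ b ∈ V, DifferentiableAt ℝ Q b := fun b hb =>
    (hQ.contDiffAt (hV.mem_nhds hb)).differentiableAt (by simp)
  -- The derivative of a parallel section is orthogonal to the fibre, so inner products of parallel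
  -- sections are constant on the ball.
  have horth : ∀ b ∈ Metric.ball (c x₀) ρ, ∀ a a', ⟪ξ a b, ξ a' b⟫_ℝ = ⟪e a, e a'⟫_ℝ := by
    intro b hb a a'
    have hd : ∀ z ∈ Metric.ball (c x₀) ρ,
        HasFDerivAt (fun z => ⟪ξ a z, ξ a' z⟫_ℝ) (0 : B →L[ℝ] ℝ) z := by
      intro z hz
      refine ((hξ a z hz).2.inner ℝ (hξ a' z hz).2).congr_fderiv ?_
      ext v
      have key : ∀ n n', Q z n = n → Q z n' = n' → ⟪n, fderiv ℝ Q z v n'⟫_ℝ = 0 := by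
        intro n n' hn hn'
        rw [← hn, hQa, Submodule.inner_starProjection_left_eq_right, ← hQa,
          proj_fderiv_proj hV hdQ (fun b _ a => (hmN b _).2 (Submodule.starProjection_apply_mem _ _))
            (hball hz) v hn', inner_zero_right]
      have k1 := key _ _ (hξ a z hz).1 (hξ a' z hz).1
      have k2 := key _ _ (hξ a' z hz).1 (hξ a z hz).1
      rw [real_inner_comm] at k2
      simp [k1, k2]
    have h1 := Metric.isOpen_ball.is_const_of_fderiv_eq_zero (𝕜 := ℝ)
      (convex_ball (c x₀) ρ).isPreconnected
      (fun z hz => (hd z hz).differentiableAt.differentiableWithinAt)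
      (fun z hz => (hd z hz).fderiv) hb (Metric.mem_ball_self hρ)
    rw [h1, hξ0, hξ0, Submodule.coe_inner]
  have hsrc : IsOpen (c.source ∩ c ⁻¹' Metric.ball (c x₀) ρ) :=
    (continuousOn_extChartAt x₀).isOpen_inter_preimage (isOpen_extChartAt_source x₀)
      Metric.isOpen_ball
  have hVU : ∀ x ∈ c.source ∩ c ⁻¹' Metric.ball (c x₀) ρ, x ∈ U := fun x hx => by
    have h1 := (hball hx.2).2
    rwa [Set.mem_preimage, c.left_inv hx.1] at h1
  refine ⟨c.source ∩ c ⁻¹' Metric.ball (c x₀) ρ, hVU, hsrc,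
    ⟨mem_extChartAt_source x₀, Metric.mem_ball_self hρ⟩, fun a x => ξ a (c x), ?_, ?_⟩
  · intro a x hx
    refine (contMDiffAt_of_read hx.1 ?_).contMDiffWithinAt
    exact (hξs a).contDiffAt (Metric.isOpen_ball.mem_nhds hx.2)
  · intro x hx
    have hxs : c.symm (c x) = x := c.left_inv hx.1
    have ho : Orthonormal ℝ fun a => ξ a (c x) := by
      rw [orthonormal_iff_ite]
      intro a a'
      rw [horth _ hx.2, orthonormal_iff_ite.1 e.orthonormal]
    refine ⟨ho, ?_, ?_⟩
    · refine Submodule.eq_of_le_of_finrank_eq (Submodule.span_le.2 ?_) ?_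
      · rintro _ ⟨a, rfl⟩
        have := hξN a _ hx.2
        rwa [hxs] at this
      · rw [finrank_span_eq_card ho.linearIndependent, Fintype.card_fin, hr x (hVU x hx)]
    · intro a v
      have h1 : HasPush I (fun x => ξ a (c x)) x
          (((fderiv ℝ Q (c x)).flip (ξ a (c x))).comp (dchart I x₀ x)) :=
        HasFDerivAt.comp_hasPush (hξ a _ hx.2).2 (hasPush_chart hx.1)
      have h2 := hDQ _ (hball hx.2) v (ξ a (c x))
      rw [hxs] at h2
      rw [h1.eq, ← h2]
      rfl

variable {f : M → E}

variable (I) in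
/-- `N` is a smooth bundle of normal vectors, parallel in the normal connection. -/
structure IsParallelBundleOn (U : Set M) (f : M → E) (N : M → Submodule ℝ E) : Prop where
  le_normal : ∀ x ∈ U, N x ≤ normal I f x
  smooth : ContMDiffOn I 𝓘(ℝ, E →L[ℝ] E) ∞ (fun x => (N x).starProjection) U
  parallel : ∀ x ∈ U, ∀ n ∈ N x, ∀ v : B, dProj I N x v n ∈ tangent I f x

/-- Differentiate P (P n) = P n and use P n = n at the point: the bundle turns only in directions
orthogonal to itself. -/
theorem starProjection_dProj (hU : IsOpen U)
    (hN : ContMDiffOn I 𝓘(ℝ, E →L[ℝ] E) ∞ (fun x => (N x).starProjection) U) {x : M} (hx : x ∈ U)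
    {n : E} (hn : n ∈ N x) (v : B) : (N x).starProjection (dProj I N x v n) = 0 := by
  have h1 := (hasPush_proj hU hN hx (hasPush_proj hU hN hx (hasPush_const n x)))
  have h2 : HasPush I (fun y => (N y).starProjection ((N y).starProjection n)) x _ :=
    (hasPush_proj hU hN hx (hasPush_const n x)).congr (.of_forall fun y =>
      Submodule.starProjection_eq_self_iff.2 (Submodule.starProjection_apply_mem _ _))
  have h3 := congrArg (fun L : B →L[ℝ] E => L v) (h1.unique h2)
  have h4 : (N x).starProjection n = n := Submodule.starProjection_eq_self_iff.2 hn
  simpa [h4, dProj] using h3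

theorem mem_orthogonal_of_starProjection_eq_zero {K : Submodule ℝ E} {a : E}
    (h : K.starProjection a = 0) : a ∈ Kᗮ := by
  rw [Submodule.mem_orthogonal]
  intro u hu
  rw [← Submodule.starProjection_eq_self_iff.2 hu, Submodule.inner_starProjection_left_eq_right, h,
    inner_zero_right]

/-- A normal vector extended by projection has derivative orthogonal to the normal space, that is,
tangent. -/
theorem isParallelBundleOn_normal (hU : IsOpen U) (hf : IsImmersionOn I U f) :
    IsParallelBundleOn I U f (normal I f) := by
  refine ⟨fun x _ => le_rfl, contMDiffOn_normal_starProjection hU hf, fun x hx n hn v => ?_⟩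
  have h := mem_orthogonal_of_starProjection_eq_zero
    (starProjection_dProj hU (contMDiffOn_normal_starProjection hU hf) hx hn v)
  rwa [normal, Submodule.orthogonal_orthogonal] at h

theorem mem_tangent_of_inner_eq_zero {x : M} {a : E} (h : ∀ n ∈ normal I f x, ⟪a, n⟫_ℝ = 0) :
    a ∈ tangent I f x := by
  rw [← Submodule.orthogonal_orthogonal (tangent I f x)]
  rw [Submodule.mem_orthogonal']
  exact h

theorem IsParallelFlatSubbundleOn.isParallelBundleOn (hU : IsOpen U) {s : ℕ}
    (h : IsParallelFlatSubbundleOn I U f N s) : IsParallelBundleOn I U f N := by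
  refine ⟨h.le_normal, h.smooth, fun x hx n hn v => ?_⟩
  have h1 : nablaB I f (fun y => (N y).starProjection n) x v ∈ N x :=
    h.parallel U le_rfl hU (fun y => (N y).starProjection n)
      ⟨ContMDiffOn.clm_apply h.smooth contMDiffOn_const,
        fun y _ => Submodule.starProjection_apply_mem _ _⟩ x hx v
  rw [← D_proj hU h.smooth hx n v]
  -- The normal derivative lies in N because N is parallel, and it is orthogonal to N by
  -- `starProjection_dProj`; hence it vanishes.
  refine mem_tangent_of_nablaB_eq_zero ?_
  rw [← Submodule.starProjection_eq_self_iff.2 h1, nablaB_eq, D_proj hU h.smooth hx n v]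
  refine eq_of_inner_eq (Submodule.starProjection_apply_mem _ _) (N x).zero_mem fun a ha => ?_
  rw [Submodule.inner_starProjection_left_eq_right, Submodule.starProjection_eq_self_iff.2 ha,
    inner_normal_starProjection (h.le_normal x hx ha), inner_zero_left]
  exact (Submodule.mem_orthogonal' _ _).1 (mem_orthogonal_of_starProjection_eq_zero
    (starProjection_dProj hU h.smooth hx hn v)) a ha

/-- The orthogonal complement of a parallel bundle in the normal bundle. -/
theorem IsParallelBundleOn.orthogonal (hU : IsOpen U) (hf : IsImmersionOn I U f)
    (h : IsParallelBundleOn I U f N) :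
    IsParallelBundleOn I U f (fun x => (N x)ᗮ ⊓ normal I f x) := by
  -- As N lies in the normal bundle, the projection onto its complement there is a difference of
  -- projections, and is therefore smooth.
  have hP : ∀ x ∈ U, ((N x)ᗮ ⊓ normal I f x).starProjection
      = (normal I f x).starProjection - (N x).starProjection := by
    intro x hx
    ext1 a
    refine Submodule.eq_starProjection_of_mem_of_inner_eq_zero ⟨?_, ?_⟩ ?_
    · refine (Submodule.mem_orthogonal' _ _).2 fun u hu => ?_
      rw [sub_apply, inner_sub_left, inner_normal_starProjection (h.le_normal x hx hu),
        Submodule.inner_starProjection_left_eq_right, Submodule.starProjection_eq_self_iff.2 hu,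
        sub_self]
    · exact Submodule.sub_mem _ (Submodule.starProjection_apply_mem _ _)
        (h.le_normal x hx (Submodule.starProjection_apply_mem _ _))
    · rintro w ⟨hw, hw'⟩
      rw [sub_apply, inner_sub_left, inner_sub_left, inner_normal_starProjection hw',
        (Submodule.mem_orthogonal _ _).1 hw _ (Submodule.starProjection_apply_mem _ _)]
      ring
  have hs : ContMDiffOn I 𝓘(ℝ, E →L[ℝ] E) ∞
      (fun x => ((N x)ᗮ ⊓ normal I f x).starProjection) U :=
    ((contMDiffOn_normal_starProjection hU hf).sub h.smooth).congr hP
  refine ⟨fun x _ => inf_le_right, hs, fun x hx n hn v => ?_⟩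
  have hself : ((N x)ᗮ ⊓ normal I f x).starProjection n = n :=
    Submodule.starProjection_eq_self_iff.2 hn
  have h0 := mem_orthogonal_of_starProjection_eq_zero (starProjection_dProj hU hs hx hn v)
  refine mem_tangent_of_inner_eq_zero fun a ha => ?_
  have hsplit : a = (N x).starProjection a + (a - (N x).starProjection a) := by abel
  rw [hsplit, inner_add_right]
  have e2 : ⟪dProj I (fun x => (N x)ᗮ ⊓ normal I f x) x v n, a - (N x).starProjection a⟫_ℝ = 0 := by
    refine (Submodule.mem_orthogonal' _ _).1 h0 _ ⟨?_, ?_⟩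
    · exact Submodule.sub_starProjection_mem_orthogonal _
    · exact Submodule.sub_mem _ ha
        (h.le_normal x hx (Submodule.starProjection_apply_mem _ _))
  rw [e2, add_zero]
  set b := (N x).starProjection a with hb
  have hbN : b ∈ N x := Submodule.starProjection_apply_mem _ _
  -- Sections of the two bundles are orthogonal. Differentiating moves the derivative onto the
  -- section of N, where it is tangent and pairs to zero with n.
  have h1 := inner_D_add_eq_zero
    (a := fun y => ((N y)ᗮ ⊓ normal I f y).starProjection n) (b := fun y => (N y).starProjection b)
    (hasPush_proj hU hs hx (hasPush_const n x)).mdifferentiableAt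
    (hasPush_proj hU h.smooth hx (hasPush_const b x)).mdifferentiableAt
    (.of_forall fun y => (Submodule.mem_orthogonal' _ _).1
      (Submodule.starProjection_apply_mem ((N y)ᗮ ⊓ normal I f y) n).1 _
        (Submodule.starProjection_apply_mem _ _)) v
  rw [D_proj hU hs hx, D_proj hU h.smooth hx, hself,
    Submodule.starProjection_eq_self_iff.2 hbN] at h1
  have h2 : ⟪n, dProj I N x v b⟫_ℝ = 0 := by
    obtain ⟨w, hw⟩ := h.parallel x hx b hbN v
    rw [← hw]
    exact mem_normal.1 hn.2 w
  linarith

end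

theorem _root_.Orthonormal.sum_inner_smul_of_mem_span {E : Type*} [NormedAddCommGroup E]
    [InnerProductSpace ℝ E] {ι : Type*} [Fintype ι] {e : ι → E} (he : Orthonormal ℝ e) {a : E}
    (ha : a ∈ Submodule.span ℝ (Set.range e)) : ∑ i, ⟪e i, a⟫_ℝ • e i = a := by
  obtain ⟨c, rfl⟩ := (Submodule.mem_span_range_iff_exists_fun ℝ).1 ha
  exact Finset.sum_congr rfl fun i _ => by rw [he.inner_right_fintype]

/-! ### Parallel normal frames characterize flatness and the Dupin property. -/

section

variable {B : Type*} [NormedAddCommGroup B] [NormedSpace ℝ B] [FiniteDimensional ℝ B]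
  {H : Type*} [TopologicalSpace H] {I : ModelWithCorners ℝ B H} [I.Boundaryless]
  {M : Type*} [TopologicalSpace M] [ChartedSpace H M] [IsManifold I ∞ M]
  {E : Type*} [NormedAddCommGroup E] [InnerProductSpace ℝ E] [FiniteDimensional ℝ E]
  {U V : Set M} {f : M → E} {N : M → Submodule ℝ E} {k r : ℕ}

theorem contMDiffOn_inner {a b : M → E} (ha : ContMDiffOn I 𝓘(ℝ, E) ∞ a U)
    (hb : ContMDiffOn I 𝓘(ℝ, E) ∞ b U) : ContMDiffOn I 𝓘(ℝ, ℝ) ∞ (fun x => ⟪a x, b x⟫_ℝ) U := by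
  have h : ContDiff ℝ ∞ (fun p : E × E => ⟪p.1, p.2⟫_ℝ) := contDiff_inner
  exact h.contMDiff.comp_contMDiffOn (ha.prodMk_space hb)

section Flat

/-- The frame is parallel, so the normal connection differentiates only the coefficients. -/
theorem nablaB_sum {ζ : Fin r → M → E} {c : Fin r → M → ℝ} {x : M}
    (hc : ∀ a, MDifferentiableAt I 𝓘(ℝ, ℝ) (c a) x) (hζ : ∀ a, MDifferentiableAt I 𝓘(ℝ, E) (ζ a) x)
    (hn : ∀ a, ζ a x ∈ normal I f x) (ht : ∀ a v, D I (ζ a) x v ∈ tangent I f x) (v : B) :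
    nablaB I f (fun y => ∑ a, c a y • ζ a y) x v = ∑ a, D I (c a) x v • ζ a x := by
  have h := HasPush.sum (I := I) Finset.univ fun a _ =>
    (hasPush_of_mdifferentiableAt (hc a)).smul (hasPush_of_mdifferentiableAt (hζ a))
  rw [nablaB_eq, h.eq]
  simp only [sum_apply, map_sum]
  refine Finset.sum_congr rfl fun a _ => ?_
  have h1 := nablaB_eq_zero_of_mem_tangent (I := I) (ht a v)
  rw [nablaB_eq] at h1
  simp [h1, Submodule.starProjection_eq_self_iff.2 (hn a)]

/-- A bundle with local parallel frames is flat. -/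
theorem isFlatOn_of_frame
    (h : ∀ x₀ ∈ U, ∃ V, IsOpen V ∧ x₀ ∈ V ∧ ∃ (r : ℕ) (ζ : Fin r → M → E),
      (∀ a, ContMDiffOn I 𝓘(ℝ, E) ∞ (ζ a) V) ∧ ∀ x ∈ V, (Orthonormal ℝ fun a => ζ a x) ∧
        N x ≤ Submodule.span ℝ (Set.range fun a => ζ a x) ∧ (∀ a, ζ a x ∈ normal I f x) ∧
        ∀ a v, D I (ζ a) x v ∈ tangent I f x) : IsFlatOn I U f N := by
  intro V' hV'U hV' X Y hX hY ξ hξ x hx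
  obtain ⟨V, hV, hxV, r, ζ, hζs, hζ⟩ := h x (hV'U hx)
  have hW : IsOpen (V ∩ V') := hV.inter hV'
  have hζm : ∀ a, ∀ y ∈ V, MDifferentiableAt I 𝓘(ℝ, E) (ζ a) y := fun a y hy =>
    ((hζs a).hasPush hV hy).mdifferentiableAt
  set c : Fin r → M → ℝ := fun a y => ⟪ζ a y, ξ y⟫_ℝ with hc
  have hcs : ∀ a, ContMDiffOn I 𝓘(ℝ, ℝ) ∞ (c a) (V ∩ V') := fun a =>
    contMDiffOn_inner ((hζs a).mono Set.inter_subset_left) (hξ.1.mono Set.inter_subset_right)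
  have hξc : ∀ y ∈ V ∩ V', ξ y = ∑ a, c a y • ζ a y := fun y hy =>
    ((hζ y hy.1).1.sum_inner_smul_of_mem_span ((hζ y hy.1).2.1 (hξ.2 y hy.2))).symm
  have key : ∀ (b : Fin r → M → ℝ), (∀ a, ContMDiffOn I 𝓘(ℝ, ℝ) ∞ (b a) (V ∩ V')) →
      ∀ y ∈ V ∩ V', ∀ χ : M → E, (∀ z ∈ V ∩ V', χ z = ∑ a, b a z • ζ a z) → ∀ v : B,
      nablaB I f χ y v = ∑ a, D I (b a) y v • ζ a y := by
    intro b hb y hy χ hχ v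
    have h1 : nablaB I f χ y v = nablaB I f (fun z => ∑ a, b a z • ζ a z) y v := by
      rw [nablaB_eq, nablaB_eq, D_congr (Filter.eventually_of_mem (hW.mem_nhds hy) hχ)]
    rw [h1]
    exact nablaB_sum (fun a => ((hb a).hasPush hW hy).mdifferentiableAt)
      (fun a => hζm a y hy.1) (hζ y hy.1).2.2.1 (hζ y hy.1).2.2.2 v
  have hsec : ∀ Z : (∀ x : M, TangentSpace I x), IsVectorFieldOn I V' Z → ∀ a,
      ContMDiffOn I 𝓘(ℝ, ℝ) ∞ (fun y => D I (c a) y (vec Z y)) (V ∩ V') := fun Z hZ a =>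
    contMDiffOn_D_apply hW (hcs a) (hZ.mono Set.inter_subset_right)
  have hfirst : ∀ Z : (∀ x : M, TangentSpace I x), ∀ y ∈ V ∩ V',
      nablaB I f ξ y (vec Z y) = ∑ a, D I (c a) y (vec Z y) • ζ a y := fun Z y hy =>
    key c hcs y hy ξ hξc _
  have e : normalCurvature I f X Y ξ x
      = nablaB I f (fun y => nablaB I f ξ y (vec Y y)) x (vec X x)
        - nablaB I f (fun y => nablaB I f ξ y (vec X y)) x (vec Y x)
        - nablaB I f ξ x (vec (VectorField.mlieBracket I X Y) x) := rfl
  rw [e, key _ (hsec Y hY) x ⟨hxV, hx⟩ _ (hfirst Y), key _ (hsec X hX) x ⟨hxV, hx⟩ _ (hfirst X),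
    hfirst _ x ⟨hxV, hx⟩, ← Finset.sum_sub_distrib, ← Finset.sum_sub_distrib]
  refine Finset.sum_eq_zero fun a _ => ?_
  -- In a parallel frame the curvature acts on each coefficient as XY - YX - [X, Y], which is zero.
  rw [D_mlieBracket hW (hcs a) (hX.mono Set.inter_subset_right) (hY.mono Set.inter_subset_right)
    ⟨hxV, hx⟩]
  module

end Flat

section FromDupin

variable {η : Fin k → M → E}

theorem IsDupinOn.iSup_nullB (h : IsDupinOn I U f η) {x : M} (hx : x ∈ U) :
    ⨆ j, nullB I f (η j) x = ⊤ := h.splitting x hx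

theorem IsDupinOn.inner_eq_zero (hU : IsOpen U) (h : IsDupinOn I U f η) {x : M} (hx : x ∈ U)
    {i j : Fin k} (hij : i ≠ j) {v w : B} (hv : v ∈ nullB I f (η i) x)
    (hw : w ∈ nullB I f (η j) x) : ⟪D I f x v, D I f x w⟫_ℝ = 0 :=
  inner_D_eq_zero_of_mem_nullB hU h.immersion hx
    (fun e => hij (h.distinct x hx e)) hv hw

theorem IsDupinOn.smooth_normal (h : IsDupinOn I U f η) (j : Fin k) :
    ContMDiffOn I 𝓘(ℝ, E) ∞ (η j) U := (h.principal j).choose_spec.1.1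

theorem IsDupinOn.mem_normal (h : IsDupinOn I U f η) (j : Fin k) {x : M} (hx : x ∈ U) :
    η j x ∈ normal I f x := (h.principal j).choose_spec.1.2 x hx

/-- On the nullity of η_j the shape operator A_n is multiplication by ⟨η_j, n⟩, and for a parallel
bundle dP has no component beyond the shape operator. -/
theorem IsDupinOn.dProj_eq (hU : IsOpen U) (h : IsDupinOn I U f η)
    (hN : IsParallelBundleOn I U f N) {x : M} (hx : x ∈ U) {j : Fin k} {v : B}
    (hv : v ∈ nullB I f (η j) x) {n : E} (hn : n ∈ N x) :
    dProj I N x v n = -(⟪η j x, n⟫_ℝ • D I f x v) := by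
  have h1 := D_eq_neg_smul_of_mem_nullB hU h.immersion hx
    (n := fun y => (N y).starProjection n)
    (hasPush_proj hU hN.smooth hx (hasPush_const n x)).mdifferentiableAt
    (Filter.eventually_of_mem (hU.mem_nhds hx) fun y hy =>
      hN.le_normal y hy (Submodule.starProjection_apply_mem _ _)) hv
    (by rw [D_proj hU hN.smooth hx]; exact hN.parallel x hx n hn v)
  rwa [D_proj hU hN.smooth hx, Submodule.starProjection_eq_self_iff.2 hn] at h1

/-- This is the curvature hypothesis of `exists_parallel_frame`. Shape operators are diagonal in the
orthogonal sum of the nullities and therefore commute; by the Ricci equation that is flatness. -/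
theorem IsDupinOn.inner_dProj (hU : IsOpen U) (h : IsDupinOn I U f η)
    (hN : IsParallelBundleOn I U f N) {x : M} (hx : x ∈ U) {n n' : E} (hn : n ∈ N x)
    (hn' : n' ∈ N x) (v w : B) :
    ⟪dProj I N x v n, dProj I N x w n'⟫_ℝ = ⟪dProj I N x w n, dProj I N x v n'⟫_ℝ := by
  have hv : v ∈ ⨆ j, nullB I f (η j) x := by rw [h.iSup_nullB hx]; trivial
  have hw : w ∈ ⨆ j, nullB I f (η j) x := by rw [h.iSup_nullB hx]; trivial
  have hadd : ∀ v v' m, dProj I N x (v + v') m = dProj I N x v m + dProj I N x v' m := by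
    intro v v' m; simp [dProj]
  have h0 : ∀ m, dProj I N x 0 m = 0 := by intro m; simp [dProj]
  induction hv using Submodule.iSup_induction' with
  | zero => simp [h0]
  | add v v' _ _ ih ih' => rw [hadd, hadd, inner_add_left, inner_add_right, ih, ih']
  | mem i v hv =>
    induction hw using Submodule.iSup_induction' with
    | zero => simp [h0]
    | add w w' _ _ ih ih' => rw [hadd, hadd, inner_add_left, inner_add_right, ih, ih']
    | mem j w hw =>
      rw [h.dProj_eq hU hN hx hv hn, h.dProj_eq hU hN hx hw hn', h.dProj_eq hU hN hx hw hn,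
        h.dProj_eq hU hN hx hv hn']
      by_cases hij : i = j
      · subst hij
        simp only [inner_neg_left, inner_neg_right, real_inner_smul_left, real_inner_smul_right,
          real_inner_comm (D I f x v)]
      · have := h.inner_eq_zero hU hx hij hv hw
        simp [real_inner_smul_left, real_inner_smul_right, this, real_inner_comm (D I f x v)]

/-- A Dupin submanifold has parallel frames of every parallel bundle of normal vectors. -/
theorem IsDupinOn.exists_frame (hU : IsOpen U) (h : IsDupinOn I U f η)
    (hN : IsParallelBundleOn I U f N) (hr : ∀ x ∈ U, Module.finrank ℝ (N x) = r) {x₀ : M}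
    (hx₀ : x₀ ∈ U) :
    ∃ V ⊆ U, IsOpen V ∧ x₀ ∈ V ∧ ∃ ζ : Fin r → M → E,
      (∀ a, ContMDiffOn I 𝓘(ℝ, E) ∞ (ζ a) V) ∧
      ∀ x ∈ V, (Orthonormal ℝ fun a => ζ a x) ∧ Submodule.span ℝ (Set.range fun a => ζ a x) = N x ∧
        (∀ a v, D I (ζ a) x v ∈ tangent I f x) := by
  obtain ⟨V, hVU, hV, hxV, ζ, hζs, hζ⟩ := exists_parallel_frame hU hN.smooth
    (fun x hx v w n hn n' hn' => h.inner_dProj hU hN hx hn hn' v w) hr hx₀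
  refine ⟨V, hVU, hV, hxV, ζ, hζs, fun x hx => ⟨(hζ x hx).1, (hζ x hx).2.1, fun a v => ?_⟩⟩
  rw [(hζ x hx).2.2 a v]
  refine hN.parallel x (hVU hx) _ ?_ v
  rw [← (hζ x hx).2.1]
  exact Submodule.subset_span ⟨a, rfl⟩

/-- The derivative of a parallel normal field of a Dupin submanifold. -/
theorem IsDupinOn.D_parallel (hU : IsOpen U) (h : IsDupinOn I U f η) (hVU : V ⊆ U) (hV : IsOpen V)
    {ζ : M → E} (hζs : ContMDiffOn I 𝓘(ℝ, E) ∞ ζ V) (hn : ∀ x ∈ V, ζ x ∈ normal I f x)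
    (ht : ∀ x ∈ V, ∀ v, D I ζ x v ∈ tangent I f x) {x : M} (hx : x ∈ V) {j : Fin k} {v : B}
    (hv : v ∈ nullB I f (η j) x) :
    D I ζ x v = -(⟪η j x, ζ x⟫_ℝ • D I f x v) ∧ D I (fun y => ⟪η j y, ζ y⟫_ℝ) x v = 0 := by
  refine ⟨D_eq_neg_smul_of_mem_nullB hU h.immersion (hVU hx) (hζs.hasPush hV hx).mdifferentiableAt
    (Filter.eventually_of_mem (hV.mem_nhds hx) hn) hv (ht x hx v), ?_⟩
  have h1 := ((h.smooth_normal j).hasPush hU (hVU hx)).inner (hζs.hasPush hV hx)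
  rw [h1.eq]
  -- Both η_j and ζ are parallel along the nullity, so each derivative is tangent and pairs to zero
  -- with the other field.
  obtain ⟨w, hw⟩ : D I (η j) x v ∈ tangent I f x :=
    mem_tangent_of_nablaB_eq_zero (h.dupin j x (hVU hx) v hv)
  obtain ⟨w', hw'⟩ := ht x hx v
  have e1 : ⟪η j x, D I ζ x v⟫_ℝ = 0 := by
    rw [← hw']; exact DupinSub.mem_normal.1 (h.mem_normal j (hVU hx)) w'
  have e2 : ⟪ζ x, D I (η j) x v⟫_ℝ = 0 := by
    rw [← hw]; exact DupinSub.mem_normal.1 (hn x hx) w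
  simp [e1, e2]

end FromDupin

section ToDupin

variable {η : Fin k → M → E} {Δ : Fin k → M → Submodule ℝ B}

/-- An immersion is a Dupin submanifold if it has local parallel normal frames `ζ` such that
`ζ_a` has derivative `-⟪η_j, ζ_a⟫ f_*` along `Δ_j`, and `⟪η_j, ζ_a⟫` is constant along `Δ_j`. -/
theorem isDupinOn_of_frame (hU : IsOpen U) (hf : IsImmersionOn I U f)
    (hη : ∀ j, IsSectionOn I U (normal I f) (η j))
    (hdist : ∀ x ∈ U, Function.Injective fun j => η j x)
    (hΔ : ∀ x ∈ U, ⨆ j, Δ j x = ⊤)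
    (hrank : ∀ j, ∃ s, 1 ≤ s ∧ ∀ x ∈ U, Module.finrank ℝ (Δ j x) = s)
    (hframe : ∀ x₀ ∈ U, ∃ V, IsOpen V ∧ x₀ ∈ V ∧ ∃ (r : ℕ) (ζ : Fin r → M → E),
      (∀ a, ContMDiffOn I 𝓘(ℝ, E) ∞ (ζ a) V) ∧ ∀ x ∈ V, (Orthonormal ℝ fun a => ζ a x) ∧
        Submodule.span ℝ (Set.range fun a => ζ a x) = normal I f x ∧
        ∀ a j, ∀ v ∈ Δ j x, D I (ζ a) x v = -(⟪η j x, ζ a x⟫_ℝ • D I f x v) ∧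
          D I (fun y => ⟪η j y, ζ a y⟫_ℝ) x v = 0) :
    IsDupinOn I U f η ∧ ∀ j, ∀ x ∈ U, nullB I f (η j) x = Δ j x := by
  -- By Weingarten's formula the components of α(v, ·) in the frame are read off from the
  -- derivatives of the frame.
  have hle : ∀ j, ∀ x ∈ U, Δ j x ≤ nullB I f (η j) x := by
    intro j x hx v hv
    obtain ⟨V, hV, hxV, r, ζ, hζs, hζ⟩ := hframe x hx
    obtain ⟨ho, hsp, hd⟩ := hζ x hxV
    refine mem_nullB.2 fun w => ?_
    refine eq_of_inner_eq (K := normal I f x) (sffB_mem_normal f x v w)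
      (Submodule.smul_mem _ _ ((hη j).2 x hx)) fun n hn => ?_
    rw [← hsp] at hn
    induction hn using Submodule.span_induction with
    | zero => simp
    | add a b _ _ ha hb => rw [inner_add_right, inner_add_right, ha, hb]
    | smul c a _ ha => rw [real_inner_smul_right, real_inner_smul_right, ha]
    | mem _ hn =>
      obtain ⟨a, rfl⟩ := hn
      rw [inner_sffB hU hf hx ((hζs a).hasPush hV hxV).mdifferentiableAt
        (Filter.eventually_of_mem (hV.mem_nhds hxV) fun y hy => by
          rw [← (hζ y hy).2.1]; exact Submodule.subset_span ⟨a, rfl⟩), (hd a j v hv).1,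
        inner_neg_right, neg_neg, real_inner_smul_right, real_inner_smul_left,
        real_inner_comm (D I f x v)]
      ring
  -- Nullities of distinct principal normals are orthogonal, and the subspaces Δ_i of them already
  -- span; so a vector of the j-th nullity has no component in Δ_i for i ≠ j.
  have heq : ∀ j, ∀ x ∈ U, nullB I f (η j) x = Δ j x := by
    intro j x hx
    refine le_antisymm (fun v hv => ?_) (hle j x hx)
    have hvt : v ∈ ⨆ i, Δ i x := by rw [hΔ x hx]; trivial
    obtain ⟨u, hu⟩ := (Submodule.mem_iSup_iff_exists_finsupp _ _).1 hvt
    obtain ⟨hu, hsum⟩ := hu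
    rw [Finsupp.sum_fintype _ _ (by simp)] at hsum
    have hz : ∀ i, i ≠ j → u i = 0 := by
      intro i hij
      refine hf.injective hx ?_
      rw [map_zero, ← inner_self_eq_zero (𝕜 := ℝ)]
      have h1 : ⟪D I f x v, D I f x (u i)⟫_ℝ = 0 :=
        inner_D_eq_zero_of_mem_nullB hU hf hx (fun e => hij (hdist x hx e).symm) hv
          (hle i x hx (hu i))
      rw [← hsum, map_sum, sum_inner, Finset.sum_eq_single i] at h1
      · exact h1
      · intro l _ hl
        exact inner_D_eq_zero_of_mem_nullB hU hf hx (fun e => hl (hdist x hx e))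
          (hle l x hx (hu l)) (hle i x hx (hu i))
      · simp
    rw [← hsum, Finset.sum_eq_single j (fun i _ hi => hz i hi) (by simp)]
    exact hu j
  have htan : ∀ (r : ℕ) (V : Set M) (ζ : Fin r → M → E), ∀ x ∈ U,
      (∀ a j, ∀ v ∈ Δ j x, D I (ζ a) x v = -(⟪η j x, ζ a x⟫_ℝ • D I f x v) ∧
          D I (fun y => ⟪η j y, ζ a y⟫_ℝ) x v = 0) → ∀ a v, D I (ζ a) x v ∈ tangent I f x := by
    intro r V ζ x hx hd a v
    have hvt : v ∈ ⨆ i, Δ i x := by rw [hΔ x hx]; trivial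
    induction hvt using Submodule.iSup_induction' with
    | zero => rw [map_zero]; exact Submodule.zero_mem _
    | add v w _ _ hv hw => rw [map_add]; exact Submodule.add_mem _ hv hw
    | mem j v hv =>
      rw [(hd a j v hv).1]
      exact Submodule.neg_mem _ (Submodule.smul_mem _ _ (D_mem_tangent f x v))
  have hdupin : ∀ j, ∀ x ∈ U, ∀ v ∈ Δ j x, nablaB I f (η j) x v = 0 := by
    intro j x hx v hv
    obtain ⟨V, hV, hxV, r, ζ, hζs, hζ⟩ := hframe x hx
    obtain ⟨ho, hsp, hd⟩ := hζ x hxV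
    refine eq_of_inner_eq (K := normal I f x)
      (by rw [nablaB_eq]; exact Submodule.starProjection_apply_mem _ _)
      (Submodule.zero_mem _) fun n hn => ?_
    rw [nablaB_eq, inner_normal_starProjection hn, inner_zero_left]
    rw [← hsp] at hn
    induction hn using Submodule.span_induction with
    | zero => simp
    | add a b _ _ ha hb => rw [inner_add_right, ha, hb, add_zero]
    | smul c a _ ha => rw [real_inner_smul_right, ha, mul_zero]
    | mem _ hn =>
      obtain ⟨a, rfl⟩ := hn
      -- The component of ∇^⊥ η_j along ζ_a is the derivative of ⟨η_j, ζ_a⟩, because ζ_a is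
      -- parallel.
      have h1 := ((hη j).1.hasPush hU hx).inner ((hζs a).hasPush hV hxV)
      have h2 := (hd a j v hv).2
      rw [h1.eq] at h2
      obtain ⟨w, hw⟩ := htan r V ζ x hx hd a v
      have h3 : ⟪η j x, D I (ζ a) x v⟫_ℝ = 0 := by
        rw [← hw]; exact DupinSub.mem_normal.1 ((hη j).2 x hx) w
      simp only [add_apply, ContinuousLinearMap.comp_apply, innerSL_apply_apply, h3, zero_add] at h2
      change ⟪D I (η j) x v, ζ a x⟫_ℝ = 0
      rw [real_inner_comm]
      exact h2
  refine ⟨⟨hf, isFlatOn_of_frame fun x₀ hx₀ => ?_, fun j => ?_, hdist, fun x hx => ?_, fun j => ?_⟩,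
    heq⟩
  · obtain ⟨V, hV, hxV, r, ζ, hζs, hζ⟩ := hframe x₀ hx₀
    refine ⟨V ∩ U, hV.inter hU, ⟨hxV, hx₀⟩, r, ζ,
      fun a => (hζs a).mono Set.inter_subset_left, fun x hx => ?_⟩
    obtain ⟨ho, hsp, hd⟩ := hζ x hx.1
    exact ⟨ho, hsp.ge, fun a => by rw [← hsp]; exact Submodule.subset_span ⟨a, rfl⟩,
      htan r V ζ x hx.2 hd⟩
  · obtain ⟨s, hs, hs'⟩ := hrank j
    refine ⟨s, hη j, hs, fun x hx => ?_⟩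
    have : Module.finrank ℝ (nullB I f (η j) x) = s := by rw [heq j x hx, hs' x hx]
    exact this
  · have : ⨆ j, nullB I f (η j) x = ⊤ := by
      simp only [heq _ x hx, hΔ x hx]
    exact this
  · exact fun x hx v hv => hdupin j x hx v ((heq j x hx).le hv)

end ToDupin

end

/-! ### Global parallel frames over a simply connected manifold. -/

section

variable {B : Type*} [NormedAddCommGroup B] [NormedSpace ℝ B] [FiniteDimensional ℝ B]
  {H : Type*} [TopologicalSpace H] {I : ModelWithCorners ℝ B H} [I.Boundaryless]
  {M : Type*} [TopologicalSpace M] [ChartedSpace H M] [IsManifold I ∞ M]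
  {F : Type*} [NormedAddCommGroup F] [NormedSpace ℝ F]
  {E : Type*} [NormedAddCommGroup E] [InnerProductSpace ℝ E] [FiniteDimensional ℝ E]
  {U V : Set M}

/-- A map with vanishing differential is locally constant. -/
theorem eventually_eq_of_D_eq_zero (hV : IsOpen V) {g : M → F}
    (hg : ∀ y ∈ V, HasPush I g y 0) {x : M} (hx : x ∈ V) : ∀ᶠ y in 𝓝 x, g y = g x := by
  set c := extChartAt I x with hc
  have h1 := eventually_of_chart (I := I) (hV.mem_nhds hx)
  obtain ⟨ρ, hρ, hb⟩ := Metric.eventually_nhds_iff_ball.1 h1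
  -- Read in the chart on a ball, which is connected, the map has zero derivative.
  have hd : ∀ b ∈ Metric.ball (c x) ρ, HasFDerivAt (read I x g) (0 : B →L[ℝ] F) b := by
    intro b hbb
    obtain ⟨h2, h3⟩ := hb b hbb
    have h4 : MDifferentiableAt 𝓘(ℝ, B) I c.symm b :=
      (contMDiffAt_chart_symm h2).mdifferentiableAt (by simp)
    obtain ⟨L, hL⟩ : ∃ L : B →L[ℝ] B, HasMFDerivAt 𝓘(ℝ, B) I c.symm b L := ⟨_, h4.hasMFDerivAt⟩
    have h5 : HasPush 𝓘(ℝ, B) (read I x g) b ((0 : B →L[ℝ] F).comp L) :=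
      HasPush.comp (f := g) (g := c.symm) (hg _ h3) hL
    rw [ContinuousLinearMap.zero_comp] at h5
    exact hasPush_id_iff.1 h5
  have hconst : ∀ b ∈ Metric.ball (c x) ρ, read I x g b = read I x g (c x) := fun b hbb =>
    Metric.isOpen_ball.is_const_of_fderiv_eq_zero (𝕜 := ℝ) (convex_ball (c x) ρ).isPreconnected
      (fun z hz => (hd z hz).differentiableAt.differentiableWithinAt)
      (fun z hz => (hd z hz).fderiv) hbb (Metric.mem_ball_self hρ)
  filter_upwards [extChartAt_source_mem_nhds (I := I) x,
    (continuousAt_extChartAt (I := I) x).preimage_mem_nhds (Metric.ball_mem_nhds _ hρ)] with y hy hy'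
  rw [← read_chart hy g, hconst _ hy', read_chart (mem_extChartAt_source x)]

/-- A type of coordinate vectors with the discrete topology. -/
def DiscreteVec (s : ℕ) : Type := Fin s → ℝ

instance (s : ℕ) : TopologicalSpace (DiscreteVec s) := ⊥

instance (s : ℕ) : DiscreteTopology (DiscreteVec s) := ⟨rfl⟩

theorem hasPush_inner_of_orthogonal (hV : IsOpen V) {a b : M → E}
    (ha : ContMDiffOn I 𝓘(ℝ, E) ∞ a V) (hb : ContMDiffOn I 𝓘(ℝ, E) ∞ b V) {x : M} (hx : x ∈ V)
    (h : ∀ v, ⟪b x, D I a x v⟫_ℝ = 0) (h' : ∀ v, ⟪a x, D I b x v⟫_ℝ = 0) :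
    HasPush I (fun y => ⟪a y, b y⟫_ℝ) x 0 := by
  have h1 := (ha.hasPush hV hx).inner (hb.hasPush hV hx)
  convert h1 using 1
  ext v
  simp [h v, h' v]

/-- On a simply connected manifold a flat bundle has a global parallel orthonormal frame. -/
theorem exists_global_frame [SimplyConnectedSpace M] [LocallyPathConnectedSpace M]
    {N T : M → Submodule ℝ E} {s : ℕ} (hT : ∀ x, T x ≤ (N x)ᗮ)
    (hloc : ∀ x₀ : M, ∃ V, IsOpen V ∧ x₀ ∈ V ∧ ∃ ζ : Fin s → M → E,
      (∀ a, ContMDiffOn I 𝓘(ℝ, E) ∞ (ζ a) V) ∧ ∀ x ∈ V, (Orthonormal ℝ fun a => ζ a x) ∧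
        Submodule.span ℝ (Set.range fun a => ζ a x) = N x ∧ ∀ a v, D I (ζ a) x v ∈ T x) :
    ∃ ξ : Fin s → M → E, (∀ a, ContMDiffOn I 𝓘(ℝ, E) ∞ (ξ a) Set.univ) ∧
      ∀ x, (Orthonormal ℝ fun a => ξ a x) ∧
        Submodule.span ℝ (Set.range fun a => ξ a x) = N x ∧ ∀ a v, D I (ξ a) x v ∈ T x := by
  choose V hV hxV ζ hζs hζ using hloc
  have ho : ∀ i, ∀ x ∈ V i, Orthonormal ℝ fun a => ζ i a x := fun i x hx => (hζ i x hx).1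
  have hsp : ∀ i, ∀ x ∈ V i, Submodule.span ℝ (Set.range fun a => ζ i a x) = N x :=
    fun i x hx => (hζ i x hx).2.1
  have hd : ∀ i, ∀ x ∈ V i, ∀ a v, D I (ζ i a) x v ∈ T x := fun i x hx => (hζ i x hx).2.2
  have hmem : ∀ i, ∀ x ∈ V i, ∀ a, ζ i a x ∈ N x := fun i x hx a => by
    rw [← hsp i x hx]; exact Submodule.subset_span ⟨a, rfl⟩
  have hperp : ∀ i, ∀ x ∈ V i, ∀ a v, ∀ n ∈ N x, ⟪n, D I (ζ i a) x v⟫_ℝ = 0 :=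
    fun i x hx a v n hn => (Submodule.mem_orthogonal _ _).1 (hT x (hd i x hx a v)) n hn
  let comb (i : M) (x : M) (c : Fin s → ℝ) : E := ∑ a, c a • ζ i a x
  have hcombN : ∀ i, ∀ x ∈ V i, ∀ c, comb i x c ∈ N x := fun i x hx c =>
    Submodule.sum_mem _ fun a _ => Submodule.smul_mem _ _ (hmem i x hx a)
  have hrep : ∀ i, ∀ x ∈ V i, ∀ n ∈ N x, comb i x (fun a => ⟪ζ i a x, n⟫_ℝ) = n :=
    fun i x hx n hn => (ho i x hx).sum_inner_smul_of_mem_span (by rw [hsp i x hx]; exact hn)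
  have hcoord : ∀ i, ∀ x ∈ V i, ∀ c, (fun a => ⟪ζ i a x, comb i x c⟫_ℝ) = c := fun i x hx c => by
    funext a
    exact (ho i x hx).inner_right_fintype c a
  -- The germs of parallel sections form a covering: the local frames give trivializations whose
  -- coordinate changes are locally constant, hence continuous for the discrete topology on
  -- coordinate vectors.
  let Z : FiberBundleCore M M (DiscreteVec s) :=
    { baseSet := V
      isOpen_baseSet := hV
      indexAt := id
      mem_baseSet_at := hxV
      coordChange := fun i j x c => fun a => ⟪ζ j a x, comb i x c⟫_ℝ
      coordChange_self := fun i x hx c => hcoord i x hx c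
      continuousOn_coordChange := by
        intro i j
        rintro ⟨x, c⟩ ⟨⟨hxi, hxj⟩, -⟩
        refine ContinuousAt.continuousWithinAt ?_
        -- Inner products of members of two parallel frames have zero derivative, since derivatives
        -- lie in T, which is orthogonal to N.
        have h1 : ∀ᶠ y in 𝓝 x, ∀ a b, ⟪ζ j a y, ζ i b y⟫_ℝ = ⟪ζ j a x, ζ i b x⟫_ℝ := by
          rw [Filter.eventually_all]; intro a
          rw [Filter.eventually_all]; intro b
          exact eventually_eq_of_D_eq_zero ((hV j).inter (hV i)) (fun y hy =>
            hasPush_inner_of_orthogonal (I := I) ((hV j).inter (hV i))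
              ((hζs j a).mono Set.inter_subset_left) ((hζs i b).mono Set.inter_subset_right) hy
              (fun v => hperp j y hy.1 a v _ (hmem i y hy.2 b))
              (fun v => hperp i y hy.2 b v _ (hmem j y hy.1 a))) ⟨hxj, hxi⟩
        have h2 : (fun p : M × DiscreteVec s => (fun a => ⟪ζ j a p.1, comb i p.1 p.2⟫_ℝ :
            DiscreteVec s)) =ᶠ[𝓝 (x, c)] fun _ => (fun a => ⟪ζ j a x, comb i x c⟫_ℝ) := by
          have h3 : {c} ∈ 𝓝 c := by rw [nhds_discrete]; exact Filter.mem_pure.2 rfl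
          rw [nhds_prod_eq]
          filter_upwards [Filter.prod_mem_prod h1 h3] with p hp
          obtain ⟨hp1, hp2⟩ := hp
          rw [Set.mem_singleton_iff] at hp2
          funext a
          simp only [comb, hp2, inner_sum, real_inner_smul_right, hp1 _ _]
        exact ContinuousAt.congr continuousAt_const h2.symm
      coordChange_comp := by
        rintro i j k x ⟨⟨hi, hj⟩, hk⟩ c
        funext a
        have : comb j x (fun a => ⟪ζ j a x, comb i x c⟫_ℝ) = comb i x c :=
          hrep j x hj _ (hcombN i x hi c)
        exact congrArg (fun e => ⟪ζ k a x, e⟫_ℝ) this }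
  have hcov : IsCoveringMap Z.proj := FiberBundle.isCoveringMap (F := DiscreteVec s) (E := Z.Fiber)
  obtain ⟨x₀⟩ : Nonempty M := inferInstance
  have hlift : ∀ a : Fin s, ∃ ξ : M → E, ContMDiffOn I 𝓘(ℝ, E) ∞ ξ Set.univ ∧
      (∀ x, ξ x ∈ N x ∧ ∀ v, D I ξ x v ∈ T x) ∧ ξ x₀ = ζ x₀ a x₀ := by
    intro a
    let e : DiscreteVec s := Pi.single a (1 : ℝ)
    -- Lifting the identity of the simply connected M gives a section with prescribed value at x₀;
    -- here the value is the a-th vector of the frame at x₀.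
    obtain ⟨σ, ⟨hσ0, hσ⟩, -⟩ := hcov.existsUnique_continuousMap_lifts (ContinuousMap.id M) x₀
      (⟨x₀, e⟩ : Z.TotalSpace) rfl
    have hproj : ∀ x, (σ x).1 = x := fun x => congrFun hσ x
    have hξi : ∀ i x, x ∈ V i →
        comb (σ x).1 x (σ x).2 = comb i x ((Z.localTriv i (σ x)).2) := by
      intro i x hx
      have h1 : (Z.localTriv i (σ x)).2
          = Z.coordChange (Z.indexAt (σ x).1) i (σ x).1 (σ x).2 := by
        rw [Z.localTriv_apply]
      rw [h1]
      change _ = comb i x (fun a => ⟪ζ i a (σ x).1, comb (σ x).1 (σ x).1 (σ x).2⟫_ℝ)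
      have h2 : ∀ z : M, z = x → ∀ c : Fin s → ℝ, comb z x c
          = comb i x (fun a => ⟪ζ i a z, comb z z c⟫_ℝ) := by
        rintro z rfl c
        exact (hrep i z hx _ (hcombN z z (hxV z) c)).symm
      exact h2 _ (hproj x) _
    -- A continuous section has locally constant coordinates, so it is locally a fixed combination
    -- of parallel fields.
    have hloc : ∀ x, ∃ c : Fin s → ℝ, ∀ᶠ y in 𝓝 x, y ∈ V x ∧ comb (σ y).1 y (σ y).2
        = comb x y c := by
      intro x
      have h1 : ContinuousAt (fun y => (Z.localTriv x (σ y)).2) x := by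
        refine continuous_snd.continuousAt.comp ?_
        refine ContinuousAt.comp (f := σ) (g := Z.localTriv x) ?_ σ.continuous.continuousAt
        refine (Z.localTriv x).continuousOn.continuousAt ((Z.localTriv x).open_source.mem_nhds ?_)
        rw [Z.mem_localTriv_source]
        change (σ x).1 ∈ V x
        rw [hproj]; exact hxV x
      have h2 : ∀ᶠ y in 𝓝 x, (Z.localTriv x (σ y)).2 = (Z.localTriv x (σ x)).2 := by
        refine h1.eventually (p := fun c => c = (Z.localTriv x (σ x)).2) ?_
        rw [nhds_discrete]; exact Filter.eventually_pure.2 rfl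
      refine ⟨(Z.localTriv x (σ x)).2, ?_⟩
      filter_upwards [h2, (hV x).mem_nhds (hxV x)] with y hy hyV
      exact ⟨hyV, by rw [hξi x y hyV, hy]⟩
    refine ⟨fun x => comb (σ x).1 x (σ x).2, ?_, ?_, ?_⟩
    · intro x _
      obtain ⟨c, hc⟩ := hloc x
      refine ContMDiffAt.contMDiffWithinAt ?_
      refine ContMDiffAt.congr_of_eventuallyEq (f := fun y => comb x y c) ?_ (hc.mono fun y hy => hy.2)
      refine contMDiffAt_finsetSum fun b _ => ?_
      exact (contMDiffAt_const (I := I) (I' := 𝓘(ℝ, ℝ)) (c := c b)).smul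
        ((hζs x b).contMDiffAt ((hV x).mem_nhds (hxV x)))
    · intro x
      obtain ⟨c, hc⟩ := hloc x
      refine ⟨?_, fun v => ?_⟩
      · have := hc.self_of_nhds.2
        beta_reduce
        rw [this]
        exact hcombN x x (hxV x) c
      · have h1 : HasPush I (fun y => comb (σ y).1 y (σ y).2) x _ :=
          (HasPush.sum (I := I) Finset.univ fun b _ =>
            ((hζs x b).hasPush (hV x) (hxV x)).const_smul (c b)).congr (hc.mono fun y hy => hy.2)
        rw [h1.eq, sum_apply]
        exact Submodule.sum_mem _ fun b _ => Submodule.smul_mem _ _ (hd x x (hxV x) b v)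
    · have h1 : ∀ p : Z.TotalSpace, p = ⟨x₀, e⟩ → comb p.1 x₀ p.2 = ζ x₀ a x₀ := by
        rintro _ rfl
        change comb x₀ x₀ (Pi.single a (1 : ℝ)) = _
        simp [comb]
      exact h1 _ hσ0
  choose ξ hξs hξ hξ0 using hlift
  have horth : ∀ x, Orthonormal ℝ fun a => ξ a x := by
    intro x
    rw [orthonormal_iff_ite]
    intro a b
    -- Orthonormality propagates from x₀ because M is connected.
    have h1 : IsLocallyConstant fun x => ⟪ξ a x, ξ b x⟫_ℝ := by
      rw [IsLocallyConstant.iff_eventually_eq]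
      intro x
      exact eventually_eq_of_D_eq_zero isOpen_univ (fun y hy =>
        hasPush_inner_of_orthogonal (I := I) isOpen_univ (hξs a) (hξs b) hy
          (fun v => (Submodule.mem_orthogonal _ _).1 (hT y ((hξ a y).2 v)) _ (hξ b y).1)
          (fun v => (Submodule.mem_orthogonal _ _).1 (hT y ((hξ b y).2 v)) _ (hξ a y).1))
        (Set.mem_univ x)
    have h2 := h1.apply_eq_of_isPreconnected isPreconnected_univ (Set.mem_univ x) (Set.mem_univ x₀)
    rw [h2, hξ0, hξ0, orthonormal_iff_ite.1 (ho x₀ x₀ (hxV x₀))]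
  refine ⟨ξ, hξs, fun x => ⟨horth x, ?_, fun a => (hξ a x).2⟩⟩
  refine Submodule.eq_of_le_of_finrank_eq (Submodule.span_le.2 ?_) ?_
  · rintro _ ⟨a, rfl⟩
    exact (hξ a x).1
  · rw [finrank_span_eq_card (horth x).linearIndependent, ← hsp x x (hxV x),
      finrank_span_eq_card (ho x x (hxV x)).linearIndependent]

end

/-! ### Algebra of the reflection along F_t, written so that it extends to t = ∞. -/

section Reflection

variable {E : Type*} [NormedAddCommGroup E] [InnerProductSpace ℝ E]

/-- The transformation `n ↦ n - 2 ⟪n, F⟫ G / q` of normal vectors. -/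
noncomputable def reflect (F G : E) (q : ℝ) (n : E) : E := n - (2 * ⟪n, F⟫_ℝ / q) • G

/-- The vectors tangent to the spheres of a Ribaucour transform, up to a factor. -/
noncomputable def sphereTangent (F G : E) (q a : ℝ) (w : E) : E :=
  w + (2 * a) • F - (2 * (⟪F, F⟫_ℝ * a + ⟪F, w⟫_ℝ) / q) • G

theorem reflect_add (F G : E) (q : ℝ) (a b : E) :
    reflect F G q (a + b) = reflect F G q a + reflect F G q b := by
  simp only [reflect, inner_add_left]; module

theorem reflect_smul (F G : E) (q c : ℝ) (a : E) :
    reflect F G q (c • a) = c • reflect F G q a := by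
  simp only [reflect, real_inner_smul_left]; module

theorem reflect_sum {ι : Type*} (s : Finset ι) (F G : E) (q : ℝ) (c : ι → ℝ) (a : ι → E) :
    reflect F G q (∑ i ∈ s, c i • a i) = ∑ i ∈ s, c i • reflect F G q (a i) := by
  classical
  induction s using Finset.induction_on with
  | empty => simp [reflect]
  | insert i s hi ih => rw [Finset.sum_insert hi, Finset.sum_insert hi, reflect_add, reflect_smul, ih]

variable {F Z : E} {ρ q : ℝ} (hZ : ⟪Z, Z⟫_ℝ = ρ) (hq : q = ⟪F, F⟫_ℝ * ρ + 2 * ⟪F, Z⟫_ℝ + 1)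
  (hq0 : q ≠ 0)

-- With ρ = ‖z‖² and Z = ∑ z_i ξ_i, the vector ρ F + Z is ‖z‖² F_t. Its squared norm is divisible by
-- ρ, and the quotient q equals 1 at z = 0.
include hZ hq in
theorem inner_transform_self : ⟪ρ • F + Z, ρ • F + Z⟫_ℝ = ρ * q := by
  simp only [inner_add_left, inner_add_right, real_inner_smul_left, real_inner_smul_right, hZ,
    real_inner_comm F Z, hq]
  ring

-- For n orthogonal to Z one has ⟨n, G⟩ = ρ⟨n, F⟩, so the factor ρ cancels and `reflect` is the
-- ordinary reflection along G; the computation remains valid for ρ = 0.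
include hZ hq hq0 in
theorem inner_reflect {n n' : E} (hn : ⟪n, Z⟫_ℝ = 0) (hn' : ⟪n', Z⟫_ℝ = 0) :
    ⟪reflect F (ρ • F + Z) q n, reflect F (ρ • F + Z) q n'⟫_ℝ = ⟪n, n'⟫_ℝ := by
  have h1 := inner_transform_self hZ hq
  set G := ρ • F + Z with hG
  have h2 : ⟪n, G⟫_ℝ = ρ * ⟪n, F⟫_ℝ := by
    rw [hG, inner_add_right, real_inner_smul_right, hn, add_zero]
  have h3 : ⟪G, n'⟫_ℝ = ρ * ⟪n', F⟫_ℝ := by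
    rw [real_inner_comm, hG, inner_add_right, real_inner_smul_right, hn', add_zero]
  simp only [reflect, inner_sub_left, inner_sub_right, real_inner_smul_left, real_inner_smul_right,
    h1, h2, h3]
  field_simp
  ring

include hZ hq in
theorem inner_sphereTangent_aux {w : E} {a : ℝ} (hw : ⟪Z, w⟫_ℝ = a) :
    ⟪w + (2 * a) • F, ρ • F + Z⟫_ℝ = ρ * ⟪F, w⟫_ℝ + a * (q + ρ * ⟪F, F⟫_ℝ) := by
  simp only [inner_add_left, inner_add_right, real_inner_smul_left, real_inner_smul_right,
    real_inner_comm F w, real_inner_comm Z w, hw, hq]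
  ring

include hZ hq hq0 in
theorem inner_sphereTangent_reflect {n w : E} {a : ℝ} (hn : ⟪n, Z⟫_ℝ = 0) (hnw : ⟪n, w⟫_ℝ = 0)
    (hw : ⟪Z, w⟫_ℝ = a) :
    ⟪sphereTangent F (ρ • F + Z) q a w, reflect F (ρ • F + Z) q n⟫_ℝ = 0 := by
  have h1 := inner_transform_self hZ hq
  have h4 := inner_sphereTangent_aux hZ hq hw
  have h2 : ⟪ρ • F + Z, n⟫_ℝ = ρ * ⟪n, F⟫_ℝ := by
    rw [real_inner_comm, inner_add_right, real_inner_smul_right, hn, add_zero]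
  have h5 : ⟪w + (2 * a) • F, n⟫_ℝ = 2 * a * ⟪n, F⟫_ℝ := by
    rw [real_inner_comm, inner_add_right, real_inner_smul_right, hnw, zero_add]
  set G := ρ • F + Z
  set X := w + (2 * a) • F
  change ⟪X - _ • G, n - _ • G⟫_ℝ = 0
  simp only [inner_sub_left, inner_sub_right, real_inner_smul_left, real_inner_smul_right,
    h1, h2, h4, h5]
  field_simp
  ring

-- The z-directions are mapped conformally: up to the common factor of the transform, w goes to a
-- vector of the same length.
include hZ hq hq0 in
theorem inner_sphereTangent_self {w : E} {a : ℝ} (hw : ⟪Z, w⟫_ℝ = a) :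
    ⟪sphereTangent F (ρ • F + Z) q a w, sphereTangent F (ρ • F + Z) q a w⟫_ℝ = ⟪w, w⟫_ℝ := by
  have h1 := inner_transform_self hZ hq
  have h4 := inner_sphereTangent_aux hZ hq hw
  have h5 : ⟪w + (2 * a) • F, w + (2 * a) • F⟫_ℝ
      = ⟪w, w⟫_ℝ + 4 * a * ⟪F, w⟫_ℝ + 4 * a ^ 2 * ⟪F, F⟫_ℝ := by
    simp only [inner_add_left, inner_add_right, real_inner_smul_left, real_inner_smul_right,
      real_inner_comm F w]
    ring
  set G := ρ • F + Z
  set X := w + (2 * a) • F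
  have h6 : ⟪G, X⟫_ℝ = ⟪X, G⟫_ℝ := real_inner_comm _ _
  change ⟪X - _ • G, X - _ • G⟫_ℝ = _
  simp only [inner_sub_left, inner_sub_right, real_inner_smul_left, real_inner_smul_right,
    h1, h4, h5, h6]
  field_simp
  ring

end Reflection

/-! ### The completed transform in the coordinate z. -/

section Transform

variable {B : Type*} [NormedAddCommGroup B] [NormedSpace ℝ B] [FiniteDimensional ℝ B]
  {H : Type*} [TopologicalSpace H] {I : ModelWithCorners ℝ B H} [I.Boundaryless]
  {M : Type*} [TopologicalSpace M] [ChartedSpace H M] [IsManifold I ∞ M]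
  {F : Type*} [NormedAddCommGroup F] [NormedSpace ℝ F]
  {E : Type*} [NormedAddCommGroup E] [InnerProductSpace ℝ E] [FiniteDimensional ℝ E]
  {k s : ℕ}

local notation "ℝ^" s => EuclideanSpace ℝ (Fin s)

theorem HasPush.comp_fst {g : M → F} {p : M × ℝ^ s} {g' : B →L[ℝ] F} (hg : HasPush I g p.1 g') :
    HasPush (I.prod (𝓡 s)) (fun p : M × ℝ^ s => g p.1) p
      (g'.comp (ContinuousLinearMap.fst ℝ B (ℝ^ s))) := by
  have h : HasMFDerivAt (I.prod (𝓡 s)) I (Prod.fst : M × (ℝ^ s) → M) p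
      (ContinuousLinearMap.fst ℝ B (ℝ^ s)) := hasMFDerivAt_fst (x := p)
  exact HasPush.comp hg h

theorem HasPush.comp_snd {g : (ℝ^ s) → F} {p : M × ℝ^ s} {g' : (ℝ^ s) →L[ℝ] F}
    (hg : HasFDerivAt g g' p.2) :
    HasPush (I.prod (𝓡 s)) (fun p : M × ℝ^ s => g p.2) p
      (g'.comp (ContinuousLinearMap.snd ℝ B (ℝ^ s))) := by
  have h : HasMFDerivAt (I.prod (𝓡 s)) (𝓡 s) (Prod.snd : M × (ℝ^ s) → ℝ^ s) p
      (ContinuousLinearMap.snd ℝ B (ℝ^ s)) := hasMFDerivAt_snd (x := p)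
  exact HasPush.comp (I := 𝓡 s) (hasPush_id_iff.2 hg) h

variable (φ : M → ℝ) (F : M → E) (ξ : Fin s → M → E)

/-- The section of `N` with coordinates `z`. -/
noncomputable def frameSum (p : M × ℝ^ s) : E := ∑ i, p.2 i • ξ i p.1

/-- The vector `‖z‖² F_t`, for `t = z / ‖z‖²`. -/
noncomputable def scaledF (p : M × ℝ^ s) : E := ‖p.2‖ ^ 2 • F p.1 + frameSum ξ p

/-- The number `‖z‖² ‖F_t‖²`, for `t = z / ‖z‖²`. -/
noncomputable def scaledQ (p : M × ℝ^ s) : ℝ :=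
  ⟪F p.1, F p.1⟫_ℝ * ‖p.2‖ ^ 2 + 2 * ⟪F p.1, frameSum ξ p⟫_ℝ + 1

/-- The completed transform in the coordinate `z`. -/
noncomputable def transform (h : M → E) (p : M × ℝ^ s) : E :=
  h p.1 - (2 * φ p.1 * (scaledQ F ξ p)⁻¹) • scaledF F ξ p

variable {φ F ξ}

theorem inner_frameSum {p : M × ℝ^ s} (ho : Orthonormal ℝ fun i => ξ i p.1) (w : ℝ^ s) :
    ⟪frameSum ξ p, frameSum ξ (p.1, w)⟫_ℝ = ⟪p.2, w⟫_ℝ := by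
  simp only [frameSum]
  rw [ho.inner_sum]
  simp [PiLp.inner_apply, mul_comm]

theorem inner_frameSum_self {p : M × ℝ^ s} (ho : Orthonormal ℝ fun i => ξ i p.1) :
    ⟪frameSum ξ p, frameSum ξ p⟫_ℝ = ‖p.2‖ ^ 2 := by
  rw [← real_inner_self_eq_norm_sq]
  exact inner_frameSum ho p.2

/-- Substituting t = z / ‖z‖² gives F_t = ‖z‖⁻² G and ‖F_t‖² = ‖z‖⁻² q, so the powers of ‖z‖ cancel
and the case distinction at z = 0 disappears. -/
theorem ribaucourAtInfinity_eq {I : ModelWithCorners ℝ B H} {h β : M → E} {φ : M → ℝ}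
    (ho : ∀ u, Orthonormal ℝ fun i => ξ i u) :
    ribaucourAtInfinity I h φ β ξ = transform φ (combescure I h φ β) ξ h := by
  funext p
  obtain ⟨u, z⟩ := p
  by_cases hz : z = 0
  · subst hz
    simp [ribaucourAtInfinity, transform, scaledF, frameSum]
  · have hz' : ‖z‖ ^ 2 ≠ 0 := by simpa using hz
    set F := combescure I h φ β with hF
    have h1 : combescureT I h φ β ξ (u, inv z) = (‖z‖ ^ 2)⁻¹ • scaledF F ξ (u, z) := by
      simp only [combescureT, scaledF, frameSum, inv, smul_add, smul_smul, inv_mul_cancel₀ hz',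
        one_smul, Finset.smul_sum, PiLp.smul_apply, smul_eq_mul, hF]
    have h2 : ‖combescureT I h φ β ξ (u, inv z)‖ ^ 2 = (‖z‖ ^ 2)⁻¹ * scaledQ F ξ (u, z) := by
      have h3 := inner_transform_self (F := F u) (Z := frameSum ξ (u, z)) (q := scaledQ F ξ (u, z))
        (inner_frameSum_self (p := (u, z)) (ho u)) rfl
      have h4 : ⟪scaledF F ξ (u, z), scaledF F ξ (u, z)⟫_ℝ = ‖z‖ ^ 2 * scaledQ F ξ (u, z) := h3
      rw [h1, norm_smul, mul_pow, ← real_inner_self_eq_norm_sq (scaledF F ξ (u, z)), h4]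
      simp only [norm_inv, norm_pow, norm_norm]
      field_simp
    simp only [ribaucourAtInfinity, ribaucour, transform, hz, if_false]
    rw [h2, h1, smul_smul]
    congr 2
    rw [mul_inv, inv_inv]
    field_simp

theorem hasPush_frameSum {p : M × ℝ^ s} {ξ' : Fin s → B →L[ℝ] E}
    (hξ : ∀ i, HasPush I (ξ i) p.1 (ξ' i)) : ∃ L, HasPush (I.prod (𝓡 s)) (frameSum ξ) p L ∧
      ∀ v w, L (v, w) = ∑ i, p.2 i • ξ' i v + frameSum ξ (p.1, w) := by
  have h1 : ∀ i, HasPush (I.prod (𝓡 s)) (fun p : M × ℝ^ s => p.2 i • ξ i p.1) p _ := fun i =>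
    (HasPush.comp_snd (I := I) (g := fun z : ℝ^ s => z i)
      (EuclideanSpace.proj (𝕜 := ℝ) i : (ℝ^ s) →L[ℝ] ℝ).hasFDerivAt).smul (hξ i).comp_fst
  refine ⟨_, HasPush.sum Finset.univ fun i _ => h1 i, fun v w => ?_⟩
  simp [frameSum, Finset.sum_add_distrib]

theorem hasPush_norm_sq (p : M × ℝ^ s) : ∃ L, HasPush (I.prod (𝓡 s))
    (fun p : M × ℝ^ s => ‖p.2‖ ^ 2) p L ∧ ∀ v w, L (v, w) = 2 * ⟪p.2, w⟫_ℝ := by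
  refine ⟨_, HasPush.comp_snd (I := I) (g := fun z : ℝ^ s => ‖z‖ ^ 2)
    (hasStrictFDerivAt_norm_sq p.2).hasFDerivAt, fun v w => ?_⟩
  simp

theorem hasPush_scaledF {p : M × ℝ^ s} {ξ' : Fin s → B →L[ℝ] E} {F' : B →L[ℝ] E}
    (hF : HasPush I F p.1 F') (hξ : ∀ i, HasPush I (ξ i) p.1 (ξ' i)) :
    ∃ L, HasPush (I.prod (𝓡 s)) (scaledF F ξ) p L ∧
      ∀ v w, L (v, w) = (‖p.2‖ ^ 2 • F' v + ∑ i, p.2 i • ξ' i v)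
        + (frameSum ξ (p.1, w) + (2 * ⟪p.2, w⟫_ℝ) • F p.1) := by
  obtain ⟨L1, h1, e1⟩ := hasPush_frameSum (I := I) hξ
  obtain ⟨L2, h2, e2⟩ := hasPush_norm_sq (I := I) p
  refine ⟨_, (h2.smul hF.comp_fst).add h1, fun v w => ?_⟩
  simp only [add_apply, smul_apply, ContinuousLinearMap.comp_apply, ContinuousLinearMap.coe_fst',
    ContinuousLinearMap.smulRight_apply, e1, e2]
  abel

theorem hasPush_scaledQ {p : M × ℝ^ s} {ξ' : Fin s → B →L[ℝ] E} {F' : B →L[ℝ] E}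
    (hF : HasPush I F p.1 F') (hξ : ∀ i, HasPush I (ξ i) p.1 (ξ' i)) :
    ∃ L, HasPush (I.prod (𝓡 s)) (scaledQ F ξ) p L ∧
      ∀ v w, L (v, w) = 2 * ⟪F p.1, ‖p.2‖ ^ 2 • F' v + ∑ i, p.2 i • ξ' i v⟫_ℝ
          + 2 * ⟪F' v, frameSum ξ p⟫_ℝ
        + 2 * (⟪F p.1, F p.1⟫_ℝ * ⟪p.2, w⟫_ℝ + ⟪F p.1, frameSum ξ (p.1, w)⟫_ℝ) := by
  obtain ⟨L1, h1, e1⟩ := hasPush_frameSum (I := I) hξ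
  obtain ⟨L2, h2, e2⟩ := hasPush_norm_sq (I := I) p
  have hF1 := hF.comp_fst (s := s) (p := p)
  refine ⟨_, (((hF1.inner hF1).mul h2).add ((hF1.inner h1).const_mul 2)).add
    (hasPush_const (1 : ℝ) p), fun v w => ?_⟩
  simp only [add_apply, smul_apply, ContinuousLinearMap.comp_apply, ContinuousLinearMap.coe_fst',
    e1, e2, smul_eq_mul, innerSL_apply_apply, inner_add_right, real_inner_smul_right,
    zero_apply, real_inner_comm (frameSum ξ p)]
  ring

/-- The transform of a function valued field along the transform: derivative of
`a - (c / q) G`. -/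
theorem hasPush_sub_div_smul {p : M × ℝ^ s} {a G : M × (ℝ^ s) → E} {c q : M × (ℝ^ s) → ℝ}
    {a' G' : B × (ℝ^ s) →L[ℝ] E} {c' q' : B × (ℝ^ s) →L[ℝ] ℝ}
    (ha : HasPush (I.prod (𝓡 s)) a p a') (hG : HasPush (I.prod (𝓡 s)) G p G')
    (hc : HasPush (I.prod (𝓡 s)) c p c') (hq : HasPush (I.prod (𝓡 s)) q p q') (h0 : q p ≠ 0) :
    ∃ L, HasPush (I.prod (𝓡 s)) (fun p => a p - (2 * c p * (q p)⁻¹) • G p) p L ∧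
      ∀ x, L x = a' x - (2 * c' x / q p - 2 * c p * q' x / q p ^ 2) • G p
        - (2 * c p / q p) • G' x := by
  refine ⟨_, ha.sub (((hc.const_mul 2).mul (hq.inv h0)).smul hG), fun x => ?_⟩
  simp only [sub_apply, add_apply, smul_apply, ContinuousLinearMap.smulRight_apply, smul_eq_mul]
  have e1 : 2 * c p * (-(q p ^ 2)⁻¹ * q' x) + (q p)⁻¹ * (2 * c' x)
      = 2 * c' x / q p - 2 * c p * q' x / q p ^ 2 := by field_simp; ring
  have e2 : 2 * c p * (q p)⁻¹ = 2 * c p / q p := by field_simp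
  rw [e1, e2]
  module

end Transform

/-! ### Differential of the transform and its regular domain. -/

section Transform

variable {B : Type*} [NormedAddCommGroup B] [NormedSpace ℝ B] [FiniteDimensional ℝ B]
  {H : Type*} [TopologicalSpace H] {I : ModelWithCorners ℝ B H} [I.Boundaryless]
  {M : Type*} [TopologicalSpace M] [ChartedSpace H M] [IsManifold I ∞ M]
  {E : Type*} [NormedAddCommGroup E] [InnerProductSpace ℝ E] [FiniteDimensional ℝ E]
  {k s : ℕ}

local notation "ℝ^" s => EuclideanSpace ℝ (Fin s)

variable (I) in
/-- An immersion `h` with its net `Δ` and principal normals `η`, the map `F` with eigenvalues `ψ` and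
potential `φ`, and an orthonormal parallel frame `ξ` of normal fields. -/
structure IsTransformData (h F : M → E) (φ : M → ℝ) (ξ : Fin s → M → E)
    (Δ : Fin k → M → Submodule ℝ B) (η : Fin k → M → E) (ψ : Fin k → M → ℝ) : Prop where
  immersion : IsImmersionOn I Set.univ h
  smooth_F : ContMDiffOn I 𝓘(ℝ, E) ∞ F Set.univ
  smooth_phi : ContMDiffOn I 𝓘(ℝ, ℝ) ∞ φ Set.univ
  smooth_frame : ∀ i, ContMDiffOn I 𝓘(ℝ, E) ∞ (ξ i) Set.univ
  smooth_eta : ∀ j, ContMDiffOn I 𝓘(ℝ, E) ∞ (η j) Set.univ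
  smooth_psi : ∀ j, ContMDiffOn I 𝓘(ℝ, ℝ) ∞ (ψ j) Set.univ
  ne_zero : ∀ u, φ u ≠ 0
  orthonormal : ∀ u, Orthonormal ℝ fun i => ξ i u
  frame_normal : ∀ u i, ξ i u ∈ normal I h u
  D_phi : ∀ u v, D I φ u v = ⟪F u, D I h u v⟫_ℝ
  iSup_eq : ∀ u, ⨆ j, Δ j u = ⊤
  ortho : ∀ u i j, i ≠ j → ∀ v ∈ Δ i u, ∀ w ∈ Δ j u, ⟪D I h u v, D I h u w⟫_ℝ = 0
  D_F : ∀ u j, ∀ v ∈ Δ j u, D I F u v = ψ j u • D I h u v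
  D_frame : ∀ u j, ∀ v ∈ Δ j u, ∀ i, D I (ξ i) u v = -(⟪η j u, ξ i u⟫_ℝ • D I h u v)
  D_frame_eta : ∀ u j, ∀ v ∈ Δ j u, ∀ i, D I (fun u => ⟪η j u, ξ i u⟫_ℝ) u v = 0
  D_psi : ∀ u j, ∀ v ∈ Δ j u, D I (ψ j) u v = 0

/-- The eigenvalue `‖z‖² ψ_j - ⟪η_j, ∑ z_i ξ_i⟫`. -/
noncomputable def scaledMu (ξ : Fin s → M → E) (η : M → E) (ψ : M → ℝ) (p : M × ℝ^ s) : ℝ :=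
  ‖p.2‖ ^ 2 * ψ p.1 - frameSum (fun i u => ⟪η u, ξ i u⟫_ℝ) p

theorem inner_frameSum_right {ξ : Fin s → M → E} {a : E} (p : M × ℝ^ s) :
    ⟪a, frameSum ξ p⟫_ℝ = ∑ i, p.2 i * ⟪a, ξ i p.1⟫_ℝ := by
  simp [frameSum, inner_sum, real_inner_smul_right]

/-- The reflection of normal vectors at a point of the transform. -/
noncomputable def reflectAt (F : M → E) (ξ : Fin s → M → E) (p : M × ℝ^ s) (n : E) : E :=
  reflect (F p.1) (scaledF F ξ p) (scaledQ F ξ p) n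

/-- The vectors tangent to the spheres of the transform at a point, up to a factor. -/
noncomputable def sphereAt (F : M → E) (ξ : Fin s → M → E) (p : M × ℝ^ s) (w : ℝ^ s) : E :=
  sphereTangent (F p.1) (scaledF F ξ p) (scaledQ F ξ p) ⟪p.2, w⟫_ℝ (frameSum ξ (p.1, w))

variable {h F : M → E} {φ : M → ℝ} {ξ : Fin s → M → E} {Δ : Fin k → M → Submodule ℝ B}
  {η : Fin k → M → E} {ψ : Fin k → M → ℝ}

section Smooth

variable {G : Type*} [NormedAddCommGroup G] [NormedSpace ℝ G]

theorem contMDiffOn_comp_fst {g : M → G} {V : Set M} (hg : ContMDiffOn I 𝓘(ℝ, G) ∞ g V)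
    {W : Set (M × ℝ^ s)} (hW : ∀ p ∈ W, p.1 ∈ V) :
    ContMDiffOn (I.prod (𝓡 s)) 𝓘(ℝ, G) ∞ (fun p : M × ℝ^ s => g p.1) W :=
  hg.comp contMDiffOn_fst hW

theorem contMDiffOn_frameSum {ξ : Fin s → M → G}
    (hξ : ∀ i, ContMDiffOn I 𝓘(ℝ, G) ∞ (ξ i) Set.univ) (W : Set (M × ℝ^ s)) :
    ContMDiffOn (I.prod (𝓡 s)) 𝓘(ℝ, G) ∞ (fun p : M × ℝ^ s => ∑ i, p.2 i • ξ i p.1) W := by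
  refine contMDiffOn_finsetSum fun i _ => ?_
  have h1 : ContMDiffOn (I.prod (𝓡 s)) 𝓘(ℝ, ℝ) ∞ (fun p : M × ℝ^ s => p.2 i) W :=
    (EuclideanSpace.proj (𝕜 := ℝ) i : (ℝ^ s) →L[ℝ] ℝ).contDiff.contMDiff.comp_contMDiffOn
      (contMDiffOn_snd (I := I) (J := 𝓡 s) (s := W))
  exact h1.smul (contMDiffOn_comp_fst (hξ i) fun _ _ => trivial)

theorem contMDiffOn_norm_sq (W : Set (M × ℝ^ s)) :
    ContMDiffOn (I.prod (𝓡 s)) 𝓘(ℝ, ℝ) ∞ (fun p : M × ℝ^ s => ‖p.2‖ ^ 2) W :=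
  (contDiff_norm_sq ℝ (E := ℝ^ s)).contMDiff.comp_contMDiffOn
    (contMDiffOn_snd (I := I) (J := 𝓡 s) (s := W))

end Smooth

namespace IsTransformData

variable (T : IsTransformData I h F φ ξ Δ η ψ)

include T

theorem hasPush_F (u : M) : HasPush I F u (D I F u) :=
  ContMDiffOn.hasPush isOpen_univ T.smooth_F trivial

theorem hasPush_frame (u : M) (i : Fin s) : HasPush I (ξ i) u (D I (ξ i) u) :=
  ContMDiffOn.hasPush isOpen_univ (T.smooth_frame i) trivial

theorem hasPush_h (u : M) : HasPush I h u (D I h u) :=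
  ContMDiffOn.hasPush isOpen_univ T.immersion.1 trivial

theorem hasPush_phi (u : M) : HasPush I φ u (D I φ u) :=
  ContMDiffOn.hasPush isOpen_univ T.smooth_phi trivial

theorem inner_frameSum_D (p : M × ℝ^ s) (v : B) : ⟪frameSum ξ p, D I h p.1 v⟫_ℝ = 0 := by
  rw [real_inner_comm, inner_frameSum_right]
  refine Finset.sum_eq_zero fun i _ => ?_
  rw [real_inner_comm, mem_normal.1 (T.frame_normal p.1 i), mul_zero]

/-- The vector G = ‖z‖² F + ∑ z_i ξ_i has derivative μ_j dh along Δ_j, because F and the ξ_i have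
scalar derivatives there. -/
theorem D_scaledF_aux {p : M × ℝ^ s} {j : Fin k} {v : B} (hv : v ∈ Δ j p.1) :
    ‖p.2‖ ^ 2 • D I F p.1 v + ∑ i, p.2 i • D I (ξ i) p.1 v
      = scaledMu ξ (η j) (ψ j) p • D I h p.1 v := by
  simp only [T.D_F _ _ _ hv, T.D_frame _ _ _ hv, scaledMu, frameSum, sub_smul, Finset.sum_smul,
    smul_neg, smul_smul, Finset.sum_neg_distrib, smul_eq_mul]
  rw [sub_eq_add_neg]

/-- The differential of the transform of a field. -/
theorem hasPush_transform {a : M → E} {c : M → ℝ} {p : M × ℝ^ s} {a' : B →L[ℝ] E} {c' : B →L[ℝ] ℝ}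
    (ha : HasPush I a p.1 a') (hc : HasPush I c p.1 c') (h0 : scaledQ F ξ p ≠ 0) :
    ∃ L, HasPush (I.prod (𝓡 s))
        (fun p => a p.1 - (2 * c p.1 * (scaledQ F ξ p)⁻¹) • scaledF F ξ p) p L ∧
      (∀ j, ∀ v ∈ Δ j p.1, ∀ α : ℝ, a' v = α • D I h p.1 v → c' v = α * ⟪F p.1, D I h p.1 v⟫_ℝ →
        L (v, 0) = (α - 2 * c p.1 * scaledMu ξ (η j) (ψ j) p / scaledQ F ξ p) •
            reflectAt F ξ p (D I h p.1 v)) ∧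
      ∀ w, L (0, w) = -((2 * c p.1 / scaledQ F ξ p) • sphereAt F ξ p w) := by
  -- The assumptions on (a, c, α) cover two cases at once: (h, φ) with α = 1, which is the transform
  -- itself, and (ζ, ⟨ζ, F⟩) with α = -⟨η_j, ζ⟩, which is the reflection of a parallel normal field
  -- ζ.
  obtain ⟨LG, hG, eG⟩ := hasPush_scaledF (p := p) (T.hasPush_F p.1) (T.hasPush_frame p.1)
  obtain ⟨Lq, hq, eq⟩ := hasPush_scaledQ (p := p) (T.hasPush_F p.1) (T.hasPush_frame p.1)
  obtain ⟨L, hL, eL⟩ := hasPush_sub_div_smul ha.comp_fst hG hc.comp_fst hq h0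
  refine ⟨L, hL, fun j v hv α hα hγ => ?_, fun w => ?_⟩
  · rw [eL, eG, eq, T.D_scaledF_aux hv, T.D_F _ _ _ hv]
    have h1 : ⟪ψ j p.1 • D I h p.1 v, frameSum ξ p⟫_ℝ = 0 := by
      rw [real_inner_smul_left, real_inner_comm, T.inner_frameSum_D, mul_zero]
    have h2 : frameSum ξ (p.1, (0 : ℝ^ s)) = 0 := by simp [frameSum]
    simp only [ContinuousLinearMap.comp_apply, ContinuousLinearMap.coe_fst', hα, hγ, h1, h2,
      reflectAt, reflect, real_inner_comm (F p.1), real_inner_smul_right, inner_zero_right]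
    set q := scaledQ F ξ p
    set G := scaledF F ξ p
    set μ := scaledMu ξ (η j) (ψ j) p
    match_scalars <;> field_simp <;> ring
  · rw [eL, eG, eq]
    simp only [ContinuousLinearMap.comp_apply, ContinuousLinearMap.coe_fst', sphereAt,
      sphereTangent, map_zero, smul_zero, Finset.sum_const_zero, add_zero, inner_zero_left,
      inner_zero_right, mul_zero, zero_div, zero_add, zero_sub]
    set q := scaledQ F ξ p
    set G := scaledF F ξ p
    set A := ⟪p.2, w⟫_ℝ
    match_scalars <;> field_simp

theorem hasPush_scaledMu (p : M × ℝ^ s) (j : Fin k) :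
    ∃ L, HasPush (I.prod (𝓡 s)) (scaledMu ξ (η j) (ψ j)) p L ∧ ∀ v ∈ Δ j p.1, L (v, 0) = 0 := by
  have h1 : ∀ i, HasPush I (fun u => ⟪η j u, ξ i u⟫_ℝ) p.1 (D I (fun u => ⟪η j u, ξ i u⟫_ℝ) p.1) :=
    fun i => ContMDiffOn.hasPush isOpen_univ (contMDiffOn_inner (T.smooth_eta j) (T.smooth_frame i))
      trivial
  obtain ⟨L1, h1, e1⟩ := hasPush_frameSum (p := p) h1
  obtain ⟨L2, h2, e2⟩ := hasPush_norm_sq (I := I) p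
  have h3 := (ContMDiffOn.hasPush isOpen_univ (T.smooth_psi j) (x := p.1) trivial)
  refine ⟨_, (h2.mul h3.comp_fst).sub h1, fun v hv => ?_⟩
  simp [e1, e2, T.D_frame_eta _ _ _ hv, T.D_psi _ _ _ hv, frameSum]

/-- Along Δ_j the derivative of q is 2 μ_j⟨F, dh⟩, which is also that of 2 φ μ_j; so the
denominators q - 2 φ μ_j are constant along Δ_j. -/
theorem hasPush_scaledQ' (p : M × ℝ^ s) :
    ∃ L, HasPush (I.prod (𝓡 s)) (scaledQ F ξ) p L ∧ ∀ j, ∀ v ∈ Δ j p.1,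
      L (v, 0) = 2 * scaledMu ξ (η j) (ψ j) p * ⟪F p.1, D I h p.1 v⟫_ℝ := by
  obtain ⟨Lq, hq, eq⟩ := hasPush_scaledQ (p := p) (T.hasPush_F p.1) (T.hasPush_frame p.1)
  refine ⟨Lq, hq, fun j v hv => ?_⟩
  have h1 : ⟪ψ j p.1 • D I h p.1 v, frameSum ξ p⟫_ℝ = 0 := by
    rw [real_inner_smul_left, real_inner_comm, T.inner_frameSum_D, mul_zero]
  rw [eq, T.D_scaledF_aux hv, T.D_F _ _ _ hv, h1]
  simp [frameSum, real_inner_smul_right]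
  ring

theorem contMDiffOn_scaledF (W : Set (M × ℝ^ s)) :
    ContMDiffOn (I.prod (𝓡 s)) 𝓘(ℝ, E) ∞ (scaledF F ξ) W :=
  ((contMDiffOn_norm_sq W).smul (contMDiffOn_comp_fst T.smooth_F fun _ _ => trivial)).add
    (contMDiffOn_frameSum T.smooth_frame W)

theorem contMDiffOn_scaledQ (W : Set (M × ℝ^ s)) :
    ContMDiffOn (I.prod (𝓡 s)) 𝓘(ℝ, ℝ) ∞ (scaledQ F ξ) W := by
  have hF : ContMDiffOn (I.prod (𝓡 s)) 𝓘(ℝ, E) ∞ (fun p : M × ℝ^ s => F p.1) W :=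
    contMDiffOn_comp_fst T.smooth_F fun _ _ => trivial
  have h2 : ContMDiffOn (I.prod (𝓡 s)) 𝓘(ℝ, ℝ) ∞ (fun _ : M × ℝ^ s => (2 : ℝ)) W :=
    contMDiffOn_const
  exact (((contMDiffOn_inner hF hF).mul (contMDiffOn_norm_sq W)).add
    (h2.mul (contMDiffOn_inner hF (contMDiffOn_frameSum T.smooth_frame W)))).add contMDiffOn_const

theorem contMDiffOn_scaledMu (j : Fin k) (W : Set (M × ℝ^ s)) :
    ContMDiffOn (I.prod (𝓡 s)) 𝓘(ℝ, ℝ) ∞ (scaledMu ξ (η j) (ψ j)) W :=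
  ((contMDiffOn_norm_sq W).mul (contMDiffOn_comp_fst (T.smooth_psi j) fun _ _ => trivial)).sub
    (contMDiffOn_frameSum (fun i => contMDiffOn_inner (T.smooth_eta j) (T.smooth_frame i)) W)

theorem contMDiffOn_transform {W : Set (M × ℝ^ s)} (hW : ∀ p ∈ W, scaledQ F ξ p ≠ 0)
    {a : M × (ℝ^ s) → E} {c : M × (ℝ^ s) → ℝ} (ha : ContMDiffOn (I.prod (𝓡 s)) 𝓘(ℝ, E) ∞ a W)
    (hc : ContMDiffOn (I.prod (𝓡 s)) 𝓘(ℝ, ℝ) ∞ c W) :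
    ContMDiffOn (I.prod (𝓡 s)) 𝓘(ℝ, E) ∞
      (fun p => a p - (2 * c p * (scaledQ F ξ p)⁻¹) • scaledF F ξ p) W := by
  have h2 : ContMDiffOn (I.prod (𝓡 s)) 𝓘(ℝ, ℝ) ∞ (fun _ : M × ℝ^ s => (2 : ℝ)) W :=
    contMDiffOn_const
  exact ha.sub (((h2.mul hc).mul ((T.contMDiffOn_scaledQ W).inv₀ hW)).smul
    (T.contMDiffOn_scaledF W))

theorem contMDiffOn_reflect {W : Set (M × ℝ^ s)} (hW : ∀ p ∈ W, scaledQ F ξ p ≠ 0)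
    {a : M × (ℝ^ s) → E} (ha : ContMDiffOn (I.prod (𝓡 s)) 𝓘(ℝ, E) ∞ a W) :
    ContMDiffOn (I.prod (𝓡 s)) 𝓘(ℝ, E) ∞
      (fun p => reflectAt F ξ p (a p)) W := by
  simp only [reflectAt, reflect, div_eq_mul_inv]
  exact T.contMDiffOn_transform hW ha
    (contMDiffOn_inner ha (contMDiffOn_comp_fst T.smooth_F fun _ _ => trivial))

theorem inner_reflectAt {p : M × ℝ^ s} (h0 : scaledQ F ξ p ≠ 0) {n n' : E}
    (hn : ∀ i, ⟪n, ξ i p.1⟫_ℝ = 0) (hn' : ∀ i, ⟪n', ξ i p.1⟫_ℝ = 0) :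
    ⟪reflectAt F ξ p n, reflectAt F ξ p n'⟫_ℝ = ⟪n, n'⟫_ℝ :=
  inner_reflect (inner_frameSum_self (T.orthonormal p.1)) rfl h0
    (by simp [inner_frameSum_right, hn]) (by simp [inner_frameSum_right, hn'])

theorem inner_sphereAt_reflectAt {p : M × ℝ^ s} (h0 : scaledQ F ξ p ≠ 0) {n : E}
    (hn : ∀ i, ⟪n, ξ i p.1⟫_ℝ = 0) (w : ℝ^ s) : ⟪sphereAt F ξ p w, reflectAt F ξ p n⟫_ℝ = 0 :=
  inner_sphereTangent_reflect (inner_frameSum_self (T.orthonormal p.1)) rfl h0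
    (by simp [inner_frameSum_right, hn]) (by simp [inner_frameSum_right, hn])
    (inner_frameSum (T.orthonormal p.1) w)

theorem inner_sphereAt {p : M × ℝ^ s} (h0 : scaledQ F ξ p ≠ 0) (w : ℝ^ s) :
    ⟪sphereAt F ξ p w, sphereAt F ξ p w⟫_ℝ = ⟪w, w⟫_ℝ := by
  have h1 := inner_frameSum (p := (p.1, w)) (T.orthonormal p.1) w
  rw [← h1]
  exact inner_sphereTangent_self (inner_frameSum_self (T.orthonormal p.1)) rfl h0
    (inner_frameSum (T.orthonormal p.1) w)

theorem inner_D_frame (u : M) (v : B) (i : Fin s) : ⟪D I h u v, ξ i u⟫_ℝ = 0 := by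
  rw [real_inner_comm]
  exact mem_normal.1 (T.frame_normal u i) v

variable (F φ ξ η ψ) in
omit T in
/-- The set where the transform is regular. -/
def _root_.DupinSub.transformDomain : Set (M × ℝ^ s) :=
  {p | 0 < scaledQ F ξ p ∧ ∀ j, 0 < scaledQ F ξ p - 2 * φ p.1 * scaledMu ξ (η j) (ψ j) p}

theorem isOpen_transformDomain : IsOpen (transformDomain F φ ξ η ψ) := by
  have hq := (T.contMDiffOn_scaledQ Set.univ).continuousOn
  rw [continuousOn_univ] at hq
  have hφ := T.smooth_phi.continuousOn
  rw [continuousOn_univ] at hφ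
  have e : transformDomain F φ ξ η ψ = {p | 0 < scaledQ F ξ p}
    ∩ ⋂ j, {p | 0 < scaledQ F ξ p - 2 * φ p.1 * scaledMu ξ (η j) (ψ j) p} := by
    ext; simp [transformDomain]
  rw [e]
  refine (isOpen_lt continuous_const hq).inter ?_
  refine isOpen_iInter_of_finite fun j => isOpen_lt continuous_const (hq.sub ?_)
  have hm := (T.contMDiffOn_scaledMu j Set.univ).continuousOn
  rw [continuousOn_univ] at hm
  exact (continuous_const.mul (hφ.comp continuous_fst)).mul hm

theorem D_transform_of_mem {p : M × ℝ^ s} (hp : p ∈ transformDomain F φ ξ η ψ) {j : Fin k} {v : B}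
    (hv : v ∈ Δ j p.1) : D (I.prod (𝓡 s)) (transform φ F ξ h) p (v, 0)
      = (1 - 2 * φ p.1 * scaledMu ξ (η j) (ψ j) p / scaledQ F ξ p) •
        reflectAt F ξ p (D I h p.1 v) := by
  obtain ⟨L, hL, h1, -⟩ := T.hasPush_transform (T.hasPush_h p.1) (T.hasPush_phi p.1) hp.1.ne'
  have hL' : HasPush (I.prod (𝓡 s)) (transform φ F ξ h) p L := hL
  rw [hL'.eq, h1 j v hv 1 (by simp) (by rw [T.D_phi, one_mul])]

theorem D_transform_snd {p : M × ℝ^ s} (hp : p ∈ transformDomain F φ ξ η ψ) (w : ℝ^ s) :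
    D (I.prod (𝓡 s)) (transform φ F ξ h) p (0, w)
      = -((2 * φ p.1 / scaledQ F ξ p) • sphereAt F ξ p w) := by
  obtain ⟨L, hL, -, h2⟩ := T.hasPush_transform (T.hasPush_h p.1) (T.hasPush_phi p.1) hp.1.ne'
  have hL' : HasPush (I.prod (𝓡 s)) (transform φ F ξ h) p L := hL
  rw [hL'.eq, h2]

/-- On Δ_j the horizontal differential is R dh times (q - 2 φ μ_j) / q, which is nonzero on the
domain; v' collects the rescaled components of v. Orthogonality of the Δ_j makes v ↦ v' injective.
-/
theorem exists_D_transform_fst {p : M × ℝ^ s} (hp : p ∈ transformDomain F φ ξ η ψ) (v : B) :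
    ∃ v', D (I.prod (𝓡 s)) (transform φ F ξ h) p (v, 0) = reflectAt F ξ p (D I h p.1 v') ∧
      (v' = 0 → v = 0) := by
  have hv : v ∈ ⨆ i, Δ i p.1 := by rw [T.iSup_eq]; trivial
  obtain ⟨x, hx, rfl⟩ := (Submodule.mem_iSup_iff_exists_finsupp _ _).1 hv
  rw [Finsupp.sum_fintype _ _ (by simp)]
  set c : Fin k → ℝ := fun j =>
    1 - 2 * φ p.1 * scaledMu ξ (η j) (ψ j) p / scaledQ F ξ p with hc
  have hc0 : ∀ j, c j ≠ 0 := by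
    intro j
    have e : c j = (scaledQ F ξ p - 2 * φ p.1 * scaledMu ξ (η j) (ψ j) p) / scaledQ F ξ p := by
      rw [hc]; field_simp [hp.1.ne']
    rw [e]
    exact (div_pos (hp.2 j) hp.1).ne'
  refine ⟨∑ j, c j • x j, ?_, fun h0 => ?_⟩
  · have e1 : ((∑ j, x j, 0) : B × ℝ^ s) = ∑ j, ((x j, 0) : B × ℝ^ s) := by
      ext1 <;> simp [Prod.fst_sum, Prod.snd_sum]
    rw [e1, map_sum, map_sum]
    simp only [map_smul]
    rw [reflectAt, reflect_sum]
    exact Finset.sum_congr rfl fun j _ => T.D_transform_of_mem hp (hx j)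
  · refine Finset.sum_eq_zero fun i _ => T.immersion.injective (Set.mem_univ p.1) ?_
    rw [map_zero, ← inner_self_eq_zero (𝕜 := ℝ)]
    have h1 : ⟪D I h p.1 (∑ j, c j • x j), D I h p.1 (x i)⟫_ℝ = 0 := by
      rw [h0, map_zero, inner_zero_left]
    rw [map_sum, sum_inner, Finset.sum_eq_single i] at h1
    · rw [map_smul, real_inner_smul_left] at h1
      exact (mul_eq_zero.1 h1).resolve_left (hc0 i)
    · intro j _ hj
      rw [map_smul, real_inner_smul_left, T.ortho p.1 j i hj _ (hx j) _ (hx i), mul_zero]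
    · simp

theorem inner_D_transform {p : M × ℝ^ s} (hp : p ∈ transformDomain F φ ξ η ψ) (v : B) (w w' : ℝ^ s) :
    ⟪D (I.prod (𝓡 s)) (transform φ F ξ h) p (v, w),
      D (I.prod (𝓡 s)) (transform φ F ξ h) p (0, w')⟫_ℝ
      = (2 * φ p.1 / scaledQ F ξ p) ^ 2 * ⟪sphereAt F ξ p w, sphereAt F ξ p w'⟫_ℝ := by
  obtain ⟨v', h1, -⟩ := T.exists_D_transform_fst hp v
  have e : ((v, w) : B × ℝ^ s) = (v, 0) + (0, w) := by simp
  rw [e, map_add, h1, T.D_transform_snd hp, T.D_transform_snd hp, inner_add_left, inner_neg_right,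
    real_inner_smul_right, real_inner_comm (sphereAt F ξ p w'),
    T.inner_sphereAt_reflectAt hp.1.ne' (T.inner_D_frame p.1 v'), inner_neg_neg,
    real_inner_smul_left, real_inner_smul_right]
  ring

/-- Sphere directions are orthogonal to reflected tangent vectors, so the two components of the
kernel can be treated separately. -/
theorem injective_D_transform {p : M × ℝ^ s} (hp : p ∈ transformDomain F φ ξ η ψ) :
    Function.Injective (D (I.prod (𝓡 s)) (transform φ F ξ h) p) := by
  rw [injective_iff_map_eq_zero]
  rintro ⟨v, w⟩ h0
  have h1 := T.inner_D_transform hp v w w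
  rw [h0, inner_zero_left, T.inner_sphereAt hp.1.ne'] at h1
  have hw : w = 0 := by
    have h2 : (2 * φ p.1 / scaledQ F ξ p) ^ 2 ≠ 0 :=
      pow_ne_zero 2 (div_ne_zero (mul_ne_zero two_ne_zero (T.ne_zero p.1)) hp.1.ne')
    exact inner_self_eq_zero.1 ((mul_eq_zero.1 h1.symm).resolve_left h2)
  subst hw
  obtain ⟨v', h3, h4⟩ := T.exists_D_transform_fst hp v
  rw [h0] at h3
  have h5 := T.inner_reflectAt hp.1.ne' (T.inner_D_frame p.1 v') (T.inner_D_frame p.1 v')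
  rw [← h3, inner_zero_left] at h5
  have h6 : v' = 0 := T.immersion.injective (Set.mem_univ p.1) (by
    rw [map_zero]; exact inner_self_eq_zero.1 h5.symm)
  rw [h4 h6]
  rfl

theorem isImmersionOn_transform {W : Set (M × ℝ^ s)} (hW : W ⊆ transformDomain F φ ξ η ψ) :
    IsImmersionOn (I.prod (𝓡 s)) W (transform φ F ξ h) :=
  ⟨T.contMDiffOn_transform (fun _ hp => (hW hp).1.ne')
    (contMDiffOn_comp_fst T.immersion.1 fun _ _ => trivial)
    (contMDiffOn_comp_fst T.smooth_phi fun _ _ => trivial),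
    fun _ hp => T.injective_D_transform (hW hp)⟩

theorem reflectAt_mem_normal {p : M × ℝ^ s} (hp : p ∈ transformDomain F φ ξ η ψ) {n : E}
    (hn : n ∈ normal I h p.1) (hn' : ∀ i, ⟪n, ξ i p.1⟫_ℝ = 0) :
    reflectAt F ξ p n ∈ normal (I.prod (𝓡 s)) (transform φ F ξ h) p := by
  refine mem_normal.2 ?_
  rintro ⟨v, w⟩
  obtain ⟨v', h1, -⟩ := T.exists_D_transform_fst hp v
  have e : ((v, w) : B × ℝ^ s) = (v, 0) + (0, w) := by simp
  rw [e, map_add, h1, T.D_transform_snd hp, inner_add_right, inner_neg_right, real_inner_smul_right,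
    real_inner_comm (sphereAt F ξ p w), T.inner_sphereAt_reflectAt hp.1.ne' hn',
    T.inner_reflectAt hp.1.ne' hn' (T.inner_D_frame p.1 v'), mem_normal.1 hn]
  ring

end IsTransformData

end Transform

/-! ### Principal normals of the transform and its Dupin property near z = 0. -/

section Transform

variable {B : Type*} [NormedAddCommGroup B] [NormedSpace ℝ B] [FiniteDimensional ℝ B]
  {H : Type*} [TopologicalSpace H] {I : ModelWithCorners ℝ B H} [I.Boundaryless]
  {M : Type*} [TopologicalSpace M] [ChartedSpace H M] [IsManifold I ∞ M]
  {E : Type*} [NormedAddCommGroup E] [InnerProductSpace ℝ E] [FiniteDimensional ℝ E]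
  {k s : ℕ}

local notation "ℝ^" s => EuclideanSpace ℝ (Fin s)

variable {h F : M → E} {φ : M → ℝ} {ξ : Fin s → M → E} {Δ : Fin k → M → Submodule ℝ B}
  {η : Fin k → M → E} {ψ : Fin k → M → ℝ}

/-- The principal normals of the transform, before reflection. -/
noncomputable def transformCore (F : M → E) (φ : M → ℝ) (ξ : Fin s → M → E) (η : Fin k → M → E)
    (ψ : Fin k → M → ℝ) (ηp : Fin k → M → E) (bp : M → E) : Fin (k + 1) → M × (ℝ^ s) → E :=
  Fin.cons (fun p => -((φ p.1)⁻¹ • bp p.1)) fun j p =>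
    (scaledQ F ξ p - 2 * φ p.1 * scaledMu ξ (η j) (ψ j) p)⁻¹ •
      (scaledQ F ξ p • ηp j p.1 + (2 * scaledMu ξ (η j) (ψ j) p) • bp p.1)

/-- The nullity distributions of the transform. -/
noncomputable def transformNet (s : ℕ) (Δ : Fin k → M → Submodule ℝ B) :
    Fin (k + 1) → M × (ℝ^ s) → Submodule ℝ (B × ℝ^ s) :=
  Fin.cons (fun _ => LinearMap.range (LinearMap.inr ℝ B (ℝ^ s))) fun j p =>
    (Δ j p.1).map (LinearMap.inl ℝ B (ℝ^ s))

theorem iSup_transformNet (hΔ : ∀ u, ⨆ j, Δ j u = ⊤) (p : M × ℝ^ s) :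
    ⨆ i, transformNet s Δ i p = ⊤ := by
  rw [eq_top_iff]
  rintro ⟨v, w⟩ -
  have h1 : ((v, 0) : B × ℝ^ s) ∈ ⨆ i, transformNet s Δ i p := by
    have hv : v ∈ ⨆ i, Δ i p.1 := by rw [hΔ]; trivial
    induction hv using Submodule.iSup_induction' with
    | zero => exact Submodule.zero_mem _
    | add a b _ _ ha hb => simpa using Submodule.add_mem _ ha hb
    | mem j v hv =>
      refine Submodule.mem_iSup_of_mem (Fin.succ j) ?_
      exact ⟨v, hv, rfl⟩
  have h2 : ((0, w) : B × ℝ^ s) ∈ ⨆ i, transformNet s Δ i p :=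
    Submodule.mem_iSup_of_mem 0 ⟨w, rfl⟩
  simpa using Submodule.add_mem _ h1 h2

theorem finrank_transformNet (hs : 1 ≤ s)
    (hΔ : ∀ j, ∃ t, 1 ≤ t ∧ ∀ u, Module.finrank ℝ (Δ j u) = t) (i : Fin (k + 1)) :
    ∃ t, 1 ≤ t ∧ ∀ p, Module.finrank ℝ (transformNet s Δ i p) = t := by
  refine Fin.cases ⟨s, hs, fun p => ?_⟩ (fun j => ?_) i
  · change Module.finrank ℝ (LinearMap.range (LinearMap.inr ℝ B (ℝ^ s))) = s
    rw [LinearMap.finrank_range_of_inj LinearMap.inr_injective, finrank_euclideanSpace_fin]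
  · obtain ⟨t, ht, ht'⟩ := hΔ j
    refine ⟨t, ht, fun p => ?_⟩
    change Module.finrank ℝ ((Δ j p.1).map (LinearMap.inl ℝ B (ℝ^ s))) = t
    rw [← ht' p.1]
    exact (Submodule.equivMapOfInjective _ LinearMap.inl_injective (Δ j p.1)).finrank_eq.symm

namespace IsTransformData

variable (T : IsTransformData I h F φ ξ Δ η ψ)

include T

/-- The differential of the transform of a parallel normal field. -/
theorem D_reflectAt {ζ : M → E} {p : M × ℝ^ s} {ζ' : B →L[ℝ] E}
    (hp : p ∈ transformDomain F φ ξ η ψ) (hζ : HasPush I ζ p.1 ζ') (hn : ζ p.1 ∈ normal I h p.1)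
    (hd : ∀ j, ∀ v ∈ Δ j p.1, ζ' v = -(⟪η j p.1, ζ p.1⟫_ℝ • D I h p.1 v)) :
    (∀ j, ∀ v ∈ Δ j p.1, D (I.prod (𝓡 s)) (fun p => reflectAt F ξ p (ζ p.1)) p (v, 0)
      = -(((scaledQ F ξ p - 2 * φ p.1 * scaledMu ξ (η j) (ψ j) p)⁻¹ *
          (scaledQ F ξ p * ⟪η j p.1, ζ p.1⟫_ℝ + 2 * scaledMu ξ (η j) (ψ j) p * ⟪F p.1, ζ p.1⟫_ℝ)) •
            D (I.prod (𝓡 s)) (transform φ F ξ h) p (v, 0))) ∧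
    ∀ w, D (I.prod (𝓡 s)) (fun p => reflectAt F ξ p (ζ p.1)) p (0, w)
      = -(-((φ p.1)⁻¹ * ⟪F p.1, ζ p.1⟫_ℝ) • D (I.prod (𝓡 s)) (transform φ F ξ h) p (0, w)) := by
  have hκ := hζ.inner (T.hasPush_F p.1)
  obtain ⟨L, hL, h1, h2⟩ := T.hasPush_transform hζ hκ hp.1.ne'
  have hL' : HasPush (I.prod (𝓡 s)) (fun p => reflectAt F ξ p (ζ p.1)) p L := by
    simpa only [reflectAt, reflect, div_eq_mul_inv] using hL
  have hq := hp.1.ne'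
  have hφ := T.ne_zero p.1
  rw [hL'.eq, real_inner_comm (ζ p.1)]
  refine ⟨fun j v hv => ?_, fun w => ?_⟩
  · have hqj := (hp.2 j).ne'
    rw [h1 j v hv (-⟪η j p.1, ζ p.1⟫_ℝ) (by rw [hd j v hv, neg_smul]) ?_,
      T.D_transform_of_mem hp hv]
    · set q := scaledQ F ξ p
      set μ := scaledMu ξ (η j) (ψ j) p
      have e : 1 - 2 * φ p.1 * μ / q = (q - 2 * φ p.1 * μ) / q := by field_simp
      rw [e]
      generalize q - 2 * φ p.1 * μ = d at hqj
      match_scalars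
      field_simp
      ring
    · have e : ⟪ζ p.1, D I h p.1 v⟫_ℝ = 0 := mem_normal.1 hn v
      simp only [add_apply, ContinuousLinearMap.comp_apply, innerSL_apply_apply, T.D_F _ _ _ hv,
        real_inner_smul_right, e, hd j v hv, inner_neg_right]
      ring
  · rw [h2, T.D_transform_snd hp]
    set q := scaledQ F ξ p
    match_scalars
    field_simp

theorem contMDiffOn_transformCore {ηp : Fin k → M → E} {bp : M → E}
    (hηs : ∀ j, ContMDiffOn I 𝓘(ℝ, E) ∞ (ηp j) Set.univ) (hbs : ContMDiffOn I 𝓘(ℝ, E) ∞ bp Set.univ)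
    (i : Fin (k + 1)) : ContMDiffOn (I.prod (𝓡 s)) 𝓘(ℝ, E) ∞ (transformCore F φ ξ η ψ ηp bp i)
      (transformDomain F φ ξ η ψ) := by
  have hb : ContMDiffOn (I.prod (𝓡 s)) 𝓘(ℝ, E) ∞ (fun p : M × ℝ^ s => bp p.1)
      (transformDomain F φ ξ η ψ) := contMDiffOn_comp_fst hbs fun _ _ => trivial
  have hf : ContMDiffOn (I.prod (𝓡 s)) 𝓘(ℝ, ℝ) ∞ (fun p : M × ℝ^ s => φ p.1)
      (transformDomain F φ ξ η ψ) := contMDiffOn_comp_fst T.smooth_phi fun _ _ => trivial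
  have h2 : ContMDiffOn (I.prod (𝓡 s)) 𝓘(ℝ, ℝ) ∞ (fun _ : M × ℝ^ s => (2 : ℝ))
      (transformDomain F φ ξ η ψ) := contMDiffOn_const
  refine Fin.cases ?_ (fun j => ?_) i
  · exact ((hf.inv₀ fun p _ => T.ne_zero p.1).smul hb).neg
  · have hm := T.contMDiffOn_scaledMu j (transformDomain F φ ξ η ψ)
    have hq := T.contMDiffOn_scaledQ (transformDomain F φ ξ η ψ)
    have hη : ContMDiffOn (I.prod (𝓡 s)) 𝓘(ℝ, E) ∞ (fun p : M × ℝ^ s => ηp j p.1)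
      (transformDomain F φ ξ η ψ) := contMDiffOn_comp_fst (hηs j) fun _ _ => trivial
    exact ((hq.sub ((h2.mul hf).mul hm)).inv₀ fun p hp => (hp.2 j).ne').smul
      ((hq.smul hη).add ((h2.mul hm).smul hb))

/-- The transform is a Dupin submanifold near `z = 0`. -/
theorem exists_isDupinOn {ηp : Fin k → M → E} {bp : M → E}
    (hηs : ∀ j, ContMDiffOn I 𝓘(ℝ, E) ∞ (ηp j) Set.univ) (hbs : ContMDiffOn I 𝓘(ℝ, E) ∞ bp Set.univ)
    (hηn : ∀ u j, ηp j u ∈ normal I h u) (hbn : ∀ u, bp u ∈ normal I h u)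
    (hηξ : ∀ u j i, ⟪ηp j u, ξ i u⟫_ℝ = 0) (hbξ : ∀ u i, ⟪bp u, ξ i u⟫_ℝ = 0)
    (hηi : ∀ u j, ∀ n ∈ normal I h u, (∀ i, ⟪n, ξ i u⟫_ℝ = 0) → ⟪ηp j u, n⟫_ℝ = ⟪η j u, n⟫_ℝ)
    (hbi : ∀ u, ∀ n ∈ normal I h u, (∀ i, ⟪n, ξ i u⟫_ℝ = 0) → ⟪bp u, n⟫_ℝ = ⟪F u, n⟫_ℝ)
    (hinj : ∀ u, Function.Injective fun j => ηp j u)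
    (hne : ∀ u j, ηp j u ≠ -((φ u)⁻¹ • bp u)) (hs : 1 ≤ s)
    (hrank : ∀ j, ∃ t, 1 ≤ t ∧ ∀ u, Module.finrank ℝ (Δ j u) = t) {r : ℕ}
    (hr : Module.finrank ℝ E = Module.finrank ℝ B + s + r)
    (hframe : ∀ u₀ : M, ∃ V, IsOpen V ∧ u₀ ∈ V ∧ ∃ ζ : Fin r → M → E,
      (∀ a, ContMDiffOn I 𝓘(ℝ, E) ∞ (ζ a) V) ∧ ∀ u ∈ V, (Orthonormal ℝ fun a => ζ a u) ∧
        (∀ a, ζ a u ∈ normal I h u) ∧ (∀ a i, ⟪ζ a u, ξ i u⟫_ℝ = 0) ∧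
        ∀ a j, ∀ v ∈ Δ j u, D I (ζ a) u v = -(⟪η j u, ζ a u⟫_ℝ • D I h u v) ∧
          D I (fun u => ⟪η j u, ζ a u⟫_ℝ) u v = 0) :
    ∃ W ⊆ transformDomain F φ ξ η ψ, IsOpen W ∧ (∀ u, (u, 0) ∈ W) ∧
      ∃ η' : Fin (k + 1) → M × (ℝ^ s) → E,
        IsDupinOn (I.prod (𝓡 s)) W (transform φ F ξ h) η' ∧
        ∀ i, ∀ p ∈ W, nullB (I.prod (𝓡 s)) (transform φ F ξ h) (η' i) p
          = transformNet s Δ i p := by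
  set W₀ := transformDomain F φ ξ η ψ with hW₀
  have hW₀o : IsOpen W₀ := T.isOpen_transformDomain
  set core := transformCore F φ ξ η ψ ηp bp with hcore
  have hcs := T.contMDiffOn_transformCore hηs hbs
  have hcn : ∀ i p, core i p ∈ normal I h p.1 := by
    intro i p
    refine Fin.cases ?_ (fun j => ?_) i
    · exact Submodule.neg_mem _ (Submodule.smul_mem _ _ (hbn _))
    · exact Submodule.smul_mem _ _ (Submodule.add_mem _ (Submodule.smul_mem _ _ (hηn _ _))
        (Submodule.smul_mem _ _ (hbn _)))
  have hcξ : ∀ i p l, ⟪core i p, ξ l p.1⟫_ℝ = 0 := by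
    intro i p l
    refine Fin.cases ?_ (fun j => ?_) i
    · change ⟪-((φ p.1)⁻¹ • bp p.1), _⟫_ℝ = 0
      simp [real_inner_smul_left, hbξ]
    · change ⟪(scaledQ F ξ p - 2 * φ p.1 * scaledMu ξ (η j) (ψ j) p)⁻¹ •
        (scaledQ F ξ p • ηp j p.1 + (2 * scaledMu ξ (η j) (ψ j) p) • bp p.1), _⟫_ℝ = 0
      simp [real_inner_smul_left, inner_add_left, hbξ, hηξ]
  set η' : Fin (k + 1) → M × (ℝ^ s) → E := fun i p => reflectAt F ξ p (core i p) with hη'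
  have hη's : ∀ i, ContMDiffOn (I.prod (𝓡 s)) 𝓘(ℝ, E) ∞ (η' i) W₀ := fun i =>
    T.contMDiffOn_reflect (fun p hp => hp.1.ne') (hcs i)
  -- The open set on which the candidate principal normals are pairwise distinct.
  set W : Set (M × ℝ^ s) := {p ∈ W₀ | ∀ i j, i ≠ j → η' i p ≠ η' j p} with hW
  have hWo : IsOpen W := by
    have e : W = W₀ ∩ ⋂ i, ⋂ j, {p | p ∈ W₀ ∧ (i ≠ j → η' i p ≠ η' j p)} := by
      ext p
      simp only [hW, Set.mem_ofPred_eq, Set.mem_inter_iff, Set.mem_iInter]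
      exact ⟨fun hp => ⟨hp.1, fun i j => ⟨hp.1, hp.2 i j⟩⟩, fun hp => ⟨hp.1, fun i j => (hp.2 i j).2⟩⟩
    rw [e]
    refine hW₀o.inter (isOpen_iInter_of_finite fun i => isOpen_iInter_of_finite fun j => ?_)
    by_cases hij : i = j
    · simpa [hij] using hW₀o
    · have h1 := ((hη's i).continuousOn.prodMk (hη's j).continuousOn).isOpen_inter_preimage hW₀o
        (isClosed_diagonal (X := E)).isOpen_compl
      convert h1 using 1
      ext p
      simp [hij]
  have hdist : ∀ p ∈ W, Function.Injective fun i => η' i p := by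
    intro p hp i j hij
    by_contra hne
    exact hp.2 i j hne hij
  have hrank' := finrank_transformNet hs hrank
  have hWimm := T.isImmersionOn_transform (W := W) fun p hp => hp.1
  refine ⟨W, fun p hp => hp.1, hWo, fun u => ?_, η', ?_⟩
  -- At z = 0 the reflection is the identity and μ_j = 0, so the candidates are -φ⁻¹ β and the η_j,
  -- projected to the complement of N. They are distinct by regularity, hence W contains the zero
  -- section.
  · have hq : scaledQ F ξ (u, (0 : ℝ^ s)) = 1 := by simp [scaledQ, frameSum]
    have hμ : ∀ j, scaledMu ξ (η j) (ψ j) (u, (0 : ℝ^ s)) = 0 := fun j => by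
      simp [scaledMu, frameSum]
    have hG : scaledF F ξ (u, (0 : ℝ^ s)) = 0 := by simp [scaledF, frameSum]
    have hη0 : ∀ i, η' i (u, 0) = core i (u, 0) := fun i => by
      simp [hη', reflectAt, reflect, hG]
    have hc0 : core 0 (u, 0) = -((φ u)⁻¹ • bp u) := rfl
    have hcj : ∀ j : Fin k, core j.succ (u, 0) = ηp j u := fun j => by
      change (scaledQ F ξ (u, 0) - 2 * φ u * scaledMu ξ (η j) (ψ j) (u, 0))⁻¹ •
        (scaledQ F ξ (u, 0) • ηp j u + (2 * scaledMu ξ (η j) (ψ j) (u, 0)) • bp u) = _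
      rw [hq, hμ]; simp
    refine ⟨⟨by rw [hq]; exact one_pos, fun j => by rw [hq, hμ]; simp⟩, fun i j => ?_⟩
    rw [hη0, hη0]
    refine Fin.cases ?_ (fun i => ?_) i <;> refine Fin.cases ?_ (fun j => ?_) j
    · intro h0; exact absurd rfl h0
    · intro _; rw [hc0, hcj]; exact (hne u j).symm
    · intro _; rw [hc0, hcj]; exact hne u i
    · intro hij; rw [hcj, hcj]; exact fun e => hij (congrArg Fin.succ (hinj u e))
  · refine isDupinOn_of_frame hWo hWimm (fun i => ⟨(hη's i).mono fun p hp => hp.1, fun p hp => ?_⟩)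
      hdist (fun p _ => iSup_transformNet T.iSup_eq p) (fun i => ?_) fun p₀ hp₀ => ?_
    · exact T.reflectAt_mem_normal hp.1 (hcn i p) (hcξ i p)
    · obtain ⟨t, ht, ht'⟩ := hrank' i
      exact ⟨t, ht, fun p _ => ht' p⟩
    · obtain ⟨V, hV, hV0, ζ, hζs, hζ⟩ := hframe p₀.1
      have hV'o : IsOpen (W ∩ Prod.fst ⁻¹' V) := hWo.inter (hV.preimage continuous_fst)
      refine ⟨W ∩ Prod.fst ⁻¹' V, hV'o, ⟨hp₀, hV0⟩, r,
        fun a p => reflectAt F ξ p (ζ a p.1), fun a => ?_, fun p hp => ?_⟩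
      · exact T.contMDiffOn_reflect (fun p hp => hp.1.1.1.ne')
          (contMDiffOn_comp_fst (hζs a) fun p hp => hp.2)
      obtain ⟨ho, hn, hnξ, hd⟩ := hζ p.1 hp.2
      have hq := hp.1.1.1.ne'
      have horth : Orthonormal ℝ fun a => reflectAt F ξ p (ζ a p.1) := by
        rw [orthonormal_iff_ite] at ho ⊢
        intro a b
        rw [T.inner_reflectAt hq (hnξ a) (hnξ b), ho]
      have hinner : ∀ p ∈ W ∩ Prod.fst ⁻¹' V, ∀ i a, ⟪η' i p, reflectAt F ξ p (ζ a p.1)⟫_ℝ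
          = ⟪core i p, ζ a p.1⟫_ℝ := fun p hp i a =>
        T.inner_reflectAt hp.1.1.1.ne' (hcξ i p) ((hζ p.1 hp.2).2.2.1 a)
      have hcore0 : ∀ p ∈ W ∩ Prod.fst ⁻¹' V, ∀ a, ⟪core 0 p, ζ a p.1⟫_ℝ
          = -((φ p.1)⁻¹ * ⟪F p.1, ζ a p.1⟫_ℝ) := fun p hp a => by
        change ⟪-((φ p.1)⁻¹ • bp p.1), _⟫_ℝ = _
        rw [inner_neg_left, real_inner_smul_left,
          hbi _ _ ((hζ p.1 hp.2).2.1 a) ((hζ p.1 hp.2).2.2.1 a)]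
      have hcorej : ∀ p ∈ W ∩ Prod.fst ⁻¹' V, ∀ (j : Fin k) a, ⟪core j.succ p, ζ a p.1⟫_ℝ
          = (scaledQ F ξ p - 2 * φ p.1 * scaledMu ξ (η j) (ψ j) p)⁻¹ *
          (scaledQ F ξ p * ⟪η j p.1, ζ a p.1⟫_ℝ
            + 2 * scaledMu ξ (η j) (ψ j) p * ⟪F p.1, ζ a p.1⟫_ℝ) := fun p hp j a => by
        change ⟪(scaledQ F ξ p - 2 * φ p.1 * scaledMu ξ (η j) (ψ j) p)⁻¹ •
          (scaledQ F ξ p • ηp j p.1 + (2 * scaledMu ξ (η j) (ψ j) p) • bp p.1), _⟫_ℝ = _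
        rw [real_inner_smul_left, inner_add_left, real_inner_smul_left, real_inner_smul_left,
          hbi _ _ ((hζ p.1 hp.2).2.1 a) ((hζ p.1 hp.2).2.2.1 a),
          hηi _ j _ ((hζ p.1 hp.2).2.1 a) ((hζ p.1 hp.2).2.2.1 a)]
      have hmemn : ∀ a, reflectAt F ξ p (ζ a p.1) ∈ normal (I.prod (𝓡 s)) (transform φ F ξ h) p :=
        fun a => T.reflectAt_mem_normal hp.1.1 (hn a) (hnξ a)
      refine ⟨horth, ?_, fun a i => ?_⟩
      -- Passing to the transform adds s tangent dimensions and removes the s normal dimensions of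
      -- N, so the r reflected fields fill the normal space.
      · refine Submodule.eq_of_le_of_finrank_eq (Submodule.span_le.2 ?_) ?_
        · rintro _ ⟨a, rfl⟩
          exact hmemn a
        · rw [finrank_span_eq_card horth.linearIndependent, Fintype.card_fin]
          have h1 := (tangent (I.prod (𝓡 s)) (transform φ F ξ h) p).finrank_add_finrank_orthogonal
          have h2 : Module.finrank ℝ (tangent (I.prod (𝓡 s)) (transform φ F ξ h) p)
              = Module.finrank ℝ (B × ℝ^ s) :=
            LinearMap.finrank_range_of_inj (T.injective_D_transform hp.1.1)
          rw [h2, Module.finrank_prod, finrank_euclideanSpace_fin, hr] at h1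
          change _ = Module.finrank ℝ (tangent (I.prod (𝓡 s)) (transform φ F ξ h) p)ᗮ
          omega
      · have hD := T.D_reflectAt hp.1.1 ((hζs a).hasPush hV hp.2) (hn a) (fun j v hv => (hd a j v hv).1)
        -- The reflection is isometric on vectors orthogonal to N, so the components can be
        -- differentiated before reflecting.
        have hev : (fun p => ⟪η' i p, reflectAt F ξ p (ζ a p.1)⟫_ℝ) =ᶠ[𝓝 p]
            fun p => ⟪core i p, ζ a p.1⟫_ℝ :=
          Filter.eventually_of_mem (hV'o.mem_nhds hp) fun y hy => hinner y hy i a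
        rw [hinner p hp, D_congr hev]
        have hκ := (T.hasPush_F p.1).inner ((hζs a).hasPush hV hp.2)
        refine Fin.cases ?_ (fun j => ?_) i
        · rintro _ ⟨w, rfl⟩
          refine ⟨?_, ?_⟩
          · rw [hcore0 p hp]
            exact hD.2 w
          -- This component depends on u alone, hence is constant in the z-directions.
          · have hev2 : (fun p => ⟪core 0 p, ζ a p.1⟫_ℝ) =ᶠ[𝓝 p]
                fun p => -((φ p.1)⁻¹ * ⟪F p.1, ζ a p.1⟫_ℝ) :=
              Filter.eventually_of_mem (hV'o.mem_nhds hp) fun y hy => hcore0 y hy a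
            have h3 := (((T.hasPush_phi p.1).inv (T.ne_zero p.1)).mul hκ).neg.comp_fst (p := p)
            rw [D_congr hev2, h3.eq]
            simp
        · rintro _ ⟨v, hv, rfl⟩
          refine ⟨?_, ?_⟩
          · rw [hcorej p hp]
            exact hD.1 j v hv
          -- Along Δ_j the denominator q - 2 φ μ_j is constant, and in the numerator the derivative
          -- 2 μ_j⟨F, dh⟩⟨η_j, ζ⟩ of the first term cancels that of 2 μ_j⟨F, ζ⟩.
          · have hev2 : (fun p => ⟪core j.succ p, ζ a p.1⟫_ℝ) =ᶠ[𝓝 p] _ :=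
              Filter.eventually_of_mem (hV'o.mem_nhds hp) fun y hy => hcorej y hy j a
            obtain ⟨Lq, hLq, eq⟩ := T.hasPush_scaledQ' p
            obtain ⟨Lm, hLm, em⟩ := T.hasPush_scaledMu p j
            have hlam : HasPush I (fun u => ⟪η j u, ζ a u⟫_ℝ) p.1 _ :=
              ((ContMDiffOn.hasPush isOpen_univ (T.smooth_eta j) trivial).inner
                ((hζs a).hasPush hV hp.2))
            have hlam0 := (hd a j v hv).2
            rw [hlam.eq] at hlam0
            have hden := hLq.sub ((((T.hasPush_phi p.1).comp_fst (p := p)).const_mul 2).mul hLm)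
            have hnum := (hLq.mul hlam.comp_fst).add ((hLm.const_mul 2).mul hκ.comp_fst)
            have h3 := (hden.inv (hp.1.1.2 j).ne').mul hnum
            rw [D_congr hev2, h3.eq]
            have e1 : Lq ((LinearMap.inl ℝ B (ℝ^ s)) v) = _ := eq j v hv
            have e2 : Lm ((LinearMap.inl ℝ B (ℝ^ s)) v) = 0 := em v hv
            have e3 : ContinuousLinearMap.fst ℝ B (ℝ^ s) ((LinearMap.inl ℝ B (ℝ^ s)) v) = v := rfl
            have e4 : ⟪ζ a p.1, D I h p.1 v⟫_ℝ = 0 := mem_normal.1 (hn a) v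
            simp only [add_apply, sub_apply, smul_apply, ContinuousLinearMap.comp_apply, e3,
              innerSL_apply_apply, T.D_F _ _ _ hv, (hd a j v hv).1, T.D_phi, e1, e2, smul_eq_mul,
              inner_neg_right, real_inner_smul_right, e4] at hlam0 ⊢
            linear_combination (scaledQ F ξ p - 2 * φ p.1 * scaledMu ξ (η j) (ψ j) p)⁻¹
              * scaledQ F ξ p * hlam0

end IsTransformData

end Transform

/-! ### The first half: regular transforms of Dupin type are weakly reducible. -/

section

variable {B : Type*} [NormedAddCommGroup B] [NormedSpace ℝ B] [FiniteDimensional ℝ B]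
  {H : Type*} [TopologicalSpace H] {I : ModelWithCorners ℝ B H} [I.Boundaryless]
  {M : Type*} [TopologicalSpace M] [ChartedSpace H M] [IsManifold I ∞ M]
  {E : Type*} [NormedAddCommGroup E] [InnerProductSpace ℝ E] [FiniteDimensional ℝ E]
  {k s : ℕ}

local notation "ℝ^" s => EuclideanSpace ℝ (Fin s)

section Slices

theorem exists_hasMFDerivAt_chart_symm {x₀ : M} {b : B} (hb : b ∈ (extChartAt I x₀).target) :
    ∃ L : B →L[ℝ] B, HasMFDerivAt 𝓘(ℝ, B) I (extChartAt I x₀).symm b L ∧ Function.Bijective L := by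
  have h4 : MDifferentiableAt 𝓘(ℝ, B) I (extChartAt I x₀).symm b :=
    (contMDiffAt_chart_symm hb).mdifferentiableAt (by simp)
  obtain ⟨L, hL⟩ : ∃ L : B →L[ℝ] B, HasMFDerivAt 𝓘(ℝ, B) I (extChartAt I x₀).symm b L :=
    ⟨_, h4.hasMFDerivAt⟩
  have hs := (extChartAt I x₀).map_target hb
  have hbij := dchart_bijective hs
  have h1 : HasPush 𝓘(ℝ, B) (fun z => extChartAt I x₀ ((extChartAt I x₀).symm z)) b
      ((dchart I x₀ ((extChartAt I x₀).symm b)).comp L) := HasPush.comp (hasPush_chart hs) hL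
  have h2 : HasPush 𝓘(ℝ, B) (fun z => extChartAt I x₀ ((extChartAt I x₀).symm z)) b
      (ContinuousLinearMap.id ℝ B) :=
    (hasPush_id_iff.2 (hasFDerivAt_id b)).congr (Filter.eventually_of_mem
      ((isOpen_extChartAt_target x₀).mem_nhds hb) fun z hz => (extChartAt I x₀).right_inv hz)
  have h3 : ∀ v, dchart I x₀ ((extChartAt I x₀).symm b) (L v) = v := fun v =>
    congrArg (fun A : B →L[ℝ] B => A v) (h1.unique h2)
  refine ⟨L, hL, fun v w hvw => ?_, fun v => ⟨dchart I x₀ _ v, hbij.1 (h3 _)⟩⟩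
  have := congrArg (dchart I x₀ ((extChartAt I x₀).symm b)) hvw
  rwa [h3, h3] at this

/-- The horizontal distribution of a product is integrable. -/
theorem isIntegrableOn_horizontal {m : ℕ} {L : Type*} [TopologicalSpace L]
    [ChartedSpace (EuclideanSpace ℝ (Fin m)) L] [IsManifold (𝓡 m) ∞ L]
    {W : Set (L × ℝ^ s)} (hW : IsOpen W)
    {Δ : ∀ p : L × ℝ^ s, Submodule ℝ (TangentSpace ((𝓡 m).prod (𝓡 s)) p)}
    (hΔ : ∀ p ∈ W, Δ p = LinearMap.range (LinearMap.inl ℝ (ℝ^ m) (ℝ^ s))) :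
    IsIntegrableOn ((𝓡 m).prod (𝓡 s)) W Δ := by
  rintro ⟨u, z⟩ hp
  set c := extChartAt (𝓡 m) u with hc
  let ι : (ℝ^ m) → L × ℝ^ s := fun y => (c.symm (y + c u), z)
  have hcont : ContinuousOn ι ((fun y => y + c u) ⁻¹' c.target) :=
    ContinuousOn.prodMk ((continuousOn_extChartAt_symm u).comp
      (continuous_id.add continuous_const).continuousOn fun y hy => hy) continuousOn_const
  have ht : IsOpen ((fun y : ℝ^ m => y + c u) ⁻¹' c.target) :=
    (isOpen_extChartAt_target u).preimage (continuous_id.add continuous_const)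
  have hder : ∀ y ∈ (fun y : ℝ^ m => y + c u) ⁻¹' c.target, ∃ A : (ℝ^ m) →L[ℝ] (ℝ^ m),
      Function.Bijective A ∧ HasMFDerivAt (𝓡 m) ((𝓡 m).prod (𝓡 s)) ι y
        (A.prod (0 : (ℝ^ m) →L[ℝ] (ℝ^ s))) := by
    intro y hy
    obtain ⟨A, hA, hb⟩ := exists_hasMFDerivAt_chart_symm (I := 𝓡 m) hy
    have h1 : HasMFDerivAt (𝓡 m) (𝓡 m) (fun y : ℝ^ m => y + c u) y
        (ContinuousLinearMap.id ℝ (ℝ^ m)) :=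
      hasMFDerivAt_iff_hasFDerivAt.2 ((hasFDerivAt_id y).add_const (c u))
    have h2 : HasMFDerivAt (𝓡 m) (𝓡 m) (fun y => c.symm (y + c u)) y
        (A.comp (ContinuousLinearMap.id ℝ (ℝ^ m))) := HasMFDerivAt.comp y hA h1
    exact ⟨A.comp (ContinuousLinearMap.id ℝ (ℝ^ m)), hb,
      HasMFDerivAt.prodMk h2 (hasMFDerivAt_const z y)⟩
  refine ⟨m, (fun y => y + c u) ⁻¹' c.target ∩ ι ⁻¹' W, ι,
    hcont.isOpen_inter_preimage ht hW, ?_, ?_, fun y hy => hy.2, fun y hy => ?_, fun y hy => ?_⟩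
  · refine ⟨?_, ?_⟩
    · have h0 : (0 : ℝ^ m) + c u ∈ c.target := by rw [zero_add]; exact mem_extChartAt_target u
      exact h0
    · simpa [ι, hc] using hp
  · simp [ι, hc]
  · refine ContMDiffAt.contMDiffWithinAt (ContMDiffAt.prodMk ?_ contMDiffAt_const)
    refine ContMDiffAt.comp y (contMDiffAt_chart_symm (I := 𝓡 m) hy.1) ?_
    exact (contDiff_id.add contDiff_const).contMDiff.contMDiffAt
  · obtain ⟨A, hA, hι⟩ := hder y hy.1
    rw [hι.mfderiv]
    refine ⟨fun v w hvw => hA.1 (congrArg Prod.fst hvw), ?_⟩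
    rw [hΔ _ hy.2]
    ext x
    constructor
    · rintro ⟨v, rfl⟩
      exact ⟨A v, rfl⟩
    · rintro ⟨v, rfl⟩
      obtain ⟨v', rfl⟩ := hA.2 v
      exact ⟨v', rfl⟩

end Slices

section FromHypotheses

variable {U : Set M} {h : M → E} {η : Fin k → M → E} {N : M → Submodule ℝ E} {φ : M → ℝ}
  {β : M → E} {ξ : Fin s → M → E}

theorem IsParallelFrameOn.D_mem_tangent (hξ : IsParallelFrameOn I U h N ξ) {x : M} (hx : x ∈ U)
    (i : Fin s) (v : B) : D I (ξ i) x v ∈ tangent I h x :=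
  mem_tangent_of_nablaB_eq_zero (hξ.parallel i x hx v)

/-- The covariant derivative of `F` along the eigenspaces of the Dupin tensor. -/
theorem IsDupinTensorOn.D_combescure (hU : IsOpen U) (hd : IsDupinOn I U h η)
    (hp : IsRibaucourPairOn I U h φ β) {ψ : Fin k → M → ℝ}
    (hψ : ∀ x ∈ U, ∀ v : TangentSpace I x, codazziTensor I h φ β x v = ∑ j, ψ j x •
      ((nullity I h (η j) x).map (push I h x : TangentSpace I x →ₗ[ℝ] E)).starProjection
        (push I h x v)) {x : M} (hx : x ∈ U) {j : Fin k} {v : B} (hv : v ∈ nullB I h (η j) x) :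
    D I (combescure I h φ β) x v = ψ j x • D I h x v := by
  have h1 := codazziTensor_eq hU hd.immersion hp.smooth hp.section_normal.1 hx v
  rw [Submodule.starProjection_eq_self_iff.2 (D_combescure_mem_tangent hU hd.immersion hp hx v)]
    at h1
  have h2 : codazziTensor I h φ β x v = ∑ j, ψ j x •
      ((nullB I h (η j) x).map (D I h x : B →ₗ[ℝ] E)).starProjection (D I h x v) := hψ x hx v
  rw [← h1, h2, Finset.sum_eq_single j]
  · have hm : D I h x v ∈ (nullB I h (η j) x).map (D I h x : B →ₗ[ℝ] E) := ⟨v, hv, rfl⟩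
    rw [Submodule.starProjection_eq_self_iff.2 hm]
  · intro i _ hij
    have h3 : ((nullB I h (η i) x).map (D I h x : B →ₗ[ℝ] E)).starProjection (D I h x v) = 0 := by
      rw [Submodule.starProjection_apply_eq_zero_iff, Submodule.mem_orthogonal]
      rintro _ ⟨w, hw, rfl⟩
      exact hd.inner_eq_zero hU hx hij hw hv
    rw [h3, smul_zero]
  · simp

theorem isTransformData (hd : IsDupinOn I Set.univ h η) (hp : IsRibaucourPairOn I Set.univ h φ β)
    (hN : ∀ x, N x ≤ normal I h x) (hξ : IsParallelFrameOn I Set.univ h N ξ) {ψ : Fin k → M → ℝ}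
    (hψs : ∀ j, ContMDiffOn I 𝓘(ℝ, ℝ) ∞ (ψ j) Set.univ)
    (hψ0 : ∀ j, ∀ x ∈ Set.univ, ∀ v ∈ nullity I h (η j) x, push I (ψ j) x v = 0)
    (hψ : ∀ x ∈ Set.univ, ∀ v : TangentSpace I x, codazziTensor I h φ β x v = ∑ j, ψ j x •
      ((nullity I h (η j) x).map (push I h x : TangentSpace I x →ₗ[ℝ] E)).starProjection
        (push I h x v)) :
    IsTransformData I h (combescure I h φ β) φ ξ (fun j => nullB I h (η j)) η ψ := by
  have hξn : ∀ x i, ξ i x ∈ normal I h x := fun x i => hN x ((hξ.smooth i).2 x trivial)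
  have hpar : ∀ u j, ∀ v ∈ nullB I h (η j) u, ∀ i, D I (ξ i) u v = -(⟪η j u, ξ i u⟫_ℝ • D I h u v) ∧
      D I (fun y => ⟪η j y, ξ i y⟫_ℝ) u v = 0 := fun u j v hv i =>
    hd.D_parallel isOpen_univ le_rfl isOpen_univ (hξ.smooth i).1 (fun x _ => hξn x i)
      (fun x _ v => hξ.D_mem_tangent trivial i v) (Set.mem_univ u) hv
  exact
    { immersion := hd.immersion
      smooth_F := contMDiffOn_combescure isOpen_univ hd.immersion hp
      smooth_phi := hp.smooth
      smooth_frame := fun i => (hξ.smooth i).1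
      smooth_eta := hd.smooth_normal
      smooth_psi := hψs
      ne_zero := fun u => hp.ne_zero u trivial
      orthonormal := fun u => hξ.orthonormal u trivial
      frame_normal := hξn
      D_phi := fun u v => (inner_combescure hd.immersion hp trivial v).symm
      iSup_eq := fun u => hd.iSup_nullB trivial
      ortho := fun u i j hij v hv w hw => hd.inner_eq_zero isOpen_univ trivial hij hv hw
      D_F := fun u j v hv => IsDupinTensorOn.D_combescure isOpen_univ hd hp hψ trivial hv
      D_frame := fun u j v hv i => (hpar u j v hv i).1
      D_frame_eta := fun u j v hv i => (hpar u j v hv i).2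
      D_psi := fun u j v hv => hψ0 j u trivial v hv }

theorem finrank_normal (hd : IsImmersionOn I U h) {x : M} (hx : x ∈ U) :
    Module.finrank ℝ B + Module.finrank ℝ (normal I h x) = Module.finrank ℝ E := by
  rw [← (tangent I h x).finrank_add_finrank_orthogonal, normal]
  congr 1
  exact (LinearMap.finrank_range_of_inj (hd.injective hx)).symm

/-- A simply connected Dupin submanifold has global parallel frames of its parallel flat normal
subbundles. -/
theorem exists_isParallelFrameOn [SimplyConnectedSpace M] [LocallyPathConnectedSpace M]
    (hd : IsDupinOn I Set.univ h η) (hN : IsParallelFlatSubbundleOn I Set.univ h N s) :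
    ∃ ξ : Fin s → M → E, IsParallelFrameOn I Set.univ h N ξ := by
  have hNp := hN.isParallelBundleOn isOpen_univ
  obtain ⟨ξ, hξs, hξ⟩ := exists_global_frame (I := I) (N := N) (T := fun x => tangent I h x) (s := s)
    (fun x => by
      have h1 := Submodule.orthogonal_le (hN.le_normal x trivial)
      rwa [normal, Submodule.orthogonal_orthogonal] at h1)
    (fun x₀ => by
      obtain ⟨V, -, hV, hxV, ζ, hζs, hζ⟩ :=
        hd.exists_frame isOpen_univ hNp hN.rank (Set.mem_univ x₀)
      exact ⟨V, hV, hxV, ζ, hζs, hζ⟩)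
  refine ⟨ξ, fun i => ⟨hξs i, fun x _ => ?_⟩, fun i x _ v => ?_, fun x _ => (hξ x).1,
    fun x _ => (hξ x).2.1⟩
  · rw [← (hξ x).2.1]; exact Submodule.subset_span ⟨i, rfl⟩
  · exact nablaB_eq_zero_of_mem_tangent ((hξ x).2.2 i v)

/-- The Ribaucour transforms of a Dupin submanifold are weakly reducible. -/
theorem exists_isWeaklyReducibleDupinOn {m : ℕ} {L : Type*} [TopologicalSpace L] [Nonempty L]
    [ChartedSpace (EuclideanSpace ℝ (Fin m)) L] [IsManifold (𝓡 m) ∞ L] {h : L → E}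
    {η : Fin k → L → E} {N : L → Submodule ℝ E} {φ : L → ℝ} {β : L → E} {ξ : Fin s → L → E}
    (H : IsRegularDupinTypeOn (𝓡 m) Set.univ h η N s φ β)
    (hξ : IsParallelFrameOn (𝓡 m) Set.univ h N ξ) :
    ∃ W : Set (L × ℝ^ s), IsOpen W ∧ (∀ u : L, (u, 0) ∈ W) ∧
      (∀ p ∈ W, p.2 ≠ 0 → combescureT (𝓡 m) h φ β ξ (p.1, inv p.2) ≠ 0) ∧
      IsWeaklyReducibleDupinOn ((𝓡 m).prod (𝓡 s)) W (ribaucourAtInfinity (𝓡 m) h φ β ξ)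
        (k + 1) := by
  obtain ⟨hd, hN, hp, hreg, -, ψ, hψs, hψ0, hψ⟩ := H
  have T := isTransformData hd hp (fun x => hN.le_normal x trivial) hξ hψs hψ0 hψ
  have hNp := hN.isParallelBundleOn isOpen_univ
  have hNo := hNp.orthogonal isOpen_univ hd.immersion
  have hdim : ∀ u, Module.finrank ℝ (ℝ^ m) + (s + Module.finrank ℝ
      ((N u)ᗮ ⊓ normal (𝓡 m) h u : Submodule ℝ E)) = Module.finrank ℝ E := by
    intro u
    rw [← finrank_normal hd.immersion (Set.mem_univ u), ← hN.rank u trivial,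
      Submodule.finrank_add_inf_finrank_orthogonal (hN.le_normal u trivial)]
  obtain ⟨u₀⟩ := ‹Nonempty L›
  -- Regularity includes N ≠ 0, which gives the new principal normal positive multiplicity.
  have hs : 1 ≤ s := by
    rw [← hN.rank u₀ trivial, Nat.one_le_iff_ne_zero, Ne, Submodule.finrank_eq_zero]
    exact (hreg u₀ trivial).1
  set r := Module.finrank ℝ ((N u₀)ᗮ ⊓ normal (𝓡 m) h u₀ : Submodule ℝ E) with hr
  have hperp : ∀ (a : E) (u : L), (N u)ᗮ.starProjection a = a - (N u).starProjection a := by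
    intro a u
    rw [Submodule.starProjection_orthogonal]; rfl
  have hξN : ∀ u i, ξ i u ∈ N u := fun u i => (hξ.smooth i).2 u trivial
  have hproj : ∀ u (n : E), (∀ i, ⟪n, ξ i u⟫_ℝ = 0) → n ∈ (N u)ᗮ := by
    intro u n hn
    rw [← hξ.spans u trivial, Submodule.mem_orthogonal']
    exact fun x hx => inner_eq_zero_of_mem_span hn hx
  have hperps : ∀ a : L → E, ContMDiffOn (𝓡 m) 𝓘(ℝ, E) ∞ a Set.univ →
      ContMDiffOn (𝓡 m) 𝓘(ℝ, E) ∞ (fun u => (N u)ᗮ.starProjection (a u)) Set.univ := by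
    intro a ha
    simp only [hperp]
    exact ha.sub (hN.smooth.clm_apply ha)
  have hperpn : ∀ u a, a ∈ normal (𝓡 m) h u → (N u)ᗮ.starProjection a ∈ normal (𝓡 m) h u := by
    intro u a ha
    rw [hperp]
    exact Submodule.sub_mem _ ha
      (hN.le_normal u trivial (Submodule.starProjection_apply_mem _ _))
  have hperpξ : ∀ u a i, ⟪(N u)ᗮ.starProjection a, ξ i u⟫_ℝ = 0 := fun u a i =>
    (Submodule.mem_orthogonal' _ _).1 (Submodule.starProjection_apply_mem _ _) _ (hξN u i)
  have hperpi : ∀ u a n, (∀ i, ⟪n, ξ i u⟫_ℝ = 0) → ⟪(N u)ᗮ.starProjection a, n⟫_ℝ = ⟪a, n⟫_ℝ := by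
    intro u a n hn
    rw [Submodule.inner_starProjection_left_eq_right,
      Submodule.starProjection_eq_self_iff.2 (hproj u n hn)]
  -- The frames required are parallel frames of the complement of N in the normal bundle. On that
  -- complement F and β have the same components, because F - β is tangent.
  obtain ⟨W, hWd, hWo, hW0, η', hη', hnull⟩ := T.exists_isDupinOn
    (ηp := fun j u => (N u)ᗮ.starProjection (η j u)) (bp := fun u => (N u)ᗮ.starProjection (β u))
    (fun j => hperps _ (hd.smooth_normal j)) (hperps _ hp.section_normal.1)
    (fun u j => hperpn u _ (hd.mem_normal j trivial))
    (fun u => hperpn u _ (hp.section_normal.2 u trivial))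
    (fun u j i => hperpξ u _ i) (fun u i => hperpξ u _ i)
    (fun u j n _ hn => hperpi u _ n hn)
    (fun u n hn hn' => by
      have e : ⟪D (𝓡 m) h u (gradB (𝓡 m) h φ u), n⟫_ℝ = 0 := by
        rw [real_inner_comm]; exact mem_normal.1 hn _
      rw [hperpi u _ n hn', combescure_eq, inner_add_left, e, zero_add])
    (fun u => (hreg u trivial).2.1) (fun u j => (hreg u trivial).2.2 j) hs
    (fun j => by
      obtain ⟨t, -, ht, ht'⟩ := hd.principal j
      exact ⟨t, ht, fun u => ht' u trivial⟩)
    (r := r) (by rw [← hdim u₀]; ring)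
    (fun u => by
      obtain ⟨V, -, hV, hxV, ζ, hζs, hζ⟩ := hd.exists_frame isOpen_univ hNo (r := r)
        (fun x _ => by have h1 := hdim x; have h2 := hdim u₀; omega) (Set.mem_univ u)
      have hmem : ∀ x ∈ V, ∀ a, ζ a x ∈ ((N x)ᗮ ⊓ normal (𝓡 m) h x : Submodule ℝ E) :=
        fun x hx a => by rw [← (hζ x hx).2.1]; exact Submodule.subset_span ⟨a, rfl⟩
      refine ⟨V, hV, hxV, ζ, hζs, fun x hx => ⟨(hζ x hx).1, fun a => (hmem x hx a).2,
        fun a i => (Submodule.mem_orthogonal' _ _).1 (hmem x hx a).1 _ (hξN x i),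
        fun a j v hv => ?_⟩⟩
      exact hd.D_parallel isOpen_univ (Set.subset_univ V) hV (hζs a) (fun x hx => (hmem x hx a).2)
        (fun x hx => (hζ x hx).2.2 a) hx hv)
  have htr := ribaucourAtInfinity_eq (I := 𝓡 m) (h := h) (β := β) (φ := φ) T.orthonormal
  refine ⟨W, hWo, hW0, fun p hp hz h0 => ?_, ?_⟩
  · have hz' : ‖p.2‖ ^ 2 ≠ 0 := by simpa using hz
    have h1 : combescureT (𝓡 m) h φ β ξ (p.1, inv p.2)
        = (‖p.2‖ ^ 2)⁻¹ • scaledF (combescure (𝓡 m) h φ β) ξ p := by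
      simp only [combescureT, scaledF, frameSum, inv, smul_add, smul_smul, inv_mul_cancel₀ hz',
        one_smul, Finset.smul_sum, PiLp.smul_apply, smul_eq_mul]
    rw [h1, smul_eq_zero] at h0
    have h2 := h0.resolve_left (inv_ne_zero hz')
    have h3 := inner_transform_self (F := combescure (𝓡 m) h φ β p.1) (Z := frameSum ξ p)
      (inner_frameSum_self (T.orthonormal p.1)) rfl
    have h4 : ⟪scaledF (combescure (𝓡 m) h φ β) ξ p, scaledF (combescure (𝓡 m) h φ β) ξ p⟫_ℝ
      = ‖p.2‖ ^ 2 * scaledQ (combescure (𝓡 m) h φ β) ξ p := h3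
    -- If F_t vanished, so would ‖z‖² q; but z ≠ 0 and q > 0 on the domain.
    rw [h2, inner_zero_left] at h4
    exact mul_ne_zero hz' (hWd hp).1.ne' h4.symm
  · rw [htr]
    -- The principal normal with index 0 has the z-directions as nullity, so its conullity is
    -- horizontal and the slices z = const integrate it.
    refine ⟨η', hη', 0, isIntegrableOn_horizontal hWo fun p hp => ?_⟩
    ext x
    obtain ⟨v, w⟩ := x
    have hn0 : nullB ((𝓡 m).prod (𝓡 s)) (transform φ (combescure (𝓡 m) h φ β) ξ h) (η' 0) p
        = LinearMap.range (LinearMap.inr ℝ (ℝ^ m) (ℝ^ s)) := hnull 0 p hp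
    have hpd := hWd hp
    have hiff : (∀ y ∈ nullB ((𝓡 m).prod (𝓡 s)) (transform φ (combescure (𝓡 m) h φ β) ξ h) (η' 0) p,
        ⟪D ((𝓡 m).prod (𝓡 s)) (transform φ (combescure (𝓡 m) h φ β) ξ h) p (v, w),
          D ((𝓡 m).prod (𝓡 s)) (transform φ (combescure (𝓡 m) h φ β) ξ h) p y⟫_ℝ = 0) ↔ w = 0 := by
      rw [hn0]
      constructor
      · intro hy
        have h1 := hy (0, w) ⟨w, rfl⟩
        rw [T.inner_D_transform hpd, T.inner_sphereAt hpd.1.ne'] at h1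
        have h2 : (2 * φ p.1 / scaledQ (combescure (𝓡 m) h φ β) ξ p) ^ 2 ≠ 0 :=
          pow_ne_zero 2 (div_ne_zero (mul_ne_zero two_ne_zero (T.ne_zero p.1)) hpd.1.ne')
        exact inner_self_eq_zero.1 ((mul_eq_zero.1 h1).resolve_left h2)
      · rintro rfl _ ⟨w', rfl⟩
        have h1 := T.inner_D_transform hpd v 0 w'
        have h2 : sphereAt (combescure (𝓡 m) h φ β) ξ p 0 = 0 := by
          have := T.inner_sphereAt hpd.1.ne' 0
          rw [inner_zero_left] at this
          exact inner_self_eq_zero.1 this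
        rw [h2, inner_zero_left, mul_zero] at h1
        exact h1
    refine Iff.trans hiff ?_
    constructor
    · rintro rfl
      exact ⟨v, rfl⟩
    · rintro ⟨v', hv'⟩
      exact (congrArg Prod.snd hv').symm

end FromHypotheses

end

/-! ### Diagonal parallel data on a leaf determine a regular transform of Dupin type. -/

section

variable {B : Type*} [NormedAddCommGroup B] [NormedSpace ℝ B] [FiniteDimensional ℝ B]
  {H : Type*} [TopologicalSpace H] {I : ModelWithCorners ℝ B H} [I.Boundaryless]
  {M : Type*} [TopologicalSpace M] [ChartedSpace H M] [IsManifold I ∞ M]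
  {E : Type*} [NormedAddCommGroup E] [InnerProductSpace ℝ E] [FiniteDimensional ℝ E]
  {k r s : ℕ}

/-- Two continuous linear maps which agree on subspaces spanning the space are equal there. -/
theorem clm_eq_of_iSup_eq_top {F : Type*} [NormedAddCommGroup F] [NormedSpace ℝ F] {ι : Sort*}
    {Δ : ι → Submodule ℝ B} (hΔ : ⨆ j, Δ j = ⊤) {P Q : B →L[ℝ] F}
    (h : ∀ j, ∀ v ∈ Δ j, P v = Q v) (v : B) : P v = Q v := by
  have h1 : v ∈ ⨆ j, Δ j := by rw [hΔ]; trivial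
  induction h1 using Submodule.iSup_induction' with
  | mem j v hv => exact h j v hv
  | zero => simp
  | add a b _ _ ha hb => rw [map_add, map_add, ha, hb]

theorem mem_of_iSup_eq_top {F : Type*} [NormedAddCommGroup F] [NormedSpace ℝ F] {ι : Sort*}
    {Δ : ι → Submodule ℝ B} (hΔ : ⨆ j, Δ j = ⊤) {P : B →L[ℝ] F} {T : Submodule ℝ F}
    (h : ∀ j, ∀ v ∈ Δ j, P v ∈ T) (v : B) : P v ∈ T := by
  have h1 : v ∈ ⨆ j, Δ j := by rw [hΔ]; trivial
  induction h1 using Submodule.iSup_induction' with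
  | mem j v hv => exact h j v hv
  | zero => simp
  | add a b _ _ ha hb => rw [map_add]; exact T.add_mem ha hb

variable (I) in
/-- Parallel normal frames `ζ`, `ξ` of an immersion `h`, together with a map `F` with tangential
component `∇φ`, whose derivatives are diagonal in a common orthogonal net `Δ`, the eigenvalues
being constant along the leaves. -/
structure IsRibaucourNetOn (O : Set M) (h : M → E) (ζ : Fin r → M → E) (ξ : Fin s → M → E)
    (F : M → E) (φ : M → ℝ) (lam : Fin r → M → ℝ) (Δ : Fin k → M → Submodule ℝ B)
    (l : Fin k → Fin r → M → ℝ) (χ : Fin k → Fin s → M → ℝ) (ψ : Fin k → M → ℝ) : Prop where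
  immersion : IsImmersionOn I O h
  smooth_zeta : ∀ a, ContMDiffOn I 𝓘(ℝ, E) ∞ (ζ a) O
  smooth_xi : ∀ i, ContMDiffOn I 𝓘(ℝ, E) ∞ (ξ i) O
  smooth_F : ContMDiffOn I 𝓘(ℝ, E) ∞ F O
  smooth_phi : ContMDiffOn I 𝓘(ℝ, ℝ) ∞ φ O
  smooth_l : ∀ j a, ContMDiffOn I 𝓘(ℝ, ℝ) ∞ (l j a) O
  smooth_chi : ∀ j i, ContMDiffOn I 𝓘(ℝ, ℝ) ∞ (χ j i) O
  smooth_psi : ∀ j, ContMDiffOn I 𝓘(ℝ, ℝ) ∞ (ψ j) O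
  phi_ne : ∀ x ∈ O, φ x ≠ 0
  F_ne : ∀ x ∈ O, F x ≠ 0
  zeta_normal : ∀ x ∈ O, ∀ a, ζ a x ∈ normal I h x
  xi_normal : ∀ x ∈ O, ∀ i, ξ i x ∈ normal I h x
  orthonormal : ∀ x ∈ O, Orthonormal ℝ (Sum.elim (fun a => ζ a x) fun i => ξ i x)
  dim : Module.finrank ℝ B + (r + s) = Module.finrank ℝ E
  inner_F : ∀ x ∈ O, ∀ v, ⟪F x, D I h x v⟫_ℝ = D I φ x v
  inner_F_zeta : ∀ x ∈ O, ∀ a, ⟪F x, ζ a x⟫_ℝ = -(φ x * lam a x)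
  iSup_eq : ∀ x ∈ O, ⨆ j, Δ j x = ⊤
  rank : ∀ j, ∃ t, 1 ≤ t ∧ ∀ x ∈ O, Module.finrank ℝ (Δ j x) = t
  distinct : ∀ x ∈ O, ∀ i j, (∀ a, l i a x = l j a x) → i = j
  ne_lam : ∀ x ∈ O, ∀ j, ∃ a, l j a x ≠ lam a x
  D_zeta : ∀ x ∈ O, ∀ j, ∀ v ∈ Δ j x, ∀ a, D I (ζ a) x v = -(l j a x • D I h x v)
  D_xi : ∀ x ∈ O, ∀ j, ∀ v ∈ Δ j x, ∀ i, D I (ξ i) x v = -(χ j i x • D I h x v)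
  D_F : ∀ x ∈ O, ∀ j, ∀ v ∈ Δ j x, D I F x v = ψ j x • D I h x v
  D_l : ∀ x ∈ O, ∀ j, ∀ v ∈ Δ j x, ∀ a, D I (l j a) x v = 0
  D_chi : ∀ x ∈ O, ∀ j, ∀ v ∈ Δ j x, ∀ i, D I (χ j i) x v = 0
  D_psi : ∀ x ∈ O, ∀ j, ∀ v ∈ Δ j x, D I (ψ j) x v = 0

/-- The principal normals with components `l` and `χ` in the frames `ζ` and `ξ`. -/
noncomputable def netNormal (ζ : Fin r → M → E) (ξ : Fin s → M → E)
    (l : Fin k → Fin r → M → ℝ) (χ : Fin k → Fin s → M → ℝ) (j : Fin k) (x : M) : E :=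
  ∑ a, l j a x • ζ a x + ∑ i, χ j i x • ξ i x

/-- The bundle spanned by a frame. -/
def frameSpan (ξ : Fin s → M → E) (x : M) : Submodule ℝ E :=
  Submodule.span ℝ (Set.range fun i => ξ i x)

variable (I) in
/-- The normal part of a map with tangential component `∇φ`. -/
noncomputable def normalPart (h F : M → E) (φ : M → ℝ) (x : M) : E :=
  F x - D I h x (gradB I h φ x)

theorem combescure_normalPart (h F : M → E) (φ : M → ℝ) :
    combescure I h φ (normalPart I h F φ) = F := by
  funext x
  rw [combescure_eq, normalPart, add_sub_cancel]

namespace IsRibaucourNetOn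

variable {O : Set M} {h : M → E} {ζ : Fin r → M → E} {ξ : Fin s → M → E} {F : M → E} {φ : M → ℝ}
  {lam : Fin r → M → ℝ} {Δ : Fin k → M → Submodule ℝ B} {l : Fin k → Fin r → M → ℝ}
  {χ : Fin k → Fin s → M → ℝ} {ψ : Fin k → M → ℝ}

section

variable (T : IsRibaucourNetOn I O h ζ ξ F φ lam Δ l χ ψ) {x : M} (hx : x ∈ O)
include T hx

theorem inner_zeta_zeta (a b : Fin r) : ⟪ζ a x, ζ b x⟫_ℝ = if a = b then 1 else 0 := by
  have := (orthonormal_iff_ite.1 (T.orthonormal x hx)) (Sum.inl a) (Sum.inl b)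
  simpa using this

theorem inner_xi_xi (a b : Fin s) : ⟪ξ a x, ξ b x⟫_ℝ = if a = b then 1 else 0 := by
  have := (orthonormal_iff_ite.1 (T.orthonormal x hx)) (Sum.inr a) (Sum.inr b)
  simpa using this

theorem inner_zeta_xi (a : Fin r) (b : Fin s) : ⟪ζ a x, ξ b x⟫_ℝ = 0 := by
  have := (orthonormal_iff_ite.1 (T.orthonormal x hx)) (Sum.inl a) (Sum.inr b)
  simpa using this

theorem inner_netNormal_zeta (j : Fin k) (a : Fin r) : ⟪netNormal ζ ξ l χ j x, ζ a x⟫_ℝ = l j a x := by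
  have h1 : ∀ i, ⟪ξ i x, ζ a x⟫_ℝ = 0 := fun i => by rw [real_inner_comm, T.inner_zeta_xi hx]
  simp [netNormal, inner_add_left, sum_inner, real_inner_smul_left, T.inner_zeta_zeta hx, h1]

theorem inner_netNormal_xi (j : Fin k) (i : Fin s) : ⟪netNormal ζ ξ l χ j x, ξ i x⟫_ℝ = χ j i x := by
  simp [netNormal, inner_add_left, sum_inner, real_inner_smul_left, T.inner_xi_xi hx,
    T.inner_zeta_xi hx]

theorem orthonormal_xi : Orthonormal ℝ fun i => ξ i x :=
  orthonormal_iff_ite.2 fun i j => T.inner_xi_xi hx i j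

theorem zeta_mem_orthogonal (a : Fin r) : ζ a x ∈ (frameSpan ξ x)ᗮ := by
  rw [frameSpan, Submodule.mem_orthogonal']
  exact fun y hy => inner_eq_zero_of_mem_span (T.inner_zeta_xi hx a) hy

theorem inner_orthogonal_starProjection (y : E) (a : Fin r) :
    ⟪(frameSpan ξ x)ᗮ.starProjection y, ζ a x⟫_ℝ = ⟪y, ζ a x⟫_ℝ := by
  rw [Submodule.inner_starProjection_left_eq_right,
    Submodule.starProjection_eq_self_iff.2 (T.zeta_mem_orthogonal hx a)]

theorem D_xi_mem_tangent (i : Fin s) (v : B) : D I (ξ i) x v ∈ tangent I h x :=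
  mem_of_iSup_eq_top (T.iSup_eq x hx) (fun j w hw => by
    rw [T.D_xi x hx j w hw]
    exact Submodule.neg_mem _ (Submodule.smul_mem _ _ (D_mem_tangent h x w))) v

theorem D_F_mem_tangent (v : B) : D I F x v ∈ tangent I h x :=
  mem_of_iSup_eq_top (T.iSup_eq x hx) (fun j w hw => by
    rw [T.D_F x hx j w hw]
    exact Submodule.smul_mem _ _ (D_mem_tangent h x w)) v

theorem frameSpan_le_normal : frameSpan ξ x ≤ normal I h x :=
  Submodule.span_le.2 (by rintro _ ⟨i, rfl⟩; exact T.xi_normal x hx i)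

end

/-- The frame formed by `ζ` and `ξ`. -/
def jointFrame (ζ : Fin r → M → E) (ξ : Fin s → M → E) (a : Fin (r + s)) (x : M) : E :=
  Sum.elim (fun a => ζ a x) (fun i => ξ i x) (finSumFinEquiv.symm a)

/-- By the dimension count ζ and ξ together frame the normal bundle, so `isDupinOn_of_frame`
applies. The ζ-components alone already separate the principal normals. -/
theorem isDupinOn (hO : IsOpen O) (T : IsRibaucourNetOn I O h ζ ξ F φ lam Δ l χ ψ) :
    IsDupinOn I O h (netNormal ζ ξ l χ) ∧
      ∀ j, ∀ x ∈ O, nullB I h (netNormal ζ ξ l χ j) x = Δ j x := by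
  refine isDupinOn_of_frame hO T.immersion (fun j => ⟨?_, fun x hx => ?_⟩) (fun x hx i j hij => ?_)
    T.iSup_eq T.rank fun x₀ hx₀ => ⟨O, hO, hx₀, r + s, jointFrame ζ ξ, fun a => ?_,
      fun x hx => ⟨?_, ?_, fun a j v hv => ?_⟩⟩
  · exact (contMDiffOn_finsetSum fun a _ => (T.smooth_l j a).smul (T.smooth_zeta a)).add
      (contMDiffOn_finsetSum fun i _ => (T.smooth_chi j i).smul (T.smooth_xi i))
  · exact Submodule.add_mem _
      (Submodule.sum_mem _ fun a _ => Submodule.smul_mem _ _ (T.zeta_normal x hx a))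
      (Submodule.sum_mem _ fun i _ => Submodule.smul_mem _ _ (T.xi_normal x hx i))
  · refine T.distinct x hx i j fun a => ?_
    rw [← T.inner_netNormal_zeta hx i a, ← T.inner_netNormal_zeta hx j a]
    exact congrArg (fun y => ⟪y, ζ a x⟫_ℝ) hij
  · unfold jointFrame
    rcases finSumFinEquiv.symm a with a | i
    · exact T.smooth_zeta a
    · exact T.smooth_xi i
  · exact (T.orthonormal x hx).comp _ finSumFinEquiv.symm.injective
  · refine Submodule.eq_of_le_of_finrank_eq (Submodule.span_le.2 ?_) ?_
    · rintro _ ⟨a, rfl⟩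
      simp only [jointFrame]
      rcases finSumFinEquiv.symm a with a | i
      · exact T.zeta_normal x hx a
      · exact T.xi_normal x hx i
    · have h1 : LinearIndependent ℝ fun a => jointFrame ζ ξ a x :=
        ((T.orthonormal x hx).comp _ finSumFinEquiv.symm.injective).linearIndependent
      rw [finrank_span_eq_card h1, Fintype.card_fin]
      have h2 := finrank_normal T.immersion hx
      have h3 := T.dim
      omega
  · unfold jointFrame
    rcases finSumFinEquiv.symm a with a | i
    · simp only [Sum.elim_inl]
      refine ⟨?_, ?_⟩
      · rw [T.inner_netNormal_zeta hx, T.D_zeta x hx j v hv]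
      · rw [D_congr (Filter.eventually_of_mem (hO.mem_nhds hx) fun y hy =>
          T.inner_netNormal_zeta hy j a)]
        exact T.D_l x hx j v hv a
    · simp only [Sum.elim_inr]
      refine ⟨?_, ?_⟩
      · rw [T.inner_netNormal_xi hx, T.D_xi x hx j v hv]
      · rw [D_congr (Filter.eventually_of_mem (hO.mem_nhds hx) fun y hy =>
          T.inner_netNormal_xi hy j i)]
        exact T.D_chi x hx j v hv i

theorem isParallelFrameOn (T : IsRibaucourNetOn I O h ζ ξ F φ lam Δ l χ ψ) :
    IsParallelFrameOn I O h (frameSpan ξ) ξ where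
  smooth i := ⟨T.smooth_xi i, fun _ _ => Submodule.subset_span ⟨i, rfl⟩⟩
  parallel i _ hx v := nablaB_eq_zero_of_mem_tangent (T.D_xi_mem_tangent hx i v)
  orthonormal _ hx := T.orthonormal_xi hx
  spans _ _ := rfl

theorem starProjection_frameSpan (T : IsRibaucourNetOn I O h ζ ξ F φ lam Δ l χ ψ) {x : M}
    (hx : x ∈ O) (y : E) : (frameSpan ξ x).starProjection y = ∑ i, ⟪ξ i x, y⟫_ℝ • ξ i x := by
  have h1 : ∀ i, ⟪ξ i x, y⟫_ℝ = ⟪ξ i x, (frameSpan ξ x).starProjection y⟫_ℝ := by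
    intro i
    have h2 : ξ i x ∈ frameSpan ξ x := Submodule.subset_span ⟨i, rfl⟩
    rw [← Submodule.inner_starProjection_left_eq_right, Submodule.starProjection_eq_self_iff.2 h2]
  simp only [h1]
  exact ((T.orthonormal_xi hx).sum_inner_smul_of_mem_span
    (Submodule.starProjection_apply_mem _ _)).symm

theorem isParallelFlatSubbundleOn (hO : IsOpen O)
    (T : IsRibaucourNetOn I O h ζ ξ F φ lam Δ l χ ψ) :
    IsParallelFlatSubbundleOn I O h (frameSpan ξ) s where
  le_normal _ hx := T.frameSpan_le_normal hx
  rank x hx := by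
    rw [frameSpan, finrank_span_eq_card (T.orthonormal_xi hx).linearIndependent, Fintype.card_fin]
  smooth := by
    have h1 : ContMDiffOn I 𝓘(ℝ, E →L[ℝ] E) ∞
        (fun x => ∑ i, (innerSL ℝ (ξ i x)).smulRight (ξ i x)) O := by
      refine contMDiffOn_finsetSum fun i _ => ?_
      have h2 : ContDiff ℝ ∞ fun y : E => (innerSL ℝ y).smulRight y :=
        ContDiff.smulRight (innerSL ℝ).contDiff contDiff_id
      exact h2.contMDiff.comp_contMDiffOn (T.smooth_xi i)
    refine h1.congr fun x hx => ?_
    ext y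
    rw [T.starProjection_frameSpan hx]
    simp
  parallel V hVO hV n hn x hx v := by
    have hs : ∀ i, ContMDiffOn I 𝓘(ℝ, ℝ) ∞ (fun y => ⟪ξ i y, n y⟫_ℝ) V := fun i =>
      contMDiffOn_inner ((T.smooth_xi i).mono hVO) hn.1
    have h1 : ∀ v : B, nablaB I h n x v = nablaB I h (fun y => ∑ i, ⟪ξ i y, n y⟫_ℝ • ξ i y) x v := by
      intro v
      refine congrArg (fun A : B →L[ℝ] E => (normal I h x).starProjection (A v)) (D_congr ?_)
      exact Filter.eventually_of_mem (hV.mem_nhds hx) fun y hy =>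
        ((T.orthonormal_xi (hVO hy)).sum_inner_smul_of_mem_span (hn.2 y hy)).symm
    have h2 : ∀ v : B, nablaB I h n x v ∈ frameSpan ξ x := by
      intro v
      rw [h1, nablaB_sum (fun i => ((hs i).hasPush hV hx).mdifferentiableAt)
        (fun i => ((T.smooth_xi i).hasPush hO (hVO hx)).mdifferentiableAt)
        (fun i => T.xi_normal x (hVO hx) i) (fun i w => T.D_xi_mem_tangent (hVO hx) i w)]
      exact Submodule.sum_mem _ fun i _ => Submodule.smul_mem _ _ (Submodule.subset_span ⟨i, rfl⟩)
    exact h2 v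
  flat := isFlatOn_of_frame fun x₀ hx₀ => ⟨O, hO, hx₀, s, ξ, T.smooth_xi, fun x hx =>
    ⟨T.orthonormal_xi hx, le_rfl, fun i => T.xi_normal x hx i,
      fun i v => T.D_xi_mem_tangent hx i v⟩⟩

/-- F has tangential part ∇φ, so subtracting it leaves a normal field β; the equation for the pair
holds because dF is tangent. -/
theorem isRibaucourPairOn (hO : IsOpen O) (T : IsRibaucourNetOn I O h ζ ξ F φ lam Δ l χ ψ) :
    IsRibaucourPairOn I O h φ (normalPart I h F φ) where
  smooth := T.smooth_phi
  section_normal := by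
    refine ⟨T.smooth_F.sub (contMDiffOn_push_grad hO T.immersion T.smooth_phi), fun x hx => ?_⟩
    rw [mem_normal]
    intro w
    rw [normalPart, inner_sub_left, T.inner_F x hx, push_grad (T.immersion.injective hx), sub_self]
  eqn x hx v := by
    have hg := contMDiffOn_push_grad hO T.immersion T.smooth_phi
    have h1 : D I (normalPart I h F φ) x
        = D I F x - D I (fun y => D I h y (gradB I h φ y)) x :=
      ((T.smooth_F.hasPush hO hx).sub (hg.hasPush hO hx)).eq
    have h2 : ∀ v : B, (normal I h x).starProjection (D I F x v) = 0 := fun v =>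
      nablaB_eq_zero_of_mem_tangent (n := F) (T.D_F_mem_tangent hx v)
    have h3 : ∀ v : B, sffB I h x (gradB I h φ x) v + nablaB I h (normalPart I h F φ) x v = 0 := by
      intro v
      change sffB I h x (gradB I h φ x) v
        + (normal I h x).starProjection (D I (normalPart I h F φ) x v) = 0
      rw [h1, sub_apply, map_sub, h2,
        normal_starProjection_D_push_grad hO T.immersion T.smooth_phi hx]
      simp
    exact h3 v
  ne_zero := T.phi_ne
  combescure_ne_zero x hx := by
    rw [combescure_normalPart]; exact T.F_ne x hx

/-- The fields ζ_a are orthogonal to N, so projecting to the complement of N does not change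
ζ-components. Those of η_j are l_j, those of -φ⁻¹ β are `lam`. -/
theorem isRegularOn (hs : 1 ≤ s) (T : IsRibaucourNetOn I O h ζ ξ F φ lam Δ l χ ψ) :
    IsRegularOn O (frameSpan ξ) (netNormal ζ ξ l χ) φ (normalPart I h F φ) := by
  intro x hx
  refine ⟨fun h0 => ?_, fun i j hij => ?_, fun j hj => ?_⟩
  · have h1 : ξ ⟨0, hs⟩ x ∈ frameSpan ξ x := Submodule.subset_span ⟨_, rfl⟩
    rw [h0, Submodule.mem_bot] at h1
    exact (T.orthonormal_xi hx).ne_zero ⟨0, hs⟩ h1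
  · refine T.distinct x hx i j fun a => ?_
    rw [← T.inner_netNormal_zeta hx i a, ← T.inner_netNormal_zeta hx j a,
      ← T.inner_orthogonal_starProjection hx (netNormal ζ ξ l χ i x),
      ← T.inner_orthogonal_starProjection hx (netNormal ζ ξ l χ j x)]
    exact congrArg (fun y => ⟪y, ζ a x⟫_ℝ) hij
  · obtain ⟨a, ha⟩ := T.ne_lam x hx j
    apply ha
    rw [← T.inner_netNormal_zeta hx j a, ← T.inner_orthogonal_starProjection hx, hj, inner_neg_left,
      real_inner_smul_left, T.inner_orthogonal_starProjection hx, normalPart, inner_sub_left,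
      T.inner_F_zeta x hx, real_inner_comm, mem_normal.1 (T.zeta_normal x hx a)]
    field_simp [T.phi_ne x hx]
    ring

/-- Here Φ = dF. It is symmetric since ⟨F, dh⟩ = dφ is closed, and Codazzi since second derivatives
of F commute up to the bracket. The spectral form holds because both sides agree on each Δ_j. -/
theorem isDupinTensorOn (hO : IsOpen O) (T : IsRibaucourNetOn I O h ζ ξ F φ lam Δ l χ ψ) :
    IsDupinTensorOn I O h (netNormal ζ ξ l χ) (codazziTensor I h φ (normalPart I h F φ)) := by
  obtain ⟨hd, hnull⟩ := T.isDupinOn hO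
  have hp := T.isRibaucourPairOn hO
  have hT : ∀ x ∈ O, ∀ v : B, codazziTensor I h φ (normalPart I h F φ) x v = D I F x v := by
    intro x hx v
    rw [codazziTensor_eq hO T.immersion T.smooth_phi hp.section_normal.1 hx v,
      combescure_normalPart, Submodule.starProjection_eq_self_iff.2 (T.D_F_mem_tangent hx v)]
  refine ⟨⟨fun x hx v => ?_, fun x hx v w => ?_, fun V hVO hV X hX => ?_,
    fun V hVO hV X Y hX hY x hx => ?_⟩, ψ, T.smooth_psi, fun j x hx v hv => ?_, fun x hx v => ?_⟩
  · have := T.D_F_mem_tangent hx v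
    rw [← hT x hx v] at this
    exact this
  · have h1 := inner_D_symm ((T.smooth_F x hx).contMDiffAt (hO.mem_nhds hx))
      ((T.immersion.1 x hx).contMDiffAt (hO.mem_nhds hx))
      ((T.smooth_phi x hx).contMDiffAt (hO.mem_nhds hx))
      (Filter.eventually_of_mem (hO.mem_nhds hx) fun y hy v => T.inner_F y hy v) v w
    rw [← hT x hx v, ← hT x hx w, real_inner_comm (D I h x v)] at h1
    exact h1
  · exact (contMDiffOn_D_apply hV (T.smooth_F.mono hVO) hX).congr fun x hx => hT x (hVO hx) (X x)
  · have h1 := D_mlieBracket hV (T.smooth_F.mono hVO) hX hY hx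
    have h2 : ∀ Z : (∀ x : M, TangentSpace I x),
        D I (fun y => codazziTensor I h φ (normalPart I h F φ) y (Z y)) x
          = D I (fun y => D I F y (vec Z y)) x := fun Z => D_congr
      (Filter.eventually_of_mem (hV.mem_nhds hx) fun y hy => hT y (hVO hy) (Z y))
    have h3 : (tangent I h x).starProjection (D I (fun y => D I F y (vec Y y)) x (vec X x))
        - (tangent I h x).starProjection (D I (fun y => D I F y (vec X y)) x (vec Y x))
        = D I F x (vec (VectorField.mlieBracket I X Y) x) := by
      rw [← map_sub, ← h1, Submodule.starProjection_eq_self_iff.2 (T.D_F_mem_tangent (hVO hx) _)]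
    rw [← h2 X, ← h2 Y, ← hT x (hVO hx)] at h3
    exact h3
  · have hv' : v ∈ nullB I h (netNormal ζ ξ l χ j) x := hv
    rw [hnull j x hx] at hv'
    exact T.D_psi x hx j v hv'
  · have h1 : ∀ w : B, D I F x w = (∑ j, ψ j x • (((nullB I h (netNormal ζ ξ l χ j) x).map
        (D I h x : B →ₗ[ℝ] E)).starProjection.comp (D I h x))) w := by
      refine clm_eq_of_iSup_eq_top (hd.iSup_nullB hx) fun j w hw => ?_
      rw [sum_apply, Finset.sum_eq_single j]
      · have hm : D I h x w ∈ (nullB I h (netNormal ζ ξ l χ j) x).map (D I h x : B →ₗ[ℝ] E) :=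
          ⟨w, hw, rfl⟩
        rw [hnull j x hx] at hw
        rw [T.D_F x hx j w hw, smul_apply, ContinuousLinearMap.comp_apply,
          Submodule.starProjection_eq_self_iff.2 hm]
      · intro i _ hij
        have h3 : ((nullB I h (netNormal ζ ξ l χ i) x).map (D I h x : B →ₗ[ℝ] E)).starProjection
            (D I h x w) = 0 := by
          rw [Submodule.starProjection_apply_eq_zero_iff, Submodule.mem_orthogonal]
          rintro _ ⟨w', hw', rfl⟩
          exact hd.inner_eq_zero hO hx hij hw' hw
        rw [smul_apply, ContinuousLinearMap.comp_apply, h3, smul_zero]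
      · simp
    have h2 : ∀ w : B, codazziTensor I h φ (normalPart I h F φ) x w = ∑ j, ψ j x •
        ((nullB I h (netNormal ζ ξ l χ j) x).map (D I h x : B →ₗ[ℝ] E)).starProjection
          (D I h x w) := by
      intro w
      rw [hT x hx w, h1 w, sum_apply]
      rfl
    exact h2 v

/-- A Ribaucour net determines a regular Ribaucour transform of Dupin type. -/
theorem isRegularDupinTypeOn (hO : IsOpen O) (hs : 1 ≤ s)
    (T : IsRibaucourNetOn I O h ζ ξ F φ lam Δ l χ ψ) :
    IsRegularDupinTypeOn I O h (netNormal ζ ξ l χ) (frameSpan ξ) s φ (normalPart I h F φ) :=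
  ⟨(T.isDupinOn hO).1, T.isParallelFlatSubbundleOn hO, T.isRibaucourPairOn hO, T.isRegularOn hs,
    T.isDupinTensorOn hO⟩

end IsRibaucourNetOn

end

/-! ### Simultaneous diagonalization and orthogonal decompositions. -/

section Linear

variable {B : Type*} [NormedAddCommGroup B] [NormedSpace ℝ B] [FiniteDimensional ℝ B]
  {E : Type*} [NormedAddCommGroup E] [InnerProductSpace ℝ E] [FiniteDimensional ℝ E]

/-- The joint eigenspaces of a family of linear maps, relative to a linear map `A`. -/
def jointEigenspace {ι : Type*} (A : B →L[ℝ] E) (C : ι → B →L[ℝ] E) (c : ι → ℝ) :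
    Submodule ℝ B where
  carrier := {v | ∀ i, C i v = c i • A v}
  add_mem' ha hb i := by rw [map_add, ha i, hb i, map_add, smul_add]
  zero_mem' i := by simp
  smul_mem' t a ha i := by rw [map_smul, ha i, map_smul, smul_comm]

/-- A commuting family of symmetric maps is simultaneously diagonalizable. -/
theorem iSup_jointEigenspace {ι : Type*} {A : B →L[ℝ] E} (hA : Function.Injective A)
    {C : ι → B →L[ℝ] E} (hr : ∀ i v, C i v ∈ LinearMap.range (A : B →ₗ[ℝ] E))
    (hs : ∀ i v w, ⟪C i v, A w⟫_ℝ = ⟪C i w, A v⟫_ℝ)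
    (hc : ∀ i j v w, ⟪C i v, C j w⟫_ℝ = ⟪C i w, C j v⟫_ℝ) :
    ⨆ c : ι → ℝ, jointEigenspace A C c = ⊤ := by
  set R := LinearMap.range (A : B →ₗ[ℝ] E)
  let e : B ≃ₗ[ℝ] R := LinearEquiv.ofInjective (A : B →ₗ[ℝ] E) hA
  have he : ∀ v, (e v : E) = A v := fun v => LinearEquiv.ofInjective_apply _ v
  let T : ι → R →ₗ[ℝ] R := fun i =>
    (LinearMap.codRestrict R (C i : B →ₗ[ℝ] E) (hr i)).comp (e.symm : R →ₗ[ℝ] B)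
  have hT : ∀ i v, (T i (e v) : E) = C i v := by
    intro i v
    simp [T]
  have hsym : ∀ i, (T i).IsSymmetric := by
    intro i x y
    obtain ⟨v, rfl⟩ := e.surjective x
    obtain ⟨w, rfl⟩ := e.surjective y
    rw [Submodule.coe_inner, Submodule.coe_inner, hT, hT, he, he, hs, real_inner_comm]
  -- For symmetric operators, symmetry of ⟨C_i v, C_j w⟩ in v and w is the same as commutation.
  have hcomm : Pairwise (Function.onFun Commute T) := by
    intro i j _
    refine LinearMap.ext fun x => ?_
    refine ext_inner_right ℝ fun y => ?_
    obtain ⟨v, rfl⟩ := e.surjective x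
    obtain ⟨w, rfl⟩ := e.surjective y
    have h1 : ⟪T i (T j (e v)), e w⟫_ℝ = ⟪C j v, C i w⟫_ℝ := by
      rw [hsym i, Submodule.coe_inner, hT, hT]
    have h2 : ⟪T j (T i (e v)), e w⟫_ℝ = ⟪C i v, C j w⟫_ℝ := by
      rw [hsym j, Submodule.coe_inner, hT, hT]
    rw [Module.End.mul_apply, Module.End.mul_apply, h1, h2, hc, real_inner_comm]
  have h1 := LinearMap.IsSymmetric.iSup_iInf_eq_top_of_commute hsym hcomm
  rw [eq_top_iff]
  intro v _
  have h2 : e v ∈ ⨆ χ : ι → ℝ, ⨅ i, Module.End.eigenspace (T i) (χ i) := by rw [h1]; trivial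
  suffices h : ∀ x ∈ ⨆ χ : ι → ℝ, ⨅ i, Module.End.eigenspace (T i) (χ i),
      e.symm x ∈ ⨆ c : ι → ℝ, jointEigenspace A C c by
    simpa using h _ h2
  intro x hx
  induction hx using Submodule.iSup_induction' with
  | mem χ x hx =>
    obtain ⟨w, rfl⟩ := e.surjective x
    rw [e.symm_apply_apply]
    refine Submodule.mem_iSup_of_mem χ fun i => ?_
    have h3 := Module.End.mem_eigenspace_iff.1 ((Submodule.mem_iInf _).1 hx i)
    have h4 := congrArg (fun z : R => (z : E)) h3
    simpa [hT, he] using h4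
  | zero => simp
  | add a b _ _ ha hb => rw [map_add]; exact Submodule.add_mem _ ha hb

variable {ι : Type*} [Fintype ι] {A : B →L[ℝ] E} {Δ : ι → Submodule ℝ B}

theorem exists_sum_of_iSup_eq_top (hΔ : ⨆ j, Δ j = ⊤) (x : B) :
    ∃ δ : ι → B, (∀ j, δ j ∈ Δ j) ∧ ∑ j, δ j = x := by
  have h1 : x ∈ ⨆ j, Δ j := by rw [hΔ]; trivial
  rw [Submodule.mem_iSup_iff_exists_finsupp] at h1
  obtain ⟨f, hf, rfl⟩ := h1
  exact ⟨f, hf, (Finsupp.sum_fintype f (fun _ x => x) fun _ => rfl).symm⟩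

theorem eq_zero_of_sum_eq_zero (hA : Function.Injective A)
    (ho : ∀ i j, i ≠ j → ∀ v ∈ Δ i, ∀ w ∈ Δ j, ⟪A v, A w⟫_ℝ = 0) {δ : ι → B}
    (hδ : ∀ j, δ j ∈ Δ j) (h0 : ∑ j, δ j = 0) (j : ι) : δ j = 0 := by
  classical
  apply hA
  rw [map_zero, ← inner_self_eq_zero (𝕜 := ℝ)]
  have h1 : ⟪A (δ j), A (∑ i, δ i)⟫_ℝ = 0 := by rw [h0, map_zero, inner_zero_right]
  rw [map_sum, inner_sum, Finset.sum_eq_single j (fun i _ hij => ho j i hij.symm _ (hδ j) _ (hδ i))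
    (by simp)] at h1
  exact h1

/-- A joint eigenvector of a diagonal family with distinct eigenvalues lies in one summand. -/
theorem exists_mem_of_eigen {κ : Type*} (hA : Function.Injective A) (hΔ : ⨆ j, Δ j = ⊤)
    (ho : ∀ i j, i ≠ j → ∀ v ∈ Δ i, ∀ w ∈ Δ j, ⟪A v, A w⟫_ℝ = 0)
    {C : κ → B →L[ℝ] E} {l : ι → κ → ℝ} (hl : ∀ i j, (∀ a, l i a = l j a) → i = j)
    (hC : ∀ j, ∀ v ∈ Δ j, ∀ a, C a v = -(l j a • A v)) {x : B} (hx : x ≠ 0) {μ : κ → ℝ}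
    (hμ : ∀ a, C a x = -(μ a • A x)) : ∃ j, (∀ a, μ a = l j a) ∧ x ∈ Δ j := by
  classical
  obtain ⟨δ, hδ, rfl⟩ := exists_sum_of_iSup_eq_top hΔ x
  -- Comparing components in the orthogonal sum, each nonzero component has eigenvalues μ. As the
  -- tuples l_j are distinct, only one component survives.
  have h1 : ∀ a j, (l j a - μ a) • δ j = 0 := by
    intro a
    refine eq_zero_of_sum_eq_zero hA ho (fun j => (Δ j).smul_mem _ (hδ j)) (hA ?_)
    have h2 := hμ a
    simp only [map_sum] at h2
    rw [Finset.sum_congr rfl fun j _ => hC j (δ j) (hδ j) a, Finset.smul_sum] at h2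
    simp only [sub_smul, Finset.sum_sub_distrib, map_zero, map_sub, map_sum, map_smul]
    rw [Finset.sum_neg_distrib, neg_inj] at h2
    rw [h2, sub_self]
  obtain ⟨j, -, hj⟩ : ∃ j ∈ Finset.univ, δ j ≠ 0 := Finset.exists_ne_zero_of_sum_ne_zero hx
  have h3 : ∀ a, μ a = l j a := fun a => by
    have := (smul_eq_zero.1 (h1 a j)).resolve_right hj
    linarith
  refine ⟨j, h3, ?_⟩
  rw [Finset.sum_eq_single j]
  · exact hδ j
  · intro i _ hij
    by_contra hne
    refine hij (hl i j fun a => ?_)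
    have := (smul_eq_zero.1 (h1 a i)).resolve_right hne
    rw [← h3 a]
    linarith
  · simp

/-- Subspaces of an orthogonal family which span the space are the whole family. -/
theorem le_of_iSup_eq_top (hA : Function.Injective A)
    (ho : ∀ i j, i ≠ j → ∀ v ∈ Δ i, ∀ w ∈ Δ j, ⟪A v, A w⟫_ℝ = 0) {G : ι → Submodule ℝ B}
    (hG : ⨆ j, G j = ⊤) (hle : ∀ j, G j ≤ Δ j) (j : ι) : Δ j ≤ G j := by
  classical
  intro v hv
  obtain ⟨g, hg, hgv⟩ := exists_sum_of_iSup_eq_top hG v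
  -- Two decompositions of v into the Δ_i are compared: the one coming from the G_i, and v alone in
  -- the j-th place. By uniqueness v is the j-th component of the first, hence in G_j.
  have h1 := eq_zero_of_sum_eq_zero hA ho (δ := fun i => g i - if i = j then v else 0)
    (fun i => ?_) (by rw [Finset.sum_sub_distrib, hgv]; simp) j
  · simp only [if_true] at h1
    rw [← sub_eq_zero.1 h1]; exact hg j
  · refine (Δ i).sub_mem (hle i (hg i)) ?_
    split_ifs with h
    · rw [h]; exact hv
    · exact zero_mem _

/-- Orthogonality to complementary subspaces. -/
theorem mem_of_orthogonal_of_finrank {T K Z : Submodule ℝ E} (hTK : ∀ a ∈ T, ∀ b ∈ K, ⟪a, b⟫_ℝ = 0)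
    (hTZ : ∀ a ∈ T, ∀ b ∈ Z, ⟪a, b⟫_ℝ = 0) (hKZ : ∀ a ∈ K, ∀ b ∈ Z, ⟪a, b⟫_ℝ = 0)
    (hdim : Module.finrank ℝ E ≤
      Module.finrank ℝ T + Module.finrank ℝ K + Module.finrank ℝ Z) {x : E}
    (hK : ∀ b ∈ K, ⟪x, b⟫_ℝ = 0) (hZ : ∀ b ∈ Z, ⟪x, b⟫_ℝ = 0) : x ∈ T := by
  have hdis : Disjoint K Z := by
    rw [Submodule.disjoint_def]
    intro a ha hb
    exact inner_self_eq_zero.1 (hKZ a ha a hb)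
  have h1 : Module.finrank ℝ (K ⊔ Z : Submodule ℝ E) = Module.finrank ℝ K + Module.finrank ℝ Z := by
    have h2 := Submodule.finrank_sup_add_finrank_inf_eq K Z
    rw [hdis.eq_bot, finrank_bot, add_zero] at h2
    exact h2
  have hle : T ≤ (K ⊔ Z)ᗮ := by
    intro a ha
    rw [Submodule.mem_orthogonal']
    intro y hy
    obtain ⟨b, hb, c, hc, rfl⟩ := Submodule.mem_sup.1 hy
    rw [inner_add_right, hTK a ha b hb, hTZ a ha c hc, add_zero]
  have h3 : T = (K ⊔ Z)ᗮ := by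
    refine Submodule.eq_of_le_of_finrank_le hle ?_
    have h4 := (K ⊔ Z).finrank_add_finrank_orthogonal
    omega
  rw [h3, Submodule.mem_orthogonal']
  intro y hy
  obtain ⟨b, hb, c, hc, rfl⟩ := Submodule.mem_sup.1 hy
  rw [inner_add_right, hK b hb, hZ c hc, add_zero]

end Linear

/-! ### Hyperplane reflections and twin leaves. -/

section Mirror

variable {E : Type*} [NormedAddCommGroup E] [InnerProductSpace ℝ E]

/-- The reflection in the hyperplane orthogonal to `y`. -/
noncomputable def mirror (y : E) : E ≃ₗᵢ[ℝ] E := (ℝ ∙ y)ᗮ.reflection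

theorem mirror_apply (y x : E) : mirror y x = x - (2 * ⟪y, x⟫_ℝ / ‖y‖ ^ 2) • y := by
  rw [mirror, Submodule.reflection_orthogonal_apply, Submodule.reflection_singleton_apply]
  simp only [RCLike.ofReal_real_eq_id, id_eq, two_smul]
  module

theorem mirror_mirror (y x : E) : mirror y (mirror y x) = x :=
  Submodule.reflection_reflection _ x

theorem inner_mirror (y a b : E) : ⟪mirror y a, mirror y b⟫_ℝ = ⟪a, b⟫_ℝ :=
  (mirror y).inner_map_map a b

theorem inner_mirror_left (y a b : E) : ⟪mirror y a, b⟫_ℝ = ⟪a, mirror y b⟫_ℝ := by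
  rw [← inner_mirror y a, mirror_mirror]

end Mirror

section

variable {X : Type*} [NormedAddCommGroup X] [NormedSpace ℝ X] [FiniteDimensional ℝ X]
  {E : Type*} [NormedAddCommGroup E] [InnerProductSpace ℝ E] [FiniteDimensional ℝ E]
  {k r s : ℕ}

/-- Smoothness on a subset of a normed space. -/
local notation "SmoothOn" => ContMDiffOn 𝓘(ℝ, X) 𝓘(ℝ, E) ∞

local notation "𝒟" => D 𝓘(ℝ, X)

/-- An immersion with an orthonormal frame of normal fields whose derivatives are diagonal in an
orthogonal net. -/
structure IsNetOn (O : Set X) (h : X → E) (ζ : Fin r → X → E) (l : Fin k → Fin r → X → ℝ)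
    (Δ : Fin k → X → Submodule ℝ X) : Prop where
  immersion : IsImmersionOn 𝓘(ℝ, X) O h
  smooth_zeta : ∀ a, SmoothOn (ζ a) O
  smooth_l : ∀ j a, ContMDiffOn 𝓘(ℝ, X) 𝓘(ℝ, ℝ) ∞ (l j a) O
  orthonormal : ∀ x ∈ O, Orthonormal ℝ fun a => ζ a x
  zeta_normal : ∀ x ∈ O, ∀ a v, ⟪ζ a x, 𝒟 h x v⟫_ℝ = 0
  iSup_eq : ∀ x ∈ O, ⨆ j, Δ j x = ⊤
  ortho : ∀ x ∈ O, ∀ i j, i ≠ j → ∀ v ∈ Δ i x, ∀ w ∈ Δ j x, ⟪𝒟 h x v, 𝒟 h x w⟫_ℝ = 0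
  rank : ∀ j, ∃ t, 1 ≤ t ∧ ∀ x ∈ O, Module.finrank ℝ (Δ j x) = t
  distinct : ∀ x ∈ O, ∀ i j, (∀ a, l i a x = l j a x) → i = j
  D_zeta : ∀ x ∈ O, ∀ j, ∀ v ∈ Δ j x, ∀ a, 𝒟 (ζ a) x v = -(l j a x • 𝒟 h x v)
  D_l : ∀ x ∈ O, ∀ j, ∀ v ∈ Δ j x, ∀ a, 𝒟 (l j a) x v = 0

/-- The inversion of `g - h`. -/
noncomputable def nu (h g : X → E) (x : X) : E := (‖g x - h x‖ ^ 2)⁻¹ • (g x - h x)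

section Twin

variable {h g ζ : X → E} {lam : X → ℝ} {x : X}

theorem inner_nu_self (hne : g x ≠ h x) : ‖nu h g x‖ ^ 2 = (‖g x - h x‖ ^ 2)⁻¹ := by
  have h0 : ‖g x - h x‖ ≠ 0 := norm_ne_zero_iff.2 (sub_ne_zero.2 hne)
  rw [nu, norm_smul, mul_pow, norm_inv, norm_pow, norm_norm]
  field_simp

/-- The differential of the inversion y ↦ y / ‖y‖² is ‖y‖⁻² times the reflection along y. Reflecting
dh as well gives -dh and the term proportional to ν. -/
theorem D_nu (hh : MDifferentiableAt 𝓘(ℝ, X) 𝓘(ℝ, E) h x)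
    (hg : MDifferentiableAt 𝓘(ℝ, X) 𝓘(ℝ, E) g x) (hne : g x ≠ h x) (v : X) :
    𝒟 (nu h g) x v = (2 * ⟪nu h g x, 𝒟 h x v⟫_ℝ) • nu h g x
      + (‖g x - h x‖ ^ 2)⁻¹ • (mirror (g x - h x) (𝒟 g x v) - 𝒟 h x v) := by
  have hy := (hasPush_of_mdifferentiableAt hg).sub (hasPush_of_mdifferentiableAt hh)
  have h0 : ‖g x - h x‖ ^ 2 ≠ 0 := pow_ne_zero 2 (norm_ne_zero_iff.2 (sub_ne_zero.2 hne))
  have h1 : HasPush 𝓘(ℝ, X) (fun y => ‖g y - h y‖ ^ 2) x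
      ((innerSL ℝ (g x - h x)).comp (𝒟 g x - 𝒟 h x)
        + (innerSL ℝ (g x - h x)).comp (𝒟 g x - 𝒟 h x)) :=
    (hy.inner hy).congr (Filter.Eventually.of_forall fun y => (real_inner_self_eq_norm_sq _).symm)
  have h2 : HasPush 𝓘(ℝ, X) (nu h g) x _ := (h1.inv h0).smul hy
  rw [h2.eq]
  simp only [add_apply, smul_apply, sub_apply, ContinuousLinearMap.comp_apply,
    ContinuousLinearMap.smulRight_apply, innerSL_apply_apply, mirror_apply, nu,
    real_inner_smul_left, inner_sub_right, smul_eq_mul]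
  match_scalars <;> field_simp <;> ring

theorem mirror_zeta (hne : g x ≠ h x)
    (hin : 2 * ⟪g x - h x, ζ x⟫_ℝ = lam x * ‖g x - h x‖ ^ 2) :
    mirror (g x - h x) (ζ x) = ζ x - lam x • (g x - h x) := by
  have h0 : ‖g x - h x‖ ^ 2 ≠ 0 := pow_ne_zero 2 (norm_ne_zero_iff.2 (sub_ne_zero.2 hne))
  rw [mirror_apply, hin, mul_div_cancel_right₀ _ h0]

/-- `ζ` is normal to `h`, and its reflection in the bisecting hyperplanes of `h` and `g` is
normal to `g`. -/
structure IsTwinAt (h g ζ : X → E) (lam : X → ℝ) (x : X) : Prop where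
  mdiff_base : MDifferentiableAt 𝓘(ℝ, X) 𝓘(ℝ, E) h x
  mdiff_twin : MDifferentiableAt 𝓘(ℝ, X) 𝓘(ℝ, E) g x
  mdiff_zeta : MDifferentiableAt 𝓘(ℝ, X) 𝓘(ℝ, E) ζ x
  mdiff_lam : MDifferentiableAt 𝓘(ℝ, X) 𝓘(ℝ, ℝ) lam x
  inner_eq : ∀ᶠ y in 𝓝 x, 2 * ⟪g y - h y, ζ y⟫_ℝ = lam y * ‖g y - h y‖ ^ 2
  inner_D : ∀ v : X, ⟪ζ x, 𝒟 h x v⟫_ℝ = 0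
  inner_D' : ∀ v : X, ⟪ζ x - lam x • (g x - h x), 𝒟 g x v⟫_ℝ = 0

/-- Differentiate the relation `inner_eq`; the terms with dg cancel because ζ - λ (g - h) is normal
to g. -/
theorem IsTwinAt.two_inner_eq (T : IsTwinAt h g ζ lam x) (v : X) : 2 * ⟪𝒟 ζ x v + lam x • 𝒟 h x v, g x - h x⟫_ℝ
    = 𝒟 lam x v * ‖g x - h x‖ ^ 2 := by
  have hy := (hasPush_of_mdifferentiableAt T.mdiff_twin).sub (hasPush_of_mdifferentiableAt T.mdiff_base)
  have h1 := (hy.inner (hasPush_of_mdifferentiableAt T.mdiff_zeta)).const_mul 2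
  have h2 : HasPush 𝓘(ℝ, X) (fun y => 2 * ⟪g y - h y, ζ y⟫_ℝ) x _ :=
    ((hasPush_of_mdifferentiableAt T.mdiff_lam).mul (hy.inner hy)).congr
      (T.inner_eq.mono fun y e => by simp only [e, real_inner_self_eq_norm_sq])
  have h3 := congrArg (fun A : X →L[ℝ] ℝ => A v) (h1.unique h2)
  simp only [add_apply, smul_apply, sub_apply, ContinuousLinearMap.comp_apply,
    innerSL_apply_apply, smul_eq_mul, inner_sub_right (𝕜 := ℝ) _ (𝒟 g x v), T.inner_D] at h3
  have h4 := T.inner_D' v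
  rw [inner_sub_left, real_inner_smul_left] at h4
  rw [inner_add_left, real_inner_smul_left, real_inner_comm (g x - h x),
    real_inner_comm (g x - h x) (𝒟 h x v), ← real_inner_self_eq_norm_sq]
  linear_combination h3 - 2 * h4

theorem IsTwinAt.two_inner_nu_eq (T : IsTwinAt h g ζ lam x) (hne : g x ≠ h x) (v : X) :
    2 * ⟪𝒟 ζ x v + lam x • 𝒟 h x v, nu h g x⟫_ℝ = 𝒟 lam x v := by
  have h0 : ‖g x - h x‖ ^ 2 ≠ 0 := pow_ne_zero 2 (norm_ne_zero_iff.2 (sub_ne_zero.2 hne))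
  have h1 := T.two_inner_eq v
  rw [nu, real_inner_smul_right]
  rw [mul_left_comm, h1, mul_comm, mul_assoc, mul_inv_cancel₀ h0, mul_one]

/-- By `two_inner_eq` the derivative of λ supplies exactly the multiple of g - h in the reflection
formula. So dζ + λ df is carried from one leaf to its twin by the reflection. -/
theorem IsTwinAt.D_zeta_add (T : IsTwinAt h g ζ lam x) (hne : g x ≠ h x) (v : X) :
    𝒟 (fun y => ζ y - lam y • (g y - h y)) x v + lam x • 𝒟 g x v
      = mirror (g x - h x) (𝒟 ζ x v + lam x • 𝒟 h x v) := by
  have h0 : ‖g x - h x‖ ^ 2 ≠ 0 := pow_ne_zero 2 (norm_ne_zero_iff.2 (sub_ne_zero.2 hne))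
  have hy := (hasPush_of_mdifferentiableAt T.mdiff_twin).sub (hasPush_of_mdifferentiableAt T.mdiff_base)
  have h1 := (hasPush_of_mdifferentiableAt T.mdiff_zeta).sub ((hasPush_of_mdifferentiableAt T.mdiff_lam).smul hy)
  rw [h1.eq, mirror_apply, real_inner_comm, T.two_inner_eq v,
    mul_div_cancel_right₀ _ h0]
  simp only [sub_apply, add_apply, smul_apply, ContinuousLinearMap.smulRight_apply]
  module

end Twin

namespace IsNetOn

variable {O : Set X} {h : X → E} {ζ : Fin r → X → E} {l : Fin k → Fin r → X → ℝ}
  {Δ : Fin k → X → Submodule ℝ X}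

/-- On Δ_j the vectors dζ_a + λ_a dh are (λ_a - l_{ja}) dh, and for each j some coefficient is
nonzero; so together they span the whole tangent space. -/
theorem inner_D_eq_zero (T : IsNetOn O h ζ l Δ) {x : X} (hx : x ∈ O) {lam : Fin r → ℝ}
    (hlam : ∀ j, ∃ a, l j a x ≠ lam a) {n : E}
    (hn : ∀ a v, ⟪𝒟 (ζ a) x v + lam a • 𝒟 h x v, n⟫_ℝ = 0) (v : X) : ⟪n, 𝒟 h x v⟫_ℝ = 0 := by
  refine clm_eq_of_iSup_eq_top (P := (innerSL ℝ n).comp (𝒟 h x)) (Q := 0) (T.iSup_eq x hx)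
    (fun j v hv => ?_) v
  obtain ⟨a, ha⟩ := hlam j
  have h1 := hn a v
  have h2 : -(l j a x • 𝒟 h x v) + lam a • 𝒟 h x v = (lam a - l j a x) • 𝒟 h x v := by module
  rw [T.D_zeta x hx j v hv, h2, real_inner_smul_left, real_inner_comm] at h1
  exact (mul_eq_zero.1 h1).resolve_left (sub_ne_zero.2 ha.symm)

theorem D_zeta_mem (T : IsNetOn O h ζ l Δ) {x : X} (hx : x ∈ O) (a : Fin r) (v : X) :
    𝒟 (ζ a) x v ∈ tangent 𝓘(ℝ, X) h x :=
  mem_of_iSup_eq_top (T.iSup_eq x hx) (fun j w hw => by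
    rw [T.D_zeta x hx j w hw]
    exact Submodule.neg_mem _ (Submodule.smul_mem _ _ (D_mem_tangent h x w))) v

end IsNetOn

end

/-! ### Pencils of leaves: construction of φ, F and the frame ξ. -/

section

variable {X : Type*} [NormedAddCommGroup X] [NormedSpace ℝ X] [FiniteDimensional ℝ X]
  {E : Type*} [NormedAddCommGroup E] [InnerProductSpace ℝ E] [FiniteDimensional ℝ E]
  {k r s : ℕ}

local notation "SmoothOn" => ContMDiffOn 𝓘(ℝ, X) 𝓘(ℝ, E) ∞

local notation "𝒟" => D 𝓘(ℝ, X)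

/-- The function `φ` determined by the leaves `g` over `h`. -/
noncomputable def pencilPhi (h : X → E) (g : Option (Fin s) → X → E) (i₀ : Fin s) (x : X) : ℝ :=
  ‖nu h (g (some i₀)) x - nu h (g none) x‖⁻¹

/-- The maps `-2 φ ν` determined by the leaves `g` over `h`. -/
noncomputable def pencilF (h : X → E) (g : Option (Fin s) → X → E) (i₀ : Fin s)
    (c : Option (Fin s)) (x : X) : E :=
  (-2 * pencilPhi h g i₀ x) • nu h (g c) x

/-- The normal frame determined by the leaves `g` over `h`. -/
noncomputable def pencilXi (h : X → E) (g : Option (Fin s) → X → E) (i₀ : Fin s)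
    (i : Fin s) (x : X) : E :=
  (1 / 2 : ℝ) • (pencilF h g i₀ none x - pencilF h g i₀ (some i) x)

/-- A net `h` together with `s + 1` further immersions `g c`, such that the reflections of the
normal frame are normal to `g c`. -/
structure IsPencilOn (O : Set X) (h : X → E) (ζ : Fin r → X → E) (lam : Fin r → X → ℝ)
    (l : Fin k → Fin r → X → ℝ) (Δ : Fin k → X → Submodule ℝ X) (g : Option (Fin s) → X → E)
    (i₀ : Fin s) (x₀ : X) : Prop where
  isOpen : IsOpen O
  preconnected : IsPreconnected O
  base_mem : x₀ ∈ O
  net : IsNetOn O h ζ l Δ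
  smooth_lam : ∀ a, ContMDiffOn 𝓘(ℝ, X) 𝓘(ℝ, ℝ) ∞ (lam a) O
  ne_lam : ∀ x ∈ O, ∀ j, ∃ a, l j a x ≠ lam a x
  dim : Module.finrank ℝ X + (r + s) = Module.finrank ℝ E
  smooth_g : ∀ c, SmoothOn (g c) O
  ne : ∀ c, ∀ x ∈ O, g c x ≠ h x
  inner_eq : ∀ c a, ∀ x ∈ O, 2 * ⟪g c x - h x, ζ a x⟫_ℝ = lam a x * ‖g c x - h x‖ ^ 2
  inner_D' : ∀ c a, ∀ x ∈ O, ∀ v, ⟪ζ a x - lam a x • (g c x - h x), 𝒟 (g c) x v⟫_ℝ = 0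
  mirror_mem : ∀ c, ∀ x ∈ O, ∀ v, mirror (g c x - h x) (𝒟 (g c) x v) ∈ tangent 𝓘(ℝ, X) h x
  nu_ne : ∀ x ∈ O, nu h (g (some i₀)) x ≠ nu h (g none) x
  gram : ∀ i j, ⟪nu h (g (some i)) x₀ - nu h (g none) x₀, nu h (g (some j)) x₀ - nu h (g none) x₀⟫_ℝ
    = if i = j then ‖nu h (g (some i₀)) x₀ - nu h (g none) x₀‖ ^ 2 else 0

theorem contMDiffOn_nu {O : Set X} {h g : X → E} (hh : SmoothOn h O) (hg : SmoothOn g O)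
    (hne : ∀ x ∈ O, g x ≠ h x) : SmoothOn (nu h g) O := by
  have h1 : ContMDiffOn 𝓘(ℝ, X) 𝓘(ℝ, ℝ) ∞ (fun x => ‖g x - h x‖ ^ 2) O :=
    (contDiff_norm_sq ℝ).contMDiff.comp_contMDiffOn (hg.sub hh)
  exact (h1.inv₀ fun x hx =>
    pow_ne_zero 2 (norm_ne_zero_iff.2 (sub_ne_zero.2 (hne x hx)))).smul (hg.sub hh)

namespace IsPencilOn

variable {O : Set X} {h : X → E} {ζ : Fin r → X → E} {lam : Fin r → X → ℝ}
  {l : Fin k → Fin r → X → ℝ} {Δ : Fin k → X → Submodule ℝ X} {g : Option (Fin s) → X → E}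
  {i₀ : Fin s} {x₀ x : X}

theorem hasPush {F : Type*} [NormedAddCommGroup F] [NormedSpace ℝ F] {a : X → F}
    (T : IsPencilOn O h ζ lam l Δ g i₀ x₀) (ha : ContMDiffOn 𝓘(ℝ, X) 𝓘(ℝ, F) ∞ a O) (hx : x ∈ O) :
    HasPush 𝓘(ℝ, X) a x (𝒟 a x) := ha.hasPush T.isOpen hx

theorem isTwinAt (T : IsPencilOn O h ζ lam l Δ g i₀ x₀) (hx : x ∈ O) (c : Option (Fin s))
    (a : Fin r) : IsTwinAt h (g c) (ζ a) (lam a) x where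
  mdiff_base := (T.hasPush T.net.immersion.1 hx).mdifferentiableAt
  mdiff_twin := (T.hasPush (T.smooth_g c) hx).mdifferentiableAt
  mdiff_zeta := (T.hasPush (T.net.smooth_zeta a) hx).mdifferentiableAt
  mdiff_lam := (T.hasPush (T.smooth_lam a) hx).mdifferentiableAt
  inner_eq := Filter.eventually_of_mem (T.isOpen.mem_nhds hx) fun y hy => T.inner_eq c a y hy
  inner_D := T.net.zeta_normal x hx a
  inner_D' := T.inner_D' c a x hx

theorem smooth_nu (T : IsPencilOn O h ζ lam l Δ g i₀ x₀) (c : Option (Fin s)) :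
    SmoothOn (nu h (g c)) O :=
  contMDiffOn_nu T.net.immersion.1 (T.smooth_g c) (T.ne c)

theorem smooth_phi (T : IsPencilOn O h ζ lam l Δ g i₀ x₀) :
    ContMDiffOn 𝓘(ℝ, X) 𝓘(ℝ, ℝ) ∞ (pencilPhi h g i₀) O := by
  have h1 : ContMDiffOn 𝓘(ℝ, X) 𝓘(ℝ, ℝ) ∞
      (fun x => ‖nu h (g (some i₀)) x - nu h (g none) x‖) O := by
    rw [contMDiffOn_iff_contDiffOn]
    exact (((T.smooth_nu (some i₀)).sub (T.smooth_nu none)).contDiffOn).norm ℝ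
      fun x hx => sub_ne_zero.2 (T.nu_ne x hx)
  exact h1.inv₀ fun x hx => norm_ne_zero_iff.2 (sub_ne_zero.2 (T.nu_ne x hx))

theorem phi_pos (T : IsPencilOn O h ζ lam l Δ g i₀ x₀) (hx : x ∈ O) : 0 < pencilPhi h g i₀ x :=
  inv_pos.2 (norm_pos_iff.2 (sub_ne_zero.2 (T.nu_ne x hx)))

theorem smooth_F (T : IsPencilOn O h ζ lam l Δ g i₀ x₀) (c : Option (Fin s)) :
    SmoothOn (pencilF h g i₀ c) O :=
  (contMDiffOn_const (I := 𝓘(ℝ, X)) (I' := 𝓘(ℝ, ℝ)) (c := (-2 : ℝ))).mul T.smooth_phi |>.smul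
    (T.smooth_nu c)

theorem smooth_xi (T : IsPencilOn O h ζ lam l Δ g i₀ x₀) (i : Fin s) :
    SmoothOn (pencilXi h g i₀ i) O :=
  (contMDiffOn_const (I := 𝓘(ℝ, X)) (I' := 𝓘(ℝ, ℝ)) (c := (1 / 2 : ℝ))).smul ((T.smooth_F none).sub (T.smooth_F (some i)))

theorem norm_ne_zero (T : IsPencilOn O h ζ lam l Δ g i₀ x₀) (hx : x ∈ O) (c : Option (Fin s)) :
    ‖g c x - h x‖ ^ 2 ≠ 0 := pow_ne_zero 2 (norm_ne_zero_iff.2 (sub_ne_zero.2 (T.ne c x hx)))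

theorem nu_ne_zero (T : IsPencilOn O h ζ lam l Δ g i₀ x₀) (hx : x ∈ O) (c : Option (Fin s)) :
    nu h (g c) x ≠ 0 :=
  smul_ne_zero (inv_ne_zero (T.norm_ne_zero hx c)) (sub_ne_zero.2 (T.ne c x hx))

/-- For each leaf 2⟨dζ_a + λ_a dh, ν⟩ = dλ_a, whose right side does not involve the leaf, and the
vectors dζ_a + λ_a dh span the tangent space. -/
theorem inner_nu_D (T : IsPencilOn O h ζ lam l Δ g i₀ x₀) (hx : x ∈ O) (c : Option (Fin s)) (v : X) :
    ⟪nu h (g c) x, 𝒟 h x v⟫_ℝ = ⟪nu h (g none) x, 𝒟 h x v⟫_ℝ := by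
  rw [← sub_eq_zero, ← inner_sub_left]
  refine T.net.inner_D_eq_zero hx (lam := fun a => lam a x) (T.ne_lam x hx) (fun a v => ?_) v
  have h1 := (T.isTwinAt hx c a).two_inner_nu_eq (T.ne c x hx) v
  have h2 := (T.isTwinAt hx none a).two_inner_nu_eq (T.ne none x hx) v
  rw [inner_sub_right]
  linarith

theorem inner_nu_zeta (T : IsPencilOn O h ζ lam l Δ g i₀ x₀) (hx : x ∈ O) (c : Option (Fin s))
    (a : Fin r) : 2 * ⟪nu h (g c) x, ζ a x⟫_ℝ = lam a x := by
  have h0 := T.norm_ne_zero hx c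
  rw [nu, real_inner_smul_left, mul_left_comm, T.inner_eq c a x hx, mul_comm, mul_assoc,
    mul_inv_cancel₀ h0, mul_one]

theorem exists_D_nu (T : IsPencilOn O h ζ lam l Δ g i₀ x₀) (hx : x ∈ O) (c : Option (Fin s)) (v : X) :
    𝒟 (nu h (g c)) x v = (2 * ⟪nu h (g none) x, 𝒟 h x v⟫_ℝ) • nu h (g c) x
      + (‖g c x - h x‖ ^ 2)⁻¹ • (mirror (g c x - h x) (𝒟 (g c) x v) - 𝒟 h x v) := by
  rw [D_nu (T.hasPush T.net.immersion.1 hx).mdifferentiableAt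
    (T.hasPush (T.smooth_g c) hx).mdifferentiableAt (T.ne c x hx), T.inner_nu_D hx]

/-- The difference w of two inversions is normal to h. By the formula for dν, the derivative of w is
2⟨ν, dh⟩ w up to tangent terms, so ‖w‖ grows at the rate 2⟨ν, dh⟩ and φ = ‖w‖⁻¹ decays at that rate.
-/
theorem D_phi (T : IsPencilOn O h ζ lam l Δ g i₀ x₀) (hx : x ∈ O) (v : X) :
    𝒟 (pencilPhi h g i₀) x v
      = -(2 * ⟪nu h (g none) x, 𝒟 h x v⟫_ℝ * pencilPhi h g i₀ x) := by
  set w := fun y => nu h (g (some i₀)) y - nu h (g none) y with hw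
  have hw0 : ∀ y ∈ O, ‖w y‖ ≠ 0 := fun y hy => norm_ne_zero_iff.2 (sub_ne_zero.2 (T.nu_ne y hy))
  have hwp := (T.hasPush (T.smooth_nu (some i₀)) hx).sub (T.hasPush (T.smooth_nu none) hx)
  have hφ := T.hasPush T.smooth_phi hx
  have h1 := (hφ.mul hφ).mul (hwp.inner hwp)
  have h2 : HasPush 𝓘(ℝ, X) (fun y => pencilPhi h g i₀ y * pencilPhi h g i₀ y * ⟪w y, w y⟫_ℝ) x
      (0 : X →L[ℝ] ℝ) := by
    refine (hasPush_const (1 : ℝ) x).congr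
      (Filter.eventually_of_mem (T.isOpen.mem_nhds hx) fun y hy => ?_)
    have := hw0 y hy
    change ‖w y‖⁻¹ * ‖w y‖⁻¹ * ⟪w y, w y⟫_ℝ = 1
    rw [real_inner_self_eq_norm_sq]
    field_simp
  have h3 := congrArg (fun A : X →L[ℝ] ℝ => A v) (h1.unique h2)
  have hwT : ∀ t ∈ tangent 𝓘(ℝ, X) h x, ⟪w x, t⟫_ℝ = 0 := by
    rintro _ ⟨u, rfl⟩
    have := T.inner_nu_D hx (some i₀) u
    change ⟪w x, 𝒟 h x u⟫_ℝ = 0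
    rw [hw, inner_sub_left, this, sub_self]
  have ht : ∀ c, ⟪w x, (‖g c x - h x‖ ^ 2)⁻¹ • (mirror (g c x - h x) (𝒟 (g c) x v) - 𝒟 h x v)⟫_ℝ = 0 :=
    fun c => hwT _ (Submodule.smul_mem _ _
      (Submodule.sub_mem _ (T.mirror_mem c x hx v) (D_mem_tangent h x v)))
  have h4 : ⟪w x, 𝒟 (nu h (g (some i₀))) x v - 𝒟 (nu h (g none)) x v⟫_ℝ
      = 2 * ⟪nu h (g none) x, 𝒟 h x v⟫_ℝ * ⟪w x, w x⟫_ℝ := by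
    rw [T.exists_D_nu hx, T.exists_D_nu hx none]
    rw [inner_sub_right, inner_add_right, inner_add_right, ht, ht, add_zero, add_zero,
      ← inner_sub_right, ← smul_sub, real_inner_smul_right]
  simp only [add_apply, smul_apply, sub_apply, ContinuousLinearMap.comp_apply,
    innerSL_apply_apply, smul_eq_mul, zero_apply] at h3
  change _ * (⟪w x, _⟫_ℝ + ⟪w x, _⟫_ℝ) + ⟪w x, w x⟫_ℝ * _ = 0 at h3
  rw [h4] at h3
  have h5 : 2 * pencilPhi h g i₀ x * ⟪w x, w x⟫_ℝ ≠ 0 := by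
    rw [real_inner_self_eq_norm_sq]
    exact mul_ne_zero (mul_ne_zero two_ne_zero (T.phi_pos hx).ne') (pow_ne_zero 2 (hw0 x hx))
  refine mul_left_cancel₀ h5 ?_
  linear_combination h3

/-- The factor φ is chosen so that its derivative cancels the term of dν proportional to ν, leaving
only tangent vectors. -/
theorem D_F (T : IsPencilOn O h ζ lam l Δ g i₀ x₀) (hx : x ∈ O) (c : Option (Fin s)) (v : X) :
    𝒟 (pencilF h g i₀ c) x v = (2 * pencilPhi h g i₀ x * (‖g c x - h x‖ ^ 2)⁻¹) •
      (𝒟 h x v - mirror (g c x - h x) (𝒟 (g c) x v)) := by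
  have h1 := ((T.hasPush T.smooth_phi hx).const_mul (-2)).smul (T.hasPush (T.smooth_nu c) hx)
  have h2 : 𝒟 (pencilF h g i₀ c) x v = _ := congrArg (fun A : X →L[ℝ] E => A v) h1.eq
  rw [h2]
  simp only [add_apply, smul_apply, ContinuousLinearMap.smulRight_apply, T.D_phi hx,
    T.exists_D_nu hx c, smul_eq_mul]
  module

theorem D_F_mem (T : IsPencilOn O h ζ lam l Δ g i₀ x₀) (hx : x ∈ O) (c : Option (Fin s)) (v : X) :
    𝒟 (pencilF h g i₀ c) x v ∈ tangent 𝓘(ℝ, X) h x := by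
  rw [T.D_F hx]
  exact Submodule.smul_mem _ _ (Submodule.sub_mem _ (D_mem_tangent h x v) (T.mirror_mem c x hx v))

theorem D_xi (T : IsPencilOn O h ζ lam l Δ g i₀ x₀) (hx : x ∈ O) (i : Fin s) (v : X) :
    𝒟 (pencilXi h g i₀ i) x v
      = (1 / 2 : ℝ) • (𝒟 (pencilF h g i₀ none) x v - 𝒟 (pencilF h g i₀ (some i)) x v) := by
  have h1 := ((T.hasPush (T.smooth_F none) hx).sub (T.hasPush (T.smooth_F (some i)) hx)).const_smul
    (1 / 2)
  exact congrArg (fun A : X →L[ℝ] E => A v) h1.eq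

theorem D_xi_mem (T : IsPencilOn O h ζ lam l Δ g i₀ x₀) (hx : x ∈ O) (i : Fin s) (v : X) :
    𝒟 (pencilXi h g i₀ i) x v ∈ tangent 𝓘(ℝ, X) h x := by
  rw [T.D_xi hx]
  exact Submodule.smul_mem _ _ (Submodule.sub_mem _ (T.D_F_mem hx _ v) (T.D_F_mem hx _ v))

theorem inner_F_D (T : IsPencilOn O h ζ lam l Δ g i₀ x₀) (hx : x ∈ O) (c : Option (Fin s)) (v : X) :
    ⟪pencilF h g i₀ c x, 𝒟 h x v⟫_ℝ = 𝒟 (pencilPhi h g i₀) x v := by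
  rw [pencilF, real_inner_smul_left, T.inner_nu_D hx, T.D_phi hx]
  ring

theorem inner_F_zeta (T : IsPencilOn O h ζ lam l Δ g i₀ x₀) (hx : x ∈ O) (c : Option (Fin s))
    (a : Fin r) : ⟪pencilF h g i₀ c x, ζ a x⟫_ℝ = -(pencilPhi h g i₀ x * lam a x) := by
  rw [pencilF, real_inner_smul_left, ← T.inner_nu_zeta hx c a]
  ring

theorem inner_xi_D (T : IsPencilOn O h ζ lam l Δ g i₀ x₀) (hx : x ∈ O) (i : Fin s) (v : X) :
    ⟪pencilXi h g i₀ i x, 𝒟 h x v⟫_ℝ = 0 := by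
  rw [pencilXi, real_inner_smul_left, inner_sub_left, T.inner_F_D hx, T.inner_F_D hx, sub_self,
    mul_zero]

theorem inner_xi_zeta (T : IsPencilOn O h ζ lam l Δ g i₀ x₀) (hx : x ∈ O) (i : Fin s) (a : Fin r) :
    ⟪pencilXi h g i₀ i x, ζ a x⟫_ℝ = 0 := by
  rw [pencilXi, real_inner_smul_left, inner_sub_left, T.inner_F_zeta hx, T.inner_F_zeta hx, sub_self,
    mul_zero]

theorem xi_eq (i : Fin s) (x : X) : pencilXi h g i₀ i x
    = pencilPhi h g i₀ x • (nu h (g (some i)) x - nu h (g none) x) := by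
  rw [pencilXi, pencilF, pencilF]; module

/-- The ξ_i are normal with tangent derivatives, so their inner products are constant on the
connected set O; at x₀ they are prescribed by `gram`. -/
theorem inner_xi_xi (T : IsPencilOn O h ζ lam l Δ g i₀ x₀) (hx : x ∈ O) (i j : Fin s) :
    ⟪pencilXi h g i₀ i x, pencilXi h g i₀ j x⟫_ℝ = if i = j then 1 else 0 := by
  have h1 : ∀ y ∈ O, HasPush 𝓘(ℝ, X) (fun y => ⟪pencilXi h g i₀ i y, pencilXi h g i₀ j y⟫_ℝ) y 0 := by
    intro y hy
    refine hasPush_inner_of_orthogonal T.isOpen (T.smooth_xi i) (T.smooth_xi j) hy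
      (fun v => ?_) (fun v => ?_)
    · obtain ⟨w, hw⟩ := T.D_xi_mem hy i v
      rw [← hw]; exact T.inner_xi_D hy j w
    · obtain ⟨w, hw⟩ := T.D_xi_mem hy j v
      rw [← hw]; exact T.inner_xi_D hy i w
  have h2 : ⟪pencilXi h g i₀ i x, pencilXi h g i₀ j x⟫_ℝ
      = ⟪pencilXi h g i₀ i x₀, pencilXi h g i₀ j x₀⟫_ℝ :=
    T.isOpen.is_const_of_fderiv_eq_zero T.preconnected
      (f := fun y => ⟪pencilXi h g i₀ i y, pencilXi h g i₀ j y⟫_ℝ)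
      (fun y hy => (hasPush_id_iff.1 (h1 y hy)).differentiableAt.differentiableWithinAt)
      (fun y hy => (hasPush_id_iff.1 (h1 y hy)).fderiv) hx T.base_mem
  rw [h2, xi_eq, xi_eq, real_inner_smul_left, real_inner_smul_right, T.gram]
  have h0 : ‖nu h (g (some i₀)) x₀ - nu h (g none) x₀‖ ≠ 0 :=
    norm_ne_zero_iff.2 (sub_ne_zero.2 (T.nu_ne x₀ T.base_mem))
  split_ifs
  · rw [pencilPhi]; field_simp
  · simp

/-- The family of all derivatives which are to be diagonalized. -/
noncomputable def family (ζ : Fin r → X → E) (h : X → E) (g : Option (Fin s) → X → E) (i₀ : Fin s)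
    (x : X) : Fin r ⊕ Option (Fin s) → X →L[ℝ] E :=
  Sum.elim (fun a => 𝒟 (ζ a) x) fun c => 𝒟 (pencilF h g i₀ c) x

theorem inner_D_symm_of_smooth (T : IsPencilOn O h ζ lam l Δ g i₀ x₀) (hx : x ∈ O) {a b : X → E}
    {θ : X → ℝ} (ha : SmoothOn a O) (hb : SmoothOn b O)
    (hθ : ContMDiffOn 𝓘(ℝ, X) 𝓘(ℝ, ℝ) ∞ θ O)
    (e : ∀ y ∈ O, ∀ v, ⟪a y, 𝒟 b y v⟫_ℝ = 𝒟 θ y v) (v w : X) :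
    ⟪𝒟 a x v, 𝒟 b x w⟫_ℝ = ⟪𝒟 a x w, 𝒟 b x v⟫_ℝ :=
  inner_D_symm ((ha x hx).contMDiffAt (T.isOpen.mem_nhds hx))
    ((hb x hx).contMDiffAt (T.isOpen.mem_nhds hx)) ((hθ x hx).contMDiffAt (T.isOpen.mem_nhds hx))
    (Filter.eventually_of_mem (T.isOpen.mem_nhds hx) e) v w

theorem D_const_zero (y v : X) : 𝒟 (fun _ : X => (0 : ℝ)) y v = 0 := by
  rw [(hasPush_const (I := 𝓘(ℝ, X)) (0 : ℝ) y).eq, zero_apply]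

theorem inner_normal_D {n : E} {b : X → E} {v : X} (hn : ∀ v, ⟪n, 𝒟 h x v⟫_ℝ = 0)
    (hb : 𝒟 b x v ∈ tangent 𝓘(ℝ, X) h x) : ⟪n, 𝒟 b x v⟫_ℝ = 0 := by
  obtain ⟨w, hw⟩ := hb
  rw [← hw]
  exact hn w

/-- All symmetries come from `inner_D_symm`. The forms ⟨ζ_a, db⟩ vanish when db is tangent, ⟨F_c,
dh⟩ = dφ, and ⟨F_c, dF_{c'}⟩ is half the differential of ‖F_{c'}‖² because F_c - F_{c'} is normal
and dF_{c'} is tangent. -/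
theorem iSup_family (T : IsPencilOn O h ζ lam l Δ g i₀ x₀) (hx : x ∈ O) :
    ⨆ c, jointEigenspace (𝒟 h x) (family ζ h g i₀ x) c = ⊤ := by
  have hz : ∀ a (b : X → E), SmoothOn b O → (∀ y ∈ O, ∀ v, 𝒟 b y v ∈ tangent 𝓘(ℝ, X) h y) →
      ∀ v w, ⟪𝒟 (ζ a) x v, 𝒟 b x w⟫_ℝ = ⟪𝒟 (ζ a) x w, 𝒟 b x v⟫_ℝ := fun a b hb hb' v w =>
    T.inner_D_symm_of_smooth hx (T.net.smooth_zeta a) hb (contMDiffOn_const (c := (0 : ℝ)))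
      (fun y hy v => by
        rw [D_const_zero]
        exact inner_normal_D (T.net.zeta_normal y hy a) (hb' y hy v)) v w
  refine iSup_jointEigenspace (T.net.immersion.injective hx) ?_ ?_ ?_
  · rintro (a | c) v
    · exact T.net.D_zeta_mem hx a v
    · exact T.D_F_mem hx c v
  · rintro (a | c) v w
    · exact hz a h T.net.immersion.1 (fun y _ v => D_mem_tangent h y v) v w
    · exact T.inner_D_symm_of_smooth hx (T.smooth_F c) T.net.immersion.1 T.smooth_phi
        (fun y hy v => T.inner_F_D hy c v) v w
  · rintro (a | c) (b | c') v w
    · exact hz a _ (T.net.smooth_zeta b) (fun y hy v => T.net.D_zeta_mem hy b v) v w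
    · exact hz a _ (T.smooth_F c') (fun y hy v => T.D_F_mem hy c' v) v w
    · have := hz b _ (T.smooth_F c) (fun y hy v => T.D_F_mem hy c v) w v
      rw [real_inner_comm] at this
      exact this.trans (real_inner_comm _ _)
    · refine T.inner_D_symm_of_smooth hx (T.smooth_F c) (T.smooth_F c')
        (θ := fun y => (1 / 2) * ⟪pencilF h g i₀ c' y, pencilF h g i₀ c' y⟫_ℝ)
        ((contMDiffOn_const (c := (1 / 2 : ℝ))).mul
          (contMDiffOn_inner (T.smooth_F c') (T.smooth_F c'))) (fun y hy u => ?_) v w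
      have hF := T.hasPush (T.smooth_F c') hy
      have h1 : ⟪pencilF h g i₀ c y - pencilF h g i₀ c' y, 𝒟 (pencilF h g i₀ c') y u⟫_ℝ = 0 :=
        inner_normal_D (fun v => by
          rw [inner_sub_left, T.inner_F_D hy, T.inner_F_D hy, sub_self]) (T.D_F_mem hy c' u)
      rw [((hF.inner hF).const_mul (1 / 2)).eq]
      simp only [smul_apply, add_apply, ContinuousLinearMap.comp_apply, innerSL_apply_apply,
        smul_eq_mul]
      rw [inner_sub_left] at h1
      linarith

end IsPencilOn

end

/-! ### Adapted product coordinates, and leaves of the conullity as graphs. -/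

section

variable {X : Type*} [NormedAddCommGroup X] [NormedSpace ℝ X] [FiniteDimensional ℝ X]
  {Y : Type*} [NormedAddCommGroup Y] [NormedSpace ℝ Y] [FiniteDimensional ℝ Y]
  {E : Type*} [NormedAddCommGroup E] [InnerProductSpace ℝ E] [FiniteDimensional ℝ E]
  {F : Type*} [NormedAddCommGroup F] [NormedSpace ℝ F]
  {k r s : ℕ}

local notation "𝒟" => D 𝓘(ℝ, X)
local notation "𝒟'" => D 𝓘(ℝ, X × Y)

/-- The product `A × C` carries an immersion `f` with parallel normal frame `ζ`, whose second
fundamental form is diagonal in the net formed by the `Δ j` and the vertical subspaces. -/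
structure IsAdaptedOn (A : Set X) (C : Set Y) (f : X × Y → E) (ζ : Fin r → X × Y → E)
    (lam : Fin r → X × Y → ℝ) (l : Fin k → Fin r → X × Y → ℝ)
    (Δ : Fin k → X × Y → Submodule ℝ (X × Y)) : Prop where
  isOpen_left : IsOpen A
  isOpen_right : IsOpen C
  preconnected : IsPreconnected C
  immersion : IsImmersionOn 𝓘(ℝ, X × Y) (A ×ˢ C) f
  injOn : Set.InjOn f (A ×ˢ C)
  smooth_zeta : ∀ a, ContMDiffOn 𝓘(ℝ, X × Y) 𝓘(ℝ, E) ∞ (ζ a) (A ×ˢ C)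
  smooth_lam : ∀ a, ContMDiffOn 𝓘(ℝ, X × Y) 𝓘(ℝ, ℝ) ∞ (lam a) (A ×ˢ C)
  smooth_l : ∀ j a, ContMDiffOn 𝓘(ℝ, X × Y) 𝓘(ℝ, ℝ) ∞ (l j a) (A ×ˢ C)
  orthonormal : ∀ p ∈ A ×ˢ C, Orthonormal ℝ fun a => ζ a p
  zeta_normal : ∀ p ∈ A ×ˢ C, ∀ a v, ⟪ζ a p, 𝒟' f p v⟫_ℝ = 0
  dim : Module.finrank ℝ X + (r + Module.finrank ℝ Y) = Module.finrank ℝ E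
  vert_zeta : ∀ p ∈ A ×ˢ C, ∀ a w, 𝒟' (ζ a) p (0, w) = -(lam a p • 𝒟' f p (0, w))
  vert_lam : ∀ p ∈ A ×ˢ C, ∀ a w, 𝒟' (lam a) p (0, w) = 0
  D_zeta : ∀ p ∈ A ×ˢ C, ∀ j, ∀ v ∈ Δ j p, ∀ a, 𝒟' (ζ a) p v = -(l j a p • 𝒟' f p v)
  D_l : ∀ p ∈ A ×ˢ C, ∀ j, ∀ v ∈ Δ j p, ∀ a, 𝒟' (l j a) p v = 0
  ortho_vert : ∀ p ∈ A ×ˢ C, ∀ j, ∀ v ∈ Δ j p, ∀ w, ⟪𝒟' f p v, 𝒟' f p (0, w)⟫_ℝ = 0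
  ortho : ∀ p ∈ A ×ˢ C, ∀ i j, i ≠ j → ∀ v ∈ Δ i p, ∀ w ∈ Δ j p, ⟪𝒟' f p v, 𝒟' f p w⟫_ℝ = 0
  iSup_eq : ∀ p ∈ A ×ˢ C, (⨆ j, Δ j p) ⊔ LinearMap.range (LinearMap.inr ℝ X Y) = ⊤
  rank : ∀ j, ∃ t, 1 ≤ t ∧ ∀ p ∈ A ×ˢ C, Module.finrank ℝ (Δ j p) = t
  distinct : ∀ p ∈ A ×ˢ C, ∀ i j, (∀ a, l i a p = l j a p) → i = j
  ne_lam : ∀ p ∈ A ×ˢ C, ∀ j, ∃ a, l j a p ≠ lam a p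

/-- The graph of `q` is an integral manifold of the orthogonal complement of the vertical
subspaces. -/
structure IsLeafOn (A : Set X) (C : Set Y) (f : X × Y → E) (O : Set X) (q : X → Y) : Prop where
  isOpen : IsOpen O
  smooth : ContMDiffOn 𝓘(ℝ, X) 𝓘(ℝ, Y) ∞ q O
  mem : ∀ x ∈ O, (x, q x) ∈ A ×ˢ C
  ortho : ∀ x ∈ O, ∀ v w, ⟪𝒟' f (x, q x) (v, 𝒟 q x v), 𝒟' f (x, q x) (0, w)⟫_ℝ = 0

theorem IsLeafOn.mono {A : Set X} {C : Set Y} {f : X × Y → E} {O O' : Set X} {q : X → Y}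
    (L : IsLeafOn A C f O q) (hO' : IsOpen O') (h : O' ⊆ O) : IsLeafOn A C f O' q :=
  ⟨hO', L.smooth.mono h, fun x hx => L.mem x (h hx), fun x hx => L.ortho x (h hx)⟩

/-- The restriction of a function to a graph. -/
def onGraph (q : X → Y) (a : X × Y → F) (x : X) : F := a (x, q x)

/-- The net induced on a graph. -/
noncomputable def graphNet (q : X → Y) (Δ : Fin k → X × Y → Submodule ℝ (X × Y)) (j : Fin k) (x : X) :
    Submodule ℝ X :=
  (Δ j (x, q x)).comap ((LinearMap.id : X →ₗ[ℝ] X).prod (𝒟 q x : X →ₗ[ℝ] Y))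

theorem mem_graphNet {q : X → Y} {Δ : Fin k → X × Y → Submodule ℝ (X × Y)} {j : Fin k} {x v : X} :
    v ∈ graphNet q Δ j x ↔ (v, 𝒟 q x v) ∈ Δ j (x, q x) := Iff.rfl

variable {A : Set X} {C : Set Y} {f : X × Y → E} {ζ : Fin r → X × Y → E}
    {lam : Fin r → X × Y → ℝ} {l : Fin k → Fin r → X × Y → ℝ}
    {Δ : Fin k → X × Y → Submodule ℝ (X × Y)} {O : Set X} {q : X → Y}

theorem hasPush_comp_pair {a : X × Y → F} {q : X → Y} {x : X} {q' : X →L[ℝ] Y}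
    {a' : X × Y →L[ℝ] F} (hq : HasPush 𝓘(ℝ, X) q x q')
    (ha : HasPush 𝓘(ℝ, X × Y) a (x, q x) a') :
    HasPush 𝓘(ℝ, X) (onGraph q a) x (a'.comp ((ContinuousLinearMap.id ℝ X).prod q')) :=
  have h : HasMFDerivAt 𝓘(ℝ, X) 𝓘(ℝ, X × Y) (fun x => (x, q x)) x
      ((ContinuousLinearMap.id ℝ X).prod q') := (hasPush_id_iff.2 (hasFDerivAt_id x)).prodMk hq
  HasPush.comp (g := fun x => (x, q x)) ha h

theorem hasPush_comp_right {a : X × Y → F} {x : X} {y : Y} {a' : X × Y →L[ℝ] F}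
    (ha : HasPush 𝓘(ℝ, X × Y) a (x, y) a') :
    HasPush 𝓘(ℝ, Y) (fun z => a (x, z)) y (a'.comp (ContinuousLinearMap.inr ℝ X Y)) :=
  HasPush.comp ha ((hasPush_const x y).prodMk (hasPush_id_iff.2 (hasFDerivAt_id y)))

namespace IsAdaptedOn

variable (T : IsAdaptedOn A C f ζ lam l Δ)
include T

theorem isOpen : IsOpen (A ×ˢ C) := T.isOpen_left.prod T.isOpen_right

theorem eq_of_vert {a : X × Y → F} (ha : ContMDiffOn 𝓘(ℝ, X × Y) 𝓘(ℝ, F) ∞ a (A ×ˢ C))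
    (h0 : ∀ p ∈ A ×ˢ C, ∀ w, 𝒟' a p (0, w) = 0) {x : X} (hx : x ∈ A) {y y' : Y} (hy : y ∈ C)
    (hy' : y' ∈ C) : a (x, y) = a (x, y') := by
  have h1 : ∀ z ∈ C, HasFDerivAt (fun z => a (x, z)) (0 : Y →L[ℝ] F) z := by
    intro z hz
    have h2 := hasPush_comp_right (ha.hasPush T.isOpen (x := (x, z)) ⟨hx, hz⟩)
    have h3 : (𝒟' a (x, z)).comp (ContinuousLinearMap.inr ℝ X Y) = 0 := by
      ext w
      exact h0 _ ⟨hx, hz⟩ w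
    rw [h3] at h2
    exact hasPush_id_iff.1 h2
  exact T.isOpen_right.is_const_of_fderiv_eq_zero T.preconnected (f := fun z => a (x, z))
    (fun z hz => (h1 z hz).differentiableAt.differentiableWithinAt)
    (fun z hz => (h1 z hz).fderiv) hy hy'

theorem lam_eq (a : Fin r) {x : X} (hx : x ∈ A) {y y' : Y} (hy : y ∈ C) (hy' : y' ∈ C) :
    lam a (x, y) = lam a (x, y') :=
  T.eq_of_vert (T.smooth_lam a) (fun p hp w => T.vert_lam p hp a w) hx hy hy'

/-- The vector ζ_a + λ_a f is constant along the fibres, since dζ_a = -λ_a df and dλ_a = 0 there. -/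
theorem zeta_eq (a : Fin r) {x : X} (hx : x ∈ A) {y y' : Y} (hy : y ∈ C) (hy' : y' ∈ C) :
    ζ a (x, y) = ζ a (x, y') - lam a (x, y') • (f (x, y) - f (x, y')) := by
  have h1 := T.eq_of_vert (a := fun p => ζ a p + lam a p • f p)
    ((T.smooth_zeta a).add ((T.smooth_lam a).smul T.immersion.1)) (fun p hp w => ?_) hx hy hy'
  · simp only [T.lam_eq a hx hy hy'] at h1
    rw [smul_sub]
    rw [eq_sub_of_add_eq h1]; abel
  · have h2 := ((T.smooth_zeta a).hasPush T.isOpen hp).add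
      (((T.smooth_lam a).hasPush T.isOpen hp).smul (T.immersion.1.hasPush T.isOpen hp))
    rw [h2.eq]
    simp only [add_apply, smul_apply, ContinuousLinearMap.smulRight_apply, T.vert_zeta p hp,
      T.vert_lam p hp]
    module

/-- The function 2⟨ζ_a, f⟩ + λ_a ‖f‖² is constant along the fibres. Together with `zeta_eq` it says
that ζ_a is reflected to itself along chords of a fibre. -/
theorem two_inner_eq (a : Fin r) {x : X} (hx : x ∈ A) {y y' : Y} (hy : y ∈ C) (hy' : y' ∈ C) :
    2 * ⟪f (x, y) - f (x, y'), ζ a (x, y')⟫_ℝ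
      = lam a (x, y') * ‖f (x, y) - f (x, y')‖ ^ 2 := by
  have h1 := T.eq_of_vert (a := fun p => 2 * ⟪ζ a p, f p⟫_ℝ + lam a p * ⟪f p, f p⟫_ℝ)
    (((contMDiffOn_const (c := (2 : ℝ))).mul (contMDiffOn_inner (T.smooth_zeta a) T.immersion.1)).add
      ((T.smooth_lam a).mul (contMDiffOn_inner T.immersion.1 T.immersion.1)))
    (fun p hp w => ?_) hx hy hy'
  · simp only [T.lam_eq a hx hy hy'] at h1
    rw [T.zeta_eq a hx hy hy', ← real_inner_self_eq_norm_sq] at *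
    simp only [inner_sub_left, inner_sub_right, real_inner_smul_left] at h1 ⊢
    rw [real_inner_comm (f (x, y)) (f (x, y')), real_inner_comm (ζ a (x, y')) (f (x, y)),
      real_inner_comm (ζ a (x, y')) (f (x, y'))]
    rw [real_inner_comm (f (x, y)) (f (x, y'))] at h1
    linarith
  · have hf := T.immersion.1.hasPush T.isOpen hp
    have h2 := ((((T.smooth_zeta a).hasPush T.isOpen hp).inner hf).const_mul 2).add
      (((T.smooth_lam a).hasPush T.isOpen hp).mul (hf.inner hf))
    rw [h2.eq]
    simp only [add_apply, smul_apply, ContinuousLinearMap.comp_apply, innerSL_apply_apply,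
      smul_eq_mul, T.vert_zeta p hp, T.vert_lam p hp, T.zeta_normal p hp, inner_neg_right,
      real_inner_smul_right]
    ring

theorem smooth_onGraph {a : X × Y → F} (ha : ContMDiffOn 𝓘(ℝ, X × Y) 𝓘(ℝ, F) ∞ a (A ×ˢ C))
    (L : IsLeafOn A C f O q) : ContMDiffOn 𝓘(ℝ, X) 𝓘(ℝ, F) ∞ (onGraph q a) O := by
  have h1 : ContMDiffOn 𝓘(ℝ, X) 𝓘(ℝ, X × Y) ∞ (fun x => (x, q x)) O := by
    rw [contMDiffOn_iff_contDiffOn]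
    exact contDiffOn_id.prodMk (contMDiffOn_iff_contDiffOn.1 L.smooth)
  exact ha.comp h1 L.mem

theorem D_onGraph {a : X × Y → F} (ha : ContMDiffOn 𝓘(ℝ, X × Y) 𝓘(ℝ, F) ∞ a (A ×ˢ C))
    (L : IsLeafOn A C f O q) {x : X} (hx : x ∈ O) (v : X) :
    𝒟 (onGraph q a) x v = 𝒟' a (x, q x) (v, 𝒟 q x v) := by
  rw [(hasPush_comp_pair (L.smooth.hasPush L.isOpen hx) (ha.hasPush T.isOpen (L.mem x hx))).eq]
  rfl

/-- A vector orthogonal to the vertical space and the tangent vector of the graph with the same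
first component differ by a vertical vector orthogonal to itself. -/
theorem eq_D_of_ortho (L : IsLeafOn A C f O q) {x : X} (hx : x ∈ O) {v : X × Y}
    (hv : ∀ w, ⟪𝒟' f (x, q x) v, 𝒟' f (x, q x) (0, w)⟫_ℝ = 0) : v.2 = 𝒟 q x v.1 := by
  have h1 : v - (v.1, 𝒟 q x v.1) = (0, v.2 - 𝒟 q x v.1) := by ext <;> simp
  have h2 : 𝒟' f (x, q x) (0, v.2 - 𝒟 q x v.1) = 0 := by
    rw [← inner_self_eq_zero (𝕜 := ℝ)]
    nth_rewrite 1 [← h1]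
    rw [map_sub, inner_sub_left, hv, L.ortho x hx, sub_zero]
  have h3 := T.immersion.injective (L.mem x hx) (h2.trans (map_zero _).symm)
  exact sub_eq_zero.1 (congrArg Prod.snd h3)

theorem mem_graphNet_of_mem (L : IsLeafOn A C f O q) {x : X} (hx : x ∈ O) {j : Fin k} {v : X × Y}
    (hv : v ∈ Δ j (x, q x)) : v.1 ∈ graphNet q Δ j x := by
  rw [mem_graphNet, ← T.eq_D_of_ortho L hx (T.ortho_vert _ (L.mem x hx) j v hv)]
  exact hv

theorem iSup_graphNet (L : IsLeafOn A C f O q) {x : X} (hx : x ∈ O) :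
    ⨆ j, graphNet q Δ j x = ⊤ := by
  have hp := L.mem x hx
  rw [eq_top_iff]
  rintro v -
  have h1 : (v, 𝒟 q x v) ∈ (⨆ j, Δ j (x, q x)) ⊔ LinearMap.range (LinearMap.inr ℝ X Y) := by
    rw [T.iSup_eq _ hp]; trivial
  obtain ⟨a, ha, b, ⟨w, rfl⟩, hab⟩ := Submodule.mem_sup.1 h1
  have h2 : a.1 = v := by simpa using congrArg Prod.fst hab
  rw [← h2]
  clear hab h1 h2 v
  induction ha using Submodule.iSup_induction' with
  | mem j v hv => exact Submodule.mem_iSup_of_mem j (T.mem_graphNet_of_mem L hx hv)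
  | zero => simp
  | add a b _ _ ha hb => exact Submodule.add_mem _ ha hb

theorem isNetOn (L : IsLeafOn A C f O q) : IsNetOn O (onGraph q f) (fun a => onGraph q (ζ a))
    (fun j a => onGraph q (l j a)) (graphNet q Δ) where
  immersion := by
    refine ⟨T.smooth_onGraph T.immersion.1 L, fun x hx => ?_⟩
    have h1 : Function.Injective (𝒟 (onGraph q f) x) := by
      intro v w hvw
      rw [T.D_onGraph T.immersion.1 L hx, T.D_onGraph T.immersion.1 L hx] at hvw
      exact congrArg Prod.fst (T.immersion.injective (L.mem x hx) hvw)
    exact h1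
  smooth_zeta a := T.smooth_onGraph (T.smooth_zeta a) L
  smooth_l j a := T.smooth_onGraph (T.smooth_l j a) L
  orthonormal x hx := T.orthonormal _ (L.mem x hx)
  zeta_normal x hx a v := by
    rw [T.D_onGraph T.immersion.1 L hx]
    exact T.zeta_normal _ (L.mem x hx) a _
  iSup_eq x hx := T.iSup_graphNet L hx
  ortho x hx i j hij v hv w hw := by
    rw [T.D_onGraph T.immersion.1 L hx, T.D_onGraph T.immersion.1 L hx]
    exact T.ortho _ (L.mem x hx) i j hij _ hv _ hw
  rank j := by
    obtain ⟨t, ht, h⟩ := T.rank j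
    refine ⟨t, ht, fun x hx => ?_⟩
    rw [← h _ (L.mem x hx)]
    set e : X →ₗ[ℝ] X × Y := (LinearMap.id : X →ₗ[ℝ] X).prod (𝒟 q x : X →ₗ[ℝ] Y) with he
    have h1 : (graphNet q Δ j x).map e = Δ j (x, q x) := by
      refine le_antisymm ?_ fun v hv => ⟨v.1, T.mem_graphNet_of_mem L hx hv, ?_⟩
      · rintro _ ⟨v, hv, rfl⟩
        exact hv
      · have := T.eq_D_of_ortho L hx (T.ortho_vert _ (L.mem x hx) j v hv)
        exact Prod.ext rfl this.symm
    rw [← h1]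
    exact (Submodule.equivMapOfInjective e (fun a b hab => congrArg Prod.fst hab) _).finrank_eq
  distinct x hx := T.distinct _ (L.mem x hx)
  D_zeta x hx j v hv a := by
    rw [T.D_onGraph T.immersion.1 L hx, T.D_onGraph (T.smooth_zeta a) L hx]
    exact T.D_zeta _ (L.mem x hx) j _ hv a
  D_l x hx j v hv a := by
    rw [T.D_onGraph (T.smooth_l j a) L hx]
    exact T.D_l _ (L.mem x hx) j _ hv a

theorem isTwinAt {q' : X → Y} {O' : Set X} (L : IsLeafOn A C f O q) (L' : IsLeafOn A C f O' q')
    {x : X} (hx : x ∈ O) (hx' : x ∈ O') (a : Fin r) :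
    IsTwinAt (onGraph q f) (onGraph q' f) (onGraph q (ζ a)) (onGraph q (lam a)) x where
  mdiff_base := ((T.smooth_onGraph T.immersion.1 L).hasPush L.isOpen hx).mdifferentiableAt
  mdiff_twin := ((T.smooth_onGraph T.immersion.1 L').hasPush L'.isOpen hx').mdifferentiableAt
  mdiff_zeta := ((T.smooth_onGraph (T.smooth_zeta a) L).hasPush L.isOpen hx).mdifferentiableAt
  mdiff_lam := ((T.smooth_onGraph (T.smooth_lam a) L).hasPush L.isOpen hx).mdifferentiableAt
  inner_eq := Filter.eventually_of_mem ((L.isOpen.inter L'.isOpen).mem_nhds ⟨hx, hx'⟩)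
    fun y hy => T.two_inner_eq a (L.mem y hy.1).1 (L'.mem y hy.2).2 (L.mem y hy.1).2
  inner_D := (T.isNetOn L).zeta_normal x hx a
  inner_D' v := by
    have h1 := (T.isNetOn L').zeta_normal x hx' a v
    have h2 := T.zeta_eq a (L.mem x hx).1 (L'.mem x hx').2 (L.mem x hx).2
    rw [onGraph, h2] at h1
    exact h1

/-- The twins of `h` with vertical parameter fixed. -/
theorem isTwinAt_const (L : IsLeafOn A C f O q) {x : X} (hx : x ∈ O) {y : Y} (hy : y ∈ C)
    (a : Fin r) : IsTwinAt (onGraph q f) (onGraph (fun _ => y) f) (onGraph q (ζ a))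
      (onGraph q (lam a)) x := by
  have hc := hasPush_comp_pair (hasPush_const (I := 𝓘(ℝ, X)) y x)
    (T.immersion.1.hasPush T.isOpen (x := (x, y)) ⟨(L.mem x hx).1, hy⟩)
  refine ⟨((T.smooth_onGraph T.immersion.1 L).hasPush L.isOpen hx).mdifferentiableAt,
    hc.mdifferentiableAt,
    ((T.smooth_onGraph (T.smooth_zeta a) L).hasPush L.isOpen hx).mdifferentiableAt,
    ((T.smooth_onGraph (T.smooth_lam a) L).hasPush L.isOpen hx).mdifferentiableAt,
    Filter.eventually_of_mem (L.isOpen.mem_nhds hx) fun z hz =>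
      T.two_inner_eq a (L.mem z hz).1 hy (L.mem z hz).2, (T.isNetOn L).zeta_normal x hx a,
    fun v => ?_⟩
  have h2 := T.zeta_eq a (L.mem x hx).1 hy (L.mem x hx).2
  have h1 := T.zeta_normal (x, y) ⟨(L.mem x hx).1, hy⟩ a (v, 0)
  rw [h2] at h1
  rw [hc.eq]
  exact h1

/-- The derivative of the inversion of `f - h` in the vertical directions. -/
theorem hasPush_nu_vert (L : IsLeafOn A C f O q) {x : X} (hx : x ∈ O) {y : Y} (hy : y ∈ C)
    (hne : f (x, y) ≠ onGraph q f x) :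
    HasPush 𝓘(ℝ, Y) (nu (fun _ => onGraph q f x) fun z => f (x, z)) y
      ((‖f (x, y) - onGraph q f x‖ ^ 2)⁻¹ •
        ((mirror (f (x, y) - onGraph q f x)).toContinuousLinearEquiv : E →L[ℝ] E).comp
          ((𝒟' f (x, y)).comp (ContinuousLinearMap.inr ℝ X Y))) := by
  have hxA := (L.mem x hx).1
  have hf := hasPush_comp_right (T.immersion.1.hasPush T.isOpen (x := (x, y)) ⟨hxA, hy⟩)
  have hn0 : ‖f (x, y) - onGraph q f x‖ ^ 2 ≠ 0 :=
    pow_ne_zero 2 (norm_ne_zero_iff.2 (sub_ne_zero.2 hne))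
  have hnu : HasPush 𝓘(ℝ, Y) (nu (fun _ => onGraph q f x) fun z => f (x, z)) y
      (D 𝓘(ℝ, Y) (nu (fun _ => onGraph q f x) fun z => f (x, z)) y) := by
    apply hasPush_of_mdifferentiableAt
    have hy' := hf.sub (hasPush_const (onGraph q f x) y)
    have h2 : HasPush 𝓘(ℝ, Y) (fun z => ‖f (x, z) - onGraph q f x‖ ^ 2) y _ :=
      (hy'.inner hy').congr (Filter.Eventually.of_forall fun y => (real_inner_self_eq_norm_sq _).symm)
    exact ((h2.inv hn0).smul hy').mdifferentiableAt
  have h6 : D 𝓘(ℝ, Y) (nu (fun _ => onGraph q f x) fun z => f (x, z)) y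
      = (‖f (x, y) - onGraph q f x‖ ^ 2)⁻¹ •
        ((mirror (f (x, y) - onGraph q f x)).toContinuousLinearEquiv : E →L[ℝ] E).comp
          ((𝒟' f (x, y)).comp (ContinuousLinearMap.inr ℝ X Y)) := by
    ext w
    have h1 := D_nu (X := Y) (h := fun _ => onGraph q f x) (g := fun z => f (x, z)) (x := y)
      (hasPush_const (onGraph q f x) y).mdifferentiableAt hf.mdifferentiableAt hne w
    rw [(hasPush_const (I := 𝓘(ℝ, Y)) (onGraph q f x) y).eq, hf.eq] at h1
    simp only [zero_apply, inner_zero_right, mul_zero, zero_smul, zero_add, sub_zero] at h1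
    exact h1
  rw [← h6]
  exact hnu

/-- For fixed x the pairing of dζ_a + λ_a dh with ν(x, ·) does not depend on the point of the fibre.
Its vertical derivative is a multiple of the pairing with the reflected vertical vector, which is
therefore normal to h. -/
theorem inner_mirror_vert (L : IsLeafOn A C f O q) {x : X} (hx : x ∈ O) {y : Y} (hy : y ∈ C)
    (hne : f (x, y) ≠ onGraph q f x) (w : Y) (v : X) :
    ⟪mirror (f (x, y) - onGraph q f x) (𝒟' f (x, y) (0, w)), 𝒟 (onGraph q f) x v⟫_ℝ = 0 := by
  have hxA := (L.mem x hx).1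
  refine (T.isNetOn L).inner_D_eq_zero hx (lam := fun a => onGraph q (lam a) x)
    (fun j => T.ne_lam _ (L.mem x hx) j) (fun a v => ?_) v
  set W := 𝒟 (onGraph q (ζ a)) x v + onGraph q (lam a) x • 𝒟 (onGraph q f) x v with hW
  have hf := hasPush_comp_right (T.immersion.1.hasPush T.isOpen (x := (x, y)) ⟨hxA, hy⟩)
  have hn0 : ‖f (x, y) - onGraph q f x‖ ^ 2 ≠ 0 :=
    pow_ne_zero 2 (norm_ne_zero_iff.2 (sub_ne_zero.2 hne))
  have hnu := T.hasPush_nu_vert L hx hy hne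
  have h3 := (hasPush_const (I := 𝓘(ℝ, Y)) W y).inner hnu
  have h4 : HasPush 𝓘(ℝ, Y)
      (fun z => ⟪W, nu (fun _ => onGraph q f x) (fun z => f (x, z)) z⟫_ℝ) y (0 : Y →L[ℝ] ℝ) := by
    refine (hasPush_const ((𝒟 (onGraph q (lam a)) x v) / 2) y).congr ?_
    have hev : ∀ᶠ z in 𝓝 y, f (x, z) ≠ onGraph q f x := hf.continuousAt.eventually_ne hne
    filter_upwards [hev, T.isOpen_right.mem_nhds hy] with z hz hzC
    have := (T.isTwinAt_const L hx hzC a).two_inner_nu_eq hz v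
    rw [← this]
    change _ = 2 * ⟪W, _⟫_ℝ / 2
    rw [mul_div_cancel_left₀ _ two_ne_zero]
    rfl
  have h5 := congrArg (fun P : Y →L[ℝ] ℝ => P w) (h3.unique h4)
  simp only [add_apply, ContinuousLinearMap.comp_apply, innerSL_apply_apply, zero_apply,
    inner_zero_right, add_zero] at h5
  change ⟪W, (‖f (x, y) - onGraph q f x‖ ^ 2)⁻¹ •
    mirror (f (x, y) - onGraph q f x) (𝒟' f (x, y) (0, w))⟫_ℝ = 0 at h5
  rw [real_inner_smul_right] at h5
  exact (mul_eq_zero.1 h5).resolve_left (inv_ne_zero hn0)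

/-- The tangent space of h, the reflection of the vertical space at the twin, and the span of the
ζ_a are mutually orthogonal and fill E. The reflected tangent vectors of the twin are orthogonal to
the last two. -/
theorem mirror_mem {q' : X → Y} {O' : Set X} (L : IsLeafOn A C f O q) (L' : IsLeafOn A C f O' q')
    {x : X} (hx : x ∈ O) (hx' : x ∈ O') (hne : onGraph q' f x ≠ onGraph q f x) (v : X) :
    mirror (onGraph q' f x - onGraph q f x) (𝒟 (onGraph q' f) x v)
      ∈ tangent 𝓘(ℝ, X) (onGraph q f) x := by
  set y := onGraph q' f x - onGraph q f x with hy
  have hp := L.mem x hx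
  have hp' := L'.mem x hx'
  have N := T.isNetOn L
  have N' := T.isNetOn L'
  let P : Y →ₗ[ℝ] E := (mirror y).toLinearEquiv.toLinearMap.comp
    ((𝒟' f (x, q' x) : X × Y →ₗ[ℝ] E).comp (LinearMap.inr ℝ X Y))
  have hP : ∀ w, P w = mirror y (𝒟' f (x, q' x) (0, w)) := fun w => rfl
  have hPi : Function.Injective P := by
    intro w w' hw
    rw [hP, hP] at hw
    exact congrArg Prod.snd (T.immersion.injective hp' ((mirror y).injective hw))
  have hmz : ∀ a, mirror y (onGraph q (ζ a) x) = ζ a (x, q' x) := by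
    intro a
    have h1 := mirror_zeta (ζ := onGraph q (ζ a)) (lam := onGraph q (lam a)) (x := x) hne
      (T.two_inner_eq a hp.1 hp'.2 hp.2)
    rw [hy, h1, T.zeta_eq a hp.1 hp'.2 hp.2]
    rfl
  have hz : ∀ {n : E}, (∀ a, ⟪n, onGraph q (ζ a) x⟫_ℝ = 0) →
      ∀ b ∈ Submodule.span ℝ (Set.range fun a => onGraph q (ζ a) x), ⟪n, b⟫_ℝ = 0 :=
    fun hn b hb => inner_eq_zero_of_mem_span hn hb
  refine mem_of_orthogonal_of_finrank (K := LinearMap.range P)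
    (Z := Submodule.span ℝ (Set.range fun a => onGraph q (ζ a) x)) ?_ ?_ ?_ ?_ ?_ ?_
  · rintro _ ⟨u, rfl⟩ _ ⟨w, rfl⟩
    rw [real_inner_comm, hP]
    exact T.inner_mirror_vert L hx hp'.2 hne w u
  · rintro _ ⟨u, rfl⟩
    refine hz fun a => ?_
    rw [real_inner_comm]
    exact N.zeta_normal x hx a u
  · rintro _ ⟨w, rfl⟩
    refine hz fun a => ?_
    rw [hP, inner_mirror_left, hmz, real_inner_comm]
    exact T.zeta_normal _ hp' a _
  · rw [LinearMap.finrank_range_of_inj hPi,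
      finrank_span_eq_card (N.orthonormal x hx).linearIndependent, Fintype.card_fin]
    have h1 : Module.finrank ℝ (tangent 𝓘(ℝ, X) (onGraph q f) x) = Module.finrank ℝ X :=
      LinearMap.finrank_range_of_inj (N.immersion.injective hx)
    have h2 := T.dim
    omega
  · rintro _ ⟨w, rfl⟩
    rw [hP, inner_mirror, T.D_onGraph T.immersion.1 L' hx']
    exact L'.ortho x hx' v w
  · refine hz fun a => ?_
    rw [inner_mirror_left, hmz, real_inner_comm]
    exact N'.zeta_normal x hx' a v

end IsAdaptedOn

end

/-! ### Stretching of joint eigenvectors by a further leaf. -/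

section

variable {X : Type*} [NormedAddCommGroup X] [NormedSpace ℝ X] [FiniteDimensional ℝ X]
  {Y : Type*} [NormedAddCommGroup Y] [NormedSpace ℝ Y] [FiniteDimensional ℝ Y]
  {E : Type*} [NormedAddCommGroup E] [InnerProductSpace ℝ E] [FiniteDimensional ℝ E]
  {k r s : ℕ}

local notation "𝒟" => D 𝓘(ℝ, X)
local notation "𝒟'" => D 𝓘(ℝ, X × Y)

/-- The factor by which a further twin at distance `y` stretches a joint eigenvector with
eigenvalues `c`. -/
noncomputable def scale (φ : ℝ) (ν : E) (ξ : Fin s → E) (c : Option (Fin s) → ℝ) (y : E) : ℝ :=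
  1 - (2 * φ)⁻¹ * (c none * ‖y‖ ^ 2
    + ∑ i, ⟪ξ i, (-2 * φ) • (y - ‖y‖ ^ 2 • ν)⟫_ℝ * (1 / 2 * (c none - c (some i))))

theorem scale_zero (φ : ℝ) (ν : E) (ξ : Fin s → E) (c : Option (Fin s) → ℝ) :
    scale φ ν ξ c 0 = 1 := by
  simp [scale]

theorem continuous_scale (φ : ℝ) (ν : E) (ξ : Fin s → E) (c : Option (Fin s) → ℝ) :
    Continuous (scale φ ν ξ c) := by
  unfold scale
  fun_prop

namespace IsPencilOn

variable {O : Set X} {h : X → E} {ζ : Fin r → X → E} {lam : Fin r → X → ℝ}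
  {l : Fin k → Fin r → X → ℝ} {Δ : Fin k → X → Submodule ℝ X} {g : Option (Fin s) → X → E}
  {i₀ : Fin s} {x₀ x : X} {g' : X → E}

theorem orthonormal_xi (T : IsPencilOn O h ζ lam l Δ g i₀ x₀) (hx : x ∈ O) :
    Orthonormal ℝ fun i => pencilXi h g i₀ i x :=
  orthonormal_iff_ite.2 fun i j => T.inner_xi_xi hx i j

/-- By the dimension count the ξ_i span everything normal to h and orthogonal to the ζ_a. -/
theorem mem_span_xi (T : IsPencilOn O h ζ lam l Δ g i₀ x₀) (hx : x ∈ O) {n : E}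
    (hn : ∀ v, ⟪n, 𝒟 h x v⟫_ℝ = 0) (hn' : ∀ a, ⟪n, ζ a x⟫_ℝ = 0) :
    n ∈ Submodule.span ℝ (Set.range fun i => pencilXi h g i₀ i x) := by
  have hs : ∀ {m : ℕ} {b : E} {e : Fin m → E}, (∀ a, ⟪b, e a⟫_ℝ = 0) →
      ∀ y ∈ Submodule.span ℝ (Set.range e), ⟪b, y⟫_ℝ = 0 :=
    fun hb y hy => inner_eq_zero_of_mem_span hb hy
  refine mem_of_orthogonal_of_finrank (K := tangent 𝓘(ℝ, X) h x)
    (Z := Submodule.span ℝ (Set.range fun a => ζ a x)) ?_ ?_ ?_ ?_ ?_ (hs hn')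
  · rintro a ha _ ⟨v, rfl⟩
    rw [real_inner_comm]
    refine hs (fun i => ?_) a ha
    rw [real_inner_comm]
    exact T.inner_xi_D hx i v
  · intro a ha b hb
    refine hs (fun c => ?_) b hb
    rw [real_inner_comm]
    refine hs (fun i => ?_) a ha
    rw [real_inner_comm]
    exact T.inner_xi_zeta hx i c
  · rintro _ ⟨v, rfl⟩
    refine hs fun a => ?_
    rw [real_inner_comm]
    exact T.net.zeta_normal x hx a v
  · rw [finrank_span_eq_card (T.orthonormal_xi hx).linearIndependent,
      finrank_span_eq_card (T.net.orthonormal x hx).linearIndependent, Fintype.card_fin,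
      Fintype.card_fin]
    have h1 : Module.finrank ℝ (tangent 𝓘(ℝ, X) h x) = Module.finrank ℝ X :=
      LinearMap.finrank_range_of_inj (T.net.immersion.injective hx)
    have h2 := T.dim
    omega
  · rintro _ ⟨v, rfl⟩
    exact hn v

theorem twin_inner_nu_D (T : IsPencilOn O h ζ lam l Δ g i₀ x₀) (hx : x ∈ O)
    (htw : ∀ a, IsTwinAt h g' (ζ a) (lam a) x) (hne : g' x ≠ h x) (v : X) :
    ⟪nu h g' x, 𝒟 h x v⟫_ℝ = ⟪nu h (g none) x, 𝒟 h x v⟫_ℝ := by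
  rw [← sub_eq_zero, ← inner_sub_left]
  refine T.net.inner_D_eq_zero hx (lam := fun a => lam a x) (T.ne_lam x hx) (fun a v => ?_) v
  have h1 := (htw a).two_inner_nu_eq hne v
  have h2 := (T.isTwinAt hx none a).two_inner_nu_eq (T.ne none x hx) v
  rw [inner_sub_right]
  linarith

/-- The stretching of joint eigenvectors by a further twin. -/
theorem mirror_D_twin (T : IsPencilOn O h ζ lam l Δ g i₀ x₀) {O' : Set X} (hO' : IsOpen O')
    (hx : x ∈ O) (hx' : x ∈ O') (hg : ContMDiffOn 𝓘(ℝ, X) 𝓘(ℝ, E) ∞ g' O')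
    (htw : ∀ y ∈ O, y ∈ O' → ∀ a, IsTwinAt h g' (ζ a) (lam a) y) (hne : g' x ≠ h x)
    (hmir : ∀ v, mirror (g' x - h x) (𝒟 g' x v) ∈ tangent 𝓘(ℝ, X) h x) {r' : Fin r → ℝ}
    {c : Option (Fin s) → ℝ} {w : X}
    (hw : w ∈ jointEigenspace (𝒟 h x) (family ζ h g i₀ x) (Sum.elim r' c)) :
    mirror (g' x - h x) (𝒟 g' x w) = scale (pencilPhi h g i₀ x) (nu h (g none) x)
      (fun i => pencilXi h g i₀ i x) c (g' x - h x) • 𝒟 h x w := by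
  set φ := pencilPhi h g i₀ with hφ
  have hφ0 : φ x ≠ 0 := (T.phi_pos hx).ne'
  have hn0 : ‖g' x - h x‖ ^ 2 ≠ 0 := pow_ne_zero 2 (norm_ne_zero_iff.2 (sub_ne_zero.2 hne))
  have hhp := T.hasPush T.net.immersion.1 hx
  have hgp := hg.hasPush hO' hx'
  have hDnu := D_nu hhp.mdifferentiableAt hgp.mdifferentiableAt hne w
  rw [T.twin_inner_nu_D hx (htw x hx hx') hne] at hDnu
  have hnup : HasPush 𝓘(ℝ, X) (nu h g') x (𝒟 (nu h g') x) := by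
    apply hasPush_of_mdifferentiableAt
    have hy' := hgp.sub hhp
    have h2 : HasPush 𝓘(ℝ, X) (fun z => ‖g' z - h z‖ ^ 2) x _ :=
      (hy'.inner hy').congr (Filter.Eventually.of_forall fun y => (real_inner_self_eq_norm_sq _).symm)
    exact ((h2.inv hn0).smul hy').mdifferentiableAt
  -- The analogue of F_c for the additional leaf, built with the same φ.
  set G : X → E := fun y => (-2 * φ y) • nu h g' y with hG
  have hGp : HasPush 𝓘(ℝ, X) G x _ := ((T.hasPush T.smooth_phi hx).const_mul (-2)).smul hnup
  have hDG : 𝒟 G x w = (2 * φ x * (‖g' x - h x‖ ^ 2)⁻¹) •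
      (𝒟 h x w - mirror (g' x - h x) (𝒟 g' x w)) := by
    rw [hGp.eq]
    have hDφ : 𝒟 φ x w = -(2 * ⟪nu h (g none) x, 𝒟 h x w⟫_ℝ * φ x) := T.D_phi hx w
    simp only [add_apply, smul_apply, ContinuousLinearMap.smulRight_apply, hDφ, hDnu,
      smul_eq_mul, ← hφ]
    module
  have hFp := T.hasPush (T.smooth_F none) hx
  have hξp : ∀ i, HasPush 𝓘(ℝ, X) (pencilXi h g i₀ i) x (𝒟 (pencilXi h g i₀ i) x) := fun i =>
    T.hasPush (T.smooth_xi i) hx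
  have hGp' : HasPush 𝓘(ℝ, X) G x (𝒟 G x) := hasPush_of_mdifferentiableAt hGp.mdifferentiableAt
  have hGF : ∀ y ∈ O, y ∈ O' → g' y ≠ h y → ∀ v,
      ⟪G y - pencilF h g i₀ none y, 𝒟 h y v⟫_ℝ = 0 := by
    intro y hy hy' hyne v
    rw [inner_sub_left, T.inner_F_D hy, T.D_phi hy, hG]
    simp only [real_inner_smul_left]
    rw [T.twin_inner_nu_D hy (htw y hy hy') hyne]
    ring
  have hGζ : ∀ y ∈ O, y ∈ O' → g' y ≠ h y → ∀ a, ⟪G y - pencilF h g i₀ none y, ζ a y⟫_ℝ = 0 := by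
    intro y hy hy' hyne a
    have h1 := (htw y hy hy' a).inner_eq.self_of_nhds
    have h2 : ‖g' y - h y‖ ^ 2 ≠ 0 := pow_ne_zero 2 (norm_ne_zero_iff.2 (sub_ne_zero.2 hyne))
    rw [inner_sub_left, T.inner_F_zeta hy, hG]
    simp only [real_inner_smul_left, nu]
    have h3 : ⟪g' y - h y, ζ a y⟫_ℝ = lam a y * ‖g' y - h y‖ ^ 2 / 2 := by linarith
    rw [h3]
    generalize ‖g' y - h y‖ ^ 2 = N at h2
    have h4 : N⁻¹ * (lam a y * N / 2) = lam a y / 2 := by field_simp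
    rw [h4]
    ring
  have hev : ∀ᶠ y in 𝓝 x, y ∈ O ∧ y ∈ O' ∧ g' y ≠ h y := by
    filter_upwards [T.isOpen.mem_nhds hx, hO'.mem_nhds hx',
      (hgp.continuousAt.sub hhp.continuousAt).eventually_ne (sub_ne_zero.2 hne)] with y h1 h2 h3
    exact ⟨h1, h2, sub_ne_zero.1 h3⟩
  -- Since G - F_none is spanned by the ξ_i, it is ∑ θ_i ξ_i, and the θ_i have zero derivative.
  -- Hence dG is diagonal on w with eigenvalue c none + ∑ θ_i (c none - c (some i)) / 2, from which
  -- the stretching factor is solved.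
  set θ : Fin s → X → ℝ := fun i y => ⟪pencilXi h g i₀ i y, G y - pencilF h g i₀ none y⟫_ℝ with hθ
  have hθp : ∀ i, HasPush 𝓘(ℝ, X) (θ i) x _ := fun i => (hξp i).inner (hGp'.sub hFp)
  have hGsum : HasPush 𝓘(ℝ, X) G x _ :=
    (hFp.add (HasPush.sum Finset.univ fun i _ => (hθp i).smul (hξp i))).congr
      (hev.mono fun y hy => by
        have h1 := (T.orthonormal_xi hy.1).sum_inner_smul_of_mem_span
          (T.mem_span_xi hy.1 (hGF y hy.1 hy.2.1 hy.2.2) (hGζ y hy.1 hy.2.1 hy.2.2))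
        exact (sub_eq_iff_eq_add'.1 h1.symm))
  have hT : 𝒟 G x w ∈ tangent 𝓘(ℝ, X) h x := by
    rw [hDG]
    exact Submodule.smul_mem _ _ (Submodule.sub_mem _ (D_mem_tangent h x w) (hmir w))
  have hDθ : ∀ i, ((innerSL ℝ (pencilXi h g i₀ i x)).comp (𝒟 G x - 𝒟 (pencilF h g i₀ none) x)
      + (innerSL ℝ (G x - pencilF h g i₀ none x)).comp (𝒟 (pencilXi h g i₀ i) x)) w = 0 := by
    intro i
    simp only [add_apply, ContinuousLinearMap.comp_apply, innerSL_apply_apply, sub_apply,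
      inner_sub_right]
    rw [inner_normal_D (T.inner_xi_D hx i) hT, inner_normal_D (T.inner_xi_D hx i) (T.D_F_mem hx none w),
      inner_normal_D (hGF x hx hx' hne) (T.D_xi_mem hx i w)]
    ring
  have hF : ∀ c', 𝒟 (pencilF h g i₀ c') x w = c c' • 𝒟 h x w := fun c' => hw (Sum.inr c')
  have h5 := congrArg (fun P : X →L[ℝ] E => P w) hGsum.eq
  simp only [add_apply, sum_apply, smul_apply, ContinuousLinearMap.smulRight_apply] at h5
  simp only [← add_apply, hDθ, zero_smul, add_zero, T.D_xi hx, hF, ← sub_smul, smul_smul,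
    ← Finset.sum_smul] at h5
  rw [← add_smul, hDG] at h5
  -- Multiplied by ‖y‖², with y = g' - h, the coefficient θ_i is polynomial in y. This is why
  -- `scale` is continuous in y and equals 1 at y = 0, where the leaf meets the base.
  have h6 : ∀ i, ‖g' x - h x‖ ^ 2 * θ i x
      = ⟪pencilXi h g i₀ i x, (-2 * φ x) • ((g' x - h x) - ‖g' x - h x‖ ^ 2 • nu h (g none) x)⟫_ℝ := by
    intro i
    rw [← real_inner_smul_right]
    congr 1
    simp only [hG, pencilF, nu, ← hφ, smul_sub, smul_smul]
    generalize ‖g' x - h x‖ ^ 2 = N at hn0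
    match_scalars <;> field_simp
  set S := ∑ i, θ i x * (1 / 2 * (c none - c (some i))) with hS
  have h7 : scale (φ x) (nu h (g none) x) (fun i => pencilXi h g i₀ i x) c (g' x - h x)
      = 1 - (2 * φ x)⁻¹ * ‖g' x - h x‖ ^ 2 * (c none + S) := by
    rw [scale, hS, mul_assoc, mul_add (‖g' x - h x‖ ^ 2), Finset.mul_sum]
    simp only [← h6]
    congr 2
    congr 1
    · ring
    · exact Finset.sum_congr rfl fun i _ => by ring
  rw [h7]
  have h8 : (2 * φ x * (‖g' x - h x‖ ^ 2)⁻¹) • mirror (g' x - h x) (𝒟 g' x w)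
      = (2 * φ x * (‖g' x - h x‖ ^ 2)⁻¹) •
        ((1 - (2 * φ x)⁻¹ * ‖g' x - h x‖ ^ 2 * (c none + S)) • 𝒟 h x w) := by
    rw [smul_sub] at h5
    have h9 : 2 * φ x * (‖g' x - h x‖ ^ 2)⁻¹ * ((2 * φ x)⁻¹ * ‖g' x - h x‖ ^ 2 * (c none + S))
        = c none + S := by
      have h10 : (2 * φ x) ≠ 0 := mul_ne_zero two_ne_zero hφ0
      generalize 2 * φ x = b at h10
      generalize ‖g' x - h x‖ ^ 2 = N at hn0
      field_simp
    rw [smul_smul, mul_sub, mul_one, sub_smul, h9, ← h5]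
    abel
  exact smul_right_injective E (mul_ne_zero (mul_ne_zero two_ne_zero hφ0) (inv_ne_zero hn0)) h8

end IsPencilOn

/-- A finite family of mutually exclusive closed conditions on a connected set. -/
theorem exists_const_index {Z : Type*} [TopologicalSpace Z] {C : Set Z} (hC : IsPreconnected C)
    (hne : C.Nonempty) {P : Fin k → Z → Prop} (hex : ∀ z ∈ C, ∃ j, P j z)
    (huniq : ∀ z ∈ C, ∀ i j, P i z → P j z → i = j)
    (hcl : ∀ j, IsClosed {z : C | P j z}) : ∃ j, ∀ z ∈ C, P j z := by
  choose J hJ using fun z : C => hex z z.2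
  have hpre : PreconnectedSpace C := isPreconnected_iff_preconnectedSpace.1 hC
  have hJc : Continuous J := by
    rw [continuous_iff_isClosed]
    intro S _
    -- Uniqueness of the index makes preimages of the index function finite unions of closed sets.
    have h1 : J ⁻¹' S = ⋃ j ∈ S, {z : C | P j z} := by
      ext z
      simp only [Set.mem_preimage, Set.mem_iUnion, exists_prop]
      constructor
      · intro hz; exact ⟨J z, hz, hJ z⟩
      · rintro ⟨j, hj, hz⟩
        rwa [huniq z z.2 (J z) j (hJ z) hz]
    rw [h1]
    exact S.toFinite.isClosed_biUnion fun j _ => hcl j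
  obtain ⟨z₀, hz₀⟩ := hne
  refine ⟨J ⟨z₀, hz₀⟩, fun z hz => ?_⟩
  rw [hpre.constant hJc (y := ⟨z, hz⟩)]
  exact hJ ⟨z, hz⟩

end

/-! ### The net over the base leaf is a net of joint eigenvectors. -/

section

variable {X : Type*} [NormedAddCommGroup X] [NormedSpace ℝ X] [FiniteDimensional ℝ X]
  {Y : Type*} [NormedAddCommGroup Y] [NormedSpace ℝ Y] [FiniteDimensional ℝ Y]
  {E : Type*} [NormedAddCommGroup E] [InnerProductSpace ℝ E] [FiniteDimensional ℝ E]
  {k r s : ℕ}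

local notation "𝒟" => D 𝓘(ℝ, X)

/-- A base leaf `q` of an adapted net and `s + 1` further leaves `p c`, in general position. -/
structure IsLeafPencilOn (A : Set X) (C : Set Y) (f : X × Y → E) (ζ : Fin r → X × Y → E)
    (lam : Fin r → X × Y → ℝ) (l : Fin k → Fin r → X × Y → ℝ)
    (Δ : Fin k → X × Y → Submodule ℝ (X × Y)) (O : Set X) (q : X → Y) (p : Option (Fin s) → X → Y)
    (i₀ : Fin s) (x₀ : X) : Prop where
  adapted : IsAdaptedOn A C f ζ lam l Δ
  preconnected : IsPreconnected O
  base_mem : x₀ ∈ O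
  finrank_right : Module.finrank ℝ Y = s
  base : IsLeafOn A C f O q
  leaf : ∀ c, IsLeafOn A C f O (p c)
  exists_leaf : ∀ x ∈ A, ∀ y ∈ C, ∃ O' q', IsLeafOn A C f O' q' ∧ x ∈ O' ∧ q' x = y
  ne : ∀ c, ∀ x ∈ O, onGraph (p c) f x ≠ onGraph q f x
  nu_ne : ∀ x ∈ O, nu (onGraph q f) (onGraph (p (some i₀)) f) x
    ≠ nu (onGraph q f) (onGraph (p none) f) x
  gram : ∀ i j, ⟪nu (onGraph q f) (onGraph (p (some i)) f) x₀
      - nu (onGraph q f) (onGraph (p none) f) x₀,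
    nu (onGraph q f) (onGraph (p (some j)) f) x₀ - nu (onGraph q f) (onGraph (p none) f) x₀⟫_ℝ
    = if i = j then ‖nu (onGraph q f) (onGraph (p (some i₀)) f) x₀
      - nu (onGraph q f) (onGraph (p none) f) x₀‖ ^ 2 else 0

namespace IsLeafPencilOn

variable {A : Set X} {C : Set Y} {f : X × Y → E} {ζ : Fin r → X × Y → E}
    {lam : Fin r → X × Y → ℝ} {l : Fin k → Fin r → X × Y → ℝ}
    {Δ : Fin k → X × Y → Submodule ℝ (X × Y)} {O : Set X} {q : X → Y}
    {p : Option (Fin s) → X → Y} {i₀ : Fin s} {x₀ : X}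

section

variable (T : IsLeafPencilOn A C f ζ lam l Δ O q p i₀ x₀)
include T

theorem isPencilOn : IsPencilOn O (onGraph q f) (fun a => onGraph q (ζ a))
    (fun a => onGraph q (lam a)) (fun j a => onGraph q (l j a)) (graphNet q Δ)
    (fun c => onGraph (p c) f) i₀ x₀ where
  isOpen := T.base.isOpen
  preconnected := T.preconnected
  base_mem := T.base_mem
  net := T.adapted.isNetOn T.base
  smooth_lam a := T.adapted.smooth_onGraph (T.adapted.smooth_lam a) T.base
  ne_lam x hx := T.adapted.ne_lam _ (T.base.mem x hx)
  dim := by rw [← T.adapted.dim, T.finrank_right]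
  smooth_g c := T.adapted.smooth_onGraph T.adapted.immersion.1 (T.leaf c)
  ne := T.ne
  inner_eq c a x hx := (T.adapted.isTwinAt T.base (T.leaf c) hx hx a).inner_eq.self_of_nhds
  inner_D' c a x hx v := (T.adapted.isTwinAt T.base (T.leaf c) hx hx a).inner_D' v
  mirror_mem c x hx v := T.adapted.mirror_mem T.base (T.leaf c) hx hx (T.ne c x hx) v
  nu_ne := T.nu_ne
  gram := T.gram

/-- The joint eigenvectors over the base leaf belong to the net of every leaf. -/
theorem exists_index_leaf {O' : Set X} {q' : X → Y} (L : IsLeafOn A C f O' q') {x : X} (hx : x ∈ O)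
    (hx' : x ∈ O') (hne : onGraph q' f x ≠ onGraph q f x) {r' : Fin r → ℝ}
    {c : Option (Fin s) → ℝ} {w : X} (hw0 : w ≠ 0) (hw : w ∈ jointEigenspace (𝒟 (onGraph q f) x)
      (IsPencilOn.family (fun a => onGraph q (ζ a)) (onGraph q f) (fun c => onGraph (p c) f) i₀ x)
      (Sum.elim r' c)) :
    ∃ S, S = scale (pencilPhi (onGraph q f) (fun c => onGraph (p c) f) i₀ x)
        (nu (onGraph q f) (onGraph (p none) f) x)
        (fun i => pencilXi (onGraph q f) (fun c => onGraph (p c) f) i₀ i x) c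
        (onGraph q' f x - onGraph q f x) ∧
      mirror (onGraph q' f x - onGraph q f x) (𝒟 (onGraph q' f) x w) = S • 𝒟 (onGraph q f) x w ∧
      S ≠ 0 ∧ ∃ j, (∀ a, r' a + onGraph q (lam a) x
        = S * (onGraph q (lam a) x - onGraph q' (l j a) x)) ∧ w ∈ graphNet q' Δ j x := by
  have N' := T.adapted.isNetOn L
  have hm := T.isPencilOn.mirror_D_twin L.isOpen hx hx' N'.immersion.1
    (fun y hy hy' a => T.adapted.isTwinAt T.base L hy hy' a) hne
    (fun v => T.adapted.mirror_mem T.base L hx hx' hne v) hw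
  refine ⟨_, rfl, hm, ?_⟩
  set S := scale (pencilPhi (onGraph q f) (fun c => onGraph (p c) f) i₀ x)
    (nu (onGraph q f) (onGraph (p none) f) x)
    (fun i => pencilXi (onGraph q f) (fun c => onGraph (p c) f) i₀ i x) c
    (onGraph q' f x - onGraph q f x) with hS
  have hS0 : S ≠ 0 := by
    intro h0
    rw [h0, zero_smul] at hm
    have h1 : 𝒟 (onGraph q' f) x w = 0 := (mirror _).injective (hm.trans (map_zero _).symm)
    exact hw0 (N'.immersion.injective hx' (h1.trans (map_zero _).symm))
  refine ⟨hS0, ?_⟩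
  have hmh : mirror (onGraph q' f x - onGraph q f x) (𝒟 (onGraph q f) x w)
      = S⁻¹ • 𝒟 (onGraph q' f) x w := by
    rw [← mirror_mirror (onGraph q' f x - onGraph q f x) (𝒟 (onGraph q' f) x w), hm, map_smul,
      smul_smul, inv_mul_cancel₀ hS0, one_smul]
  -- The reflection carries dζ_a + λ_a df from the base leaf to q'. As it stretches df(w) by S, the
  -- vector w is an eigenvector for q' with eigenvalues determined by r' + λ = S (λ - l_j).
  obtain ⟨j, hj, hwj⟩ := exists_mem_of_eigen (A := 𝒟 (onGraph q' f) x)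
    (Δ := fun j => graphNet q' Δ j x) (C := fun a => 𝒟 (onGraph q' (ζ a)) x)
    (l := fun j a => onGraph q' (l j a) x)
    (μ := fun a => onGraph q (lam a) x - (r' a + onGraph q (lam a) x) * S⁻¹)
    (N'.immersion.injective hx') (N'.iSup_eq x hx') (N'.ortho x hx') (N'.distinct x hx')
    (N'.D_zeta x hx') hw0 (fun a => by
      have h1 := (T.adapted.isTwinAt T.base L hx hx' a).D_zeta_add hne w
      have h2 : 𝒟 (fun y => onGraph q (ζ a) y - onGraph q (lam a) y •
          (onGraph q' f y - onGraph q f y)) x = 𝒟 (onGraph q' (ζ a)) x := D_congr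
        (Filter.eventually_of_mem ((T.base.isOpen.inter L.isOpen).mem_nhds ⟨hx, hx'⟩) fun y hy =>
          (T.adapted.zeta_eq a (T.base.mem y hy.1).1 (L.mem y hy.2).2 (T.base.mem y hy.1).2).symm)
      have h3 : 𝒟 (onGraph q (ζ a)) x w = r' a • 𝒟 (onGraph q f) x w := hw (Sum.inl a)
      rw [h2, h3, ← add_smul, map_smul, hmh, smul_smul] at h1
      rw [eq_sub_of_add_eq h1]
      module)
  refine ⟨j, fun a => ?_, hwj⟩
  rw [← hj a]
  field_simp
  ring

theorem exists_index_base {x : X} (hx : x ∈ O) {r' : Fin r → ℝ}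
    {c : Option (Fin s) → ℝ} {w : X} (hw0 : w ≠ 0) (hw : w ∈ jointEigenspace (𝒟 (onGraph q f) x)
      (IsPencilOn.family (fun a => onGraph q (ζ a)) (onGraph q f) (fun c => onGraph (p c) f) i₀ x)
      (Sum.elim r' c)) :
    ∃ j, (∀ a, r' a + onGraph q (lam a) x = onGraph q (lam a) x - onGraph q (l j a) x) ∧
      w ∈ graphNet q Δ j x := by
  have N' := T.adapted.isNetOn T.base
  obtain ⟨j, hj, hwj⟩ := exists_mem_of_eigen (A := 𝒟 (onGraph q f) x)
    (Δ := fun j => graphNet q Δ j x) (C := fun a => 𝒟 (onGraph q (ζ a)) x)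
    (l := fun j a => onGraph q (l j a) x) (μ := fun a => -r' a)
    (N'.immersion.injective hx) (N'.iSup_eq x hx) (N'.ortho x hx) (N'.distinct x hx)
    (N'.D_zeta x hx) hw0 (fun a => by
      have h3 : 𝒟 (onGraph q (ζ a)) x w = r' a • 𝒟 (onGraph q f) x w := hw (Sum.inl a)
      rw [h3]; module)
  exact ⟨j, fun a => by rw [← hj a]; ring, hwj⟩

/-- A joint eigenvector over the base leaf belongs to summands with the same index for all
leaves. -/
theorem exists_index {x : X} (hx : x ∈ O) {r' : Fin r → ℝ}
    {c : Option (Fin s) → ℝ} {w : X} (hw0 : w ≠ 0) (hw : w ∈ jointEigenspace (𝒟 (onGraph q f) x)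
      (IsPencilOn.family (fun a => onGraph q (ζ a)) (onGraph q f) (fun c => onGraph (p c) f) i₀ x)
      (Sum.elim r' c)) :
    ∃ j, w ∈ graphNet q Δ j x ∧ ∀ c', w ∈ graphNet (p c') Δ j x ∧ ∃ S : ℝ,
      (∀ a, onGraph q (lam a) x - onGraph q (l j a) x
        = S * (onGraph q (lam a) x - onGraph (p c') (l j a) x)) ∧
      mirror (onGraph (p c') f x - onGraph q f x) (𝒟 (onGraph (p c') f) x w)
        = S • 𝒟 (onGraph q f) x w := by
  set sc : E → ℝ := scale (pencilPhi (onGraph q f) (fun c => onGraph (p c) f) i₀ x)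
    (nu (onGraph q f) (onGraph (p none) f) x)
    (fun i => pencilXi (onGraph q f) (fun c => onGraph (p c) f) i₀ i x) c with hsc
  have hxA := (T.base.mem x hx).1
  have hqC := (T.base.mem x hx).2
  -- Every point y of the fibre lies on some leaf and so has an index. By injectivity of f the
  -- excluded case f(x, y) = h(x) is the point q(x) of the base leaf, where the factor is 1.
  have hpt : ∀ y ∈ C, sc (f (x, y) - onGraph q f x) ≠ 0 ∧ ∃ j, ∀ a, r' a + onGraph q (lam a) x
      = sc (f (x, y) - onGraph q f x) * (onGraph q (lam a) x - l j a (x, y)) := by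
    intro y hy
    by_cases hne : f (x, y) = onGraph q f x
    · have hyq : y = q x :=
        congrArg Prod.snd (T.adapted.injOn (x₁ := (x, y)) (x₂ := (x, q x)) ⟨hxA, hy⟩ ⟨hxA, hqC⟩ hne)
      obtain ⟨j, hj, -⟩ := T.exists_index_base hx hw0 hw
      rw [hne, sub_self, hsc, scale_zero]
      refine ⟨one_ne_zero, j, fun a => ?_⟩
      rw [hj a, one_mul, hyq]
      rfl
    · obtain ⟨O', q', L, hx', rfl⟩ := T.exists_leaf x hxA y hy
      obtain ⟨S, hS, -, hS0, j, hj, -⟩ := T.exists_index_leaf L hx hx' hne hw0 hw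
      rw [hS] at hS0 hj
      exact ⟨hS0, j, hj⟩
  have huniq : ∀ y ∈ C, ∀ i j,
      (∀ a, r' a + onGraph q (lam a) x
        = sc (f (x, y) - onGraph q f x) * (onGraph q (lam a) x - l i a (x, y))) →
      (∀ a, r' a + onGraph q (lam a) x
        = sc (f (x, y) - onGraph q f x) * (onGraph q (lam a) x - l j a (x, y))) → i = j := by
    intro y hy i j hi hj
    refine T.adapted.distinct (x, y) ⟨hxA, hy⟩ i j fun a => ?_
    have := mul_left_cancel₀ (hpt y hy).1 ((hi a).symm.trans (hj a))
    linarith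
  have hcont : ∀ {a : X × Y → ℝ}, ContMDiffOn 𝓘(ℝ, X × Y) 𝓘(ℝ, ℝ) ∞ a (A ×ˢ C) →
      Continuous fun y : C => a (x, y) := fun ha =>
    ha.continuousOn.comp_continuous (continuous_const.prodMk continuous_subtype_val)
      fun y => ⟨hxA, y.2⟩
  have hcontf : Continuous fun y : C => f (x, y) :=
    T.adapted.immersion.1.continuousOn.comp_continuous
      (continuous_const.prodMk continuous_subtype_val) fun y => ⟨hxA, y.2⟩
  -- The condition for index j is closed in y, by continuity of `scale`, and the conditions exclude
  -- one another because the tuples l_j are distinct and the factor is nonzero.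
  obtain ⟨j, hj⟩ := exists_const_index T.adapted.preconnected ⟨q x, hqC⟩
    (P := fun j y => ∀ a, r' a + onGraph q (lam a) x
      = sc (f (x, y) - onGraph q f x) * (onGraph q (lam a) x - l j a (x, y)))
    (fun y hy => (hpt y hy).2) huniq (fun j => by
      simp only [Set.ofPred_forall]
      refine isClosed_iInter fun a => isClosed_eq continuous_const ?_
      exact ((continuous_scale _ _ _ _).comp (hcontf.sub continuous_const)).mul
        (continuous_const.sub (hcont (T.adapted.smooth_l j a))))
  have hbase : ∀ a, r' a + onGraph q (lam a) x = onGraph q (lam a) x - onGraph q (l j a) x := by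
    intro a
    have h1 := hj (q x) hqC a
    have h2 : f (x, q x) - onGraph q f x = 0 := sub_self _
    rwa [h2, hsc, scale_zero, one_mul] at h1
  refine ⟨j, ?_, fun c' => ?_⟩
  · obtain ⟨i, hi, hwi⟩ := T.exists_index_base hx hw0 hw
    have hij : i = j := T.adapted.distinct (x, q x) ⟨hxA, hqC⟩ i j fun a => by
      have h3 := (hi a).symm.trans (hbase a)
      simp only [onGraph] at h3
      linarith
    rwa [← hij]
  · obtain ⟨S, hS, hm, hS0, i, hi, hwi⟩ := T.exists_index_leaf (T.leaf c') hx hx (T.ne c' x hx) hw0 hw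
    have hC' := ((T.leaf c').mem x hx).2
    have h4 := hj (p c' x) hC'
    have h5 : sc (f (x, p c' x) - onGraph q f x) = S := hS.symm
    rw [h5] at h4
    have hij : i = j := huniq _ hC' i j (by rw [h5]; exact hi) (by rw [h5]; exact h4)
    refine ⟨by rwa [← hij], S, fun a => ?_, hm⟩
    rw [← hbase a, h4 a]
    rfl

end

/-- The factor by which the leaf `p c` stretches the `j`-th summand. -/
noncomputable def stretch (lam : Fin r → X × Y → ℝ) (l : Fin k → Fin r → X × Y → ℝ) (q : X → Y)
    (p : X → Y) (j : Fin k) (x : X) : ℝ :=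
  (∑ a, (onGraph q (lam a) x - onGraph q (l j a) x) * (onGraph q (lam a) x - onGraph p (l j a) x)) *
    (∑ a, (onGraph q (lam a) x - onGraph p (l j a) x) * (onGraph q (lam a) x - onGraph p (l j a) x))⁻¹

section

variable (T : IsLeafPencilOn A C f ζ lam l Δ O q p i₀ x₀)
include T

theorem exists_ne {x : X} (hx : x ∈ O) (c : Option (Fin s)) (j : Fin k) :
    ∃ a, onGraph q (lam a) x - onGraph (p c) (l j a) x ≠ 0 := by
  obtain ⟨a, ha⟩ := T.adapted.ne_lam _ ((T.leaf c).mem x hx) j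
  refine ⟨a, sub_ne_zero.2 fun h => ha ?_⟩
  have h1 : l j a (x, p c x) = lam a (x, q x) := h.symm
  rw [h1]
  exact T.adapted.lam_eq a (T.base.mem x hx).1 (T.base.mem x hx).2 ((T.leaf c).mem x hx).2

theorem sum_ne_zero {x : X} (hx : x ∈ O) (c : Option (Fin s)) (j : Fin k) :
    ∑ a, (onGraph q (lam a) x - onGraph (p c) (l j a) x)
      * (onGraph q (lam a) x - onGraph (p c) (l j a) x) ≠ 0 := by
  obtain ⟨a, ha⟩ := T.exists_ne hx c j
  intro h0
  rw [Finset.sum_eq_zero_iff_of_nonneg fun a _ => mul_self_nonneg _] at h0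
  exact ha (mul_self_eq_zero.1 (h0 a (Finset.mem_univ a)))

theorem smooth_stretch (c : Option (Fin s)) (j : Fin k) :
    ContMDiffOn 𝓘(ℝ, X) 𝓘(ℝ, ℝ) ∞ (stretch lam l q (p c) j) O := by
  have h1 : ∀ a, ContMDiffOn 𝓘(ℝ, X) 𝓘(ℝ, ℝ) ∞ (onGraph q (lam a)) O := fun a =>
    T.adapted.smooth_onGraph (T.adapted.smooth_lam a) T.base
  have h2 : ∀ a, ContMDiffOn 𝓘(ℝ, X) 𝓘(ℝ, ℝ) ∞ (onGraph q (l j a)) O := fun a =>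
    T.adapted.smooth_onGraph (T.adapted.smooth_l j a) T.base
  have h3 : ∀ a, ContMDiffOn 𝓘(ℝ, X) 𝓘(ℝ, ℝ) ∞ (onGraph (p c) (l j a)) O := fun a =>
    T.adapted.smooth_onGraph (T.adapted.smooth_l j a) (T.leaf c)
  have h4 : ContMDiffOn 𝓘(ℝ, X) 𝓘(ℝ, ℝ) ∞ (fun x => ∑ a,
      (onGraph q (lam a) x - onGraph (p c) (l j a) x)
        * (onGraph q (lam a) x - onGraph (p c) (l j a) x)) O :=
    contMDiffOn_finsetSum fun a _ => ((h1 a).sub (h3 a)).mul ((h1 a).sub (h3 a))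
  exact (contMDiffOn_finsetSum fun a _ => ((h1 a).sub (h2 a)).mul ((h1 a).sub (h3 a))).mul
    (h4.inv₀ fun x hx => T.sum_ne_zero hx c j)

/-- Over two leaves the vectors λ - l_j are proportional. Solving for the factor by pairing with the
second vector, which is nonzero, gives a formula that is visibly smooth. -/
theorem stretch_eq {x : X} (hx : x ∈ O) {c : Option (Fin s)} {j : Fin k} {S : ℝ}
    (h : ∀ a, onGraph q (lam a) x - onGraph q (l j a) x
      = S * (onGraph q (lam a) x - onGraph (p c) (l j a) x)) : stretch lam l q (p c) j x = S := by
  have h0 := T.sum_ne_zero hx c j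
  rw [stretch]
  simp only [h, mul_assoc]
  rw [← Finset.mul_sum, mul_assoc, mul_inv_cancel₀ h0, mul_one]

/-- The stretching of the summands of the net of the base leaf. -/
theorem mirror_D_leaf {x : X} (hx : x ∈ O) {j : Fin k} {v : X} (hv : v ∈ graphNet q Δ j x)
    (c : Option (Fin s)) : v ∈ graphNet (p c) Δ j x ∧
      mirror (onGraph (p c) f x - onGraph q f x) (𝒟 (onGraph (p c) f) x v)
        = stretch lam l q (p c) j x • 𝒟 (onGraph q f) x v := by
  have N := T.adapted.isNetOn T.base
  -- G_j is the part of Δ_j on which the assertion holds for all leaves. Joint eigenvectors lie in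
  -- the G_j and span, so G_j is all of Δ_j.
  let G : Fin k → Submodule ℝ X := fun j => graphNet q Δ j x ⊓ ⨅ c, (graphNet (p c) Δ j x ⊓
    LinearMap.ker ((((mirror (onGraph (p c) f x - onGraph q f x)).toLinearEquiv.toLinearMap.comp
      (𝒟 (onGraph (p c) f) x : X →ₗ[ℝ] E)) - stretch lam l q (p c) j x •
        (𝒟 (onGraph q f) x : X →ₗ[ℝ] E))))
  have hG : ∀ {j v}, v ∈ G j ↔ v ∈ graphNet q Δ j x ∧ ∀ c, v ∈ graphNet (p c) Δ j x ∧
      mirror (onGraph (p c) f x - onGraph q f x) (𝒟 (onGraph (p c) f) x v)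
        = stretch lam l q (p c) j x • 𝒟 (onGraph q f) x v := by
    intro j v
    simp only [G, Submodule.mem_inf, Submodule.mem_iInf, LinearMap.mem_ker, LinearMap.sub_apply,
      sub_eq_zero]
    rfl
  have hsup : ⨆ j, G j = ⊤ := by
    rw [eq_top_iff, ← T.isPencilOn.iSup_family hx]
    refine iSup_le fun c => fun w hw => ?_
    by_cases hw0 : w = 0
    · rw [hw0]; exact zero_mem _
    · have hc : c = Sum.elim (fun a => c (Sum.inl a)) fun c' => c (Sum.inr c') := by
        ext (a | b) <;> rfl
      rw [hc] at hw
      obtain ⟨j, hj, hjc⟩ := T.exists_index hx hw0 hw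
      refine Submodule.mem_iSup_of_mem j (hG.2 ⟨hj, fun c' => ?_⟩)
      obtain ⟨h1, S, hS, hm⟩ := hjc c'
      rw [T.stretch_eq hx hS]
      exact ⟨h1, hm⟩
  exact (hG.1 (le_of_iSup_eq_top (N.immersion.injective hx) (N.ortho x hx) hsup
    (fun j => inf_le_left) j hv)).2 c

/-- Apply `D_zeta_add` to a nonzero vector of Δ_j, which exists as the rank is positive, and compare
coefficients. -/
theorem sub_eq_stretch_mul {x : X} (hx : x ∈ O) (c : Option (Fin s)) (j : Fin k) (a : Fin r) :
    onGraph q (lam a) x - onGraph q (l j a) x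
      = stretch lam l q (p c) j x * (onGraph q (lam a) x - onGraph (p c) (l j a) x) := by
  have N := T.adapted.isNetOn T.base
  have N' := T.adapted.isNetOn (T.leaf c)
  obtain ⟨t, ht, hrank⟩ := N.rank j
  have h1 : graphNet q Δ j x ≠ ⊥ := by
    intro h0
    have := hrank x hx
    rw [h0, finrank_bot] at this
    omega
  obtain ⟨v, hv, hv0⟩ := Submodule.exists_mem_ne_zero_of_ne_bot h1
  obtain ⟨hv', hm⟩ := T.mirror_D_leaf hx hv c
  have h2 := (T.adapted.isTwinAt T.base (T.leaf c) hx hx a).D_zeta_add (T.ne c x hx) v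
  have h3 : 𝒟 (fun y => onGraph q (ζ a) y - onGraph q (lam a) y •
      (onGraph (p c) f y - onGraph q f y)) x = 𝒟 (onGraph (p c) (ζ a)) x := D_congr
    (Filter.eventually_of_mem (T.base.isOpen.mem_nhds hx) fun y hy =>
      (T.adapted.zeta_eq a (T.base.mem y hy).1 ((T.leaf c).mem y hy).2 (T.base.mem y hy).2).symm)
  rw [h3, N'.D_zeta x hx j v hv' a, N.D_zeta x hx j v hv a] at h2
  have h4 := congrArg (mirror (onGraph (p c) f x - onGraph q f x)) h2
  rw [mirror_mirror, map_add, map_neg, map_smul, map_smul, hm] at h4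
  have h5 : ((onGraph q (lam a) x - onGraph q (l j a) x)
      - stretch lam l q (p c) j x * (onGraph q (lam a) x - onGraph (p c) (l j a) x)) •
        𝒟 (onGraph q f) x v = 0 := by
    rw [sub_smul, mul_sub, sub_smul, sub_smul, sub_eq_zero]
    rw [smul_smul, smul_smul] at h4
    rw [add_comm, ← sub_eq_add_neg, add_comm, ← sub_eq_add_neg] at h4
    rw [← h4]
    module
  have h6 : 𝒟 (onGraph q f) x v ≠ 0 := fun h0 =>
    hv0 (N.immersion.injective hx (h0.trans (map_zero _).symm))
  exact sub_eq_zero.1 ((smul_eq_zero.1 h5).resolve_right h6)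

end

end IsLeafPencilOn

end

/-! ### Eigenvalues of the derivative of F, and their constancy along the net. -/

section

variable {X : Type*} [NormedAddCommGroup X] [NormedSpace ℝ X] [FiniteDimensional ℝ X]
  {Y : Type*} [NormedAddCommGroup Y] [NormedSpace ℝ Y] [FiniteDimensional ℝ Y]
  {E : Type*} [NormedAddCommGroup E] [InnerProductSpace ℝ E] [FiniteDimensional ℝ E]
  {k r s : ℕ}

local notation "𝒟" => D 𝓘(ℝ, X)

namespace IsLeafPencilOn

/-- The eigenvalue on the `j`-th summand of the derivative of `pencilF`. -/
noncomputable def pencilPsi (f : X × Y → E) (lam : Fin r → X × Y → ℝ)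
    (l : Fin k → Fin r → X × Y → ℝ) (q : X → Y) (p : Option (Fin s) → X → Y) (i₀ : Fin s)
    (c : Option (Fin s)) (j : Fin k) (x : X) : ℝ :=
  2 * pencilPhi (onGraph q f) (fun c => onGraph (p c) f) i₀ x
    * ⟪nu (onGraph q f) (onGraph (p c) f) x, nu (onGraph q f) (onGraph (p c) f) x⟫_ℝ
    * (1 - stretch lam l q (p c) j x)

variable {A : Set X} {C : Set Y} {f : X × Y → E} {ζ : Fin r → X × Y → E}
    {lam : Fin r → X × Y → ℝ} {l : Fin k → Fin r → X × Y → ℝ}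
    {Δ : Fin k → X × Y → Submodule ℝ (X × Y)} {O : Set X} {q : X → Y}
    {p : Option (Fin s) → X → Y} {i₀ : Fin s} {x₀ : X}
    (T : IsLeafPencilOn A C f ζ lam l Δ O q p i₀ x₀)
include T

theorem inner_nu_nu {x : X} (hx : x ∈ O) (c : Option (Fin s)) :
    ⟪nu (onGraph q f) (onGraph (p c) f) x, nu (onGraph q f) (onGraph (p c) f) x⟫_ℝ
      = (‖onGraph (p c) f x - onGraph q f x‖ ^ 2)⁻¹ := by
  rw [real_inner_self_eq_norm_sq, inner_nu_self (T.ne c x hx)]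

theorem smooth_pencilPsi (c : Option (Fin s)) (j : Fin k) :
    ContMDiffOn 𝓘(ℝ, X) 𝓘(ℝ, ℝ) ∞ (pencilPsi f lam l q p i₀ c j) O :=
  (((contMDiffOn_const (I := 𝓘(ℝ, X)) (I' := 𝓘(ℝ, ℝ)) (c := (2 : ℝ))).mul
    T.isPencilOn.smooth_phi).mul
      (contMDiffOn_inner (T.isPencilOn.smooth_nu c) (T.isPencilOn.smooth_nu c))).mul
    ((contMDiffOn_const (I := 𝓘(ℝ, X)) (I' := 𝓘(ℝ, ℝ)) (c := (1 : ℝ))).sub (T.smooth_stretch c j))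

theorem D_pencilF {x : X} (hx : x ∈ O) {j : Fin k} {v : X} (hv : v ∈ graphNet q Δ j x)
    (c : Option (Fin s)) :
    𝒟 (pencilF (onGraph q f) (fun c => onGraph (p c) f) i₀ c) x v
      = pencilPsi f lam l q p i₀ c j x • 𝒟 (onGraph q f) x v := by
  rw [T.isPencilOn.D_F hx, (T.mirror_D_leaf hx hv c).2, pencilPsi, T.inner_nu_nu hx]
  module

theorem D_lam {x : X} (hx : x ∈ O) {j : Fin k} {v : X} (hv : v ∈ graphNet q Δ j x) (a : Fin r) :
    𝒟 (onGraph q (lam a)) x v = (onGraph q (lam a) x - onGraph q (l j a) x) *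
      (2 * ⟪nu (onGraph q f) (onGraph (p none) f) x, 𝒟 (onGraph q f) x v⟫_ℝ) := by
  have N := T.adapted.isNetOn T.base
  have h1 := (T.isPencilOn.isTwinAt hx none a).two_inner_nu_eq (T.ne none x hx) v
  rw [N.D_zeta x hx j v hv a, ← neg_smul, ← add_smul, real_inner_smul_left, real_inner_comm] at h1
  rw [← h1]
  ring

/-- Differentiate λ - l_j = S (λ - l'_j) along Δ_j, where l_j and l'_j are constant and dλ = 2 (λ -
l_j)⟨ν, dh⟩; then divide by a nonzero component of λ - l'_j. -/
theorem D_stretch {x : X} (hx : x ∈ O) {j : Fin k} {v : X} (hv : v ∈ graphNet q Δ j x)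
    (c : Option (Fin s)) :
    𝒟 (stretch lam l q (p c) j) x v
      = stretch lam l q (p c) j x * (1 - stretch lam l q (p c) j x) *
        (2 * ⟪nu (onGraph q f) (onGraph (p none) f) x, 𝒟 (onGraph q f) x v⟫_ℝ) := by
  obtain ⟨a, ha⟩ := T.exists_ne hx c j
  have P := T.isPencilOn
  have hl : HasPush 𝓘(ℝ, X) (onGraph q (lam a)) x _ := P.hasPush (P.smooth_lam a) hx
  have hm : HasPush 𝓘(ℝ, X) (onGraph q (l j a)) x _ := P.hasPush (P.net.smooth_l j a) hx
  have hn : HasPush 𝓘(ℝ, X) (onGraph (p c) (l j a)) x _ :=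
    P.hasPush (T.adapted.smooth_onGraph (T.adapted.smooth_l j a) (T.leaf c)) hx
  have hS := P.hasPush (T.smooth_stretch c j) hx
  have h1 : HasPush 𝓘(ℝ, X) (fun y => onGraph q (lam a) y - onGraph q (l j a) y) x _ :=
    (hS.mul (hl.sub hn)).congr (Filter.eventually_of_mem (T.base.isOpen.mem_nhds hx)
      fun y hy => T.sub_eq_stretch_mul hy c j a)
  have h2 := congrArg (fun Q : X →L[ℝ] ℝ => Q v) (h1.unique (hl.sub hm))
  have hm0 := P.net.D_l x hx j v hv a
  have hn0 := (T.adapted.isNetOn (T.leaf c)).D_l x hx j v (T.mirror_D_leaf hx hv c).1 a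
  simp only [add_apply, smul_apply, sub_apply, smul_eq_mul, hm0, hn0, sub_zero, T.D_lam hx hv,
    T.sub_eq_stretch_mul hx c j a] at h2
  refine mul_left_cancel₀ ha ?_
  linear_combination h2

/-- With τ = ⟨ν, dh⟩, the factors of 2 φ ‖ν‖² (1 - S) change at the relative rates -2τ for φ, (2 +
2S) τ for ‖ν‖² and, when S ≠ 1, -2Sτ for 1 - S; these add to zero. -/
theorem D_pencilPsi {x : X} (hx : x ∈ O) {j : Fin k} {v : X} (hv : v ∈ graphNet q Δ j x)
    (c : Option (Fin s)) : 𝒟 (pencilPsi f lam l q p i₀ c j) x v = 0 := by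
  have P := T.isPencilOn
  have hφ := P.hasPush P.smooth_phi hx
  have hν := P.hasPush (P.smooth_nu c) hx
  have hS := P.hasPush (T.smooth_stretch c j) hx
  have h1 : HasPush 𝓘(ℝ, X) (pencilPsi f lam l q p i₀ c j) x _ :=
    ((hφ.const_mul 2).mul (hν.inner hν)).mul ((hasPush_const (1 : ℝ) x).sub hS)
  rw [h1.eq]
  have hDφ := P.D_phi hx v
  have hDν := P.exists_D_nu hx c v
  rw [(T.mirror_D_leaf hx hv c).2] at hDν
  have hin := P.inner_nu_D hx c v
  have hnn := T.inner_nu_nu hx c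
  simp only [add_apply, smul_apply, sub_apply, zero_apply, ContinuousLinearMap.comp_apply,
    innerSL_apply_apply, smul_eq_mul, hDφ, hDν, T.D_stretch hx hv c, inner_add_right,
    inner_sub_right, real_inner_smul_right, hin, hnn]
  ring

theorem isRibaucourNetOn : IsRibaucourNetOn 𝓘(ℝ, X) O (onGraph q f) (fun a => onGraph q (ζ a))
    (pencilXi (onGraph q f) (fun c => onGraph (p c) f) i₀)
    (pencilF (onGraph q f) (fun c => onGraph (p c) f) i₀ none)
    (pencilPhi (onGraph q f) (fun c => onGraph (p c) f) i₀) (fun a => onGraph q (lam a))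
    (graphNet q Δ) (fun j a => onGraph q (l j a))
    (fun j i x => -(1 / 2) * (pencilPsi f lam l q p i₀ none j x
      - pencilPsi f lam l q p i₀ (some i) j x))
    (pencilPsi f lam l q p i₀ none) where
  immersion := T.isPencilOn.net.immersion
  smooth_zeta := T.isPencilOn.net.smooth_zeta
  smooth_xi := T.isPencilOn.smooth_xi
  smooth_F := T.isPencilOn.smooth_F none
  smooth_phi := T.isPencilOn.smooth_phi
  smooth_l := T.isPencilOn.net.smooth_l
  smooth_chi j i := (contMDiffOn_const (I := 𝓘(ℝ, X)) (I' := 𝓘(ℝ, ℝ)) (c := (-(1 / 2) : ℝ))).mul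
    ((T.smooth_pencilPsi none j).sub (T.smooth_pencilPsi (some i) j))
  smooth_psi j := T.smooth_pencilPsi none j
  phi_ne x hx := (T.isPencilOn.phi_pos hx).ne'
  F_ne x hx := smul_ne_zero (mul_ne_zero (by norm_num) (T.isPencilOn.phi_pos hx).ne')
    (T.isPencilOn.nu_ne_zero hx none)
  zeta_normal x hx a := by
    rintro _ ⟨v, rfl⟩
    rw [real_inner_comm]
    exact T.isPencilOn.net.zeta_normal x hx a v
  xi_normal x hx i := by
    rintro _ ⟨v, rfl⟩
    rw [real_inner_comm]
    exact T.isPencilOn.inner_xi_D hx i v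
  orthonormal x hx := by
    rw [orthonormal_iff_ite]
    have h1 := orthonormal_iff_ite.1 (T.isPencilOn.net.orthonormal x hx)
    have h2 := T.isPencilOn.inner_xi_xi hx
    have h3 := T.isPencilOn.inner_xi_zeta hx
    rintro (a | i) (b | j)
    · simpa using h1 a b
    · simpa [real_inner_comm] using h3 j a
    · simpa using h3 i b
    · simpa using h2 i j
  dim := T.isPencilOn.dim
  inner_F x hx v := T.isPencilOn.inner_F_D hx none v
  inner_F_zeta x hx a := T.isPencilOn.inner_F_zeta hx none a
  iSup_eq := T.isPencilOn.net.iSup_eq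
  rank := T.isPencilOn.net.rank
  distinct := T.isPencilOn.net.distinct
  ne_lam := T.isPencilOn.ne_lam
  D_zeta := T.isPencilOn.net.D_zeta
  D_xi x hx j v hv i := by
    rw [T.isPencilOn.D_xi hx, T.D_pencilF hx hv, T.D_pencilF hx hv]
    module
  D_F x hx j v hv := T.D_pencilF hx hv none
  D_l := T.isPencilOn.net.D_l
  D_chi x hx j v hv i := by
    have P := T.isPencilOn
    have h1 : HasPush 𝓘(ℝ, X) (fun x => -(1 / 2) * (pencilPsi f lam l q p i₀ none j x
        - pencilPsi f lam l q p i₀ (some i) j x)) x _ :=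
      ((P.hasPush (T.smooth_pencilPsi none j) hx).sub
        (P.hasPush (T.smooth_pencilPsi (some i) j) hx)).const_mul (-(1 / 2))
    rw [h1.eq]
    simp only [smul_apply, sub_apply, T.D_pencilPsi hx hv, sub_zero, smul_zero]
  D_psi x hx j v hv := T.D_pencilPsi hx hv none

end IsLeafPencilOn

end

/-! ### Inverse functions, points in general position, existence of pencils. -/

section

/-- The inverse function theorem on an open set. -/
theorem exists_openPartialHomeomorph {F G : Type*} [NormedAddCommGroup F] [NormedSpace ℝ F]
    [CompleteSpace F] [NormedAddCommGroup G] [NormedSpace ℝ G] {a : F → G} {U : Set F}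
    (hU : IsOpen U) (ha : ContDiffOn ℝ ∞ a U) {x : F} (hx : x ∈ U) {a' : F ≃L[ℝ] G}
    (ha' : HasFDerivAt a (a' : F →L[ℝ] G) x) :
    ∃ e : OpenPartialHomeomorph F G, x ∈ e.source ∧ e.source ⊆ U ∧ (e : F → G) = a ∧
      ContDiffOn ℝ ∞ e e.source ∧ ContDiffOn ℝ ∞ e.symm e.target := by
  have hax : ContDiffAt ℝ ∞ a x := (ha x hx).contDiffAt (hU.mem_nhds hx)
  let e := hax.toOpenPartialHomeomorph a ha' (by simp)
  have he : (e : F → G) = a := hax.toOpenPartialHomeomorph_coe ha' (by simp)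
  set R : Set (F →L[ℝ] G) := Set.range ((↑) : (F ≃L[ℝ] G) → F →L[ℝ] G) with hR
  have hRo : IsOpen R := ContinuousLinearEquiv.isOpen
  have hc : ContinuousOn (fderiv ℝ a) U := ha.continuousOn_fderiv_of_isOpen hU (by simp)
  -- Restricting to points with invertible derivative makes the inverse smooth on the whole target,
  -- not only at the image of x.
  have hV : IsOpen (U ∩ fderiv ℝ a ⁻¹' R) := hc.isOpen_inter_preimage hU hRo
  refine ⟨e.restrOpen _ hV, ?_, ?_, he, ?_, ?_⟩
  · rw [OpenPartialHomeomorph.restrOpen_source]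
    exact ⟨hax.mem_toOpenPartialHomeomorph_source ha' (by simp), hx, a', by rw [ha'.fderiv]⟩
  · rw [OpenPartialHomeomorph.restrOpen_source]
    exact fun y hy => hy.2.1
  · have h1 : (e.restrOpen _ hV : F → G) = a := he
    rw [h1]
    refine ha.mono ?_
    rw [OpenPartialHomeomorph.restrOpen_source]
    exact fun y hy => hy.2.1
  · intro y hy
    set e' := e.restrOpen _ hV with he'
    have h1 : e'.symm y ∈ e'.source := e'.map_target hy
    have h2 : e'.symm y ∈ U ∩ fderiv ℝ a ⁻¹' R := by
      rw [he', OpenPartialHomeomorph.restrOpen_source] at h1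
      exact h1.2
    obtain ⟨A, hA⟩ := h2.2
    have h3 : ContDiffAt ℝ ∞ a (e'.symm y) := (ha _ h2.1).contDiffAt (hU.mem_nhds h2.1)
    have h4 : (e' : F → G) = a := he
    refine (e'.contDiffAt_symm hy (f₀' := A) ?_ ?_).contDiffWithinAt
    · rw [h4, hA]
      exact (h3.differentiableAt (by simp)).hasFDerivAt
    · rw [h4]
      exact h3

variable {X : Type*} [NormedAddCommGroup X] [NormedSpace ℝ X] [FiniteDimensional ℝ X]
  {Y : Type*} [NormedAddCommGroup Y] [NormedSpace ℝ Y] [FiniteDimensional ℝ Y]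
  {E : Type*} [NormedAddCommGroup E] [InnerProductSpace ℝ E] [FiniteDimensional ℝ E]
  {k r s : ℕ}

local notation "𝒟" => D 𝓘(ℝ, X)
local notation "𝒟'" => D 𝓘(ℝ, X × Y)

namespace IsAdaptedOn

variable {A : Set X} {C : Set Y} {f : X × Y → E} {ζ : Fin r → X × Y → E}
    {lam : Fin r → X × Y → ℝ} {l : Fin k → Fin r → X × Y → ℝ}
    {Δ : Fin k → X × Y → Submodule ℝ (X × Y)} {O : Set X} {q : X → Y}
    (T : IsAdaptedOn A C f ζ lam l Δ)

/-- The normal directions of a leaf which are orthogonal to the frame `ζ`. -/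
noncomputable def coframe (h : X → E) (ζ : Fin r → X → E) (x : X) : Submodule ℝ E :=
  (tangent 𝓘(ℝ, X) h x ⊔ Submodule.span ℝ (Set.range fun a => ζ a x))ᗮ

theorem mem_coframe {h : X → E} {ζ : Fin r → X → E} {x : X} {n : E} :
    n ∈ coframe h ζ x ↔ (∀ v, ⟪n, 𝒟 h x v⟫_ℝ = 0) ∧ ∀ a, ⟪n, ζ a x⟫_ℝ = 0 := by
  rw [coframe, ← Submodule.inf_orthogonal, Submodule.mem_inf, Submodule.mem_orthogonal',
    Submodule.mem_orthogonal']
  refine and_congr ⟨fun h v => h _ (D_mem_tangent _ x v), ?_⟩ ⟨fun h a => h _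
    (Submodule.subset_span ⟨a, rfl⟩), fun h b hb => ?_⟩
  · rintro h _ ⟨v, rfl⟩
    exact h v
  · exact inner_eq_zero_of_mem_span h hb

include T

theorem finrank_coframe (L : IsLeafOn A C f O q) {x : X} (hx : x ∈ O) :
    Module.finrank ℝ (coframe (onGraph q f) (fun a => onGraph q (ζ a)) x)
      = Module.finrank ℝ Y := by
  have N := T.isNetOn L
  have h1 : Module.finrank ℝ (tangent 𝓘(ℝ, X) (onGraph q f) x) = Module.finrank ℝ X :=
    LinearMap.finrank_range_of_inj (N.immersion.injective hx)
  have h2 : Module.finrank ℝ (Submodule.span ℝ (Set.range fun a => onGraph q (ζ a) x)) = r := by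
    rw [finrank_span_eq_card (N.orthonormal x hx).linearIndependent, Fintype.card_fin]
  have hdis : Disjoint (tangent 𝓘(ℝ, X) (onGraph q f) x)
      (Submodule.span ℝ (Set.range fun a => onGraph q (ζ a) x)) := by
    rw [Submodule.disjoint_def]
    rintro _ ⟨v, rfl⟩ hb
    refine (inner_self_eq_zero (𝕜 := ℝ)).1 (inner_eq_zero_of_mem_span (fun i => ?_) hb)
    rw [real_inner_comm]
    exact N.zeta_normal x hx i v
  have h3 := Submodule.finrank_add_finrank_orthogonal (tangent 𝓘(ℝ, X) (onGraph q f) x ⊔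
    Submodule.span ℝ (Set.range fun a => onGraph q (ζ a) x))
  have h4 := Submodule.finrank_sup_add_finrank_inf_eq (tangent 𝓘(ℝ, X) (onGraph q f) x)
    (Submodule.span ℝ (Set.range fun a => onGraph q (ζ a) x))
  rw [hdis.eq_bot, finrank_bot] at h4
  have h5 := T.dim
  rw [coframe]
  omega

theorem nu_sub_nu_mem (L : IsLeafOn A C f O q) {x : X} (hx : x ∈ O) {y y' : Y} (hy : y ∈ C)
    (hy' : y' ∈ C) (hne : f (x, y) ≠ onGraph q f x) (hne' : f (x, y') ≠ onGraph q f x) :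
    nu (onGraph q f) (onGraph (fun _ => y) f) x - nu (onGraph q f) (onGraph (fun _ => y') f) x
      ∈ coframe (onGraph q f) (fun a => onGraph q (ζ a)) x := by
  have hz : ∀ y ∈ C, f (x, y) ≠ onGraph q f x → ∀ a,
      2 * ⟪nu (onGraph q f) (onGraph (fun _ => y) f) x, onGraph q (ζ a) x⟫_ℝ
        = onGraph q (lam a) x := by
    intro y hy hne a
    have h0 : ‖onGraph (fun _ => y) f x - onGraph q f x‖ ^ 2 ≠ 0 :=
      pow_ne_zero 2 (norm_ne_zero_iff.2 (sub_ne_zero.2 hne))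
    rw [nu, real_inner_smul_left, mul_left_comm,
      (T.isTwinAt_const L hx hy a).inner_eq.self_of_nhds, mul_comm, mul_assoc,
      mul_inv_cancel₀ h0, mul_one]
  refine mem_coframe.2 ⟨(T.isNetOn L).inner_D_eq_zero hx (lam := fun a => onGraph q (lam a) x)
    (fun j => T.ne_lam _ (L.mem x hx) j) fun a v => ?_, fun a => ?_⟩
  · have h1 := (T.isTwinAt_const L hx hy a).two_inner_nu_eq hne v
    have h2 := (T.isTwinAt_const L hx hy' a).two_inner_nu_eq hne' v
    rw [inner_sub_right]
    linarith
  · rw [inner_sub_left]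
    linarith [hz y hy hne a, hz y' hy' hne' a]

theorem mirror_vert_mem (L : IsLeafOn A C f O q) {x : X} (hx : x ∈ O) {y : Y} (hy : y ∈ C)
    (hne : f (x, y) ≠ onGraph q f x) (w : Y) :
    mirror (f (x, y) - onGraph q f x) (𝒟' f (x, y) (0, w))
      ∈ coframe (onGraph q f) (fun a => onGraph q (ζ a)) x := by
  have hp := L.mem x hx
  refine mem_coframe.2 ⟨T.inner_mirror_vert L hx hy hne w, fun a => ?_⟩
  have h1 := mirror_zeta (h := onGraph q f) (g := onGraph (fun _ => y) f) (ζ := onGraph q (ζ a))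
    (lam := onGraph q (lam a)) (x := x) hne (T.two_inner_eq a hp.1 hy hp.2)
  have h2 := T.zeta_eq a hp.1 hy hp.2
  rw [inner_mirror_left]
  have h3 : mirror (f (x, y) - onGraph q f x) (onGraph q (ζ a) x) = ζ a (x, y) := by
    rw [h2]; exact h1
  rw [h3, real_inner_comm]
  exact T.zeta_normal (x, y) ⟨hp.1, hy⟩ a _

theorem injective_nu_vert (L : IsLeafOn A C f O q) {x : X} (hx : x ∈ O) {y : Y} (hy : y ∈ C)
    (hne : f (x, y) ≠ onGraph q f x) : Function.Injective
      ((‖f (x, y) - onGraph q f x‖ ^ 2)⁻¹ •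
        ((mirror (f (x, y) - onGraph q f x)).toContinuousLinearEquiv : E →L[ℝ] E).comp
          ((𝒟' f (x, y)).comp (ContinuousLinearMap.inr ℝ X Y))) := by
  have hn0 : ‖f (x, y) - onGraph q f x‖ ^ 2 ≠ 0 :=
    pow_ne_zero 2 (norm_ne_zero_iff.2 (sub_ne_zero.2 hne))
  intro w w' hw
  have h1 := smul_right_injective E (inv_ne_zero hn0) hw
  have h2 := (mirror (f (x, y) - onGraph q f x)).injective h1
  exact congrArg Prod.snd (T.immersion.injective (x := (x, y)) ⟨(L.mem x hx).1, hy⟩ h2)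

/-- Points of a fibre in general position with respect to a leaf. -/
theorem exists_orthogonal_points (hY : Module.finrank ℝ Y = s) (L : IsLeafOn A C f O q) {x : X}
    (hx : x ∈ O) {y : Y} (hy : y ∈ C) (hne : f (x, y) ≠ onGraph q f x) :
    ∃ ε : ℝ, 0 < ε ∧ ∃ z : Fin s → Y, (∀ i, z i ∈ C ∧ f (x, z i) ≠ onGraph q f x) ∧
      ∀ i j, ⟪nu (onGraph q f) (onGraph (fun _ => z i) f) x
          - nu (onGraph q f) (onGraph (fun _ => y) f) x,
        nu (onGraph q f) (onGraph (fun _ => z j) f) x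
          - nu (onGraph q f) (onGraph (fun _ => y) f) x⟫_ℝ = if i = j then ε ^ 2 else 0 := by
  set W := coframe (onGraph q f) (fun a => onGraph q (ζ a)) x with hW
  have hxA := (L.mem x hx).1
  let b : OrthonormalBasis (Fin s) ℝ W :=
    (stdOrthonormalBasis ℝ W).reindex (finCongr ((T.finrank_coframe L hx).trans hY))
  set ν : Y → E := nu (fun _ => onGraph q f x) fun z => f (x, z) with hν
  set ν' := (‖f (x, y) - onGraph q f x‖ ^ 2)⁻¹ •
        ((mirror (f (x, y) - onGraph q f x)).toContinuousLinearEquiv : E →L[ℝ] E).comp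
          ((𝒟' f (x, y)).comp (ContinuousLinearMap.inr ℝ X Y)) with hν'
  have hfs : ContDiffOn ℝ ∞ (fun z => f (x, z)) C :=
    (contMDiffOn_iff_contDiffOn.1 T.immersion.1).comp (contDiff_prodMk_right x).contDiffOn
      fun z hz => ⟨hxA, hz⟩
  have hν_smooth : ContDiffAt ℝ ∞ ν y := by
    have h1 : ContDiffAt ℝ ∞ (fun z => f (x, z) - onGraph q f x) y :=
      ((hfs y hy).contDiffAt (T.isOpen_right.mem_nhds hy)).sub contDiffAt_const
    exact ((h1.norm_sq ℝ).inv (pow_ne_zero 2 (norm_ne_zero_iff.2 (sub_ne_zero.2 hne)))).smul h1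
  have hstrict : HasStrictFDerivAt ν ν' y :=
    hν_smooth.hasStrictFDerivAt' (hasPush_id_iff.1 (T.hasPush_nu_vert L hx hy hne)) (by simp)
  -- Differences of ν along the fibre lie in the s-dimensional space W, and the vertical derivative
  -- of ν is injective with values in W; so ν - ν(y) covers a neighbourhood of 0 in W.
  let G : Y → W := fun z => W.orthogonalProjectionOnto (ν z - ν y)
  have hG : HasStrictFDerivAt G (W.orthogonalProjectionOnto.comp ν') y :=
    W.orthogonalProjectionOnto.hasStrictFDerivAt.comp y (hstrict.sub_const (ν y))
  have hν'W : ∀ w, ν' w ∈ W := fun w => W.smul_mem _ (T.mirror_vert_mem L hx hy hne w)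
  have hinj : Function.Injective (W.orthogonalProjectionOnto.comp ν') := by
    intro w w' hw
    refine T.injective_nu_vert L hx hy hne ?_
    have h1 := congrArg Subtype.val hw
    change W.starProjection (ν' w) = W.starProjection (ν' w') at h1
    rwa [Submodule.starProjection_eq_self_iff.2 (hν'W w),
      Submodule.starProjection_eq_self_iff.2 (hν'W w')] at h1
  have hsurj : Function.Surjective (W.orthogonalProjectionOnto.comp ν' : Y →ₗ[ℝ] W) :=
    (LinearMap.injective_iff_surjective_of_finrank_eq_finrank
      (T.finrank_coframe L hx).symm).1 hinj
  have hmap := hG.map_nhds_eq_of_surj (LinearMap.range_eq_top.2 hsurj)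
  have hG0 : G y = 0 := by simp [G]
  rw [hG0] at hmap
  have hev : {z | z ∈ C ∧ f (x, z) ≠ onGraph q f x} ∈ 𝓝 y := by
    filter_upwards [T.isOpen_right.mem_nhds hy,
      ((hfs.continuousOn.continuousAt (T.isOpen_right.mem_nhds hy))).eventually_ne hne] with z h1 h2
    exact ⟨h1, h2⟩
  have himg : G '' {z | z ∈ C ∧ f (x, z) ≠ onGraph q f x} ∈ 𝓝 (0 : W) := by
    rw [← hmap]
    exact Filter.image_mem_map hev
  obtain ⟨δ, hδ, hball⟩ := Metric.mem_nhds_iff.1 himg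
  -- Points over δ/2 times an orthonormal basis of W have orthogonal differences of equal length, as
  -- `IsPencilOn.gram` requires.
  have hmem : ∀ i, (δ / 2) • b i ∈ G '' {z | z ∈ C ∧ f (x, z) ≠ onGraph q f x} := by
    intro i
    apply hball
    rw [mem_ball_zero_iff, norm_smul, b.orthonormal.1 i, Real.norm_of_nonneg (by positivity)]
    linarith
  choose z hz hzG using hmem
  refine ⟨δ / 2, by positivity, z, hz, fun i j => ?_⟩
  have h2 : ∀ i, nu (onGraph q f) (onGraph (fun _ => z i) f) x
      - nu (onGraph q f) (onGraph (fun _ => y) f) x = (((δ / 2) • b i : W) : E) := by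
    intro i
    rw [← hzG i]
    exact (Submodule.starProjection_eq_self_iff.2
      (T.nu_sub_nu_mem L hx (hz i).1 hy (hz i).2 hne)).symm
  rw [h2, h2, ← Submodule.coe_inner, real_inner_smul_left, real_inner_smul_right,
    orthonormal_iff_ite.1 b.orthonormal i j]
  split_ifs <;> ring

/-- Leaf pencils exist near every point. -/
theorem exists_isLeafPencilOn (hY : Module.finrank ℝ Y = s) (hs : 1 ≤ s)
    (hleaf : ∀ x ∈ A, ∀ y ∈ C, ∃ O' q', IsLeafOn A C f O' q' ∧ x ∈ O' ∧ q' x = y) {x₀ : X} {y₀ : Y}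
    (hx₀ : x₀ ∈ A) (hy₀ : y₀ ∈ C) : ∃ (δ : ℝ) (q : X → Y) (p : Option (Fin s) → X → Y) (i₀ : Fin s),
      0 < δ ∧ IsLeafPencilOn A C f ζ lam l Δ (Metric.ball x₀ δ) q p i₀ x₀ ∧
        f (x₀, y₀) ≠ onGraph q f x₀ := by
  have : Nontrivial Y := Module.nontrivial_of_finrank_pos (R := ℝ) (by omega)
  have hnb : (𝓝[≠] y₀).NeBot := Module.punctured_nhds_neBot ℝ Y y₀
  -- The base leaf passes through a point y₁ of the fibre other than y₀, so that the inversion at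
  -- (x₀, y₀) is defined. The leaf `none` goes through y₀ and the leaves `some i` through the points
  -- z_i.
  obtain ⟨y₁, hy₁C, hy₁⟩ := (dense_compl_singleton y₀).inter_open_nonempty C T.isOpen_right ⟨y₀, hy₀⟩
  obtain ⟨O₁, q, L, hxO₁, hq⟩ := hleaf x₀ hx₀ y₁ hy₁C
  have hne : ∀ y ∈ C, y ≠ y₁ → f (x₀, y) ≠ onGraph q f x₀ := by
    intro y hy hyy h
    rw [onGraph, hq] at h
    exact hyy (congrArg Prod.snd (T.injOn (x₁ := (x₀, y)) (x₂ := (x₀, y₁)) ⟨hx₀, hy⟩ ⟨hx₀, hy₁C⟩ h))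
  have hne₀ := hne y₀ hy₀ fun h => hy₁ h.symm
  obtain ⟨ε, hε, z, hz, hgram⟩ := T.exists_orthogonal_points hY L hxO₁ hy₀ hne₀
  have hc : ∀ c : Option (Fin s), ∃ O' q', IsLeafOn A C f O' q' ∧ x₀ ∈ O' ∧
      q' x₀ = Option.elim c y₀ z := by
    rintro (_ | i)
    · exact hleaf x₀ hx₀ y₀ hy₀
    · exact hleaf x₀ hx₀ (z i) (hz i).1
  choose O' p Lp hxO' hp using hc
  let i₀ : Fin s := ⟨0, hs⟩
  have hnu : ∀ c, nu (onGraph q f) (onGraph (p c) f) x₀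
      = nu (onGraph q f) (onGraph (fun _ => Option.elim c y₀ z) f) x₀ := by
    intro c
    simp only [nu, onGraph, hp]
  have hne₁ : ∀ c, onGraph (p c) f x₀ ≠ onGraph q f x₀ := by
    rintro (_ | i)
    · have := hne₀; rw [onGraph, hp]; exact this
    · have := (hz i).2; rw [onGraph, hp]; exact this
  have hgram' : ∀ i j, ⟪nu (onGraph q f) (onGraph (p (some i)) f) x₀
      - nu (onGraph q f) (onGraph (p none) f) x₀,
      nu (onGraph q f) (onGraph (p (some j)) f) x₀
        - nu (onGraph q f) (onGraph (p none) f) x₀⟫_ℝ = if i = j then ε ^ 2 else 0 := by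
    intro i j
    rw [hnu, hnu, hnu]
    exact hgram i j
  have hfc : ∀ {O' q'}, IsLeafOn A C f O' q' → x₀ ∈ O' → ContinuousAt (onGraph q' f) x₀ :=
    fun L hx => (T.smooth_onGraph T.immersion.1 L).continuousOn.continuousAt (L.isOpen.mem_nhds hx)
  have hnuc : ∀ c, ContinuousAt (nu (onGraph q f) (onGraph (p c) f)) x₀ := by
    intro c
    have h1 := (hfc (Lp c) (hxO' c)).sub (hfc L hxO₁)
    exact ((h1.norm.pow 2).inv₀
      (pow_ne_zero 2 (norm_ne_zero_iff.2 (sub_ne_zero.2 (hne₁ c))))).smul h1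
  have hnune : nu (onGraph q f) (onGraph (p (some i₀)) f) x₀
      - nu (onGraph q f) (onGraph (p none) f) x₀ ≠ 0 := by
    intro h0
    have := hgram' i₀ i₀
    rw [h0, inner_zero_left, if_pos rfl] at this
    exact (pow_pos hε 2).ne this
  have hev : ∀ᶠ x in 𝓝 x₀, (x ∈ O₁ ∧ nu (onGraph q f) (onGraph (p (some i₀)) f) x
      - nu (onGraph q f) (onGraph (p none) f) x ≠ 0) ∧
      ∀ c, x ∈ O' c ∧ onGraph (p c) f x - onGraph q f x ≠ 0 := by
    have h1 : ∀ᶠ x in 𝓝 x₀, x ∈ O₁ := L.isOpen.mem_nhds hxO₁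
    have h2 : ∀ᶠ x in 𝓝 x₀, ∀ c, x ∈ O' c := Filter.eventually_all.2 fun c =>
      (Lp c).isOpen.mem_nhds (hxO' c)
    have h3 : ∀ᶠ x in 𝓝 x₀, ∀ c, onGraph (p c) f x - onGraph q f x ≠ 0 :=
      Filter.eventually_all.2 fun c =>
        ((hfc (Lp c) (hxO' c)).sub (hfc L hxO₁)).eventually_ne (sub_ne_zero.2 (hne₁ c))
    filter_upwards [h1, h2, h3, ((hnuc (some i₀)).sub (hnuc none)).eventually_ne hnune]
      with x h1 h2 h3 h4
    exact ⟨⟨h1, h4⟩, fun c => ⟨h2 c, h3 c⟩⟩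
  obtain ⟨δ, hδ, hball⟩ := Metric.mem_nhds_iff.1 hev
  refine ⟨δ, q, p, i₀, hδ, ?_, hne₀⟩
  exact {
    adapted := T
    preconnected := (convex_ball x₀ δ).isPreconnected
    base_mem := Metric.mem_ball_self hδ
    finrank_right := hY
    base := L.mono Metric.isOpen_ball fun x hx => (hball hx).1.1
    leaf := fun c => (Lp c).mono Metric.isOpen_ball fun x hx => ((hball hx).2 c).1
    exists_leaf := hleaf
    ne := fun c x hx => sub_ne_zero.1 ((hball hx).2 c).2
    nu_ne := fun x hx => sub_ne_zero.1 (hball hx).1.2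
    gram := fun i j => by
      rw [hgram' i j, ← real_inner_self_eq_norm_sq, hgram' i₀ i₀, if_pos rfl] }

end IsAdaptedOn

end

/-! ### The submanifold as a Ribaucour transform of the base leaf. -/

section

variable {X : Type*} [NormedAddCommGroup X] [NormedSpace ℝ X] [FiniteDimensional ℝ X]
  {Y : Type*} [NormedAddCommGroup Y] [NormedSpace ℝ Y] [FiniteDimensional ℝ Y]
  {E : Type*} [NormedAddCommGroup E] [InnerProductSpace ℝ E] [FiniteDimensional ℝ E]
  {k r s : ℕ}

local notation "𝒟" => D 𝓘(ℝ, X)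
local notation "𝒟'" => D 𝓘(ℝ, X × Y)

/-- The coordinates of `f` in the normal frame of a pencil over `h`. -/
noncomputable def pencilCoord (h : X → E) (g : Option (Fin s) → X → E) (i₀ : Fin s) (f : X × Y → E)
    (p : X × Y) : X × EuclideanSpace ℝ (Fin s) :=
  (p.1, WithLp.toLp 2 fun i => ⟪pencilXi h g i₀ i p.1,
    (-2 * pencilPhi h g i₀ p.1) • ((‖f p - h p.1‖ ^ 2)⁻¹ • (f p - h p.1))
      - pencilF h g i₀ none p.1⟫_ℝ)

namespace IsLeafPencilOn

variable {A : Set X} {C : Set Y} {f : X × Y → E} {ζ : Fin r → X × Y → E}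
    {lam : Fin r → X × Y → ℝ} {l : Fin k → Fin r → X × Y → ℝ}
    {Δ : Fin k → X × Y → Submodule ℝ (X × Y)} {O : Set X} {q : X → Y}
    {p : Option (Fin s) → X → Y} {i₀ : Fin s} {x₀ : X}
    (T : IsLeafPencilOn A C f ζ lam l Δ O q p i₀ x₀)
include T

/-- The vector -2 φ ν - F_none is normal to h and orthogonal to the ζ_a, hence equals ∑ t_i ξ_i;
`pencilCoord` reads off the t_i. So F_t = -2 φ ν. -/
theorem combescureT_eq {x : X} (hx : x ∈ O) {y : Y} (hy : y ∈ C)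
    (hne : f (x, y) ≠ onGraph q f x) :
    combescureT 𝓘(ℝ, X) (onGraph q f) (pencilPhi (onGraph q f) (fun c => onGraph (p c) f) i₀)
      (normalPart 𝓘(ℝ, X) (onGraph q f)
        (pencilF (onGraph q f) (fun c => onGraph (p c) f) i₀ none)
        (pencilPhi (onGraph q f) (fun c => onGraph (p c) f) i₀))
      (pencilXi (onGraph q f) (fun c => onGraph (p c) f) i₀)
      (pencilCoord (onGraph q f) (fun c => onGraph (p c) f) i₀ f (x, y))
    = (-2 * pencilPhi (onGraph q f) (fun c => onGraph (p c) f) i₀ x) •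
      nu (onGraph q f) (onGraph (fun _ => y) f) x := by
  have P := T.isPencilOn
  rw [combescureT, combescure_normalPart]
  have htw := fun a => T.adapted.isTwinAt_const T.base hx hy a
  have h1 := (P.orthonormal_xi hx).sum_inner_smul_of_mem_span
    (P.mem_span_xi hx (n := (-2 * pencilPhi (onGraph q f) (fun c => onGraph (p c) f) i₀ x) •
      nu (onGraph q f) (onGraph (fun _ => y) f) x
        - pencilF (onGraph q f) (fun c => onGraph (p c) f) i₀ none x)
      (fun v => by
        rw [inner_sub_left, real_inner_smul_left, P.twin_inner_nu_D hx htw hne, P.inner_F_D hx,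
          P.D_phi hx]
        ring)
      (fun a => by
        have h0 : ‖onGraph (fun _ => y) f x - onGraph q f x‖ ^ 2 ≠ 0 :=
          pow_ne_zero 2 (norm_ne_zero_iff.2 (sub_ne_zero.2 hne))
        have h2 : 2 * ⟪nu (onGraph q f) (onGraph (fun _ => y) f) x, onGraph q (ζ a) x⟫_ℝ
            = onGraph q (lam a) x := by
          rw [nu, real_inner_smul_left, mul_left_comm, (htw a).inner_eq.self_of_nhds, mul_comm,
            mul_assoc, mul_inv_cancel₀ h0, mul_one]
        rw [inner_sub_left, real_inner_smul_left, P.inner_F_zeta hx, ← h2]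
        ring))
  exact (sub_eq_iff_eq_add'.1 h1.symm).symm

/-- With F_t = -2 φ ν the Ribaucour formula becomes h + ν / ‖ν‖², and inversion is an involution. -/
theorem ribaucour_eq {x : X} (hx : x ∈ O) {y : Y} (hy : y ∈ C) (hne : f (x, y) ≠ onGraph q f x) :
    ribaucour 𝓘(ℝ, X) (onGraph q f) (pencilPhi (onGraph q f) (fun c => onGraph (p c) f) i₀)
      (normalPart 𝓘(ℝ, X) (onGraph q f)
        (pencilF (onGraph q f) (fun c => onGraph (p c) f) i₀ none)
        (pencilPhi (onGraph q f) (fun c => onGraph (p c) f) i₀))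
      (pencilXi (onGraph q f) (fun c => onGraph (p c) f) i₀)
      (pencilCoord (onGraph q f) (fun c => onGraph (p c) f) i₀ f (x, y)) = f (x, y) := by
  rw [ribaucour, T.combescureT_eq hx hy hne]
  set φ := pencilPhi (onGraph q f) (fun c => onGraph (p c) f) i₀
  change onGraph q f x - (2 * φ x * _) • _ = _
  have hφ : φ x ≠ 0 := (T.isPencilOn.phi_pos hx).ne'
  have h1 := inner_nu_self (h := onGraph q f) (g := onGraph (fun _ => y) f) (x := x) hne
  have h0 : ‖onGraph (fun _ => y) f x - onGraph q f x‖ ^ 2 ≠ 0 :=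
    pow_ne_zero 2 (norm_ne_zero_iff.2 (sub_ne_zero.2 hne))
  rw [norm_smul, mul_pow, h1, nu, Real.norm_eq_abs, sq_abs, smul_smul, smul_smul]
  change onGraph q f x - _ • (f (x, y) - onGraph q f x) = f (x, y)
  generalize ‖onGraph (fun _ => y) f x - onGraph q f x‖ ^ 2 = N at h0
  have h2 : 2 * φ x * ((-2 * φ x) ^ 2 * N⁻¹)⁻¹ * (-2 * φ x) * N⁻¹ = -1 := by
    field_simp
  rw [h2]
  module

/-- The first component is x itself. Vertically the derivative is -2 φ times the ξ-components of dν,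
which determine dν and hence the vertical vector. -/
theorem injective_fderiv_pencilCoord {x : X} (hx : x ∈ O) {y : Y} (hy : y ∈ C)
    (hne : f (x, y) ≠ onGraph q f x) {a' : X × Y →L[ℝ] X × EuclideanSpace ℝ (Fin s)}
    (ha' : HasFDerivAt (pencilCoord (onGraph q f) (fun c => onGraph (p c) f) i₀ f) a' (x, y)) :
    Function.Injective a' := by
  have P := T.isPencilOn
  rw [injective_iff_map_eq_zero]
  rintro ⟨v, w⟩ h0
  have hv : v = 0 := by
    have h1 : HasFDerivAt (fun p : X × Y => p.1) ((ContinuousLinearMap.fst ℝ X _).comp a') (x, y) :=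
      ha'.fst
    have h2 := congrArg (fun Q : X × Y →L[ℝ] X => Q (v, w)) (h1.unique hasFDerivAt_fst)
    simpa [h0] using h2.symm
  subst hv
  have hν := hasPush_id_iff.1 (T.adapted.hasPush_nu_vert T.base hx hy hne)
  have hmem := T.adapted.mirror_vert_mem T.base hx hy hne w
  set ν' := (‖f (x, y) - onGraph q f x‖ ^ 2)⁻¹ •
        ((mirror (f (x, y) - onGraph q f x)).toContinuousLinearEquiv : E →L[ℝ] E).comp
          ((𝒟' f (x, y)).comp (ContinuousLinearMap.inr ℝ X Y)) with hν'
  have hν'w : ν' w ∈ IsAdaptedOn.coframe (onGraph q f) (fun a => onGraph q (ζ a)) x :=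
    Submodule.smul_mem _ _ hmem
  have hin : ∀ i, ⟪pencilXi (onGraph q f) (fun c => onGraph (p c) f) i₀ i x, ν' w⟫_ℝ = 0 := by
    intro i
    set φ := pencilPhi (onGraph q f) (fun c => onGraph (p c) f) i₀
    have hφ : φ x ≠ 0 := (T.isPencilOn.phi_pos hx).ne'
    have h1 := (innerSL ℝ (pencilXi (onGraph q f) (fun c => onGraph (p c) f) i₀ i x)).hasFDerivAt.comp
      y ((hν.const_smul (-2 * φ x)).sub_const
        (pencilF (onGraph q f) (fun c => onGraph (p c) f) i₀ none x))
    have h2 := ((EuclideanSpace.proj i : EuclideanSpace ℝ (Fin s) →L[ℝ] ℝ).hasFDerivAt.comp (x, y)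
      ha'.snd).comp y (hasFDerivAt_prodMk_right x y)
    have h3 := congrArg (fun Q : Y →L[ℝ] ℝ => Q w) (h1.unique h2)
    simp only [ContinuousLinearMap.comp_apply, ContinuousLinearMap.inr_apply, h0, smul_apply,
      innerSL_apply_apply, real_inner_smul_right] at h3
    have h4 : -2 * φ x * ⟪pencilXi (onGraph q f) (fun c => onGraph (p c) f) i₀ i x, ν' w⟫_ℝ = 0 := by
      rw [h3]; simp
    exact (mul_eq_zero.1 h4).resolve_left (mul_ne_zero (by norm_num) hφ)
  have hspan := P.mem_span_xi hx (IsAdaptedOn.mem_coframe.1 hν'w).1 (IsAdaptedOn.mem_coframe.1 hν'w).2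
  have h5 := (P.orthonormal_xi hx).sum_inner_smul_of_mem_span hspan
  simp only [hin, zero_smul, Finset.sum_const_zero] at h5
  have h6 : w = 0 := T.adapted.injective_nu_vert T.base hx hy hne
    (show ν' w = ν' 0 by rw [← h5, map_zero])
  rw [h6]
  rfl

theorem contDiffOn_pencilCoord : ContDiffOn ℝ ∞
    (pencilCoord (onGraph q f) (fun c => onGraph (p c) f) i₀ f)
    {z | z ∈ O ×ˢ C ∧ f z ≠ onGraph q f z.1} := by
  have P := T.isPencilOn
  have hfst : ∀ {G : Type _} [NormedAddCommGroup G] [NormedSpace ℝ G] {a : X → G},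
      ContMDiffOn 𝓘(ℝ, X) 𝓘(ℝ, G) ∞ a O →
      ContDiffOn ℝ ∞ (fun z : X × Y => a z.1) {z | z ∈ O ×ˢ C ∧ f z ≠ onGraph q f z.1} := fun ha =>
    (contMDiffOn_iff_contDiffOn.1 ha).comp contDiff_fst.contDiffOn fun z hz => hz.1.1
  have hfst' : ∀ {a : X → ℝ},
      ContMDiffOn 𝓘(ℝ, X) 𝓘(ℝ, ℝ) ∞ a O →
      ContDiffOn ℝ ∞ (fun z : X × Y => a z.1) {z | z ∈ O ×ˢ C ∧ f z ≠ onGraph q f z.1} := fun ha =>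
    (contMDiffOn_iff_contDiffOn.1 ha).comp contDiff_fst.contDiffOn fun z hz => hz.1.1
  have hf : ContDiffOn ℝ ∞ f {z | z ∈ O ×ˢ C ∧ f z ≠ onGraph q f z.1} :=
    (contMDiffOn_iff_contDiffOn.1 T.adapted.immersion.1).mono
      fun z hz => ⟨(T.base.mem z.1 hz.1.1).1, hz.1.2⟩
  have hd := hf.sub (hfst P.net.immersion.1)
  have hN : ContDiffOn ℝ ∞ (fun z : X × Y => (‖f z - onGraph q f z.1‖ ^ 2)⁻¹)
      {z | z ∈ O ×ˢ C ∧ f z ≠ onGraph q f z.1} := (hd.norm_sq ℝ).inv fun z hz =>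
    pow_ne_zero 2 (norm_ne_zero_iff.2 (sub_ne_zero.2 hz.2))
  refine contDiff_fst.contDiffOn.prodMk ((contDiffOn_euclidean).2 fun i => ?_)
  exact (hfst (P.smooth_xi i)).inner ℝ
    (((contDiffOn_const.mul (hfst' P.smooth_phi)).smul (hN.smul hd)).sub (hfst (P.smooth_F none)))

theorem exists_ribaucour_chart (hs : Module.finrank ℝ Y = s) {y₀ : Y} (hy₀ : y₀ ∈ C)
    (hne : f (x₀, y₀) ≠ onGraph q f x₀) :
    ∃ e : OpenPartialHomeomorph (X × Y) (X × EuclideanSpace ℝ (Fin s)), (x₀, y₀) ∈ e.source ∧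
      e.source ⊆ O ×ˢ C ∧ e.target ⊆ O ×ˢ Set.univ ∧ ContDiffOn ℝ ∞ e e.source ∧
      ContDiffOn ℝ ∞ e.symm e.target ∧ ∀ z ∈ e.source, f z ≠ onGraph q f z.1 ∧
        e z = pencilCoord (onGraph q f) (fun c => onGraph (p c) f) i₀ f z := by
  have hO : IsOpen (O ×ˢ C) := T.base.isOpen.prod T.adapted.isOpen_right
  have hsub : O ×ˢ C ⊆ A ×ˢ C := fun z hz => ⟨(T.base.mem z.1 hz.1).1, hz.2⟩
  have hU : IsOpen {z : X × Y | z ∈ O ×ˢ C ∧ f z ≠ onGraph q f z.1} := by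
    have h1 : ContinuousOn (fun z : X × Y => f z - onGraph q f z.1) (O ×ˢ C) :=
      (T.adapted.immersion.1.continuousOn.mono hsub).sub
        (T.isPencilOn.net.immersion.1.continuousOn.comp continuous_fst.continuousOn
          fun z hz => hz.1)
    have h2 := h1.isOpen_inter_preimage hO (isOpen_compl_singleton (x := (0 : E)))
    convert h2 using 1
    ext z
    simp [sub_eq_zero]
  have hsm := T.contDiffOn_pencilCoord
  have hz₀ : (x₀, y₀) ∈ {z : X × Y | z ∈ O ×ˢ C ∧ f z ≠ onGraph q f z.1} :=
    ⟨⟨T.base_mem, hy₀⟩, hne⟩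
  have hd := (((hsm _ hz₀).contDiffAt (hU.mem_nhds hz₀)).differentiableAt (by simp)).hasFDerivAt
  have hinj := T.injective_fderiv_pencilCoord T.base_mem hy₀ hne hd
  set a := pencilCoord (onGraph q f) (fun c => onGraph (p c) f) i₀ f with ha
  let e₁ : (X × Y) ≃L[ℝ] (X × EuclideanSpace ℝ (Fin s)) :=
    (LinearMap.linearEquivOfInjective (fderiv ℝ a (x₀, y₀) : X × Y →ₗ[ℝ] _) hinj
      (by rw [Module.finrank_prod, Module.finrank_prod, hs, finrank_euclideanSpace_fin])
      ).toContinuousLinearEquiv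
  have he₁ : (e₁ : X × Y →L[ℝ] _) = fderiv ℝ a (x₀, y₀) := by
    ext z <;> rfl
  obtain ⟨e, he, hes, hea, h1, h2⟩ := exists_openPartialHomeomorph hU hsm hz₀ (a' := e₁)
    (by rw [he₁]; exact hd)
  refine ⟨e, he, fun z hz => (hes hz).1, ?_, h1, h2, fun z hz => ⟨(hes hz).2, by rw [hea]⟩⟩
  intro z hz
  have h3 := e.map_target hz
  have h4 : e (e.symm z) = z := e.right_inv hz
  rw [hea] at h4
  refine ⟨?_, trivial⟩
  rw [← h4]
  exact (hes h3).1.1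

end IsLeafPencilOn

end

/-! ### Dupin submanifolds in adapted coordinates. -/

section

variable {B : Type*} [NormedAddCommGroup B] [NormedSpace ℝ B] [FiniteDimensional ℝ B]
  {H : Type*} [TopologicalSpace H] {I : ModelWithCorners ℝ B H} [I.Boundaryless]
  {M : Type*} [TopologicalSpace M] [ChartedSpace H M] [IsManifold I ∞ M]
  {X : Type*} [NormedAddCommGroup X] [NormedSpace ℝ X] [FiniteDimensional ℝ X]
  {Y : Type*} [NormedAddCommGroup Y] [NormedSpace ℝ Y] [FiniteDimensional ℝ Y]
  {E : Type*} [NormedAddCommGroup E] [InnerProductSpace ℝ E] [FiniteDimensional ℝ E]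
  {F : Type*} [NormedAddCommGroup F] [NormedSpace ℝ F]
  {k r s : ℕ}

local notation "𝒟'" => D 𝓘(ℝ, X × Y)

variable (I) in
/-- Smooth coordinates on an open subset of `M` with values in `X × Y`. -/
structure IsSmoothCoord (e : OpenPartialHomeomorph M (X × Y)) : Prop where
  smooth : ContMDiffOn I 𝓘(ℝ, X × Y) ∞ e e.source
  smooth_symm : ContMDiffOn 𝓘(ℝ, X × Y) I ∞ e.symm e.target
  finrank_eq : Module.finrank ℝ (X × Y) = Module.finrank ℝ B

variable (I) in
/-- The differential of the inverse of a coordinate system. -/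
noncomputable def coordD (e : OpenPartialHomeomorph M (X × Y)) (p : X × Y) : X × Y →L[ℝ] B :=
  mfderiv 𝓘(ℝ, X × Y) I e.symm p

/-- The subbundle `Δ` in coordinates. -/
noncomputable def coordNet (I : ModelWithCorners ℝ B H) (e : OpenPartialHomeomorph M (X × Y))
    (Δ : M → Submodule ℝ B) (p : X × Y) : Submodule ℝ (X × Y) :=
  (Δ (e.symm p)).comap (coordD I e p : X × Y →ₗ[ℝ] B)

theorem mem_coordNet {e : OpenPartialHomeomorph M (X × Y)} {Δ : M → Submodule ℝ B} {p v : X × Y} :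
    v ∈ coordNet I e Δ p ↔ coordD I e p v ∈ Δ (e.symm p) := Iff.rfl

namespace IsSmoothCoord

variable {e : OpenPartialHomeomorph M (X × Y)} (T : IsSmoothCoord I e) {p : X × Y}
include T

theorem hasMFDerivAt (hp : p ∈ e.target) :
    HasMFDerivAt 𝓘(ℝ, X × Y) I e.symm p (coordD I e p) :=
  ((T.smooth_symm.contMDiffAt (e.open_target.mem_nhds hp)).mdifferentiableAt (by simp)).hasMFDerivAt

theorem hasPush_comp {a : M → F} (ha : MDifferentiableAt I 𝓘(ℝ, F) a (e.symm p))
    (hp : p ∈ e.target) :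
    HasPush 𝓘(ℝ, X × Y) (fun z => a (e.symm z)) p ((D I a (e.symm p)).comp (coordD I e p)) :=
  HasPush.comp (hasPush_of_mdifferentiableAt ha) (T.hasMFDerivAt hp)

theorem D_comp {a : M → F} (ha : MDifferentiableAt I 𝓘(ℝ, F) a (e.symm p)) (hp : p ∈ e.target)
    (v : X × Y) :
    𝒟' (fun z => a (e.symm z)) p v = D I a (e.symm p) (coordD I e p v) := by
  rw [(T.hasPush_comp ha hp).eq]; rfl

theorem smooth_comp {V : Set M} {a : M → F} (ha : ContMDiffOn I 𝓘(ℝ, F) ∞ a V) {A : Set (X × Y)}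
    (hA : A ⊆ e.target) (hV : Set.MapsTo e.symm A V) :
    ContMDiffOn 𝓘(ℝ, X × Y) 𝓘(ℝ, F) ∞ (fun z => a (e.symm z)) A :=
  ha.comp (T.smooth_symm.mono hA) hV

theorem hasPush_self {x : M} (hx : x ∈ e.source) : HasPush I (e : M → X × Y) x (D I e x) :=
  hasPush_of_contMDiffAt (T.smooth.contMDiffAt (e.open_source.mem_nhds hx))

theorem D_coordD (hp : p ∈ e.target) (v : X × Y) :
    D I (e : M → X × Y) (e.symm p) (coordD I e p v) = v := by
  have h1 := T.hasPush_comp (T.hasPush_self (e.map_target hp)).mdifferentiableAt hp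
  have h2 : HasPush 𝓘(ℝ, X × Y) (fun z => e (e.symm z)) p (ContinuousLinearMap.id ℝ (X × Y)) :=
    (hasPush_id_iff.2 (hasFDerivAt_id p)).congr
      (Filter.eventually_of_mem (e.open_target.mem_nhds hp) fun z hz => e.right_inv hz)
  exact congrArg (fun Q : X × Y →L[ℝ] X × Y => Q v) (h1.unique h2)

theorem bijective (hp : p ∈ e.target) : Function.Bijective (coordD I e p) := by
  have h1 : Function.Injective (coordD I e p) :=
    Function.LeftInverse.injective (T.D_coordD hp)
  exact ⟨h1, (LinearMap.injective_iff_surjective_of_finrank_eq_finrank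
    (f := (coordD I e p : X × Y →ₗ[ℝ] B)) T.finrank_eq).1 h1⟩

theorem finrank_coordNet (hp : p ∈ e.target) (Δ : M → Submodule ℝ B) :
    Module.finrank ℝ (coordNet I e Δ p) = Module.finrank ℝ (Δ (e.symm p)) := by
  have h1 : (coordNet I e Δ p).map (coordD I e p : X × Y →ₗ[ℝ] B) = Δ (e.symm p) :=
    Submodule.map_comap_eq_of_surjective (T.bijective hp).2 _
  rw [← h1]
  exact (Submodule.equivMapOfInjective (coordD I e p : X × Y →ₗ[ℝ] B) (T.bijective hp).1 _).finrank_eq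

end IsSmoothCoord

/-- Dupin submanifolds in coordinates which are adapted to a principal normal. -/
theorem IsDupinOn.isAdaptedOn {f : M → E} {η : Fin (k + 1) → M → E}
    (h : IsDupinOn I Set.univ f η) (j₀ : Fin (k + 1)) {V : Set M} (hV : IsOpen V)
    {ζ : Fin r → M → E} (hζs : ∀ a, ContMDiffOn I 𝓘(ℝ, E) ∞ (ζ a) V)
    (hζ : ∀ x ∈ V, (Orthonormal ℝ fun a => ζ a x) ∧
      Submodule.span ℝ (Set.range fun a => ζ a x) = normal I f x ∧
        (∀ a v, D I (ζ a) x v ∈ tangent I f x))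
    (hr : Module.finrank ℝ B + r = Module.finrank ℝ E)
    {e : OpenPartialHomeomorph M (X × Y)} (T : IsSmoothCoord I e) (hes : e.source ⊆ V)
    (hvert : ∀ p ∈ e.target, ∀ u, coordD I e p u ∈ nullB I f (η j₀) (e.symm p) ↔ u.1 = 0)
    {A : Set X} {C : Set Y} (hA : IsOpen A) (hC : IsOpen C) (hCc : IsPreconnected C)
    (hAC : A ×ˢ C ⊆ e.target) (hinj : Set.InjOn (fun p => f (e.symm p)) (A ×ˢ C)) :
    IsAdaptedOn A C (fun p => f (e.symm p)) (fun a p => ζ a (e.symm p))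
      (fun a p => ⟪η j₀ (e.symm p), ζ a (e.symm p)⟫_ℝ)
      (fun j a p => ⟪η (j₀.succAbove j) (e.symm p), ζ a (e.symm p)⟫_ℝ)
      (fun j => coordNet I e (nullB I f (η (j₀.succAbove j)))) := by
  have hsV : ∀ p ∈ A ×ˢ C, e.symm p ∈ V := fun p hp => hes (e.map_target (hAC hp))
  have hin : ∀ j a, ContMDiffOn I 𝓘(ℝ, ℝ) ∞ (fun x => ⟪η j x, ζ a x⟫_ℝ) V := fun j a =>
    contMDiffOn_inner ((h.smooth_normal j).mono (Set.subset_univ V)) (hζs a)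
  have hfm : ∀ x, MDifferentiableAt I 𝓘(ℝ, E) f x := fun x =>
    (h.immersion.1.hasPush isOpen_univ (Set.mem_univ x)).mdifferentiableAt
  have hζm : ∀ a, ∀ x ∈ V, MDifferentiableAt I 𝓘(ℝ, E) (ζ a) x := fun a x hx =>
    ((hζs a).hasPush hV hx).mdifferentiableAt
  have him : ∀ j a, ∀ x ∈ V, MDifferentiableAt I 𝓘(ℝ, ℝ) (fun x => ⟪η j x, ζ a x⟫_ℝ) x :=
    fun j a x hx => ((hin j a).hasPush hV hx).mdifferentiableAt
  have hζn : ∀ a, ∀ x ∈ V, ζ a x ∈ normal I f x := fun a x hx => by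
    rw [← (hζ x hx).2.1]; exact Submodule.subset_span ⟨a, rfl⟩
  have hpar : ∀ j a, ∀ x ∈ V, ∀ v ∈ nullB I f (η j) x,
      D I (ζ a) x v = -(⟪η j x, ζ a x⟫_ℝ • D I f x v) ∧ D I (fun y => ⟪η j y, ζ a y⟫_ℝ) x v = 0 :=
    fun j a x hx v hv => h.D_parallel isOpen_univ (Set.subset_univ V) hV (hζs a) (hζn a)
      (fun y hy => (hζ y hy).2.2 a) hx hv
  have heq : ∀ i j, ∀ x ∈ V, (∀ a, ⟪η i x, ζ a x⟫_ℝ = ⟪η j x, ζ a x⟫_ℝ) → i = j := by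
    intro i j x hx hij
    refine h.distinct x (Set.mem_univ x) ?_
    have h1 : ∀ j, ∑ a, ⟪ζ a x, η j x⟫_ℝ • ζ a x = η j x := fun j =>
      (hζ x hx).1.sum_inner_smul_of_mem_span (by
        rw [(hζ x hx).2.1]; exact h.mem_normal j (Set.mem_univ x))
    change η i x = η j x
    rw [← h1 i, ← h1 j]
    exact Finset.sum_congr rfl fun a _ => by
      rw [real_inner_comm, hij a, real_inner_comm]
  have hvert' : ∀ p ∈ A ×ˢ C, ∀ w : Y, coordD I e p (0, w) ∈ nullB I f (η j₀) (e.symm p) :=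
    fun p hp w => (hvert p (hAC hp) (0, w)).2 rfl
  exact {
    isOpen_left := hA
    isOpen_right := hC
    preconnected := hCc
    immersion := by
      refine ⟨T.smooth_comp h.immersion.1 hAC fun _ _ => Set.mem_univ _, fun p hp => ?_⟩
      have h1 : Function.Injective (𝒟' (fun p => f (e.symm p)) p) := by
        rw [(T.hasPush_comp (hfm _) (hAC hp)).eq]
        exact (h.immersion.injective (Set.mem_univ _)).comp (T.bijective (hAC hp)).1
      exact h1
    injOn := hinj
    smooth_zeta := fun a => T.smooth_comp (hζs a) hAC hsV
    smooth_lam := fun a => T.smooth_comp (hin j₀ a) hAC hsV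
    smooth_l := fun j a => T.smooth_comp (hin _ a) hAC hsV
    orthonormal := fun p hp => (hζ _ (hsV p hp)).1
    zeta_normal := fun p hp a v => by
      rw [T.D_comp (hfm _) (hAC hp)]
      exact DupinSub.mem_normal.1 (hζn a _ (hsV p hp)) _
    dim := by
      have := T.finrank_eq
      rw [Module.finrank_prod] at this
      omega
    vert_zeta := fun p hp a w => by
      rw [T.D_comp (hfm _) (hAC hp), T.D_comp (hζm a _ (hsV p hp)) (hAC hp)]
      exact (hpar j₀ a _ (hsV p hp) _ (hvert' p hp w)).1
    vert_lam := fun p hp a w => by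
      rw [T.D_comp (him j₀ a _ (hsV p hp)) (hAC hp)]
      exact (hpar j₀ a _ (hsV p hp) _ (hvert' p hp w)).2
    D_zeta := fun p hp j v hv a => by
      rw [T.D_comp (hfm _) (hAC hp), T.D_comp (hζm a _ (hsV p hp)) (hAC hp)]
      exact (hpar _ a _ (hsV p hp) _ hv).1
    D_l := fun p hp j v hv a => by
      rw [T.D_comp (him _ a _ (hsV p hp)) (hAC hp)]
      exact (hpar _ a _ (hsV p hp) _ hv).2
    ortho_vert := fun p hp j v hv w => by
      rw [T.D_comp (hfm _) (hAC hp), T.D_comp (hfm _) (hAC hp)]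
      exact h.inner_eq_zero isOpen_univ (Set.mem_univ _) (Fin.succAbove_ne j₀ j) hv (hvert' p hp w)
    ortho := fun p hp i j hij v hv w hw => by
      rw [T.D_comp (hfm _) (hAC hp), T.D_comp (hfm _) (hAC hp)]
      exact h.inner_eq_zero isOpen_univ (Set.mem_univ _)
        (fun e => hij (Fin.succAbove_right_injective e)) hv hw
    iSup_eq := fun p hp => by
      rw [eq_top_iff]
      rintro u -
      obtain ⟨δ, hδ, hsum⟩ := exists_sum_of_iSup_eq_top
        (h.iSup_nullB (Set.mem_univ (e.symm p))) (coordD I e p u)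
      choose g hg using fun j => (T.bijective (hAC hp)).2 (δ j)
      have h1 : u = ∑ j, g j := by
        apply (T.bijective (hAC hp)).1
        rw [map_sum]
        simp only [hg]
        exact hsum.symm
      rw [h1, Fin.sum_univ_succAbove _ j₀, add_comm]
      refine Submodule.add_mem_sup (Submodule.sum_mem _ fun j _ => Submodule.mem_iSup_of_mem j ?_) ?_
      · rw [mem_coordNet, hg]
        exact hδ _
      · refine ⟨(g j₀).2, Prod.ext ?_ rfl⟩
        exact ((hvert p (hAC hp) (g j₀)).1 (by rw [hg]; exact hδ j₀)).symm
    rank := fun j => by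
      obtain ⟨t, ht⟩ := h.principal (j₀.succAbove j)
      refine ⟨t, ht.2.1, fun p hp => ?_⟩
      rw [T.finrank_coordNet (hAC hp)]
      exact ht.2.2 _ (Set.mem_univ _)
    distinct := fun p hp i j hij => Fin.succAbove_right_injective (heq _ _ _ (hsV p hp) hij)
    ne_lam := fun p hp j => by
      by_contra hcon
      push Not at hcon
      exact Fin.succAbove_ne j₀ j (heq _ _ _ (hsV p hp) hcon) }

/-- Integral manifolds of the conullity are graphs in adapted coordinates. -/
theorem IsDupinOn.exists_isLeafOn {n : ℕ} {M : Type*} [TopologicalSpace M]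
    [ChartedSpace (EuclideanSpace ℝ (Fin n)) M] [IsManifold (𝓡 n) ∞ M]
    {f : M → E} {η : Fin (k + 1) → M → E}
    (h : IsDupinOn (𝓡 n) Set.univ f η) (j₀ : Fin (k + 1))
    (hint : IsIntegrableOn (𝓡 n) Set.univ (conullity (𝓡 n) f (η j₀)))
    {e : OpenPartialHomeomorph M (X × Y)} (T : IsSmoothCoord (𝓡 n) e)
    (hvert : ∀ p ∈ e.target, ∀ u, coordD (𝓡 n) e p u ∈ nullB (𝓡 n) f (η j₀) (e.symm p) ↔ u.1 = 0)
    {A : Set X} {C : Set Y} (hA : IsOpen A) (hC : IsOpen C)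
    (hAC : A ×ˢ C ⊆ e.target) {x : X} (hx : x ∈ A) {y : Y} (hy : y ∈ C) :
    ∃ O q, IsLeafOn A C (fun p => f (e.symm p)) O q ∧ x ∈ O ∧ q x = y := by
  obtain ⟨m, O, ι, hO, h0, hι0, -, hιs, hι⟩ := hint (e.symm (x, y)) (Set.mem_univ _)
  have hp : (x, y) ∈ e.target := hAC ⟨hx, hy⟩
  set J : EuclideanSpace ℝ (Fin m) → EuclideanSpace ℝ (Fin m) →L[ℝ] EuclideanSpace ℝ (Fin n) :=
    fun t => mfderiv (𝓡 m) (𝓡 n) ι t with hJ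
  have hιp : ∀ t ∈ O, HasMFDerivAt (𝓡 m) (𝓡 n) ι t (J t) := fun t ht =>
    ((hιs.contMDiffAt (hO.mem_nhds ht)).mdifferentiableAt (by simp)).hasMFDerivAt
  have hJinj : ∀ t ∈ O, Function.Injective (J t) := fun t ht => (hι t ht).1
  have hJr : ∀ t ∈ O, ∀ v : EuclideanSpace ℝ (Fin n), v ∈ LinearMap.range (J t : EuclideanSpace ℝ (Fin m) →ₗ[ℝ] EuclideanSpace ℝ (Fin n)) ↔
      ∀ w ∈ nullB (𝓡 n) f (η j₀) (ι t), ⟪D (𝓡 n) f (ι t) v, D (𝓡 n) f (ι t) w⟫_ℝ = 0 := by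
    intro t ht v
    have h1 : (LinearMap.range (J t : EuclideanSpace ℝ (Fin m) →ₗ[ℝ] EuclideanSpace ℝ (Fin n))) = (conullity (𝓡 n) f (η j₀) (ι t)) := (hι t ht).2
    rw [h1]
    exact Iff.rfl
  set O' := O ∩ ι ⁻¹' (e.source ∩ e ⁻¹' (A ×ˢ C)) with hO'
  have hO'o : IsOpen O' := hιs.continuousOn.isOpen_inter_preimage hO
    (e.isOpen_inter_preimage (hA.prod hC))
  have h0O' : (0 : EuclideanSpace ℝ (Fin m)) ∈ O' := by
    refine ⟨h0, ?_⟩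
    rw [Set.mem_preimage, hι0]
    refine ⟨e.map_target hp, ?_⟩
    rw [Set.mem_preimage, e.right_inv hp]
    exact ⟨hx, hy⟩
  have hκs : ContDiffOn ℝ ∞ (fun t => e (ι t)) O' := by
    rw [← contMDiffOn_iff_contDiffOn]
    exact T.smooth.comp (hιs.mono Set.inter_subset_left) fun t ht => ht.2.1
  have hκp : ∀ t ∈ O', HasFDerivAt (fun t => e (ι t)) ((D (𝓡 n) e (ι t)).comp (J t)) t :=
    fun t ht => hasPush_id_iff.1 (HasPush.comp (T.hasPush_self ht.2.1) (hιp t ht.1))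
  have hcoord : ∀ t ∈ O', ∀ v, coordD (𝓡 n) e (e (ι t)) (D (𝓡 n) e (ι t) v) = v := by
    intro t ht v
    have hpt := e.map_source ht.2.1
    obtain ⟨u, rfl⟩ := (T.bijective hpt).2 v
    have := T.D_coordD hpt u
    rw [e.left_inv ht.2.1] at this
    rw [this]
  have hfst : ∀ t ∈ O', ∀ v, (D (𝓡 n) e (ι t) v).1 = 0 ↔ v ∈ nullB (𝓡 n) f (η j₀) (ι t) := by
    intro t ht v
    rw [← hvert (e (ι t)) (e.map_source ht.2.1), hcoord t ht, e.left_inv ht.2.1]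
  -- The tangent space of the integral manifold is the conullity, a complement of the vertical
  -- space, which is the kernel of the first projection. So the integral manifold is locally a graph
  -- over X.
  have hbij : Function.Bijective ((ContinuousLinearMap.fst ℝ X Y).comp
      ((D (𝓡 n) e (ι 0)).comp (J 0)) : EuclideanSpace ℝ (Fin m) →ₗ[ℝ] X) := by
    constructor
    · rw [injective_iff_map_eq_zero]
      intro v hv
      have h1 : J 0 v ∈ nullB (𝓡 n) f (η j₀) (ι 0) := (hfst 0 h0O' _).1 hv
      have h2 := (hJr 0 h0 (J 0 v)).1 ⟨v, rfl⟩ _ h1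
      have h3 := h.immersion.injective (Set.mem_univ (ι 0))
        ((inner_self_eq_zero.1 h2).trans (map_zero _).symm)
      exact hJinj 0 h0 (h3.trans (map_zero _).symm)
    · intro u
      obtain ⟨δ, hδ, hsum⟩ := exists_sum_of_iSup_eq_top (h.iSup_nullB (Set.mem_univ (ι 0)))
        (coordD (𝓡 n) e (e (ι 0)) (u, 0))
      have h1 : coordD (𝓡 n) e (e (ι 0)) (u, 0) - δ j₀ ∈ LinearMap.range (J 0 : EuclideanSpace ℝ (Fin m) →ₗ[ℝ] EuclideanSpace ℝ (Fin n)) := by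
        rw [hJr 0 h0]
        intro w hw
        rw [← hsum, Fin.sum_univ_succAbove _ j₀, add_sub_cancel_left, map_sum, sum_inner]
        exact Finset.sum_eq_zero fun j _ =>
          h.inner_eq_zero isOpen_univ (Set.mem_univ _) (Fin.succAbove_ne j₀ j) (hδ _) hw
      obtain ⟨v, hv⟩ := h1
      refine ⟨v, ?_⟩
      change (D (𝓡 n) e (ι 0) (J 0 v)).1 = u
      have h2 : J 0 v = _ := hv
      have h3 := T.D_coordD (e.map_source h0O'.2.1) (u, 0)
      rw [e.left_inv h0O'.2.1] at h3
      rw [h2, map_sub, h3, Prod.fst_sub, (hfst 0 h0O' _).2 (hδ j₀), sub_zero]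
  let L : EuclideanSpace ℝ (Fin m) ≃L[ℝ] X := (LinearEquiv.ofBijective _ hbij).toContinuousLinearEquiv
  have hL : (L : EuclideanSpace ℝ (Fin m) →L[ℝ] X) = (ContinuousLinearMap.fst ℝ X Y).comp
      ((D (𝓡 n) e (ι 0)).comp (J 0)) := by ext v; rfl
  obtain ⟨g, hg0, hgs, hge, -, hgsymm⟩ := exists_openPartialHomeomorph hO'o
    (a := fun t => (e (ι t)).1) (contDiff_fst.comp_contDiffOn hκs) h0O' (a' := L)
    (by rw [hL]; exact (hκp 0 h0O').fst)
  have hg0x : g 0 = x := by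
    rw [hge]
    change (e (ι 0)).1 = x
    rw [hι0, e.right_inv hp]
  have hq : ∀ z ∈ g.target, (z, (e (ι (g.symm z))).2) = e (ι (g.symm z)) := by
    intro z hz
    refine Prod.ext ?_ rfl
    have := g.right_inv hz
    rw [hge] at this
    exact this.symm
  have hmem : ∀ z ∈ g.target, g.symm z ∈ O' := fun z hz => hgs (g.map_target hz)
  have hκg : ContDiffOn ℝ ∞ (fun z => e (ι (g.symm z))) g.target := hκs.comp hgsymm hmem
  refine ⟨g.target, fun z => (e (ι (g.symm z))).2, ⟨g.open_target, ?_, ?_, ?_⟩, ?_, ?_⟩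
  · rw [contMDiffOn_iff_contDiffOn]
    exact contDiff_snd.comp_contDiffOn hκg
  · intro z hz
    rw [hq z hz]
    exact (hmem z hz).2.2
  · intro z hz v w
    have ht := hmem z hz
    have hpt := e.map_source ht.2.1
    have hfm : ∀ x, MDifferentiableAt (𝓡 n) 𝓘(ℝ, E) f x := fun x =>
      (h.immersion.1.hasPush isOpen_univ (Set.mem_univ x)).mdifferentiableAt
    have h1 := ((hκg z hz).contDiffAt (g.open_target.mem_nhds hz)).differentiableAt (by simp)
    have h2 : HasFDerivAt (fun z => e (ι (g.symm z)))
        (((D (𝓡 n) e (ι (g.symm z))).comp (J (g.symm z))).comp (fderiv ℝ g.symm z)) z :=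
      (hκp _ ht).comp z ((((hgsymm z hz).contDiffAt (g.open_target.mem_nhds hz)).differentiableAt
        (by simp)).hasFDerivAt)
    have h3 : HasFDerivAt (fun z => e (ι (g.symm z))) ((ContinuousLinearMap.id ℝ X).prod
        (D 𝓘(ℝ, X) (fun z => (e (ι (g.symm z))).2) z)) z := by
      rw [D_eq_fderiv]
      refine HasFDerivAt.congr_of_eventuallyEq ((hasFDerivAt_id z).prodMk
        h1.snd.hasFDerivAt) ?_
      exact Filter.eventually_of_mem (g.open_target.mem_nhds hz) fun z hz => (hq z hz).symm
    -- Tangent vectors of the graph come from the integral manifold at nearby points as well, and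
    -- are therefore orthogonal to the vertical space.
    have h4 : (v, D 𝓘(ℝ, X) (fun z => (e (ι (g.symm z))).2) z v)
        = D (𝓡 n) e (ι (g.symm z)) (J (g.symm z) (fderiv ℝ g.symm z v)) :=
      congrArg (fun Q : X →L[ℝ] X × Y => Q v) (h3.unique h2)
    rw [hq z hz, T.D_comp (hfm _) hpt, T.D_comp (hfm _) hpt, h4, hcoord _ ht, e.left_inv ht.2.1]
    refine (hJr _ ht.1 _).1 ⟨_, rfl⟩ _ ?_
    have h5 := (hvert _ hpt (0, w)).2 rfl
    rwa [e.left_inv ht.2.1] at h5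
  · rw [← hg0x]; exact g.map_source hg0
  · change (e (ι (g.symm x))).2 = y
    rw [← hg0x, g.left_inv hg0, hι0, e.right_inv hp]

end

/-! ### Existence of adapted coordinates. -/

section

theorem exists_linearMap_injOn {V W : Type*} [AddCommGroup V] [Module ℝ V] [FiniteDimensional ℝ V]
    [AddCommGroup W] [Module ℝ W] [FiniteDimensional ℝ W] (p : Submodule ℝ V)
    (hp : Module.finrank ℝ p = Module.finrank ℝ W) :
    ∃ P : V →ₗ[ℝ] W, ∀ v ∈ p, P v = 0 → v = 0 := by
  obtain ⟨P, hP⟩ := LinearMap.exists_extend (LinearEquiv.ofFinrankEq p W hp : p →ₗ[ℝ] W)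
  refine ⟨P, fun v hv h0 => ?_⟩
  have h1 : LinearEquiv.ofFinrankEq p W hp ⟨v, hv⟩ = 0 := by
    rw [← h0]; exact (LinearMap.congr_fun hP ⟨v, hv⟩).symm
  exact congrArg Subtype.val ((LinearEquiv.map_eq_zero_iff _).1 h1)

/-- A smooth map with injective differential is locally injective. -/
theorem exists_injOn_of_injective {F G : Type*} [NormedAddCommGroup F] [NormedSpace ℝ F]
    [FiniteDimensional ℝ F] [NormedAddCommGroup G] [NormedSpace ℝ G] [FiniteDimensional ℝ G]
    {a : F → G} {x : F} (ha : ContDiffAt ℝ ∞ a x) (hinj : Function.Injective (fderiv ℝ a x)) :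
    ∃ V ∈ 𝓝 x, Set.InjOn a V := by
  obtain ⟨P, hP⟩ := LinearMap.exists_leftInverse_of_injective (fderiv ℝ a x : F →ₗ[ℝ] G)
    (LinearMap.ker_eq_bot.2 hinj)
  let P' : G →L[ℝ] F := P.toContinuousLinearMap
  have h1 : HasStrictFDerivAt (fun y => P' (a y)) (ContinuousLinearEquiv.refl ℝ F : F →L[ℝ] F) x := by
    have h2 := P'.hasStrictFDerivAt.comp x (ha.hasStrictFDerivAt (by simp))
    have h3 : P'.comp (fderiv ℝ a x) = (ContinuousLinearEquiv.refl ℝ F : F →L[ℝ] F) := by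
      ext v
      exact LinearMap.congr_fun hP v
    rw [h3] at h2
    exact h2
  refine ⟨(h1.toOpenPartialHomeomorph _).source,
    (h1.toOpenPartialHomeomorph _).open_source.mem_nhds h1.mem_toOpenPartialHomeomorph_source, ?_⟩
  intro y hy z hz hyz
  exact (h1.toOpenPartialHomeomorph _).injOn hy hz (congrArg P' hyz)

variable {X : Type*} [NormedAddCommGroup X] [NormedSpace ℝ X] [FiniteDimensional ℝ X]
  {Y : Type*} [NormedAddCommGroup Y] [NormedSpace ℝ Y] [FiniteDimensional ℝ Y]
  {E : Type*} [NormedAddCommGroup E] [InnerProductSpace ℝ E] [FiniteDimensional ℝ E]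
  {n : ℕ} {M : Type*} [TopologicalSpace M]
  [ChartedSpace (EuclideanSpace ℝ (Fin n)) M] [IsManifold (𝓡 n) ∞ M]
  {k r s : ℕ}

/-- Coordinates in which the kernels of the differential of a map are vertical. -/
theorem exists_isSmoothCoord {G : Type*} [NormedAddCommGroup G] [NormedSpace ℝ G]
    [FiniteDimensional ℝ G] {S : M → G} {V : Set M} (hV : IsOpen V)
    (hS : ContMDiffOn (𝓡 n) 𝓘(ℝ, G) ∞ S V) {x₀ : M} (hx₀ : x₀ ∈ V)
    {K : M → Submodule ℝ (EuclideanSpace ℝ (Fin n))}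
    (hK : ∀ x ∈ V, ∀ v, D (𝓡 n) S x v = 0 ↔ v ∈ K x)
    (hKs : ∀ x ∈ V, Module.finrank ℝ (K x) = Module.finrank ℝ Y)
    (hXY : Module.finrank ℝ X + Module.finrank ℝ Y = n) :
    ∃ e : OpenPartialHomeomorph M (X × Y), IsSmoothCoord (𝓡 n) e ∧ x₀ ∈ e.source ∧ e.source ⊆ V ∧
      ∀ p ∈ e.target, ∀ u, coordD (𝓡 n) e p u ∈ K (e.symm p) ↔ u.1 = 0 := by
  set c := chartAt (EuclideanSpace ℝ (Fin n)) x₀ with hc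
  have hcs : ∀ y, y ∈ c.source → y ∈ (extChartAt (𝓡 n) x₀).source := fun y hy => by
    rwa [extChartAt_source]
  have hx₀c : x₀ ∈ c.source := mem_chart_source _ x₀
  set U := c.target ∩ c.symm ⁻¹' V with hUdef
  have hU : IsOpen U := c.isOpen_inter_preimage_symm hV
  have hread : ContDiffOn ℝ ∞ (fun b => S (c.symm b)) U := by
    rw [← contMDiffOn_iff_contDiffOn]
    exact hS.comp ((contMDiffOn_chart_symm (I := 𝓡 n)).mono Set.inter_subset_left) fun b hb => hb.2
  have hb₀ : c x₀ ∈ U := ⟨c.map_source hx₀c, by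
    rw [Set.mem_preimage, c.left_inv hx₀c]; exact hx₀⟩
  set A := fderiv ℝ (fun b => S (c.symm b)) (c x₀) with hA
  have hSp := hS.hasPush hV hx₀
  have hker : LinearMap.ker (A : EuclideanSpace ℝ (Fin n) →ₗ[ℝ] G)
      = (K x₀).map (dchart (𝓡 n) x₀ x₀ : EuclideanSpace ℝ (Fin n) →ₗ[ℝ] _) := by
    have h1 : ∀ v, D (𝓡 n) S x₀ v = A (dchart (𝓡 n) x₀ x₀ v) :=
      D_read (hcs _ hx₀c) hSp.mdifferentiableAt
    ext u
    obtain ⟨v, rfl⟩ := (dchart_bijective (I := 𝓡 n) (hcs _ hx₀c)).2 u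
    rw [LinearMap.mem_ker]
    change A (dchart (𝓡 n) x₀ x₀ v) = 0 ↔ _
    rw [← h1, hK x₀ hx₀]
    constructor
    · intro hv; exact ⟨v, hv, rfl⟩
    · rintro ⟨w, hw, hwv⟩
      rwa [← (dchart_bijective (I := 𝓡 n) (hcs _ hx₀c)).1 hwv]
  have hfk : Module.finrank ℝ (LinearMap.ker (A : EuclideanSpace ℝ (Fin n) →ₗ[ℝ] G))
      = Module.finrank ℝ Y := by
    rw [hker, ← hKs x₀ hx₀]
    exact (Submodule.equivMapOfInjective _
      (dchart_bijective (I := 𝓡 n) (hcs _ hx₀c)).1 _).finrank_eq.symm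
  have hfr : Module.finrank ℝ (LinearMap.range (A : EuclideanSpace ℝ (Fin n) →ₗ[ℝ] G))
      = Module.finrank ℝ X := by
    have := LinearMap.finrank_range_add_finrank_ker (A : EuclideanSpace ℝ (Fin n) →ₗ[ℝ] G)
    rw [finrank_euclideanSpace_fin] at this
    omega
  -- P is injective on the range of dS at x₀ and Q on its kernel, so (P ∘ S, Q) has invertible
  -- derivative there.
  obtain ⟨P, hP⟩ := exists_linearMap_injOn _ hfr
  obtain ⟨Q, hQ⟩ := exists_linearMap_injOn _ hfk
  let P' : G →L[ℝ] X := P.toContinuousLinearMap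
  let Q' : EuclideanSpace ℝ (Fin n) →L[ℝ] Y := Q.toContinuousLinearMap
  have hfin : Module.finrank ℝ (X × Y) = Module.finrank ℝ (EuclideanSpace ℝ (Fin n)) := by
    rw [Module.finrank_prod, hXY, finrank_euclideanSpace_fin]
  set a : EuclideanSpace ℝ (Fin n) → X × Y := fun b => (P' (S (c.symm b)), Q' b) with ha
  have has : ContDiffOn ℝ ∞ a U := (P'.contDiff.comp_contDiffOn hread).prodMk Q'.contDiff.contDiffOn
  have had : HasFDerivAt a ((P'.comp A).prod Q') (c x₀) :=
    (P'.hasFDerivAt.comp _ (((hread _ hb₀).contDiffAt (hU.mem_nhds hb₀)).differentiableAt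
      (by simp)).hasFDerivAt).prodMk Q'.hasFDerivAt
  have hinj : Function.Injective ((P'.comp A).prod Q') := by
    rw [injective_iff_map_eq_zero]
    intro v hv
    have h1 : P (A v) = 0 := congrArg Prod.fst hv
    have h2 : Q v = 0 := congrArg Prod.snd hv
    exact hQ v (hP (A v) ⟨v, rfl⟩ h1) h2
  let L : EuclideanSpace ℝ (Fin n) ≃L[ℝ] X × Y := (LinearMap.linearEquivOfInjective
    ((P'.comp A).prod Q' : EuclideanSpace ℝ (Fin n) →ₗ[ℝ] X × Y) hinj
      hfin.symm).toContinuousLinearEquiv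
  have hL : (L : EuclideanSpace ℝ (Fin n) →L[ℝ] X × Y) = (P'.comp A).prod Q' := by
    ext v <;> rfl
  obtain ⟨e₁, he₁, he₁s, he₁a, hs₁, hs₁'⟩ := exists_openPartialHomeomorph hU has hb₀ (a' := L)
    (by rw [hL]; exact had)
  set e : OpenPartialHomeomorph M (X × Y) := c.trans e₁ with he
  have hsrc : ∀ y, y ∈ e.source ↔ y ∈ c.source ∧ c y ∈ e₁.source := fun y => by
    rw [he, OpenPartialHomeomorph.trans_source]; rfl
  have htgt : ∀ p, p ∈ e.target ↔ p ∈ e₁.target ∧ e₁.symm p ∈ c.target := fun p => by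
    rw [he, OpenPartialHomeomorph.trans_target]; rfl
  have hesV : e.source ⊆ V := by
    intro y hy
    have h1 := (he₁s ((hsrc y).1 hy).2).2
    rwa [Set.mem_preimage, c.left_inv ((hsrc y).1 hy).1] at h1
  have T : IsSmoothCoord (𝓡 n) e := by
    refine ⟨?_, ?_, hfin⟩
    · exact (contMDiffOn_iff_contDiffOn.2 hs₁).comp
        ((contMDiffOn_chart (I := 𝓡 n) (x := x₀)).mono fun y hy => ((hsrc y).1 hy).1)
        fun y hy => ((hsrc y).1 hy).2
    · exact (contMDiffOn_chart_symm (I := 𝓡 n) (x := x₀)).comp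
        ((contMDiffOn_iff_contDiffOn.2 hs₁').mono fun p hp => ((htgt p).1 hp).1)
        fun p hp => ((htgt p).1 hp).2
  have hfst : ∀ y ∈ e.source, (e y).1 = P' (S y) := by
    intro y hy
    have h1 : e y = a (c y) := by rw [← he₁a]; rfl
    rw [h1]
    change P' (S (c.symm (c y))) = _
    rw [c.left_inv ((hsrc y).1 hy).1]
  refine ⟨e, T, (hsrc x₀).2 ⟨hx₀c, he₁⟩, hesV, fun p hp => ?_⟩
  have hy := e.map_target hp
  have hD : ∀ v, (D (𝓡 n) (e : M → X × Y) (e.symm p) v).1 = P' (D (𝓡 n) S (e.symm p) v) := by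
    have h1 : HasPush (𝓡 n) (fun y => (e y).1) (e.symm p) _ :=
      (T.hasPush_self hy).clm (ContinuousLinearMap.fst ℝ X Y)
    have h2 : HasPush (𝓡 n) (fun y => (e y).1) (e.symm p) _ :=
      ((hS.hasPush hV (hesV hy)).clm P').congr
        (Filter.eventually_of_mem (e.open_source.mem_nhds hy) hfst)
    exact fun v => congrArg (fun R : EuclideanSpace ℝ (Fin n) →L[ℝ] X => R v) (h1.unique h2)
  have hle : coordNet (𝓡 n) e K p ≤ LinearMap.ker (LinearMap.fst ℝ X Y) := by
    intro u hu
    have h1 := hD (coordD (𝓡 n) e p u)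
    have hu' : coordD (𝓡 n) e p u ∈ K (e.symm p) := hu
    rw [T.D_coordD hp, (hK _ (hesV hy) _).2 hu', map_zero] at h1
    exact h1
  -- The first coordinate is P ∘ S, so K is contained in the vertical space at every point; the
  -- dimensions agree since K has constant rank.
  have heq : coordNet (𝓡 n) e K p = LinearMap.ker (LinearMap.fst ℝ X Y) := by
    refine Submodule.eq_of_le_of_finrank_eq hle ?_
    rw [T.finrank_coordNet hp, hKs _ (hesV hy), LinearMap.ker_fst,
      LinearMap.finrank_range_of_inj LinearMap.inr_injective]
  intro u
  rw [← mem_coordNet, heq]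
  rfl

/-- A Dupin submanifold has coordinates in which the nullity of a given principal normal is
vertical. -/
theorem IsDupinOn.exists_adapted_coord {f : M → E} {η : Fin (k + 1) → M → E}
    (h : IsDupinOn (𝓡 n) Set.univ f η) (j₀ : Fin (k + 1)) (x₀ : M) :
    ∃ m s : ℕ, m + s = n ∧ 1 ≤ s ∧ ∃ (r : ℕ) (V : Set M) (ζ : Fin r → M → E)
      (e : OpenPartialHomeomorph M (EuclideanSpace ℝ (Fin m) × EuclideanSpace ℝ (Fin s))),
      n + r = Module.finrank ℝ E ∧ IsOpen V ∧ (∀ a, ContMDiffOn (𝓡 n) 𝓘(ℝ, E) ∞ (ζ a) V) ∧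
      (∀ x ∈ V, (Orthonormal ℝ fun a => ζ a x) ∧
        Submodule.span ℝ (Set.range fun a => ζ a x) = normal (𝓡 n) f x ∧
          (∀ a v, D (𝓡 n) (ζ a) x v ∈ tangent (𝓡 n) f x)) ∧
      IsSmoothCoord (𝓡 n) e ∧ x₀ ∈ e.source ∧ e.source ⊆ V ∧
      ∀ p ∈ e.target, ∀ u,
        coordD (𝓡 n) e p u ∈ nullB (𝓡 n) f (η j₀) (e.symm p) ↔ u.1 = 0 := by
  have hn : ∀ x, n + Module.finrank ℝ (normal (𝓡 n) f x) = Module.finrank ℝ E := fun x => by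
    have := finrank_normal h.immersion (Set.mem_univ x)
    rwa [finrank_euclideanSpace_fin] at this
  obtain ⟨r, hr⟩ : ∃ r, n + r = Module.finrank ℝ E := ⟨_, hn x₀⟩
  obtain ⟨V, -, hV, hxV, ζ, hζs, hζ⟩ := h.exists_frame isOpen_univ
    (isParallelBundleOn_normal isOpen_univ h.immersion) (r := r)
    (fun x _ => by have := hn x; omega) (Set.mem_univ x₀)
  obtain ⟨s, hs⟩ := h.principal j₀
  have hfr : ∀ x, Module.finrank ℝ (nullB (𝓡 n) f (η j₀) x) = s := fun x =>
    hs.2.2 x (Set.mem_univ x)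
  have hsn : s ≤ n := by
    rw [← hfr x₀]
    exact (Submodule.finrank_le _).trans_eq finrank_euclideanSpace_fin
  obtain ⟨m, hm⟩ := Nat.exists_eq_add_of_le' hsn
  refine ⟨m, s, hm.symm, hs.2.1, r, V, ζ, ?_⟩
  set l : Fin (k + 1) → Fin r → M → ℝ := fun j a x => ⟪η j x, ζ a x⟫_ℝ with hl
  have hls : ∀ j a, ContMDiffOn (𝓡 n) 𝓘(ℝ, ℝ) ∞ (l j a) V := fun j a =>
    contMDiffOn_inner ((h.smooth_normal j).mono (Set.subset_univ V)) (hζs a)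
  have hζn : ∀ a, ∀ x ∈ V, ζ a x ∈ normal (𝓡 n) f x := fun a x hx => by
    rw [← (hζ x hx).2.1]; exact Submodule.subset_span ⟨a, rfl⟩
  have hpar : ∀ j a, ∀ x ∈ V, ∀ v ∈ nullB (𝓡 n) f (η j) x,
      D (𝓡 n) (ζ a) x v = -(l j a x • D (𝓡 n) f x v) ∧ D (𝓡 n) (l j a) x v = 0 :=
    fun j a x hx v hv => h.D_parallel isOpen_univ (Set.subset_univ V) hV (hζs a) (hζn a)
      (fun y hy => (hζ y hy).2.2 a) hx hv
  have hfs : ContMDiffOn (𝓡 n) 𝓘(ℝ, E) ∞ f V := h.immersion.1.mono (Set.subset_univ V)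
  -- The data of the curvature spheres. These functions are constant along the leaves of E_{η_{j₀}},
  -- and dS(v) = 0 forces dζ_a(v) = -λ_a df(v) for all a, which excludes components in the other
  -- nullities.
  set S : M → Fin r → E × ℝ := fun x a => (ζ a x + l j₀ a x • f x, l j₀ a x) with hS
  have hSa : ∀ a, ContMDiffOn (𝓡 n) 𝓘(ℝ, E × ℝ) ∞ (fun x => S x a) V := fun a =>
    ((hζs a).add ((hls j₀ a).smul hfs)).prodMk_space (hls j₀ a)
  have hSs : ContMDiffOn (𝓡 n) 𝓘(ℝ, Fin r → E × ℝ) ∞ S V := contMDiffOn_pi_space.2 hSa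
  have hDS : ∀ x ∈ V, ∀ v a, D (𝓡 n) S x v a = (D (𝓡 n) (ζ a) x v + l j₀ a x • D (𝓡 n) f x v
      + D (𝓡 n) (l j₀ a) x v • f x, D (𝓡 n) (l j₀ a) x v) := by
    intro x hx v a
    have h1 : HasPush (𝓡 n) (fun y => S y a) x _ := (hSs.hasPush hV hx).clm
      (ContinuousLinearMap.proj a : (Fin r → E × ℝ) →L[ℝ] E × ℝ)
    have h2 : HasPush (𝓡 n) (fun y => S y a) x _ :=
      (((hζs a).hasPush hV hx).add (((hls j₀ a).hasPush hV hx).smul (hfs.hasPush hV hx))).prodMk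
        ((hls j₀ a).hasPush hV hx)
    have h3 := congrArg (fun R : EuclideanSpace ℝ (Fin n) →L[ℝ] E × ℝ => R v) (h1.unique h2)
    refine Eq.trans h3 (Prod.ext ?_ rfl)
    simp only [ContinuousLinearMap.prod_apply, add_apply, smul_apply,
      ContinuousLinearMap.smulRight_apply]
    abel
  have hK : ∀ x ∈ V, ∀ v, D (𝓡 n) S x v = 0 ↔ v ∈ nullB (𝓡 n) f (η j₀) x := by
    intro x hx v
    constructor
    · intro h0
      obtain ⟨δ, hδ, hsum⟩ := exists_sum_of_iSup_eq_top (h.iSup_nullB (Set.mem_univ x)) v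
      have h1 : ∀ a, D (𝓡 n) (ζ a) x v + l j₀ a x • D (𝓡 n) f x v = 0 := by
        intro a
        have h2 := hDS x hx v a
        rw [h0] at h2
        have h3 : D (𝓡 n) (l j₀ a) x v = 0 := (congrArg Prod.snd h2).symm
        have h4 := congrArg Prod.fst h2
        simp only [h3, zero_smul, add_zero] at h4
        exact h4.symm
      have h2 : ∀ a j, (l j₀ a x - l j a x) • δ j = 0 := by
        intro a
        refine eq_zero_of_sum_eq_zero (A := D (𝓡 n) f x) (h.immersion.injective (Set.mem_univ x))
          (Δ := fun j => nullB (𝓡 n) f (η j) x)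
          (fun i j hij v hv w hw => h.inner_eq_zero isOpen_univ (Set.mem_univ x) hij hv hw)
          (fun j => Submodule.smul_mem _ _ (hδ j))
          (h.immersion.injective (Set.mem_univ x) ?_)
        rw [map_zero, ← h1 a, ← hsum]
        simp only [map_sum, map_smul, Finset.smul_sum, ← Finset.sum_add_distrib]
        refine Finset.sum_congr rfl fun j _ => ?_
        rw [(hpar j a x hx _ (hδ j)).1]
        module
      have h3 : ∀ j, j ≠ j₀ → δ j = 0 := by
        intro j hj
        by_contra hne
        refine hj (h.distinct x (Set.mem_univ x) ?_)
        have h4 : ∀ j, ∑ a, ⟪ζ a x, η j x⟫_ℝ • ζ a x = η j x := fun j =>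
          (hζ x hx).1.sum_inner_smul_of_mem_span (by
            rw [(hζ x hx).2.1]; exact h.mem_normal j (Set.mem_univ x))
        change η j x = η j₀ x
        rw [← h4 j, ← h4 j₀]
        refine Finset.sum_congr rfl fun a _ => ?_
        have h5 : l j₀ a x - l j a x = 0 := (smul_eq_zero.1 (h2 a j)).resolve_right hne
        rw [real_inner_comm, real_inner_comm (η j₀ x)]
        change l j a x • _ = l j₀ a x • _
        rw [sub_eq_zero.1 h5]
      rw [← hsum, Finset.sum_eq_single j₀ (fun j _ hj => h3 j hj) (by simp)]
      exact hδ j₀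
    · intro hv
      ext1 a
      rw [hDS x hx v a, (hpar j₀ a x hx v hv).1, (hpar j₀ a x hx v hv).2]
      simp
  obtain ⟨e, T, hxe, heV, hvert⟩ := exists_isSmoothCoord (X := EuclideanSpace ℝ (Fin m))
    (Y := EuclideanSpace ℝ (Fin s)) hV hSs hxV hK
    (fun x _ => by rw [hfr, finrank_euclideanSpace_fin])
    (by rw [finrank_euclideanSpace_fin, finrank_euclideanSpace_fin, hm])
  exact ⟨e, hr, hV, hζs, hζ, T, hxe, heV, hvert⟩

end

/-! ### The second half: assembly of the local transform. -/

section

variable {E : Type*} [NormedAddCommGroup E] [InnerProductSpace ℝ E] [FiniteDimensional ℝ E]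
  {k n : ℕ} {M : Type*} [TopologicalSpace M]
  [ChartedSpace (EuclideanSpace ℝ (Fin n)) M] [IsManifold (𝓡 n) ∞ M]

/-- A weakly reducible Dupin submanifold is locally a Ribaucour transform. -/
theorem IsDupinOn.exists_ribaucour {f : M → E} {η : Fin (k + 1) → M → E}
    (h : IsDupinOn (𝓡 n) Set.univ f η) (j₀ : Fin (k + 1))
    (hint : IsIntegrableOn (𝓡 n) Set.univ (conullity (𝓡 n) f (η j₀))) (x₀ : M) :
    ∃ (m s : ℕ) (L : Set (EuclideanSpace ℝ (Fin m)))
      (g : EuclideanSpace ℝ (Fin m) → E)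
      (η' : Fin k → EuclideanSpace ℝ (Fin m) → E)
      (N : EuclideanSpace ℝ (Fin m) → Submodule ℝ E)
      (φ : EuclideanSpace ℝ (Fin m) → ℝ)
      (β : EuclideanSpace ℝ (Fin m) → E)
      (ξ : Fin s → EuclideanSpace ℝ (Fin m) → E)
      (e : OpenPartialHomeomorph M (EuclideanSpace ℝ (Fin m) × EuclideanSpace ℝ (Fin s))),
      m + s = n ∧ IsOpen L ∧ SimplyConnectedSpace L ∧
      IsRegularDupinTypeOn (𝓡 m) L g η' N s φ β ∧
      IsParallelFrameOn (𝓡 m) L g N ξ ∧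
      x₀ ∈ e.source ∧ e.target ⊆ L ×ˢ Set.univ ∧
      ContMDiffOn (𝓡 n) ((𝓡 m).prod (𝓡 s)) ∞ e e.source ∧
      ContMDiffOn ((𝓡 m).prod (𝓡 s)) (𝓡 n) ∞ e.symm e.target ∧
      (∀ p ∈ e.target, combescureT (𝓡 m) g φ β ξ p ≠ 0) ∧
      ∀ x ∈ e.source, f x = ribaucour (𝓡 m) g φ β ξ (e x) := by
  obtain ⟨m, s, hms, hs, r, V, ζ, e₀, hr, hV, hζs, hζ, T₀, hx₀, he₀V, hvert⟩ :=
    h.exists_adapted_coord j₀ x₀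
  set p₀ := e₀ x₀ with hp₀
  have hp₀t : p₀ ∈ e₀.target := e₀.map_source hx₀
  have hfm : ∀ x, MDifferentiableAt (𝓡 n) 𝓘(ℝ, E) f x := fun x =>
    (h.immersion.1.hasPush isOpen_univ (Set.mem_univ x)).mdifferentiableAt
  have hfs : ContDiffOn ℝ ∞ (fun p => f (e₀.symm p)) e₀.target :=
    contMDiffOn_iff_contDiffOn.1
      (T₀.smooth_comp h.immersion.1 subset_rfl fun _ _ => Set.mem_univ _)
  -- Injectivity of f near x₀ ensures that distinct points of a fibre have distinct images, so that
  -- differences can be inverted.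
  obtain ⟨V', hV', hinj⟩ := exists_injOn_of_injective (a := fun p => f (e₀.symm p)) (x := p₀)
    ((hfs p₀ hp₀t).contDiffAt (e₀.open_target.mem_nhds hp₀t)) (by
      rw [(hasPush_id_iff.1 (T₀.hasPush_comp (hfm _) hp₀t)).fderiv]
      exact (h.immersion.injective (Set.mem_univ _)).comp (T₀.bijective hp₀t).1)
  obtain ⟨ρ, hρ, hball⟩ := Metric.mem_nhds_iff.1
    (Filter.inter_mem (e₀.open_target.mem_nhds hp₀t) hV')
  have hAC : Metric.ball p₀.1 ρ ×ˢ Metric.ball p₀.2 ρ ⊆ e₀.target ∩ V' := by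
    rw [ball_prod_same]; exact hball
  have T := h.isAdaptedOn j₀ hV hζs hζ (by rw [finrank_euclideanSpace_fin]; exact hr) T₀ he₀V hvert
    Metric.isOpen_ball Metric.isOpen_ball (convex_ball p₀.2 ρ).isPreconnected
    (fun p hp => (hAC hp).1) (hinj.mono fun p hp => (hAC hp).2)
  -- Integrability of the conullity enters here, through the leaf supplied at each point of the
  -- product of balls.
  obtain ⟨δ, q, p, i₀, hδ, P, hne⟩ := T.exists_isLeafPencilOn (s := s)
    finrank_euclideanSpace_fin hs
    (fun x hx y hy => h.exists_isLeafOn j₀ hint T₀ hvert Metric.isOpen_ball Metric.isOpen_ball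
      (fun p hp => (hAC hp).1) hx hy)
    (Metric.mem_ball_self (x := p₀.1) hρ) (Metric.mem_ball_self (x := p₀.2) hρ)
  obtain ⟨e₁, hp₁, he₁s, he₁t, hs₁, hs₁', he₁⟩ := P.exists_ribaucour_chart
    finrank_euclideanSpace_fin (Metric.mem_ball_self (x := p₀.2) hρ) hne
  have R := P.isRibaucourNetOn
  set e := e₀.trans e₁ with he
  have hsrc : ∀ y, y ∈ e.source ↔ y ∈ e₀.source ∧ e₀ y ∈ e₁.source := fun y => by
    rw [he, OpenPartialHomeomorph.trans_source]; rfl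
  have htgt : ∀ p, p ∈ e.target ↔ p ∈ e₁.target ∧ e₁.symm p ∈ e₀.target := fun p => by
    rw [he, OpenPartialHomeomorph.trans_target]; rfl
  have hes : ContMDiffOn (𝓡 n) 𝓘(ℝ, EuclideanSpace ℝ (Fin m) × EuclideanSpace ℝ (Fin s)) ∞ e
      e.source := (contMDiffOn_iff_contDiffOn.2 hs₁).comp
    (T₀.smooth.mono fun y hy => ((hsrc y).1 hy).1) fun y hy => ((hsrc y).1 hy).2
  have hes' : ContMDiffOn 𝓘(ℝ, EuclideanSpace ℝ (Fin m) × EuclideanSpace ℝ (Fin s)) (𝓡 n) ∞ e.symm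
      e.target := T₀.smooth_symm.comp
    ((contMDiffOn_iff_contDiffOn.2 hs₁').mono fun p hp => ((htgt p).1 hp).1)
    fun p hp => ((htgt p).1 hp).2
  set g := onGraph q fun p => f (e₀.symm p) with hg
  set G := fun c => onGraph (p c) fun p => f (e₀.symm p) with hG
  have hkey : ∀ y ∈ e.source, combescureT (𝓡 m) g (pencilPhi g G i₀)
        (normalPart (𝓡 m) g (pencilF g G i₀ none) (pencilPhi g G i₀)) (pencilXi g G i₀) (e y) ≠ 0 ∧
      f y = ribaucour (𝓡 m) g (pencilPhi g G i₀)
        (normalPart (𝓡 m) g (pencilF g G i₀ none) (pencilPhi g G i₀)) (pencilXi g G i₀) (e y) := by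
    intro y hy
    obtain ⟨hy₀, hy₁⟩ := (hsrc y).1 hy
    obtain ⟨hx, hC⟩ := he₁s hy₁
    obtain ⟨hne', heq⟩ := he₁ _ hy₁
    have h1 : e y = _ := heq
    have hc := P.combescureT_eq hx hC hne'
    have hrib := P.ribaucour_eq hx hC hne'
    rw [h1]
    refine ⟨?_, ?_⟩
    · rw [hc]
      refine smul_ne_zero (mul_ne_zero (by norm_num) (P.isPencilOn.phi_pos hx).ne')
        (smul_ne_zero (inv_ne_zero (pow_ne_zero 2 (norm_ne_zero_iff.2 ?_))) ?_)
      · exact sub_ne_zero.2 hne'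
      · exact sub_ne_zero.2 hne'
    · rw [hrib]
      change f y = f (e₀.symm (e₀ y))
      rw [e₀.left_inv hy₀]
  refine ⟨m, s, Metric.ball p₀.1 δ, _, _, _, _, _, _, e, hms, Metric.isOpen_ball, ?_,
    R.isRegularDupinTypeOn Metric.isOpen_ball hs, R.isParallelFrameOn,
    (hsrc x₀).2 ⟨hx₀, hp₁⟩, fun p hp => ?_, ?_, ?_, fun p hp => ?_, fun y hy => (hkey y hy).2⟩
  -- The domain of the base leaf is a ball, hence contractible and simply connected.
  · have := (convex_ball p₀.1 δ).contractibleSpace ⟨p₀.1, Metric.mem_ball_self hδ⟩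
    infer_instance
  · exact he₁t ((htgt p).1 hp).1
  · exact (contDiff_fst.contMDiff.comp_contMDiffOn hes).prodMk
      (contDiff_snd.contMDiff.comp_contMDiffOn hes)
  · exact hes'.comp (contMDiff_fst.prodMk_space contMDiff_snd).contMDiffOn fun p hp => hp
  · have h1 := (hkey (e.symm p) (e.map_target hp)).1
    rwa [e.right_inv hp] at h1

end

end DupinSub

/-! ### The theorem. -/

theorem theorem8 (d k : ℕ) (hk : 1 ≤ k) :
    (∀ (m s : ℕ) (L : Type*) [TopologicalSpace L] [T2Space L] [SecondCountableTopology L]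
        [ChartedSpace (EuclideanSpace ℝ (Fin m)) L] [IsManifold (𝓡 m) ∞ L]
        [SimplyConnectedSpace L]
        (h : L → EuclideanSpace ℝ (Fin d)) (η : Fin (k - 1) → L → EuclideanSpace ℝ (Fin d))
        (N : L → Submodule ℝ (EuclideanSpace ℝ (Fin d)))
        (φ : L → ℝ) (β : L → EuclideanSpace ℝ (Fin d)),
        DupinSub.IsRegularDupinTypeOn (𝓡 m) Set.univ h η N s φ β →
        (∃ ξ : Fin s → L → EuclideanSpace ℝ (Fin d),
          DupinSub.IsParallelFrameOn (𝓡 m) Set.univ h N ξ) ∧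
        ∀ ξ : Fin s → L → EuclideanSpace ℝ (Fin d),
          DupinSub.IsParallelFrameOn (𝓡 m) Set.univ h N ξ →
          ∃ W : Set (L × EuclideanSpace ℝ (Fin s)), IsOpen W ∧ (∀ u : L, (u, 0) ∈ W) ∧
            (∀ p ∈ W, p.2 ≠ 0 →
              DupinSub.combescureT (𝓡 m) h φ β ξ (p.1, DupinSub.inv p.2) ≠ 0) ∧
            DupinSub.IsWeaklyReducibleDupinOn ((𝓡 m).prod (𝓡 s)) W
              (DupinSub.ribaucourAtInfinity (𝓡 m) h φ β ξ) k) ∧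
    (∀ (n : ℕ) (M : Type*) [TopologicalSpace M] [T2Space M] [SecondCountableTopology M]
        [ChartedSpace (EuclideanSpace ℝ (Fin n)) M] [IsManifold (𝓡 n) ∞ M]
        (f : M → EuclideanSpace ℝ (Fin d)),
        DupinSub.IsWeaklyReducibleDupinOn (𝓡 n) Set.univ f k →
        ∀ x₀ : M, ∃ (m s : ℕ) (L : Set (EuclideanSpace ℝ (Fin m)))
          (h : EuclideanSpace ℝ (Fin m) → EuclideanSpace ℝ (Fin d))
          (η : Fin (k - 1) → EuclideanSpace ℝ (Fin m) → EuclideanSpace ℝ (Fin d))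
          (N : EuclideanSpace ℝ (Fin m) → Submodule ℝ (EuclideanSpace ℝ (Fin d)))
          (φ : EuclideanSpace ℝ (Fin m) → ℝ)
          (β : EuclideanSpace ℝ (Fin m) → EuclideanSpace ℝ (Fin d))
          (ξ : Fin s → EuclideanSpace ℝ (Fin m) → EuclideanSpace ℝ (Fin d))
          (e : OpenPartialHomeomorph M (EuclideanSpace ℝ (Fin m) × EuclideanSpace ℝ (Fin s))),
          m + s = n ∧ IsOpen L ∧ SimplyConnectedSpace L ∧
          DupinSub.IsRegularDupinTypeOn (𝓡 m) L h η N s φ β ∧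
          DupinSub.IsParallelFrameOn (𝓡 m) L h N ξ ∧
          x₀ ∈ e.source ∧ e.target ⊆ L ×ˢ Set.univ ∧
          ContMDiffOn (𝓡 n) ((𝓡 m).prod (𝓡 s)) ∞ e e.source ∧
          ContMDiffOn ((𝓡 m).prod (𝓡 s)) (𝓡 n) ∞ e.symm e.target ∧
          (∀ p ∈ e.target, DupinSub.combescureT (𝓡 m) h φ β ξ p ≠ 0) ∧
          ∀ x ∈ e.source, f x = DupinSub.ribaucour (𝓡 m) h φ β ξ (e x)) := by
  -- With k = k' + 1 the index type `Fin (k - 1)` becomes `Fin k'`, in agreement with the lemmas,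
  -- which pass between k' and k' + 1 principal normals.
  obtain ⟨k, rfl⟩ : ∃ k', k = k' + 1 := ⟨k - 1, by omega⟩
  refine ⟨?_, ?_⟩
  · intro m s L _ _ _ _ _ _ h η N φ β H
    -- Local path connectedness is required for lifting along the covering of parallel germs.
    have := ChartedSpace.locallyPathConnectedSpace (EuclideanSpace ℝ (Fin m)) L
    exact ⟨DupinSub.exists_isParallelFrameOn H.dupin H.subbundle, fun ξ hξ =>
      DupinSub.exists_isWeaklyReducibleDupinOn H hξ⟩
  · intro n M _ _ _ _ _ f ⟨η, hη, j₀, hint⟩ x₀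
    exact hη.exists_ribaucour j₀ hint x₀
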